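/- **Setting.** Let $(X,Y)$ have law $\mu$ on $\mathbb R^2$ with marginal distribution functions $F_1,F_2$, put $F^\leftarrow(s)=\inf\{x: F(x)\ge s\}$, $U_i(t)=F_i^\leftarrow(1-1/t)$, $U(x,y)=(U_1(x),U_2(y))$. For every $n$ let $(X_{n,j},Y_{n,j})_{1\le j\le n}$ be i.i.d. copies of $(X,Y)$, all defined on one probability space. Read $(x^\gamma-1)/\gamma$ as $\log x$ and $(1+\gamma y)^{1/\gamma}$ as $e^y$ if $\gamma=0$; where $1+\gamma y\le 0$ put $(1+\gamma y)^{1/\gamma}=0$ if $\gamma>0$ and $=\infty$ if $\gamma<0$. Let $k_n\to\infty$ with $k_n/n\to0$, $d_n,e_n>0$, $c_n=k_ne_n/n$, and write $k=k_n$. Suppose, for $i=1,2$: (M1) there is $x_i^0<F_i^\leftarrow(1)$ such that $F_i$ is continuous and strictly increasing on $[x_i^0,F_i^\leftarrow(1)]\cap\mathbb R$. (M2) There are $\gamma_i\in\mathbb R$, $\rho_i<0$ and functions $a_i>0$, $b_i$, $A_i\neq0$ such that, with $\bar\psi_{\gamma,\rho}(x)=x^{\gamma+\rho}/(\gamma+\rho)$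 (read as $\log x$ if $\gamma+\rho=0$), $$R_i(t,x):=\frac1{A_i(t)}\Big(\frac{U_i(tx)-b_i(t)}{a_i(t)}-\frac{x^{\gamma_i}-1}{\gamma_i}\Big)\to\bar\psi_{\gamma_i,\rho_i}(x)\quad(t\to\infty),\ x>0,$$ the normalization being chosen such that for all $\varepsilon,\delta>0$ there is $t_0$ with $|R_i(t,x)-\bar\psi_{\gamma_i,\rho_i}(x)|\le\delta x^{\gamma_i+\rho_i}\max(x^\varepsilon,x^{-\varepsilon})$ whenever $t,tx>t_0$. (M3) The estimators (arbitrary random variables) satisfy, in probability, $k^{1/2}\big(\hat a_i/a_i(n/k)-1,\ (\hat b_i-b_i(n/k))/a_i(n/k),\ \hat\gamma_i-\gamma_i\big)\to(\alpha_i,\beta_i,\Gamma_i)$ for random variables $\alpha_i,\beta_i,\Gamma_i$ (from weak convergence one passes to versions for which this holds). (Q1) $S=\{(x,y)\in[0,\infty)^2: y\ge q(x)\}$ with $q:[0,\infty)\to[0,\infty]$ non-increasing, right-continuous, $q(0)>0$; $d_n\to\infty$; and $D_n=U(d_nS)\cap\mathbb R^2$. Put $x_l=\inf\{x\ge 0:q(x)<\infty\}$,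 $q(\infty)=\lim_{x\to\infty}q(x)$, $q^\leftarrow(v)=\inf\{x>0:q(x)\le v\}$. (Q2) $x^{(1-\gamma_1)/2}|\log x|=O(q(x))$ as $x\downarrow x_l$, and $y^{(1-\gamma_2)/2}|\log y|=O(q^\leftarrow(y))$ as $y\downarrow q(\infty)$. (D1) $\nu$ is the exponent measure of $(X,Y)$ on $[0,\infty)^2$, i.e. $tP\{(X,Y)\in U(tB)\}\to\nu(B)$ as $t\to\infty$ for all $\nu$-continuous Borel sets $B\subset[0,\infty)^2$ bounded away from the origin, and there is $A_0>0$ with $A_0(t)\to0$ as $t\to\infty$ such that, with $T_{(t)}(x_1,x_2)=\big((1+\gamma_i(x_i-b_i(t))/a_i(t))^{1/\gamma_i}\big)_{i=1,2}$, for every $M>0$ $$t_nP\{T_{(t_n)}(X,Y)\in B\}-\nu(B)=O(A_0(t_n))$$ for $t_n=n/k$ uniformly over the sets $B=\{(\tilde H_{n,1}(x_1),\tilde H_{n,2}(x_2)): (x_1,x_2)\in C\}$, and for $t_n=d_n$ uniformly over the sets $B=\{T_{(d_n)}(U(d_n x)): x\in C\}$, where only points with finite $U(d_nx)$ are taken.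 Here $C$ ranges over the sets $S\cap[u,\infty)\times[v,\infty)$, $[x_l,u)\times[q(u-),\infty)$, $[q^\leftarrow(v),\infty)\times[q(\infty),v)$, $u,v>0$, that do not meet $[0,1/M)^2$, and $$\tilde H_{n,i}(x)=\Big[1+\gamma_i\Big(\tfrac{c_n^{-(\gamma_i-k^{-1/2}\theta_i)}-1}{\gamma_i-k^{-1/2}\theta_i}(1+k^{-1/2}\xi_i)+c_n^{-(\gamma_i+k^{-1/2}\chi_i)}\tfrac{U_i(d_nx)-b_i(n/k)}{a_i(n/k)}\Big)\Big]^{1/\gamma_i}$$ with arbitrary $\theta_i,\chi_i,\xi_i\in[-M,M]$; for $\gamma_i=0$ this is the exponential of the expression in parentheses, and for $\gamma_i=k^{-1/2}\theta_i$ the first quotient is $-\log c_n$. (D2) $\nu$ has a Lebesgue density $\eta$ that is continuous and strictly positive on $[0,\infty)^2\setminus\{(0,0)\}$. (S1) $n=O(e_n)$, $d_n\asymp e_n$, and $w_n(\gamma_i)=o(k^{1/2})$, where $w_n(\gamma)=\log c_n$ if $\gamma>0$, $\frac12\log^2c_n$ if $\gamma=0$, $(d_nk/n)^{-\gamma}$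 if $\gamma<0$. (S2) $A_i(n/k)=o(k^{-1/2}w_n(\gamma_i))$, $A_0(n/k)=o\big(k^{-1/2}\max(w_n(\gamma_1),w_n(\gamma_2))\big)$, and $A_0(d_n)=O(A_0(n/k))$ (automatic if $A_0$ is eventually non-increasing). (S3) $k^{1/2}=O(c_n\vee c_n^{\gamma_i})$ if $\gamma_i\ge0$; $k^{1/2}=o(c_n^{1-\gamma_1})$ if $\gamma_1<0$ and $x_l=0$; $k^{1/2}=o(c_n^{1-\gamma_2})$ if $\gamma_2<0$ and $q(\infty)=0$. Let $p_n=P\{(X,Y)\in D_n\}$, $\hat T_n^\leftarrow(x_1,x_2)=\big((1+\hat\gamma_i(x_i-\hat b_i)/\hat a_i)^{1/\hat\gamma_i}\big)_{i=1,2}$, $\hat\nu_n(B)=\frac1k\#\{j\le n:\hat T_n^\leftarrow(X_{n,j},Y_{n,j})\in B\}$ and $\hat p_n=\frac1{e_n}\hat\nu_n\big(\frac n{ke_n}\hat T_n^\leftarrow(D_n)\big)$. **Theorem.** Under these conditions $$k^{1/2}d_n(\hat p_n-p_n)=w_n(\gamma_1)L_1I_1+w_n(\gamma_2)L_2I_2+o_P\big(w_n(\gamma_1)\vee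 w_n(\gamma_2)\big),$$ where $$L_i=\begin{cases}\Gamma_i/\gamma_i,&\gamma_i>0,\\ \Gamma_i,&\gamma_i=0,\\ -\big(\alpha_i/\gamma_i-\beta_i-\Gamma_i/\gamma_i^2\big),&\gamma_i<0,\end{cases}$$ $$I_1=\int_{q(\infty)}^\infty(q^\leftarrow(v))^{1+\gamma_1^-}\eta(q^\leftarrow(v),v)\,dv,\qquad I_2=\int_{x_l}^\infty(q(u))^{1+\gamma_2^-}\eta(u,q(u))\,du,\qquad \gamma^-=\max(-\gamma,0),$$ and both integrals are finite. Moreover $\nu(S)<\infty$, $p_nd_n\to\nu(S)$, and the same expansion holds for $k^{1/2}\nu(S)(\hat p_n/p_n-1)$ in place of $k^{1/2}d_n(\hat p_n-p_n)$. -/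

import Mathlib

open Filter Topology MeasureTheory ProbabilityTheory Asymptotics Set
open scoped ENNReal NNReal

noncomputable section

namespace FailureProb

/-! ## Marginal transformations -/

/-- The function `(x ^ γ - 1) / γ`, read as `log x` for `γ = 0`. -/
def boxCox (γ x : ℝ) : ℝ := if γ = 0 then Real.log x else (x ^ γ - 1) / γ

/-- The function `(1 + γ y) ^ (1 / γ)`, read as `exp y` for `γ = 0`, with values in `[0, ∞]`. Where the
power is not defined it takes the only values in `[0, ∞]` that keep it non-decreasing in `y`:
`0` if `γ > 0` and `∞` if `γ < 0`. -/
def gpdInv (γ y : ℝ) : ℝ≥0∞ :=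
  if γ = 0 then ENNReal.ofReal (Real.exp y)
  else if 0 < 1 + γ * y then ENNReal.ofReal ((1 + γ * y) ^ (1 / γ))
  else if 0 < γ then 0 else ⊤

/-- Generalized inverse `inf {x | s ≤ F x}`, with values in `[-∞, ∞]`. -/
def genInv (F : ℝ → ℝ) (s : ℝ) : EReal := sInf ((fun x : ℝ => (x : EReal)) '' {x | s ≤ F x})

/-- The tail quantile function `U t = F^←(1 - 1/t)`, `t ≥ 0` (equal to `-∞` for `t ≤ 1`). -/
def tailQuantile (F : ℝ → ℝ) (t : ℝ) : EReal := if 0 < t then genInv F (1 - 1 / t) else ⊥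

/-- The two marginal distribution functions of a law on the plane. -/
def margins (μ : Measure (ℝ × ℝ)) : Fin 2 → ℝ → ℝ :=
  ![fun x => cdf (μ.map Prod.fst) x, fun x => cdf (μ.map Prod.snd) x]

/-- `U(t C) ∩ ℝ² = {(U₁ (t x), U₂ (t y)) | (x, y) ∈ C} ∩ ℝ²`. -/
def tailImage (F : Fin 2 → ℝ → ℝ) (t : ℝ) (C : Set (ℝ × ℝ)) : Set (ℝ × ℝ) :=
  {z | ∃ p ∈ C, (z.1 : EReal) = tailQuantile (F 0) (t * p.1) ∧
    (z.2 : EReal) = tailQuantile (F 1) (t * p.2)}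

/-- The coordinatewise map `z_i ↦ (1 + γ_i (z_i - b_i) / a_i) ^ (1 / γ_i)`. -/
def standardize (γ a b : Fin 2 → ℝ) (z : ℝ × ℝ) : ℝ≥0∞ × ℝ≥0∞ :=
  (gpdInv (γ 0) ((z.1 - b 0) / a 0), gpdInv (γ 1) ((z.2 - b 1) / a 1))

/-! ## Conditions on the marginals -/

/-- `F` is continuous and strictly increasing on `[x₀, F^←(1)] ∩ ℝ` for some `x₀ < F^←(1)`. -/
def RegularUpperTail (F : ℝ → ℝ) : Prop :=
  ∃ x₀ : ℝ, (x₀ : EReal) < genInv F 1 ∧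
    ContinuousOn F {x : ℝ | x₀ ≤ x ∧ (x : EReal) ≤ genInv F 1} ∧
    StrictMonoOn F {x : ℝ | x₀ ≤ x ∧ (x : EReal) ≤ genInv F 1}

/-- Limit function of the second order condition. -/
def psiBar (γ ρ x : ℝ) : ℝ :=
  if γ + ρ = 0 then Real.log x else x ^ (γ + ρ) / (γ + ρ)

/-- The quotient `((U (t x) - b t) / a t - (x ^ γ - 1) / γ) / A t`. -/
def secondOrderQuot (F : ℝ → ℝ) (γ : ℝ) (a b A : ℝ → ℝ) (t x : ℝ) : ℝ :=
  (((tailQuantile F (t * x)).toReal - b t) / a t - boxCox γ x) / A t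

/-- Second order extreme value condition with second order parameter `ρ < 0`, for normalizing
functions that are chosen such that the usual uniform version holds. -/
structure SecondOrder (F : ℝ → ℝ) (γ ρ : ℝ) (a b A : ℝ → ℝ) : Prop where
  rho_neg : ρ < 0
  a_pos : ∀ t : ℝ, 0 < t → 0 < a t
  A_ne : ∀ t : ℝ, 0 < t → A t ≠ 0
  limit : ∀ x : ℝ, 0 < x →
    Tendsto (fun t => secondOrderQuot F γ a b A t x) atTop (𝓝 (psiBar γ ρ x))
  uniform : ∀ ε : ℝ, 0 < ε → ∀ δ : ℝ, 0 < δ → ∃ t₀ : ℝ, 1 ≤ t₀ ∧ ∀ t x : ℝ, 0 < x → t₀ < t → t₀ < t * x →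
    |secondOrderQuot F γ a b A t x - psiBar γ ρ x|
      ≤ δ * (x ^ (γ + ρ) * max (x ^ ε) (x ^ (-ε)))

/-- Joint convergence, at rate `k ^ (1/2)`, of the estimators `ah`, `bh`, `gh` of
`a (n/k)`, `b (n/k)`, `γ`, towards `(α, β, Γ)` (in probability). -/
structure EstimatorsConverge {Ω : Type*} [MeasurableSpace Ω] (P : Measure Ω)
    (k : ℕ → ℝ) (γ : Fin 2 → ℝ) (a b : Fin 2 → ℝ → ℝ)
    (gh ah bh : ℕ → Fin 2 → Ω → ℝ) (α β Γ : Fin 2 → Ω → ℝ) : Prop where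
  meas_gh : ∀ n i, Measurable (gh n i)
  meas_ah : ∀ n i, Measurable (ah n i)
  meas_bh : ∀ n i, Measurable (bh n i)
  meas_α : ∀ i, Measurable (α i)
  meas_β : ∀ i, Measurable (β i)
  meas_Γ : ∀ i, Measurable (Γ i)
  scale : ∀ i, TendstoInMeasure P
    (fun n ω => √(k n) * (ah n i ω / a i (n / k n) - 1)) atTop (α i)
  location : ∀ i, TendstoInMeasure P
    (fun n ω => √(k n) * ((bh n i ω - b i (n / k n)) / a i (n / k n))) atTop (β i)
  index : ∀ i, TendstoInMeasure P
    (fun n ω => √(k n) * (gh n i ω - γ i)) atTop (Γ i)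

/-! ## The failure set -/

/-- The set `S = {(x, y) ∈ [0, ∞)² | q x ≤ y}`. -/
def failSet (q : ℝ → ℝ≥0∞) : Set (ℝ × ℝ) :=
  {p | 0 ≤ p.1 ∧ 0 ≤ p.2 ∧ q p.1 ≤ ENNReal.ofReal p.2}

/-- `x_l = inf {x ≥ 0 | q x < ∞}`. -/
def xl (q : ℝ → ℝ≥0∞) : ℝ := sInf {x : ℝ | 0 ≤ x ∧ q x < ⊤}

/-- `q(∞) = lim_{x → ∞} q x`, for non-increasing `q`. -/
def qInf (q : ℝ → ℝ≥0∞) : ℝ≥0∞ := ⨅ x ∈ Ici (0 : ℝ), q x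

/-- The left limit `q(u-)`, for non-increasing `q` and `u > 0`. -/
def qLeft (q : ℝ → ℝ≥0∞) (u : ℝ) : ℝ≥0∞ := ⨅ x ∈ Ico (0 : ℝ) u, q x

/-- The generalized inverse `q^←(v) = inf {x > 0 | q x ≤ v}`, with `inf ∅ = ∞`. -/
def qInv (q : ℝ → ℝ≥0∞) (v : ℝ) : ℝ≥0∞ :=
  sInf (ENNReal.ofReal '' {x : ℝ | 0 < x ∧ q x ≤ ENNReal.ofReal v})

/-- `q : [0, ∞) → [0, ∞]` is non-increasing and right-continuous with `q 0 > 0`. -/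
structure BoundaryFun (q : ℝ → ℝ≥0∞) : Prop where
  anti : AntitoneOn q (Ici 0)
  right_cont : ∀ x : ℝ, 0 ≤ x → ContinuousWithinAt q (Ioi x) x
  pos : 0 < q 0

/-- Growth of `q` near `x_l` and of `q^←` near `q(∞)`. -/
structure BoundaryGrowth (q : ℝ → ℝ≥0∞) (γ : Fin 2 → ℝ) : Prop where
  left : ∃ K : ℝ≥0, ∀ᶠ x in 𝓝[>] (xl q),
    ENNReal.ofReal (x ^ ((1 - γ 0) / 2) * |Real.log x|) ≤ K * q x
  right : ∃ K : ℝ≥0, ∀ᶠ y in 𝓝[>] (qInf q).toReal,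
    ENNReal.ofReal (y ^ ((1 - γ 1) / 2) * |Real.log y|) ≤ K * qInv q y

/-! ## Extremal dependence -/

/-- `ν` is the exponent measure of the law `μ`: `t μ(U(t B)) → ν(B)` for all `ν`-continuous Borel sets
`B ⊆ [0, ∞)²` that are bounded away from the origin. -/
def IsExponentMeasure (μ ν : Measure (ℝ × ℝ)) : Prop :=
  ∀ B : Set (ℝ × ℝ), MeasurableSet B → B ⊆ Ici 0 ×ˢ Ici 0 →
    (∃ ε : ℝ, 0 < ε ∧ ∀ p ∈ B, ε ≤ max p.1 p.2) → ν (frontier B) = 0 →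
    Tendsto (fun t : ℝ => ENNReal.ofReal t * μ (tailImage (margins μ) t B)) atTop (𝓝 (ν B))

/-- `ν` lives on `[0, ∞)²` and has there a Lebesgue density `η` that is continuous and strictly
positive outside the origin. -/
structure HasPosContDensity (ν : Measure (ℝ × ℝ)) (η : ℝ × ℝ → ℝ) : Prop where
  density : ν = (volume.restrict (Ici 0 ×ˢ Ici 0)).withDensity (fun z => ENNReal.ofReal (η z))
  cont : ContinuousOn η ((Ici 0 ×ˢ Ici 0) \ {0})
  pos : ∀ z ∈ ((Ici 0 ×ˢ Ici 0) \ {0} : Set (ℝ × ℝ)), 0 < η z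

/-- The sets `S ∩ [u, ∞) × [v, ∞)`, `[x_l, u) × [q(u-), ∞)` and `[q^←(v), ∞) × [q(∞), v)`. -/
def testSets (q : ℝ → ℝ≥0∞) : Set (Set (ℝ × ℝ)) :=
  {C | ∃ u v : ℝ, 0 < u ∧ 0 < v ∧
    (C = failSet q ∩ Ici u ×ˢ Ici v ∨
      C = {p | xl q ≤ p.1 ∧ p.1 < u ∧ 0 ≤ p.2 ∧ qLeft q u ≤ ENNReal.ofReal p.2} ∨
      C = {p | 0 ≤ p.1 ∧ qInv q v ≤ ENNReal.ofReal p.1 ∧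
        0 ≤ p.2 ∧ qInf q ≤ ENNReal.ofReal p.2 ∧ p.2 < v})}

/-- The map `y ↦ [1 + γ ((c^{-(γ - k^{-1/2} θ)} - 1) / (γ - k^{-1/2} θ) (1 + k^{-1/2} ξ)
+ c^{-(γ + k^{-1/2} χ)} (y - b) / a)] ^ (1 / γ)`, to be applied to `y = U (d_n x)`. -/
def hTilde (γ a b k c θ χ ξ y : ℝ) : ℝ≥0∞ :=
  gpdInv γ (boxCox (γ - θ / √k) c⁻¹ * (1 + ξ / √k) + c ^ (-(γ + χ / √k)) * ((y - b) / a))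

/-- `ν(B) < ∞` and `|t μ{T(X, Y) ∈ B} - ν(B)| ≤ r`, where `T` is the standardization with parameters
`γ`, `a t`, `b t`, and `B` is a subset of `[0, ∞]²`. -/
def BiasBound (μ ν : Measure (ℝ × ℝ)) (γ : Fin 2 → ℝ) (a b : Fin 2 → ℝ → ℝ) (t r : ℝ)
    (B : Set (ℝ≥0∞ × ℝ≥0∞)) : Prop :=
  ν {z | (ENNReal.ofReal z.1, ENNReal.ofReal z.2) ∈ B} ≠ ⊤ ∧
  |t * μ.real {z | standardize γ (fun i => a i t) (fun i => b i t) z ∈ B}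
    - ν.real {z | (ENNReal.ofReal z.1, ENNReal.ofReal z.2) ∈ B}| ≤ r

/-- `c_n = k_n e_n / n`. -/
def cSeq (k e : ℕ → ℝ) (n : ℕ) : ℝ := k n * e n / n

/-- Rate of convergence towards the exponent measure, at `t = n / k_n` and at `t = d_n`, uniformly over
the transformed test sets that stay away from the origin. -/
structure DependenceRate (μ ν : Measure (ℝ × ℝ)) (γ : Fin 2 → ℝ) (a b : Fin 2 → ℝ → ℝ)
    (q : ℝ → ℝ≥0∞) (k d e : ℕ → ℝ) (A₀ : ℝ → ℝ) : Prop where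
  pos : ∀ t : ℝ, 0 < t → 0 < A₀ t
  tendsto_zero : Tendsto A₀ atTop (𝓝 0)
  rate_k : ∀ M : ℝ, 0 < M → ∃ K : ℝ, ∀ᶠ n : ℕ in atTop, ∀ C ∈ testSets q,
    (∀ p ∈ C, 1 / M ≤ max p.1 p.2) →
    ∀ θ χ ξ : Fin 2 → ℝ, (∀ i, |θ i| ≤ M ∧ |χ i| ≤ M ∧ |ξ i| ≤ M) →
    BiasBound μ ν γ a b (n / k n) (K * A₀ (n / k n))
      ((fun z : ℝ × ℝ =>
        (hTilde (γ 0) (a 0 (n / k n)) (b 0 (n / k n)) (k n) (cSeq k e n) (θ 0) (χ 0) (ξ 0) z.1,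
         hTilde (γ 1) (a 1 (n / k n)) (b 1 (n / k n)) (k n) (cSeq k e n) (θ 1) (χ 1) (ξ 1) z.2)) ''
        tailImage (margins μ) (d n) C)
  rate_d : ∀ M : ℝ, 0 < M → ∃ K : ℝ, ∀ᶠ n : ℕ in atTop, ∀ C ∈ testSets q,
    (∀ p ∈ C, 1 / M ≤ max p.1 p.2) →
    BiasBound μ ν γ a b (d n) (K * A₀ (d n))
      (standardize γ (fun i => a i (d n)) (fun i => b i (d n)) '' tailImage (margins μ) (d n) C)

/-! ## Conditions on the sequences -/

/-- The weights `w_n(γ)`. -/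
def weight (k d e : ℕ → ℝ) (γ : ℝ) (n : ℕ) : ℝ :=
  if 0 < γ then Real.log (cSeq k e n)
  else if γ = 0 then (1 / 2) * Real.log (cSeq k e n) ^ 2
  else (d n * k n / n) ^ (-γ)

/-- Growth of the sequences `k_n`, `d_n`, `e_n`. -/
structure SequenceGrowth (k d e : ℕ → ℝ) (γ : Fin 2 → ℝ) : Prop where
  k_tendsto : Tendsto k atTop atTop
  k_div : Tendsto (fun n : ℕ => k n / n) atTop (𝓝 0)
  d_pos : ∀ n, 0 < d n
  d_tendsto : Tendsto d atTop atTop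
  e_pos : ∀ n, 0 < e n
  n_isBigO : (fun n : ℕ => (n : ℝ)) =O[atTop] e
  d_isTheta : d =Θ[atTop] e
  weight_isLittleO : ∀ i, weight k d e (γ i) =o[atTop] (fun n => √(k n))

/-- The bias terms are of smaller order. -/
structure SmallBias (k d e : ℕ → ℝ) (γ : Fin 2 → ℝ) (A : Fin 2 → ℝ → ℝ) (A₀ : ℝ → ℝ) :
    Prop where
  marginal : ∀ i, (fun n : ℕ => A i (n / k n)) =o[atTop]
    (fun n => weight k d e (γ i) n / √(k n))
  dependence : (fun n : ℕ => A₀ (n / k n)) =o[atTop]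
    (fun n => max (weight k d e (γ 0) n) (weight k d e (γ 1) n) / √(k n))
  dependence_d : (fun n : ℕ => A₀ (d n)) =O[atTop] (fun n : ℕ => A₀ (n / k n))

/-- Conditions that make the part of `S` near the axes negligible. -/
structure AxesNegligible (k e : ℕ → ℝ) (γ : Fin 2 → ℝ) (q : ℝ → ℝ≥0∞) : Prop where
  nonneg : ∀ i, 0 ≤ γ i → (fun n => √(k n)) =O[atTop]
    (fun n => max (cSeq k e n) (cSeq k e n ^ γ i))
  neg_left : γ 0 < 0 → xl q = 0 → (fun n => √(k n)) =o[atTop] (fun n => cSeq k e n ^ (1 - γ 0))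
  neg_right : γ 1 < 0 → qInf q = 0 →
    (fun n => √(k n)) =o[atTop] (fun n => cSeq k e n ^ (1 - γ 1))

/-! ## The estimator and its limit -/

/-- The estimated exponent measure: `1/k` times the number of standardized observations in `B`. -/
def nuHat {n : ℕ} (k : ℝ) (gh ah bh : Fin 2 → ℝ) (z : Fin n → ℝ × ℝ)
    (B : Set (ℝ≥0∞ × ℝ≥0∞)) : ℝ :=
  (1 / k) * ({i | standardize gh ah bh (z i) ∈ B} : Set (Fin n)).ncard

/-- The estimator `(1/e) ν̂((n / (k e)) T̂^←(D))` of the probability of the set `D`. -/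
def pHat {n : ℕ} (k e : ℝ) (gh ah bh : Fin 2 → ℝ) (z : Fin n → ℝ × ℝ) (D : Set (ℝ × ℝ)) : ℝ :=
  (1 / e) * nuHat k gh ah bh z
    ((fun w : ℝ≥0∞ × ℝ≥0∞ =>
      (ENNReal.ofReal (n / (k * e)) * w.1, ENNReal.ofReal (n / (k * e)) * w.2)) ''
      (standardize gh ah bh '' D))

/-- The linear combination of the limits of the marginal estimators. -/
def limitCoeff (γ α β Γ : ℝ) : ℝ :=
  if 0 < γ then Γ / γ
  else if γ < 0 then β + Γ / γ ^ 2 - α / γ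
  else Γ

/-- The exponent of the boundary function in the integrals: `1 - γ` if `γ < 0`, and `1` otherwise. -/
def boundaryExponent (γ : ℝ) : ℝ := if γ < 0 then 1 - γ else 1

/-- The integrand `q^←(v) ^ (1 or 1 - γ) η(q^←(v), v)`. -/
def boundaryIntegrand₁ (q : ℝ → ℝ≥0∞) (η : ℝ × ℝ → ℝ) (γ v : ℝ) : ℝ :=
  (qInv q v).toReal ^ boundaryExponent γ * η ((qInv q v).toReal, v)

/-- The integrand `q(u) ^ (1 or 1 - γ) η(u, q(u))`. -/
def boundaryIntegrand₂ (q : ℝ → ℝ≥0∞) (η : ℝ × ℝ → ℝ) (γ u : ℝ) : ℝ :=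
  (q u).toReal ^ boundaryExponent γ * η (u, (q u).toReal)

/-- The leading term of the expansion. -/
def leadingTerm {Ω : Type*} (k d e : ℕ → ℝ) (γ : Fin 2 → ℝ) (q : ℝ → ℝ≥0∞) (η : ℝ × ℝ → ℝ)
    (α β Γ : Fin 2 → Ω → ℝ) (n : ℕ) (ω : Ω) : ℝ :=
  weight k d e (γ 0) n * (limitCoeff (γ 0) (α 0 ω) (β 0 ω) (Γ 0 ω) *
      ∫ v in Ioi (qInf q).toReal, boundaryIntegrand₁ q η (γ 0) v) +
    weight k d e (γ 1) n * (limitCoeff (γ 1) (α 1 ω) (β 1 ω) (Γ 1 ω) *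
      ∫ u in Ioi (xl q), boundaryIntegrand₂ q η (γ 1) u)

end FailureProb

end

open Filter Topology MeasureTheory ProbabilityTheory Asymptotics Set
open scoped ENNReal NNReal

noncomputable section

namespace FailureProb


/-! ## Box–Cox transformation and its inverse -/

theorem boxCox_one (γ : ℝ) : boxCox γ 1 = 0 := by
  simp [boxCox]

theorem one_add_mul_boxCox {γ x : ℝ} (hγ : γ ≠ 0) : 1 + γ * boxCox γ x = x ^ γ := by
  simp only [boxCox, hγ, if_false]
  field_simp
  ring

theorem boxCox_mul {γ x y : ℝ} (hx : 0 < x) (hy : 0 < y) :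
    boxCox γ (x * y) = x ^ γ * boxCox γ y + boxCox γ x := by
  by_cases h : γ = 0
  · simp [boxCox, h, Real.log_mul hx.ne' hy.ne', add_comm]
  · simp only [boxCox, h, if_false]
    rw [Real.mul_rpow hx.le hy.le]
    field_simp
    ring

theorem boxCox_strictMono {γ x y : ℝ} (hx : 0 < x) (hxy : x < y) : boxCox γ x < boxCox γ y := by
  rcases lt_trichotomy γ 0 with h | h | h
  · have : y ^ γ < x ^ γ := Real.rpow_lt_rpow_of_neg hx hxy h
    simp only [boxCox, h.ne, if_false]
    exact div_lt_div_of_neg_of_lt h (by linarith)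
  · simp only [boxCox, h, if_true]
    exact Real.log_lt_log hx hxy
  · have : x ^ γ < y ^ γ := Real.rpow_lt_rpow hx.le hxy h
    simp only [boxCox, h.ne', if_false]
    gcongr

theorem boxCox_le_iff {γ x y : ℝ} (hx : 0 < x) (hy : 0 < y) :
    boxCox γ x ≤ boxCox γ y ↔ x ≤ y := by
  constructor
  · intro h
    by_contra! hlt
    exact absurd (boxCox_strictMono (γ := γ) hy hlt) (not_lt.2 h)
  · intro h
    rcases h.eq_or_lt with h | h
    · rw [h]
    · exact (boxCox_strictMono hx h).le

theorem boxCox_eq_integral {γ x : ℝ} (hx : 0 < x) :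
    boxCox γ x = ∫ t in (0 : ℝ)..Real.log x, Real.exp (γ * t) := by
  by_cases h : γ = 0
  · simp [boxCox, h]
  · have h1 : ∀ t ∈ uIcc 0 (Real.log x),
        HasDerivAt (fun t => Real.exp (γ * t) / γ) (Real.exp (γ * t)) t := by
      intro t _
      have := (((hasDerivAt_id t).const_mul γ).exp).div_const γ
      simpa [h] using this
    rw [intervalIntegral.integral_eq_sub_of_hasDerivAt h1
      (by apply Continuous.intervalIntegrable; fun_prop)]
    simp only [boxCox, h, if_false]
    rw [Real.rpow_def_of_pos hx, mul_comm γ]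
    simp
    ring

theorem boxCox_mono_index {γ γ' x : ℝ} (hx : 0 < x) (hγ : γ ≤ γ') :
    boxCox γ x ≤ boxCox γ' x := by
  rw [boxCox_eq_integral hx, boxCox_eq_integral hx]
  rcases le_total 0 (Real.log x) with h | h
  · refine intervalIntegral.integral_mono_on h (by apply Continuous.intervalIntegrable; fun_prop)
      (by apply Continuous.intervalIntegrable; fun_prop) fun t ht => ?_
    exact Real.exp_le_exp.2 (mul_le_mul_of_nonneg_right hγ ht.1)
  · rw [intervalIntegral.integral_symm, intervalIntegral.integral_symm (a := Real.log x)]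
    refine neg_le_neg (intervalIntegral.integral_mono_on h
      (by apply Continuous.intervalIntegrable; fun_prop)
      (by apply Continuous.intervalIntegrable; fun_prop) fun t ht => ?_)
    exact Real.exp_le_exp.2 (mul_le_mul_of_nonpos_right hγ ht.2)

theorem gpdInv_mono (γ : ℝ) : Monotone (gpdInv γ) := by
  intro v w hvw
  rcases lt_trichotomy γ 0 with h | h | h
  · simp only [gpdInv, h.ne, if_false, h.not_gt]
    have h1 : 1 + γ * w ≤ 1 + γ * v := by nlinarith
    by_cases hw : 0 < 1 + γ * w
    · rw [if_pos hw, if_pos (hw.trans_le h1)]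
      refine ENNReal.ofReal_le_ofReal (Real.rpow_le_rpow_of_nonpos hw h1 ?_)
      exact (one_div_neg.2 h).le
    · rw [if_neg hw]; exact le_top
  · simp only [gpdInv, h, if_true]
    exact ENNReal.ofReal_le_ofReal (Real.exp_le_exp.2 hvw)
  · simp only [gpdInv, h.ne', if_false, h, if_true]
    have h1 : 1 + γ * v ≤ 1 + γ * w := by nlinarith
    by_cases hv : 0 < 1 + γ * v
    · rw [if_pos hv, if_pos (hv.trans_le h1)]
      exact ENNReal.ofReal_le_ofReal (Real.rpow_le_rpow hv.le h1 (one_div_pos.2 h).le)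
    · rw [if_neg hv]; exact zero_le

theorem gpdInv_boxCox {γ x : ℝ} (hx : 0 < x) : gpdInv γ (boxCox γ x) = ENNReal.ofReal x := by
  by_cases h : γ = 0
  · simp [gpdInv, boxCox, h, Real.exp_log hx]
  · simp only [gpdInv, h, if_false, one_add_mul_boxCox h, Real.rpow_pos_of_pos hx, if_true]
    rw [← Real.rpow_mul hx.le, mul_one_div_cancel h, Real.rpow_one]

theorem gpdInv_eq_ofReal_iff {γ v x : ℝ} (hx : 0 < x) :
    gpdInv γ v = ENNReal.ofReal x ↔ v = boxCox γ x := by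
  refine ⟨fun h => ?_, fun h => h ▸ gpdInv_boxCox hx⟩
  by_cases hγ : γ = 0
  · simp only [gpdInv, hγ, if_true] at h
    rw [ENNReal.ofReal_eq_ofReal_iff (Real.exp_pos _).le hx.le] at h
    simp [boxCox, hγ, ← h]
  · simp only [gpdInv, hγ, if_false] at h
    by_cases h1 : 0 < 1 + γ * v
    · rw [if_pos h1, ENNReal.ofReal_eq_ofReal_iff (by positivity) hx.le] at h
      simp only [boxCox, hγ, if_false]
      rw [← h, ← Real.rpow_mul h1.le, one_div_mul_cancel hγ, Real.rpow_one]
      field_simp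
      ring
    · rw [if_neg h1] at h
      by_cases h2 : 0 < γ
      · rw [if_pos h2] at h
        exact absurd h.symm (by simp [hx])
      · rw [if_neg h2] at h
        exact absurd h.symm ENNReal.ofReal_ne_top

theorem ofReal_le_gpdInv_iff {γ v x : ℝ} (hx : 0 < x) :
    ENNReal.ofReal x ≤ gpdInv γ v ↔ boxCox γ x ≤ v := by
  constructor
  · intro h
    by_contra! hlt
    have h1 := gpdInv_mono γ hlt.le
    rw [gpdInv_boxCox hx] at h1
    exact hlt.ne ((gpdInv_eq_ofReal_iff hx).1 (le_antisymm h1 h))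
  · intro h
    rw [← gpdInv_boxCox (γ := γ) hx]
    exact gpdInv_mono γ h

/-- Real-valued version of `gpdInv`. -/
def gpdReal (γ v : ℝ) : ℝ := if γ = 0 then Real.exp v else (1 + γ * v) ^ (1 / γ)

theorem gpdReal_zero (γ : ℝ) : gpdReal γ 0 = 1 := by
  by_cases h : γ = 0 <;> simp [gpdReal, h]

theorem boxCox_gpdReal {γ v : ℝ} (h : 0 < 1 + γ * v) : boxCox γ (gpdReal γ v) = v := by
  by_cases hγ : γ = 0
  · simp [boxCox, gpdReal, hγ]
  · simp only [boxCox, gpdReal, hγ, if_false]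
    rw [← Real.rpow_mul h.le, one_div_mul_cancel hγ, Real.rpow_one]
    field_simp
    ring

theorem gpdReal_pos {γ v : ℝ} (h : 0 < 1 + γ * v) : 0 < gpdReal γ v := by
  by_cases hγ : γ = 0
  · simp [gpdReal, hγ, Real.exp_pos]
  · simp only [gpdReal, hγ, if_false]
    positivity

theorem hasDerivAt_gpdReal_zero (γ : ℝ) : HasDerivAt (gpdReal γ) 1 0 := by
  by_cases hγ : γ = 0
  · have : gpdReal γ = Real.exp := by funext v; simp [gpdReal, hγ]
    rw [this]
    simpa using Real.hasDerivAt_exp 0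
  · have : gpdReal γ = fun v => (1 + γ * v) ^ (1 / γ) := by funext v; simp [gpdReal, hγ]
    rw [this]
    have h1 : HasDerivAt (fun v : ℝ => 1 + γ * v) γ 0 := by
      simpa using ((hasDerivAt_id (0 : ℝ)).const_mul γ).const_add 1
    have h2 := h1.rpow_const (p := 1 / γ) (Or.inl (by simp))
    simpa [hγ] using h2

/-- First order expansion of `gpdReal` at `0`. -/
theorem exists_gpdReal_expansion (γ : ℝ) {ε : ℝ} (hε : 0 < ε) :
    ∃ δ : ℝ, 0 < δ ∧ ∀ v : ℝ, |v| ≤ δ → 0 < 1 + γ * v ∧ |gpdReal γ v - 1 - v| ≤ ε * |v| := by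
  have h := (hasDerivAt_gpdReal_zero γ).isLittleO
  have h1 := h.bound hε
  have h2 : ∀ᶠ v : ℝ in 𝓝 0, 0 < 1 + γ * v := by
    have : ContinuousAt (fun v : ℝ => 1 + γ * v) 0 := by fun_prop
    exact this.eventually (lt_mem_nhds (by simp))
  obtain ⟨δ, hδ, hball⟩ := Metric.eventually_nhds_iff.1 (h1.and h2)
  refine ⟨δ / 2, by positivity, fun v hv => ?_⟩
  have := hball (y := v) (by rw [Real.dist_eq]; simp; linarith)
  refine ⟨this.2, ?_⟩
  simpa [gpdReal_zero, Real.norm_eq_abs] using this.1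

/-- Multiplicative perturbation of the argument of `gpdInv`. -/
theorem boxCox_mul_gpdReal {γ x v : ℝ} (hx : 0 < x)
    (h : 0 < 1 + γ * (x ^ (-γ) * (v - boxCox γ x))) :
    boxCox γ (x * gpdReal γ (x ^ (-γ) * (v - boxCox γ x))) = v := by
  rw [boxCox_mul hx (gpdReal_pos h), boxCox_gpdReal h, ← mul_assoc, ← Real.rpow_add hx]
  simp

/-! ## Quantile functions -/

/-- Real-valued tail quantile function. -/
def tailQ (F : ℝ → ℝ) (t : ℝ) : ℝ := (tailQuantile F t).toReal

theorem tailQuantile_of_le_one {F : ℝ → ℝ} (hF : ∀ x, 0 ≤ F x) {t : ℝ} (ht : t ≤ 1) :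
    tailQuantile F t = ⊥ := by
  unfold tailQuantile
  split_ifs with h
  · have h1 : (1 : ℝ) - 1 / t ≤ 0 := by
      rw [sub_nonpos, le_div_iff₀ h]; linarith
    have h2 : {x : ℝ | 1 - 1 / t ≤ F x} = univ := by
      ext x; simpa using h1.trans (hF x)
    rw [genInv, h2, eq_bot_iff]
    refine EReal.le_of_forall_lt_iff_le.1 fun z hz => ?_
    exact sInf_le ⟨z, mem_univ _, rfl⟩
  · rfl

theorem setOf_le_cdf (m : Measure ℝ) [IsProbabilityMeasure m] {s : ℝ} (h0 : 0 < s) (h1 : s < 1) :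
    ∃ y : ℝ, {x : ℝ | s ≤ cdf m x} = Ici y := by
  set A := {x : ℝ | s ≤ cdf m x}
  have hne : A.Nonempty :=
    ((tendsto_cdf_atTop m).eventually (lt_mem_nhds h1)).exists.imp fun x hx => hx.le
  obtain ⟨b, hb⟩ := eventually_atBot.1 ((tendsto_cdf_atBot m).eventually (gt_mem_nhds h0))
  have hbdd : BddBelow A := ⟨b, fun x hx => by
    by_contra! hlt
    exact absurd (hb x hlt.le) (not_lt.2 hx)⟩
  refine ⟨sInf A, Set.ext fun x => ⟨fun hx => csInf_le hbdd hx, fun hx => ?_⟩⟩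
  have hmono := (cdf m).mono
  have h2 : ∀ y, sInf A < y → s ≤ cdf m y := fun y hy => by
    obtain ⟨z, hz, hzy⟩ := exists_lt_of_csInf_lt hne hy
    exact le_trans hz (hmono hzy.le)
  have hr := ((cdf m).right_continuous x).tendsto
  have hr' : Tendsto (cdf m) (𝓝[>] x) (𝓝 (cdf m x)) :=
    hr.mono_left (nhdsWithin_mono _ Ioi_subset_Ici_self)
  refine ge_of_tendsto hr' ?_
  filter_upwards [self_mem_nhdsWithin] with y hy
  exact h2 y (lt_of_le_of_lt hx hy)

theorem genInv_eq_coe {F : ℝ → ℝ} {s y : ℝ} (h : {x : ℝ | s ≤ F x} = Ici y) :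
    genInv F s = (y : EReal) := by
  rw [genInv, h]
  refine le_antisymm (sInf_le ⟨y, self_mem_Ici, rfl⟩) (le_sInf ?_)
  rintro _ ⟨x, hx, rfl⟩
  exact EReal.coe_le_coe_iff.2 hx

theorem one_sub_one_div_mem {t : ℝ} (ht : 1 < t) : 0 < 1 - 1 / t ∧ 1 - 1 / t < 1 := by
  have : 1 / t < 1 := by rw [div_lt_one (by linarith)]; exact ht
  have : 0 < 1 / t := by positivity
  constructor <;> linarith

theorem tailQuantile_eq_coe (m : Measure ℝ) [IsProbabilityMeasure m] {t : ℝ} (ht : 1 < t) :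
    tailQuantile (cdf m) t = (tailQ (cdf m) t : EReal) := by
  obtain ⟨y, hy⟩ := setOf_le_cdf m (one_sub_one_div_mem ht).1 (one_sub_one_div_mem ht).2
  have h0 : 0 < t := by linarith
  simp only [tailQ, tailQuantile, h0, if_true, genInv_eq_coe hy, EReal.toReal_coe]

theorem tailQ_le_iff (m : Measure ℝ) [IsProbabilityMeasure m] {t x : ℝ} (ht : 1 < t) :
    tailQ (cdf m) t ≤ x ↔ 1 - 1 / t ≤ cdf m x := by
  obtain ⟨y, hy⟩ := setOf_le_cdf m (one_sub_one_div_mem ht).1 (one_sub_one_div_mem ht).2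
  have h0 : 0 < t := by linarith
  have : tailQ (cdf m) t = y := by
    simp only [tailQ, tailQuantile, h0, if_true, genInv_eq_coe hy, EReal.toReal_coe]
  rw [this]
  exact (Set.ext_iff.1 hy x).symm

theorem coe_eq_tailQuantile_iff (m : Measure ℝ) [IsProbabilityMeasure m] {t x : ℝ} :
    (x : EReal) = tailQuantile (cdf m) t ↔ 1 < t ∧ x = tailQ (cdf m) t := by
  constructor
  · intro h
    by_cases ht : 1 < t
    · rw [tailQuantile_eq_coe m ht] at h
      exact ⟨ht, EReal.coe_eq_coe_iff.1 h⟩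
    · rw [tailQuantile_of_le_one (fun x => cdf_nonneg m x) (not_lt.1 ht)] at h
      exact absurd h (EReal.coe_ne_bot x)
  · rintro ⟨ht, rfl⟩
    exact (tailQuantile_eq_coe m ht).symm

theorem tailQ_mono (m : Measure ℝ) [IsProbabilityMeasure m] {t t' : ℝ} (ht : 1 < t)
    (h : t ≤ t') : tailQ (cdf m) t ≤ tailQ (cdf m) t' := by
  rw [tailQ_le_iff m ht]
  refine le_trans ?_ ((tailQ_le_iff m (ht.trans_le h)).1 le_rfl)
  have : 1 / t' ≤ 1 / t := one_div_le_one_div_of_le (by linarith) h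
  linarith

/-- The consequences of `RegularUpperTail` for the tail quantile function. -/
structure RegularTailQ (m : Measure ℝ) (t₀ : ℝ) : Prop where
  one_lt : 1 < t₀
  cdf_tailQ : ∀ t, t₀ ≤ t → cdf m (tailQ (cdf m) t) = 1 - 1 / t
  strictMono : StrictMonoOn (tailQ (cdf m)) (Ici t₀)
  cont : ContinuousOn (tailQ (cdf m)) (Ici t₀)
  measure_Ici : ∀ t, t₀ < t → m.real (Ici (tailQ (cdf m) t)) = 1 / t
  cdf_lt_one : ∀ᵐ z ∂m, cdf m z < 1
  tailQ_cdf : ∀ z, tailQ (cdf m) t₀ ≤ z → cdf m z < 1 → tailQ (cdf m) (1 / (1 - cdf m z)) = z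

theorem exists_regularTailQ (m : Measure ℝ) [IsProbabilityMeasure m]
    (h : RegularUpperTail (cdf m)) : ∃ t₀, RegularTailQ m t₀ := by
  obtain ⟨x₀, hx₀, hcont, hstrict⟩ := h
  set F := cdf m with hF
  set J : Set ℝ := {x : ℝ | x₀ ≤ x ∧ (x : EReal) ≤ genInv F 1} with hJ
  have hFmono : Monotone F := F.mono
  have hlt1 : ∀ x : ℝ, F x < 1 → (x : EReal) ≤ genInv F 1 := fun x hx => by
    refine le_sInf ?_
    rintro _ ⟨y, hy, rfl⟩
    refine EReal.coe_le_coe_iff.2 ?_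
    by_contra! hlt
    exact absurd (hFmono hlt.le) (not_le.2 (hx.trans_le hy))
  have hge1 : ∀ x : ℝ, (x : EReal) < genInv F 1 → F x < 1 := fun x hx => by
    by_contra! hle
    exact absurd hx (not_lt.2 (sInf_le ⟨x, hle, rfl⟩))
  obtain ⟨x₁, hx₀₁, hx₁⟩ := EReal.lt_iff_exists_real_btwn.1 hx₀
  rw [EReal.coe_lt_coe_iff] at hx₀₁
  have hx₁J : x₁ ∈ J := ⟨hx₀₁.le, hx₁.le⟩
  have hx₀J : x₀ ∈ J := ⟨le_rfl, hx₀.le⟩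
  have hFx₁ : F x₁ < 1 := hge1 x₁ hx₁
  have hFpos : 0 < F x₁ := (cdf_nonneg m x₀).trans_lt (hstrict hx₀J hx₁J hx₀₁)
  set t₀ := 1 / (1 - F x₁) with ht₀
  have h1t₀ : 1 < t₀ := by rw [ht₀, lt_div_iff₀ (by linarith)]; linarith
  have hge : ∀ t, t₀ ≤ t → F x₁ ≤ 1 - 1 / t := fun t ht => by
    have : 1 / t ≤ 1 / t₀ := one_div_le_one_div_of_le (by linarith) ht
    rw [ht₀, one_div_one_div] at this
    linarith
  have hU1 : ∀ t, t₀ ≤ t → x₁ ≤ tailQ F t := fun t ht => by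
    by_contra! hlt
    set w := max (tailQ F t) x₀
    have hw : w < x₁ := max_lt hlt hx₀₁
    have h2 : 1 - 1 / t ≤ F w := (tailQ_le_iff m (h1t₀.trans_le ht)).1 (le_max_left _ _)
    have hwJ : w ∈ J := ⟨le_max_right _ _, (EReal.coe_le_coe_iff.2 hw.le).trans hx₁.le⟩
    have := hstrict hwJ hx₁J hw
    linarith [hge t ht]
  have hUlow : ∀ t, t₀ ≤ t → ∀ x, x < tailQ F t → F x < 1 - 1 / t := fun t ht x hx => by
    by_contra! hle
    exact absurd ((tailQ_le_iff m (h1t₀.trans_le ht)).2 hle) (not_le.2 hx)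
  have hUJ : ∀ t, t₀ ≤ t → tailQ F t ∈ J := fun t ht => by
    refine ⟨hx₀₁.le.trans (hU1 t ht), le_sInf ?_⟩
    rintro _ ⟨y, hy, rfl⟩
    refine EReal.coe_le_coe_iff.2 ((tailQ_le_iff m (h1t₀.trans_le ht)).2 ?_)
    exact (one_sub_one_div_mem (h1t₀.trans_le ht)).2.le.trans hy
  have hval : ∀ t, t₀ ≤ t → F (tailQ F t) = 1 - 1 / t := fun t ht => by
    refine le_antisymm ?_ ((tailQ_le_iff m (h1t₀.trans_le ht)).1 le_rfl)
    have hxlt : x₀ < tailQ F t := hx₀₁.trans_le (hU1 t ht)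
    have hc : Tendsto F (𝓝[Ioo x₀ (tailQ F t)] (tailQ F t)) (𝓝 (F (tailQ F t))) := by
      refine (hcont _ (hUJ t ht)).mono_left (nhdsWithin_mono _ fun x hx => ⟨hx.1.le, ?_⟩)
      exact (EReal.coe_le_coe_iff.2 hx.2.le).trans (hUJ t ht).2
    have : (𝓝[Ioo x₀ (tailQ F t)] (tailQ F t)).NeBot := by
      rw [nhdsWithin_Ioo_eq_nhdsLT hxlt]; infer_instance
    refine le_of_tendsto hc ?_
    filter_upwards [self_mem_nhdsWithin] with x hx
    exact (hUlow t ht x hx.2).le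
  have hdiv : ∀ t t', t₀ ≤ t → t < t' → 1 - 1 / t < 1 - 1 / t' := fun t t' ht htt' => by
    have : 1 / t' < 1 / t := one_div_lt_one_div_of_lt (by linarith) htt'
    linarith
  have hstr : StrictMonoOn (tailQ F) (Ici t₀) := fun t ht t' ht' htt' => by
    by_contra! hle
    have := hFmono hle
    rw [hval t ht, hval t' ht'] at this
    linarith [hdiv t t' ht htt']
  have hcontU : ContinuousOn (tailQ F) (Ici t₀) := by
    intro t ht
    have htend : Tendsto (fun t' : ℝ => 1 - 1 / t') (𝓝[Ici t₀] t) (𝓝 (1 - 1 / t)) := by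
      have : t ≠ 0 := by have : t₀ ≤ t := ht; linarith
      have : ContinuousAt (fun t' : ℝ => 1 - 1 / t') t := by fun_prop (disch := assumption)
      exact this.tendsto.mono_left nhdsWithin_le_nhds
    refine tendsto_order.2 ⟨fun y hy => ?_, fun y hy => ?_⟩
    · filter_upwards [htend.eventually (lt_mem_nhds (hUlow t ht y hy)), self_mem_nhdsWithin]
        with t' h1 h2
      by_contra! hle
      exact absurd ((tailQ_le_iff m (h1t₀.trans_le h2)).1 hle) (not_le.2 h1)
    · obtain ⟨y', hy', hyy'⟩ := exists_between hy
      have h3 : 1 - 1 / t < F y' := by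
        by_cases h1 : F y' < 1
        · rw [← hval t ht]
          exact hstrict (hUJ t ht) ⟨(hUJ t ht).1.trans hy'.le, hlt1 y' h1⟩ hy'
        · exact (one_sub_one_div_mem (h1t₀.trans_le ht)).2.trans_le (not_lt.1 h1)
      filter_upwards [htend.eventually (gt_mem_nhds h3), self_mem_nhdsWithin] with t' h1 h2
      exact ((tailQ_le_iff m (h1t₀.trans_le h2)).2 h1.le).trans_lt hyy'
  have hIic : ∀ z, m.real (Iic z) = F z := fun z => (cdf_eq_real m z).symm
  have hmeas : ∀ t, t₀ < t → m.real (Ici (tailQ F t)) = 1 / t := fun t ht => by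
    have hcompl : m.real (Ici (tailQ F t)) = 1 - m.real (Iio (tailQ F t)) := by
      rw [← compl_Iio, probReal_compl_eq_one_sub measurableSet_Iio]
    have hle : m.real (Iio (tailQ F t)) ≤ 1 - 1 / t := by
      rw [← hval t ht.le, ← hIic]
      exact measureReal_mono Iio_subset_Iic_self
    have hge' : 1 - 1 / t ≤ m.real (Iio (tailQ F t)) := by
      have htend : Tendsto (fun t' : ℝ => 1 - 1 / t') (𝓝[<] t) (𝓝 (1 - 1 / t)) := by
        have : t ≠ 0 := by linarith
        have : ContinuousAt (fun t' : ℝ => 1 - 1 / t') t := by fun_prop (disch := assumption)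
        exact this.tendsto.mono_left nhdsWithin_le_nhds
      refine le_of_tendsto htend ?_
      filter_upwards [Ioo_mem_nhdsLT ht] with t' ht'
      rw [← hval t' ht'.1.le, ← hIic]
      exact measureReal_mono fun z hz => lt_of_le_of_lt hz (hstr ht'.1.le ht.le ht'.2)
    rw [hcompl]; linarith
  refine ⟨t₀, h1t₀, hval, hstr, hcontU, hmeas, ?_, fun z hz hz1 => ?_⟩
  · have h0 : m.real {z | ¬ F z < 1} = 0 := by
      refine le_antisymm ?_ measureReal_nonneg
      have htend : Tendsto (fun t : ℝ => 1 / t) atTop (𝓝 0) := by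
        simpa using tendsto_inv_atTop_zero (𝕜 := ℝ)
      refine ge_of_tendsto htend ?_
      filter_upwards [eventually_gt_atTop t₀] with t ht
      rw [← hmeas t ht]
      refine measureReal_mono fun z hz => ?_
      exact (tailQ_le_iff m (h1t₀.trans ht)).2
        ((one_sub_one_div_mem (h1t₀.trans ht)).2.le.trans (not_lt.1 hz))
    rw [ae_iff]
    exact (measureReal_eq_zero_iff).1 h0
  · have hzt : t₀ ≤ 1 / (1 - F z) := by
      have h2 := (tailQ_le_iff m h1t₀).1 hz
      have h3 : 1 - F z ≤ 1 / t₀ := by linarith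
      rw [le_div_iff₀ (by linarith)]
      calc t₀ * (1 - F z) ≤ t₀ * (1 / t₀) := by gcongr
        _ = 1 := by field_simp
    refine hstrict.injOn (hUJ _ hzt) ⟨hx₀₁.le.trans ((hU1 t₀ le_rfl).trans hz), hlt1 z hz1⟩ ?_
    rw [hval _ hzt, one_div_one_div]; ring

theorem measureReal_cdf_le (m : Measure ℝ) [IsProbabilityMeasure m] {v : ℝ} (hv : 0 ≤ v) :
    m.real {z | cdf m z ≤ v} ≤ v := by
  have hmeas : MeasurableSet {z | cdf m z ≤ v} :=
    measurableSet_le (cdf m).mono.measurable measurable_const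
  refine ENNReal.toReal_le_of_le_ofReal hv ?_
  rw [hmeas.measure_eq_iSup_isCompact]
  refine iSup_le fun K => iSup_le fun hK => iSup_le fun hc => ?_
  rcases K.eq_empty_or_nonempty with rfl | hne
  · simp
  · obtain ⟨k, hk, hmax⟩ := hc.exists_isMaxOn hne continuousOn_id
    calc m K ≤ m (Iic k) := measure_mono fun x hx => hmax hx
      _ = ENNReal.ofReal (cdf m k) := by rw [ofReal_cdf]
      _ ≤ ENNReal.ofReal v := ENNReal.ofReal_le_ofReal (hK hk)

/-- Almost every point is a value of the quantile function. -/
theorem ae_exists_tailQuantile (m : Measure ℝ) [IsProbabilityMeasure m] {t₀ : ℝ}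
    (h : RegularTailQ m t₀) :
    ∀ᵐ z ∂m, ∃ t : ℝ, 1 < t ∧ z = tailQ (cdf m) t := by
  have hnull : ∀ {s : Set ℝ}, m.real s ≤ 0 → m s = 0 := fun {s} hs =>
    (measureReal_eq_zero_iff).1 (le_antisymm hs measureReal_nonneg)
  have h0 : ∀ᵐ z ∂m, 0 < cdf m z := by
    rw [ae_iff]
    refine hnull ?_
    simpa only [not_lt] using measureReal_cdf_le m le_rfl
  have hflat : ∀ r : ℚ, ∀ᵐ z ∂m, (r : ℝ) < z → cdf m r < cdf m z := fun r => by
    rw [ae_iff]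
    refine hnull ?_
    have hsub : {z | ¬((r : ℝ) < z → cdf m r < cdf m z)} = {z | cdf m z ≤ cdf m r} \ Iic (r : ℝ) := by
      ext z
      simp only [mem_setOf_eq, Classical.not_imp, not_lt, mem_diff, mem_Iic, not_le]
      tauto
    have hsub' : Iic (r : ℝ) ⊆ {z | cdf m z ≤ cdf m r} := fun z hz => (cdf m).mono hz
    rw [hsub, measureReal_diff hsub' measurableSet_Iic, ← cdf_eq_real]
    linarith [measureReal_cdf_le m (cdf_nonneg m (r : ℝ))]
  filter_upwards [h0, h.cdf_lt_one, ae_all_iff.2 hflat] with z hz0 hz1 hz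
  have h1t : 1 < 1 / (1 - cdf m z) := by rw [lt_div_iff₀ (by linarith)]; linarith
  refine ⟨1 / (1 - cdf m z), h1t, le_antisymm ?_ ?_⟩
  · by_contra! hlt
    obtain ⟨r, hr1, hr2⟩ := exists_rat_btwn hlt
    have h2 := (tailQ_le_iff m h1t).1 hr1.le
    rw [one_div_one_div] at h2
    linarith [hz r hr2]
  · rw [tailQ_le_iff m h1t, one_div_one_div]; linarith

/-! ## Second order condition -/

theorem abs_psiBar_le (γ : ℝ) {ρ c₁ : ℝ} (hρ : ρ < 0) (hc : 0 < c₁) :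
    ∃ C : ℝ, 0 ≤ C ∧ ∀ x, c₁ ≤ x → |psiBar γ ρ x| ≤ C * x ^ γ := by
  by_cases h : γ + ρ = 0
  · have hγ : 0 < γ := by linarith
    refine ⟨1 / γ + |Real.log c₁| * c₁ ^ (-γ), by positivity, fun x hx => ?_⟩
    have hx0 : 0 < x := hc.trans_le hx
    simp only [psiBar, h, if_true]
    have h1 : Real.log x ≤ x ^ γ / γ := Real.log_le_rpow_div hx0.le hγ
    have h2 : Real.log c₁ ≤ Real.log x := Real.log_le_log hc hx
    have h3 : 1 ≤ c₁ ^ (-γ) * x ^ γ := by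
      rw [Real.rpow_neg hc.le, ← div_eq_inv_mul, le_div_iff₀ (by positivity), one_mul]
      exact Real.rpow_le_rpow hc.le hx hγ.le
    have h4 : |Real.log c₁| ≤ |Real.log c₁| * (c₁ ^ (-γ) * x ^ γ) :=
      le_mul_of_one_le_right (abs_nonneg _) h3
    have h5 : 0 ≤ x ^ γ / γ := by positivity
    have h6 : (1 / γ + |Real.log c₁| * c₁ ^ (-γ)) * x ^ γ
        = x ^ γ / γ + |Real.log c₁| * (c₁ ^ (-γ) * x ^ γ) := by ring
    rw [h6, abs_le]
    constructor
    · linarith [neg_abs_le (Real.log c₁)]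
    · linarith [abs_nonneg (Real.log c₁)]
  · refine ⟨c₁ ^ ρ / |γ + ρ|, by positivity, fun x hx => ?_⟩
    have hx0 : 0 < x := hc.trans_le hx
    simp only [psiBar, h, if_false]
    rw [abs_div, abs_of_pos (by positivity : 0 < x ^ (γ + ρ)), div_mul_eq_mul_div,
      Real.rpow_add hx0, mul_comm]
    have : x ^ ρ ≤ c₁ ^ ρ := Real.rpow_le_rpow_of_nonpos hc hx hρ.le
    gcongr

/-- First order approximation of the tail quantile function with an error of order `A t`. -/
theorem SecondOrder.bound {F : ℝ → ℝ} {γ ρ : ℝ} {a b A : ℝ → ℝ} (h : SecondOrder F γ ρ a b A)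
    {c₁ : ℝ} (hc : 0 < c₁) :
    ∃ C t₀ : ℝ, 0 ≤ C ∧ 1 ≤ t₀ ∧ ∀ t x, c₁ ≤ x → t₀ < t → t₀ < t * x →
      |(tailQ F (t * x) - b t) / a t - boxCox γ x| ≤ C * |A t| * x ^ γ := by
  obtain ⟨C, hC, hψ⟩ := abs_psiBar_le γ h.rho_neg hc
  obtain ⟨t₀, ht₀, hu⟩ := h.uniform (-ρ) (by linarith [h.rho_neg]) 1 one_pos
  refine ⟨C + max 1 (c₁ ^ (2 * ρ)), t₀, by positivity, ht₀, fun t x hx ht htx => ?_⟩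
  have hx0 : 0 < x := hc.trans_le hx
  have ht0 : 0 < t := by linarith
  have h1 := hu t x hx0 ht htx
  have h2 : x ^ (γ + ρ) * max (x ^ (-ρ)) (x ^ (- -ρ)) ≤ max 1 (c₁ ^ (2 * ρ)) * x ^ γ := by
    rw [mul_max_of_nonneg _ _ (by positivity), ← Real.rpow_add hx0, ← Real.rpow_add hx0,
      max_mul_of_nonneg _ _ (by positivity)]
    refine max_le_max (by simp) ?_
    rw [show γ + ρ + - -ρ = 2 * ρ + γ by ring, Real.rpow_add hx0]
    have hp : x ^ (2 * ρ) ≤ c₁ ^ (2 * ρ) :=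
      Real.rpow_le_rpow_of_nonpos hc hx (by linarith [h.rho_neg])
    gcongr
  have h3 : |secondOrderQuot F γ a b A t x| ≤ (C + max 1 (c₁ ^ (2 * ρ))) * x ^ γ := by
    have := abs_sub_abs_le_abs_sub (secondOrderQuot F γ a b A t x) (psiBar γ ρ x)
    linarith [hψ x hx]
  have h4 : (tailQ F (t * x) - b t) / a t - boxCox γ x = A t * secondOrderQuot F γ a b A t x := by
    unfold secondOrderQuot tailQ
    have := h.A_ne t ht0
    field_simp
  rw [h4, abs_mul]
  calc |A t| * |secondOrderQuot F γ a b A t x|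
      ≤ |A t| * ((C + max 1 (c₁ ^ (2 * ρ))) * x ^ γ) := by gcongr
    _ = _ := by ring

theorem tailQ_eq_secondOrderQuot {F : ℝ → ℝ} {γ ρ : ℝ} {a b A : ℝ → ℝ}
    (h : SecondOrder F γ ρ a b A) {t x : ℝ} (ht : 0 < t) :
    tailQ F (t * x) = b t + a t * (boxCox γ x + A t * secondOrderQuot F γ a b A t x) := by
  unfold secondOrderQuot tailQ
  have := h.A_ne t ht
  have := h.a_pos t ht
  field_simp
  ring

theorem abs_boxCox_le (γ : ℝ) : ∃ C : ℝ, 0 ≤ C ∧ ∀ s, 0 < s →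
    |boxCox γ s| * s ^ (-γ) ≤ C * (1 + |Real.log s| + s ^ (-γ)) := by
  by_cases h : γ = 0
  · refine ⟨1, one_pos.le, fun s hs => ?_⟩
    simp only [boxCox, h, if_true, neg_zero, Real.rpow_zero]
    linarith
  · refine ⟨1 / |γ|, by positivity, fun s hs => ?_⟩
    simp only [boxCox, h, if_false]
    rw [abs_div, div_mul_eq_mul_div, div_mul_eq_mul_div, one_mul]
    gcongr
    have h1 : s ^ γ * s ^ (-γ) = 1 := by rw [← Real.rpow_add hs]; simp
    have h2 : |s ^ γ - 1| ≤ s ^ γ + 1 := by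
      have : 0 < s ^ γ := by positivity
      rw [abs_le]; constructor <;> linarith
    calc |s ^ γ - 1| * s ^ (-γ) ≤ (s ^ γ + 1) * s ^ (-γ) := by gcongr
      _ = 1 + s ^ (-γ) := by rw [add_mul, h1, one_mul]
      _ ≤ _ := by linarith [abs_nonneg (Real.log s)]

theorem psiBar_three_point_ne_zero (γ : ℝ) {ρ : ℝ} (hρ : ρ < 0) :
    psiBar γ ρ 4 - (1 + 2 ^ γ) * psiBar γ ρ 2 + 2 ^ γ * psiBar γ ρ 1 ≠ 0 := by
  by_cases h : γ + ρ = 0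
  · have hγ : 0 < γ := by linarith
    simp only [psiBar, h, if_true, Real.log_one]
    rw [show (4 : ℝ) = 2 ^ (2 : ℕ) by norm_num, Real.log_pow]
    have h1 : 1 < (2 : ℝ) ^ γ := Real.one_lt_rpow (by norm_num) hγ
    have h2 : 0 < Real.log 2 := Real.log_pos (by norm_num)
    have : (((2 : ℕ) : ℝ) * Real.log 2 - (1 + 2 ^ γ) * Real.log 2 + 2 ^ γ * 0)
        = (1 - 2 ^ γ) * Real.log 2 := by push_cast; ring
    rw [this]
    exact mul_ne_zero (by linarith) h2.ne'
  · simp only [psiBar, h, if_false, Real.one_rpow]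
    have h4 : (4 : ℝ) ^ (γ + ρ) = 2 ^ (γ + ρ) * 2 ^ (γ + ρ) := by
      rw [← Real.mul_rpow (by norm_num) (by norm_num)]; norm_num
    have h5 : (2 : ℝ) ^ (γ + ρ) / (γ + ρ) = 2 ^ (γ + ρ) * (1 / (γ + ρ)) := by ring
    have : (4 : ℝ) ^ (γ + ρ) / (γ + ρ) - (1 + 2 ^ γ) * (2 ^ (γ + ρ) / (γ + ρ))
        + 2 ^ γ * (1 / (γ + ρ)) = (2 ^ (γ + ρ) - 1) * (2 ^ (γ + ρ) - 2 ^ γ) / (γ + ρ) := by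
      rw [h4]; field_simp; ring
    rw [this]
    have hinj : ∀ p q : ℝ, (2 : ℝ) ^ p = 2 ^ q → p = q := fun p q hpq =>
      (Real.rpow_right_inj (by norm_num) (by norm_num)).1 hpq
    refine div_ne_zero (mul_ne_zero ?_ ?_) h
    · intro h0
      exact h (hinj _ 0 (by rw [Real.rpow_zero]; linarith))
    · intro h0
      have := hinj (γ + ρ) γ (by linarith)
      linarith

set_option maxHeartbeats 400000 in
/-- Change of the reference point in the second order condition: approximation with reference point
`t * x` and an error of order `A t`. -/
theorem SecondOrder.change_reference {F : ℝ → ℝ} {γ ρ : ℝ} {a b A : ℝ → ℝ}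
    (h : SecondOrder F γ ρ a b A) :
    ∃ C ε₀ t₀ : ℝ, 0 ≤ C ∧ 0 < ε₀ ∧ 1 ≤ t₀ ∧ ∀ t x, t₀ < t → 1 ≤ x → |A t| ≤ ε₀ →
      |A (t * x)| ≤ C * |A t| ∧
      ∀ s, 0 < s → 1 ≤ x * s →
        |s ^ (-γ) * ((tailQ F (t * x * s) - b (t * x)) / a (t * x) - boxCox γ s)|
          ≤ C * |A t| * (1 + |Real.log s| + s ^ (-γ)) := by
  obtain ⟨C₀, t₁, hC₀, ht₁, hE⟩ := h.bound one_pos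
  obtain ⟨Cd, hCd, hD⟩ := abs_boxCox_le γ
  set Λ := psiBar γ ρ 4 - (1 + 2 ^ γ) * psiBar γ ρ 2 + 2 ^ γ * psiBar γ ρ 1 with hΛdef
  have hΛ : 0 < |Λ| := abs_pos.2 (psiBar_three_point_ne_zero γ h.rho_neg)
  set Q := fun t x => secondOrderQuot F γ a b A t x with hQ
  have hlim := fun (x : ℝ) (hx : 0 < x) => h.limit x hx
  have hlimΛ : Tendsto (fun t => Q t 4 - (1 + 2 ^ γ) * Q t 2 + 2 ^ γ * Q t 1) atTop (𝓝 Λ) :=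
    ((hlim 4 (by norm_num)).sub ((hlim 2 (by norm_num)).const_mul _)).add
      ((hlim 1 (by norm_num)).const_mul _)
  set Kψ := |psiBar γ ρ 1| + |psiBar γ ρ 2| + 1 with hKψ
  have hev1 := hlimΛ.abs.eventually (lt_mem_nhds (half_lt_self hΛ))
  have hev2 : ∀ᶠ t in atTop, |Q t 1| < Kψ := (hlim 1 (by norm_num)).abs.eventually
    (gt_mem_nhds (show |psiBar γ ρ 1| < Kψ by linarith [abs_nonneg (psiBar γ ρ 2)]))
  have hev3 : ∀ᶠ t in atTop, |Q t 2| < Kψ := (hlim 2 (by norm_num)).abs.eventually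
    (gt_mem_nhds (show |psiBar γ ρ 2| < Kψ by linarith [abs_nonneg (psiBar γ ρ 1)]))
  obtain ⟨t₂, ht₂⟩ := eventually_atTop.1 (hev1.and (hev2.and hev3))
  set K₁ := C₀ * (4 ^ γ + (1 + 2 ^ γ) * 2 ^ γ + 2 ^ γ) with hK₁
  set K₂ := 2 * K₁ / |Λ| with hK₂
  set D₂ := boxCox γ 2 with hD₂
  have hD₂pos : 0 < D₂ := by
    rw [hD₂, ← boxCox_one γ]; exact boxCox_strictMono one_pos (by norm_num)
  set K₄ := (K₂ * (2 * Kψ) + C₀ * (2 ^ γ + 1)) / D₂ with hK₄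
  have hKψ0 : 0 ≤ Kψ := by positivity
  have hK₁0 : 0 ≤ K₁ := by positivity
  have hK₂0 : 0 ≤ K₂ := by positivity
  have hK₄0 : 0 ≤ K₄ := by positivity
  set C := 2 * K₂ + (2 * K₄ * Cd + 2 * C₀ + (2 * C₀ + 2 * K₂ * Kψ)) with hC
  have hC0 : 0 ≤ C := by positivity
  have hQd : ∀ t x, Q t x = secondOrderQuot F γ a b A t x := fun _ _ => rfl
  clear_value C K₄ K₂ K₁ D₂ Kψ Q Λ
  refine ⟨C, 1 / (2 * K₄ + 1), max t₁ t₂, hC0, by positivity,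
    ht₁.trans (le_max_left _ _), fun t x ht hx hA => ?_⟩
  have ht1 : t₁ < t := (le_max_left _ _).trans_lt ht
  have ht0 : 0 < t := by linarith
  have hx0 : 0 < x := by linarith
  have htx : t ≤ t * x := le_mul_of_one_le_right ht0.le hx
  have htx0 : 0 < t * x := by positivity
  obtain ⟨h4, h5, h6⟩ := ht₂ (t * x) (((le_max_right _ _).trans_lt ht).le.trans htx)
  set d := t * x with hd
  set E := fun y => (tailQ F (t * (x * y)) - b t) / a t - boxCox γ (x * y) with hEdef
  have hat := h.a_pos t ht0
  have had := h.a_pos d htx0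
  have hEb : ∀ y, 0 < y → 1 ≤ x * y → |E y| ≤ C₀ * |A t| * (x ^ γ * y ^ γ) := fun y hy hxy => by
    rw [← Real.mul_rpow hx0.le hy.le]
    exact hE t (x * y) hxy ht1 (ht1.trans_le (le_mul_of_one_le_right ht0.le hxy))
  have hrep1 : ∀ y, 0 < y →
      tailQ F (d * y) = b t + a t * (x ^ γ * boxCox γ y + boxCox γ x + E y) := fun y hy => by
    rw [← boxCox_mul hx0 hy, hd, mul_assoc]
    simp only [hEdef]
    field_simp
    ring
  have hrep2 : ∀ y, tailQ F (d * y) = b d + a d * (boxCox γ y + A d * Q d y) := fun y => by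
    rw [hQd]; exact tailQ_eq_secondOrderQuot h htx0
  have hb4 : boxCox γ 4 = (1 + 2 ^ γ) * D₂ := by
    rw [show (4 : ℝ) = 2 * 2 by norm_num, boxCox_mul (by norm_num) (by norm_num), ← hD₂]; ring
  have e1 : b d + a d * (A d * Q d 1) = b t + a t * (boxCox γ x + E 1) := by
    have := (hrep2 1).symm.trans (hrep1 1 one_pos)
    rw [boxCox_one] at this
    linarith
  have e2 : b d + a d * (D₂ + A d * Q d 2) = b t + a t * (x ^ γ * D₂ + boxCox γ x + E 2) :=
    hD₂ ▸ (hrep2 2).symm.trans (hrep1 2 (by norm_num))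
  have e4 : b d + a d * ((1 + 2 ^ γ) * D₂ + A d * Q d 4)
      = b t + a t * (x ^ γ * ((1 + 2 ^ γ) * D₂) + boxCox γ x + E 4) := by
    have := (hrep2 4).symm.trans (hrep1 4 (by norm_num))
    rwa [hb4] at this
  set P := a t * x ^ γ with hP
  have hP0 : 0 < P := by positivity
  have hE1 := hEb 1 one_pos (by linarith)
  have hE2 := hEb 2 (by norm_num) (by linarith)
  clear_value P E
  have hE4 := hEb 4 (by norm_num) (by linarith)
  rw [Real.one_rpow, mul_one] at hE1
  have h2γ : (0 : ℝ) < 2 ^ γ := by positivity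
  have haA : |a d * A d| ≤ K₂ * |A t| * P := by
    have e : a d * A d * (Q d 4 - (1 + 2 ^ γ) * Q d 2 + 2 ^ γ * Q d 1)
        = a t * (E 4 - (1 + 2 ^ γ) * E 2 + 2 ^ γ * E 1) := by
      linear_combination e4 - (1 + 2 ^ γ) * e2 + 2 ^ γ * e1
    have h7 : |a t * (E 4 - (1 + 2 ^ γ) * E 2 + 2 ^ γ * E 1)| ≤ K₁ * |A t| * P := by
      rw [abs_mul, abs_of_pos hat]
      have : |E 4 - (1 + 2 ^ γ) * E 2 + 2 ^ γ * E 1|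
          ≤ |E 4| + (1 + 2 ^ γ) * |E 2| + 2 ^ γ * |E 1| := by
        calc _ ≤ |E 4 - (1 + 2 ^ γ) * E 2| + |2 ^ γ * E 1| := abs_add_le _ _
          _ ≤ |E 4| + |(1 + 2 ^ γ) * E 2| + |2 ^ γ * E 1| := by gcongr; exact abs_sub _ _
          _ = _ := by rw [abs_mul, abs_mul, abs_of_pos h2γ, abs_of_pos (by positivity : 0 < 1 + (2:ℝ) ^ γ)]
      calc a t * |E 4 - (1 + 2 ^ γ) * E 2 + 2 ^ γ * E 1|
          ≤ a t * (C₀ * |A t| * (x ^ γ * 4 ^ γ) + (1 + 2 ^ γ) * (C₀ * |A t| * (x ^ γ * 2 ^ γ))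
            + 2 ^ γ * (C₀ * |A t| * x ^ γ)) := by
              refine mul_le_mul_of_nonneg_left (this.trans ?_) hat.le
              gcongr
        _ = K₁ * |A t| * P := by rw [hK₁, hP]; ring
    rw [← e, abs_mul] at h7
    have h8 : |a d * A d| * (|Λ| / 2) ≤ K₁ * |A t| * P :=
      (mul_le_mul_of_nonneg_left h4.le (abs_nonneg _)).trans h7
    have h9 : K₂ * |A t| * P = K₁ * |A t| * P / (|Λ| / 2) := by rw [hK₂]; field_simp
    rw [h9, le_div_iff₀ (by positivity)]
    exact h8
  have haP : |a d - P| ≤ K₄ * |A t| * P := by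
    have e : (a d - P) * D₂ = a t * (E 2 - E 1) - a d * A d * (Q d 2 - Q d 1) := by
      rw [hP]; linear_combination e2 - e1
    have h7 : |(a d - P) * D₂| ≤ (K₂ * (2 * Kψ) + C₀ * (2 ^ γ + 1)) * |A t| * P := by
      rw [e]
      have t1 : |a t * (E 2 - E 1)| ≤ C₀ * (2 ^ γ + 1) * |A t| * P := by
        rw [abs_mul, abs_of_pos hat]
        calc a t * |E 2 - E 1| ≤ a t * (|E 2| + |E 1|) := by gcongr; exact abs_sub _ _
          _ ≤ a t * (C₀ * |A t| * (x ^ γ * 2 ^ γ) + C₀ * |A t| * x ^ γ) := by gcongr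
          _ = _ := by rw [hP]; ring
      have t2 : |a d * A d * (Q d 2 - Q d 1)| ≤ K₂ * |A t| * P * (2 * Kψ) := by
        rw [abs_mul]
        have : |Q d 2 - Q d 1| ≤ 2 * Kψ := (abs_sub _ _).trans (by linarith)
        gcongr
      calc _ ≤ |a t * (E 2 - E 1)| + |a d * A d * (Q d 2 - Q d 1)| := abs_sub _ _
        _ ≤ _ := by linarith
    rw [abs_mul, abs_of_pos hD₂pos] at h7
    have h9 : K₄ * |A t| * P = (K₂ * (2 * Kψ) + C₀ * (2 ^ γ + 1)) * |A t| * P / D₂ := by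
      rw [hK₄]; ring
    rw [h9, le_div_iff₀ hD₂pos]
    exact h7
  have hKA : K₄ * |A t| ≤ 1 / 2 := by
    calc K₄ * |A t| ≤ K₄ * (1 / (2 * K₄ + 1)) := by gcongr
      _ ≤ 1 / 2 := by
        rw [mul_one_div, div_le_div_iff₀ (by positivity) (by norm_num)]; linarith
  have hadP : P / 2 ≤ a d := by
    have h1 := (abs_le.1 haP).1
    have h2 : K₄ * |A t| * P ≤ 1 / 2 * P := mul_le_mul_of_nonneg_right hKA hP0.le
    linarith
  refine ⟨?_, fun s hs hxs => ?_⟩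
  · have h7 : |A d| * (P / 2) ≤ K₂ * |A t| * P := by
      rw [abs_mul, abs_of_pos had, mul_comm] at haA
      exact (mul_le_mul_of_nonneg_left hadP (abs_nonneg _)).trans haA
    have h8 : |A d| ≤ 2 * K₂ * |A t| := by
      have : |A d| * P ≤ 2 * K₂ * |A t| * P := by linarith
      exact le_of_mul_le_mul_right this hP0
    refine h8.trans ?_
    gcongr
    rw [hC]
    have : 0 ≤ 2 * K₄ * Cd + 2 * C₀ + (2 * C₀ + 2 * K₂ * Kψ) := by positivity
    linarith
  · have hEs := hEb s hs hxs
    have hsγ : 0 < s ^ γ := by positivity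
    have e : (tailQ F (d * s) - b d) / a d - boxCox γ s
        = (-(a d - P) * boxCox γ s + a t * (E s - E 1) + a d * A d * Q d 1) / a d := by
      have := hrep1 s hs
      rw [eq_div_iff had.ne', sub_mul, div_mul_cancel₀ _ had.ne', this, hP]
      linear_combination -e1
    have hnum : |-(a d - P) * boxCox γ s + a t * (E s - E 1) + a d * A d * Q d 1|
        ≤ P * |A t| * (K₄ * |boxCox γ s| + C₀ * s ^ γ + (C₀ + K₂ * Kψ)) := by
      have t1 : |-(a d - P) * boxCox γ s| ≤ K₄ * |A t| * P * |boxCox γ s| := by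
        rw [abs_mul, abs_neg]; gcongr
      have t2 : |a t * (E s - E 1)| ≤ C₀ * (s ^ γ + 1) * |A t| * P := by
        rw [abs_mul, abs_of_pos hat]
        calc a t * |E s - E 1| ≤ a t * (|E s| + |E 1|) := by gcongr; exact abs_sub _ _
          _ ≤ a t * (C₀ * |A t| * (x ^ γ * s ^ γ) + C₀ * |A t| * x ^ γ) := by gcongr
          _ = _ := by rw [hP]; ring
      have t3 : |a d * A d * Q d 1| ≤ K₂ * |A t| * P * Kψ := by
        rw [abs_mul]
        exact mul_le_mul haA h5.le (abs_nonneg _) (by positivity)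
      calc _ ≤ |-(a d - P) * boxCox γ s + a t * (E s - E 1)| + |a d * A d * Q d 1| :=
            abs_add_le _ _
        _ ≤ |-(a d - P) * boxCox γ s| + |a t * (E s - E 1)| + |a d * A d * Q d 1| := by
            gcongr; exact abs_add_le _ _
        _ ≤ _ := by linarith
    have hquot : |(tailQ F (d * s) - b d) / a d - boxCox γ s|
        ≤ 2 * |A t| * (K₄ * |boxCox γ s| + C₀ * s ^ γ + (C₀ + K₂ * Kψ)) := by
      rw [e, abs_div, abs_of_pos had, div_le_iff₀ had]
      refine hnum.trans ?_
      have h1 : 0 ≤ |A t| * (K₄ * |boxCox γ s| + C₀ * s ^ γ + (C₀ + K₂ * Kψ)) := by positivity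
      have h2 := mul_le_mul_of_nonneg_right hadP h1
      linarith
    have hss : s ^ (-γ) * s ^ γ = 1 := by rw [← Real.rpow_add hs]; simp
    have hsn : 0 < s ^ (-γ) := by positivity
    set φ := 1 + |Real.log s| + s ^ (-γ) with hφ
    have hφ1 : 1 ≤ φ := by linarith [abs_nonneg (Real.log s)]
    have hφ2 : s ^ (-γ) ≤ φ := by linarith [abs_nonneg (Real.log s)]
    rw [abs_mul, abs_of_pos hsn]
    calc s ^ (-γ) * |(tailQ F (d * s) - b d) / a d - boxCox γ s|
        ≤ s ^ (-γ) * (2 * |A t| * (K₄ * |boxCox γ s| + C₀ * s ^ γ + (C₀ + K₂ * Kψ))) := by gcongr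
      _ = |A t| * (2 * K₄ * (|boxCox γ s| * s ^ (-γ)) + 2 * C₀ * (s ^ (-γ) * s ^ γ)
          + (2 * C₀ + 2 * K₂ * Kψ) * s ^ (-γ)) := by ring
      _ ≤ |A t| * (2 * K₄ * (Cd * φ) + 2 * C₀ * φ + (2 * C₀ + 2 * K₂ * Kψ) * φ) := by
          rw [hss]
          have := hD s hs
          gcongr
      _ = (C - 2 * K₂) * |A t| * φ := by rw [hC]; ring
      _ ≤ C * |A t| * φ := by
          gcongr
          linarith

/-! ## Expansion of the transformed quantile functions -/

/-- The argument of `gpdInv` in `hTilde`, where `K` stands for `√k`. -/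
def gexpr (γ K c θ χ ξ y : ℝ) : ℝ :=
  boxCox (γ - θ / K) c⁻¹ * (1 + ξ / K) + c ^ (-(γ + χ / K)) * y

theorem abs_indexRatio_sub_one_le {γ θ ξ K : ℝ} (hγ : γ ≠ 0) (hK : 0 < K)
    (hK1 : 2 * |θ| ≤ |γ| * K) :
    γ - θ / K ≠ 0 ∧
      |γ / (γ - θ / K) * (1 + ξ / K) - 1| ≤ 2 * (|γ| * |ξ| + |θ|) / |γ| / K := by
  have hγ0 : 0 < |γ| := abs_pos.2 hγ
  have h1 : |θ / K| ≤ |γ| / 2 := by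
    rw [abs_div, abs_of_pos hK, div_le_iff₀ hK]; linarith
  have h2 : |γ| / 2 ≤ |γ - θ / K| := by
    have := abs_sub_abs_le_abs_sub γ (θ / K); linarith
  have h3 : γ - θ / K ≠ 0 := abs_pos.1 (by linarith)
  refine ⟨h3, ?_⟩
  have e : γ / (γ - θ / K) * (1 + ξ / K) - 1 = (γ * ξ + θ) / K / (γ - θ / K) := by
    have h5 : γ * K - θ ≠ 0 := fun h5 => h3 (by field_simp; linarith)
    rw [show γ - θ / K = (γ * K - θ) / K by field_simp]
    field_simp
    ring
  rw [e, abs_div, abs_div, abs_of_pos hK, div_le_iff₀ (by linarith)]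
  have h4 : |γ * ξ + θ| ≤ |γ| * |ξ| + |θ| := by
    rw [← abs_mul]; exact abs_add_le _ _
  calc |γ * ξ + θ| / K ≤ (|γ| * |ξ| + |θ|) / K := by gcongr
    _ = 2 * (|γ| * |ξ| + |θ|) / |γ| / K * (|γ| / 2) := by field_simp
    _ ≤ _ := by gcongr

theorem gexpr_eq {γ K c θ χ ξ x s E : ℝ} (hγ : γ ≠ 0) (hγθ : γ - θ / K ≠ 0) (hc : 0 < c)
    (hs : 0 < s) (hx : x = c * s) :
    s ^ (-γ) * (gexpr γ K c θ χ ξ (boxCox γ x + E) - boxCox γ s)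
      = (c ^ (-(χ / K)) * (1 + γ * (E * x ^ (-γ))) - 1
        + s ^ (-γ) * (1 - γ / (γ - θ / K) * (1 + ξ / K))
        + x ^ (-γ) * (γ / (γ - θ / K) * (1 + ξ / K) * c ^ (θ / K) - c ^ (-(χ / K)))) / γ := by
  have hxx : x ^ (-γ) = c ^ (-γ) * s ^ (-γ) := by rw [hx, Real.mul_rpow hc.le hs.le]
  have hxx' : x ^ γ = c ^ γ * s ^ γ := by rw [hx, Real.mul_rpow hc.le hs.le]
  have e1 : c ^ (-(γ + χ / K)) = c ^ (-γ) * c ^ (-(χ / K)) := by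
    rw [← Real.rpow_add hc]; congr 1; ring
  have e2 : (c⁻¹) ^ (γ - θ / K) = c ^ (-γ) * c ^ (θ / K) := by
    rw [Real.inv_rpow hc.le, ← Real.rpow_neg hc.le, ← Real.rpow_add hc]; congr 1; ring
  have e3 : c ^ γ * c ^ (-γ) = 1 := by rw [← Real.rpow_add hc]; simp
  have e4 : s ^ γ * s ^ (-γ) = 1 := by rw [← Real.rpow_add hs]; simp
  simp only [gexpr, boxCox, hγ, hγθ, if_false, e1, e2, hxx, hxx']
  generalize c ^ (-γ) = cm at *
  generalize c ^ γ = cp at *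
  generalize s ^ (-γ) = sm at *
  generalize s ^ γ = sp at *
  generalize c ^ (-(χ / K)) = u
  generalize c ^ (θ / K) = v
  have hd : (cm * v - 1) / (γ - θ / K) * (1 + ξ / K)
      = (cm * v - 1) * (γ / (γ - θ / K) * (1 + ξ / K)) / γ := by field_simp
  rw [hd]
  generalize γ / (γ - θ / K) * (1 + ξ / K) = Q
  field_simp
  linear_combination (u * sp * sm) * e3 + (-1 + u) * e4

theorem abs_exp_sub_exp_le {x y : ℝ} (hx : |x| ≤ 1) (hy : |y| ≤ 1) :
    |Real.exp x - Real.exp y| ≤ 2 * |x| + 2 * |y| := by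
  have h1 := Real.abs_exp_sub_one_le hx
  have h2 := Real.abs_exp_sub_one_le hy
  have : Real.exp x - Real.exp y = (Real.exp x - 1) - (Real.exp y - 1) := by ring
  rw [this]
  exact (abs_sub _ _).trans (by linarith)

theorem rpow_div_eq_exp {c : ℝ} (hc : 0 < c) (χ K : ℝ) :
    c ^ (χ / K) = Real.exp (χ * (Real.log c / K)) := by
  rw [Real.rpow_def_of_pos hc]; congr 1; ring

set_option maxHeartbeats 400000 in
theorem abs_mul_rpow_neg_le {x E γ C : ℝ} (hx : 0 < x) (h : |E| ≤ C * x ^ γ) :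
    |E * x ^ (-γ)| ≤ C := by
  rw [abs_mul, abs_of_pos (Real.rpow_pos_of_pos hx _), Real.rpow_neg hx.le]
  exact (mul_inv_le_iff₀ (Real.rpow_pos_of_pos hx _)).2 h

theorem gexpr_expansion_pos {γ : ℝ} (θ χ ξ Ca m : ℝ) (hγ : 0 < γ) (hCa : 0 ≤ Ca) (hm : 0 < m) :
    ∃ C K₀ l₀ : ℝ, 0 ≤ C ∧ 0 < l₀ ∧ ∀ K c r s Y α : ℝ, K₀ ≤ K → 1 ≤ K → 1 ≤ Real.log c → 0 < c →
      Real.log c / K ≤ l₀ → m ≤ r → 0 < s → 0 ≤ α →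
      |Y - boxCox γ (r * c * s)| ≤ Ca * α * (r * c * s) ^ γ →
      |(r * s) ^ (-γ) * (gexpr γ K c θ χ ξ Y - boxCox γ (r * s)) + χ / γ * (Real.log c / K)|
        ≤ C * ((Real.log c / K) ^ 2 + α) + C * (s ^ (-γ) / K) := by
  set B := 2 * (|γ| * |ξ| + |θ|) / |γ| with hB
  have hB0 : 0 ≤ B := by positivity
  set D := m ^ (-γ) * (B + (B * 3 + (2 * |θ| + 2 * |χ|)) / γ) with hD
  have hD0 : 0 ≤ D := by positivity
  refine ⟨(χ ^ 2 + 3 * γ * Ca + D) / γ, 2 * |θ| / |γ|, 1 / (|θ| + |χ| + 1), by positivity,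
    by positivity, fun K c r s Y α hK hK1 hlc hc hl hr hs hα hY => ?_⟩
  have hK0 : 0 < K := by linarith
  have hr0 : 0 < r := hm.trans_le hr
  have hrs : 0 < r * s := by positivity
  set L := Real.log c / K with hL
  have hL0 : 0 < L := by positivity
  have hL1 : (|θ| + |χ| + 1) * L ≤ 1 := by rwa [le_div_iff₀ (by positivity), mul_comm] at hl
  have hLθ : |θ * L| ≤ 1 := by
    rw [abs_mul, abs_of_pos hL0]; nlinarith [abs_nonneg χ]
  have hLχ : |-χ * L| ≤ 1 := by
    rw [abs_mul, abs_of_pos hL0, abs_neg]; nlinarith [abs_nonneg θ]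
  have hKθ : 2 * |θ| ≤ |γ| * K := by
    rw [div_le_iff₀ (abs_pos.2 hγ.ne')] at hK; linarith
  obtain ⟨hγθ, hP⟩ := abs_indexRatio_sub_one_le (ξ := ξ) hγ.ne' hK0 hKθ
  rw [← hB] at hP
  set x := r * c * s with hx
  have hx0 : 0 < x := by positivity
  set E := Y - boxCox γ x with hE
  have hYE : Y = boxCox γ x + E := by rw [hE]; ring
  have hEx : |E * x ^ (-γ)| ≤ Ca * α := abs_mul_rpow_neg_le hx0 hY
  rw [hYE, gexpr_eq hγ.ne' hγθ hc hrs (by rw [hx]; ring)]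
  set P := γ / (γ - θ / K) * (1 + ξ / K) with hPdef
  rw [show -(χ / K) = -χ / K by ring, rpow_div_eq_exp hc, rpow_div_eq_exp hc, ← hL]
  have h3 : ∀ y : ℝ, |y| ≤ 1 → Real.exp y ≤ 3 := fun y hy =>
    (Real.exp_le_exp.2 (abs_le.1 hy).2).trans (by linarith [Real.exp_one_lt_d9])
  clear_value B D P L
  have hu1 : |Real.exp (-χ * L) - 1 - -χ * L| ≤ χ ^ 2 * L ^ 2 := by
    have := Real.abs_exp_sub_one_sub_id_le hLχ
    calc _ ≤ (-χ * L) ^ 2 := this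
      _ = _ := by ring
  have hbr : |P * Real.exp (θ * L) - Real.exp (-χ * L)| ≤ (B * 3 + (2 * |θ| + 2 * |χ|)) * L := by
    have e : P * Real.exp (θ * L) - Real.exp (-χ * L)
        = (P - 1) * Real.exp (θ * L) + (Real.exp (θ * L) - Real.exp (-χ * L)) := by ring
    have h4 := abs_exp_sub_exp_le hLθ hLχ
    rw [abs_mul θ, abs_mul (-χ), abs_neg, abs_of_pos hL0] at h4
    have h5 : 1 / K ≤ L := by rw [hL]; gcongr
    calc _ ≤ |(P - 1) * Real.exp (θ * L)| + |Real.exp (θ * L) - Real.exp (-χ * L)| := by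
          rw [e]; exact abs_add_le _ _
      _ ≤ B / K * 3 + (2 * (|θ| * L) + 2 * (|χ| * L)) := by
          rw [abs_mul, abs_of_pos (Real.exp_pos _)]
          gcongr
          exact h3 _ hLθ
      _ ≤ B * L * 3 + (2 * (|θ| * L) + 2 * (|χ| * L)) := by
          have : B / K ≤ B * L := by rw [div_eq_mul_one_div]; gcongr
          gcongr
      _ = _ := by ring
  have hcL : x ^ (-γ) * L ≤ (r * s) ^ (-γ) / γ / K := by
    have e : x ^ (-γ) = c ^ (-γ) * (r * s) ^ (-γ) := by
      rw [hx, show r * c * s = c * (r * s) by ring, Real.mul_rpow hc.le hrs.le]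
    have h6 : c ^ (-γ) * Real.log c ≤ 1 / γ := by
      calc c ^ (-γ) * Real.log c ≤ c ^ (-γ) * (c ^ γ / γ) := by
            gcongr; exact Real.log_le_rpow_div hc.le hγ
        _ = 1 / γ := by rw [← mul_div_assoc, ← Real.rpow_add hc]; simp
    calc x ^ (-γ) * L = (r * s) ^ (-γ) * (c ^ (-γ) * Real.log c) / K := by rw [e, hL]; ring
      _ ≤ (r * s) ^ (-γ) * (1 / γ) / K := by gcongr
      _ = _ := by ring
  have hrsm : (r * s) ^ (-γ) ≤ m ^ (-γ) * s ^ (-γ) := by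
    rw [Real.mul_rpow hr0.le hs.le]
    gcongr ?_ * _
    exact Real.rpow_le_rpow_of_nonpos hm hr (by linarith)
  have e : (Real.exp (-χ * L) * (1 + γ * (E * x ^ (-γ))) - 1 + (r * s) ^ (-γ) * (1 - P)
        + x ^ (-γ) * (P * Real.exp (θ * L) - Real.exp (-χ * L))) / γ + χ / γ * L
      = ((Real.exp (-χ * L) - 1 - -χ * L) + γ * (Real.exp (-χ * L) * (E * x ^ (-γ)))
        + (-((r * s) ^ (-γ) * (P - 1)))
        + x ^ (-γ) * (P * Real.exp (θ * L) - Real.exp (-χ * L))) / γ := by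
    field_simp; ring
  rw [e, abs_div, abs_of_pos hγ, div_le_iff₀ hγ]
  have n1 : |γ * (Real.exp (-χ * L) * (E * x ^ (-γ)))| ≤ γ * (3 * (Ca * α)) := by
    rw [abs_mul, abs_mul, abs_of_pos hγ, abs_of_pos (Real.exp_pos _)]
    gcongr
    exact h3 _ hLχ
  have n2 : |-((r * s) ^ (-γ) * (P - 1))| ≤ m ^ (-γ) * s ^ (-γ) * (B / K) := by
    rw [abs_neg, abs_mul, abs_of_pos (by positivity : 0 < (r * s) ^ (-γ))]
    gcongr
  have n3 : |x ^ (-γ) * (P * Real.exp (θ * L) - Real.exp (-χ * L))|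
      ≤ (B * 3 + (2 * |θ| + 2 * |χ|)) * (m ^ (-γ) * s ^ (-γ) / γ / K) := by
    rw [abs_mul, abs_of_pos (by positivity : 0 < x ^ (-γ))]
    calc _ ≤ x ^ (-γ) * ((B * 3 + (2 * |θ| + 2 * |χ|)) * L) := by gcongr
      _ = (B * 3 + (2 * |θ| + 2 * |χ|)) * (x ^ (-γ) * L) := by ring
      _ ≤ (B * 3 + (2 * |θ| + 2 * |χ|)) * ((r * s) ^ (-γ) / γ / K) := by gcongr
      _ ≤ _ := by gcongr
  have n4 : m ^ (-γ) * s ^ (-γ) * (B / K)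
      + (B * 3 + (2 * |θ| + 2 * |χ|)) * (m ^ (-γ) * s ^ (-γ) / γ / K) = D * (s ^ (-γ) / K) := by
    rw [hD]; ring
  have n5 : 0 ≤ D * (L ^ 2 + α) := by positivity
  have n6 : 0 ≤ (χ ^ 2 + 3 * γ * Ca) * (s ^ (-γ) / K) := by positivity
  have n7 : 0 ≤ χ ^ 2 * α + 3 * γ * Ca * L ^ 2 := by positivity
  calc _ ≤ χ ^ 2 * L ^ 2 + γ * (3 * (Ca * α)) + m ^ (-γ) * s ^ (-γ) * (B / K)
        + (B * 3 + (2 * |θ| + 2 * |χ|)) * (m ^ (-γ) * s ^ (-γ) / γ / K) := by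
        refine (abs_add_le _ _).trans (add_le_add ((abs_add_le _ _).trans (add_le_add
          ((abs_add_le _ _).trans (add_le_add hu1 n1)) n2)) n3)
    _ ≤ (χ ^ 2 + 3 * γ * Ca + D) * (L ^ 2 + α) + (χ ^ 2 + 3 * γ * Ca + D) * (s ^ (-γ) / K) := by
        linarith
    _ = _ := by field_simp

theorem gexpr_expansion_neg {γ : ℝ} (ξ Ca m M : ℝ) (hγ : γ < 0) (hCa : 0 ≤ Ca) (hm : 0 < m)
    (hM : 0 ≤ M) :
    ∃ C : ℝ, 0 ≤ C ∧ ∀ K c r s Y α : ℝ, 1 ≤ K → 0 < c → m ≤ r → r ≤ M → 0 < s → 0 ≤ α →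
      |Y - boxCox γ (r * c * s)| ≤ Ca * α * (r * c * s) ^ γ →
      |(r * s) ^ (-γ) * (gexpr γ K c 0 0 ξ Y - boxCox γ (r * s))
          + -ξ / γ * (s ^ (-γ) * ((r * c) ^ (-γ) / K))|
        ≤ C * α + C * (s ^ (-γ) / K) := by
  refine ⟨Ca + M ^ (-γ) * |ξ| / |γ|, by positivity,
    fun K c r s Y α hK1 hc hr hrM hs hα hY => ?_⟩
  have hK0 : 0 < K := by linarith
  have hr0 : 0 < r := hm.trans_le hr
  have hrs : 0 < r * s := by positivity
  set x := r * c * s with hx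
  have hx0 : 0 < x := by positivity
  set E := Y - boxCox γ x with hE
  have hYE : Y = boxCox γ x + E := by rw [hE]; ring
  have hEx : |E * x ^ (-γ)| ≤ Ca * α := abs_mul_rpow_neg_le hx0 hY
  have hγ0 : γ - 0 / K ≠ 0 := by simpa using hγ.ne
  rw [hYE, gexpr_eq hγ.ne hγ0 hc hrs (by rw [hx]; ring)]
  have exx : x ^ (-γ) = s ^ (-γ) * (r * c) ^ (-γ) := by
    rw [hx, mul_comm (r * c), Real.mul_rpow hs.le (by positivity)]
  have e : (c ^ (-(0 / K)) * (1 + γ * (E * x ^ (-γ))) - 1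
        + (r * s) ^ (-γ) * (1 - γ / (γ - 0 / K) * (1 + ξ / K))
        + x ^ (-γ) * (γ / (γ - 0 / K) * (1 + ξ / K) * c ^ (0 / K) - c ^ (-(0 / K)))) / γ
        + -ξ / γ * (s ^ (-γ) * ((r * c) ^ (-γ) / K))
      = E * x ^ (-γ) + -((r * s) ^ (-γ) * (ξ / K) / γ) := by
    rw [← mul_div_assoc (s ^ (-γ)), ← exx]
    simp only [zero_div, neg_zero, Real.rpow_zero, sub_zero, div_self hγ.ne]
    have := hγ.ne
    field_simp
    ring
  rw [e]
  have hrsm : (r * s) ^ (-γ) ≤ M ^ (-γ) * s ^ (-γ) := by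
    rw [Real.mul_rpow hr0.le hs.le]
    gcongr
    linarith
  have n1 : |-((r * s) ^ (-γ) * (ξ / K) / γ)| ≤ M ^ (-γ) * |ξ| / |γ| * (s ^ (-γ) / K) := by
    rw [abs_neg, abs_div, abs_mul, abs_div, abs_of_pos hK0,
      abs_of_pos (by positivity : 0 < (r * s) ^ (-γ))]
    calc _ ≤ M ^ (-γ) * s ^ (-γ) * (|ξ| / K) / |γ| := by gcongr
      _ = _ := by ring
  have n2 : 0 ≤ M ^ (-γ) * |ξ| / |γ| * α := by positivity
  have n3 : 0 ≤ Ca * (s ^ (-γ) / K) := by positivity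
  calc _ ≤ Ca * α + M ^ (-γ) * |ξ| / |γ| * (s ^ (-γ) / K) :=
        (abs_add_le _ _).trans (add_le_add hEx n1)
    _ ≤ _ := by linarith

theorem abs_boxCox_sub_le {δ x : ℝ} (hx : 0 < x) (h : |δ * Real.log x| ≤ 1) :
    |boxCox δ x - (Real.log x + δ * Real.log x ^ 2 / 2)| ≤ δ ^ 2 * |Real.log x| ^ 3 := by
  by_cases hδ : δ = 0
  · simp [boxCox, hδ]
  · simp only [boxCox, hδ, if_false]
    have h1 := Real.exp_bound h (n := 3) (by norm_num)
    simp only [Finset.sum_range_succ, Finset.sum_range_zero, Nat.factorial] at h1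
    rw [Real.rpow_def_of_pos hx, mul_comm (Real.log x)]
    set t := Real.log x
    have e : (Real.exp (δ * t) - 1) / δ - (t + δ * t ^ 2 / 2)
        = (Real.exp (δ * t) - (1 + δ * t + (δ * t) ^ 2 / 2)) / δ := by field_simp; ring
    rw [e, abs_div, div_le_iff₀ (abs_pos.2 hδ)]
    have e2 : δ ^ 2 * |t| ^ 3 * |δ| = |δ * t| ^ 3 := by
      rw [abs_mul, ← sq_abs δ]; ring
    rw [e2]
    norm_num at h1
    rw [← abs_mul] at h1
    have : 0 ≤ |δ * t| ^ 3 := by positivity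
    refine h1.trans ?_
    linarith

theorem gexpr_expansion_zero (θ χ ξ Ca m M : ℝ) (hCa : 0 ≤ Ca) (hm : 0 < m) :
    ∃ C l₀ : ℝ, 0 ≤ C ∧ 0 < l₀ ∧ ∀ K c r s Y α : ℝ, 1 ≤ K → 1 ≤ Real.log c → 0 < c →
      Real.log c / K ≤ l₀ → m ≤ r → r ≤ M → 0 < s → 0 ≤ α →
      |Y - boxCox 0 (r * c * s)| ≤ Ca * α →
      |gexpr 0 K c θ χ ξ Y - boxCox 0 (r * s) + (θ + 2 * χ) * (1 / 2 * Real.log c ^ 2 / K)|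
        ≤ C * ((Real.log c / K) ^ 2 * Real.log c + Real.log c / K * (1 + |Real.log s|) + α) := by
  set R := |Real.log m| + |Real.log M| with hR
  set D := 2 * θ ^ 2 + |ξ| * (1 + |θ|) + (χ ^ 2 + (χ ^ 2 + |χ|) * (R + 1)) + 3 * Ca with hD
  refine ⟨D, 1 / (|θ| + |χ| + |ξ| + 1), by positivity, by positivity,
    fun K c r s Y α hK1 hlc hc hl hr hrM hs hα hY => ?_⟩
  have hK0 : 0 < K := by linarith
  have hr0 : 0 < r := hm.trans_le hr
  have hrs : 0 < r * s := by positivity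
  set lc := Real.log c with hlcdef
  set L := lc / K with hL
  have hL0 : 0 < L := by positivity
  have hS : ∀ v, |v| ≤ |θ| + |χ| + |ξ| + 1 → |v * L| ≤ 1 := fun v hv => by
    rw [abs_mul, abs_of_pos hL0]
    calc |v| * L ≤ (|θ| + |χ| + |ξ| + 1) * (1 / (|θ| + |χ| + |ξ| + 1)) := by gcongr
      _ = 1 := mul_one_div_cancel (by positivity)
  have hLθ : |θ * L| ≤ 1 := hS θ (by linarith [abs_nonneg χ, abs_nonneg ξ])
  have hLχ : |-χ * L| ≤ 1 := hS (-χ) (by rw [abs_neg]; linarith [abs_nonneg θ, abs_nonneg ξ])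
  have hLξ : |ξ * L| ≤ 1 := hS ξ (by linarith [abs_nonneg χ, abs_nonneg θ])
  have hL1 : L ≤ 1 := by simpa [abs_of_pos hL0] using hS 1 (by
    rw [abs_one]; linarith [abs_nonneg θ, abs_nonneg ξ, abs_nonneg χ])
  have h1K : 1 / K ≤ L := by rw [hL]; gcongr
  have hb := abs_boxCox_sub_le (δ := 0 - θ / K) (inv_pos.2 hc) (by
    rw [Real.log_inv, show (0 - θ / K) * -Real.log c = θ * L by rw [hL]; ring]; exact hLθ)
  rw [Real.log_inv, ← hlcdef] at hb
  set B := boxCox (0 - θ / K) c⁻¹ with hBdef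
  have e1 : -lc + (0 - θ / K) * (-lc) ^ 2 / 2 = -lc - θ * (lc * L) / 2 := by rw [hL]; ring
  have e2 : (0 - θ / K) ^ 2 * |-lc| ^ 3 = θ ^ 2 * (L ^ 2 * lc) := by
    rw [abs_neg, abs_of_pos (by linarith : 0 < lc), hL]; field_simp; ring
  rw [e1, e2] at hb
  set b₁ := B - (-lc - θ * (lc * L) / 2) with hb₁
  have hBe : B = -lc - θ * (lc * L) / 2 + b₁ := by rw [hb₁]; ring
  have hu := Real.abs_exp_sub_one_sub_id_le hLχ
  set u := Real.exp (-χ * L) - 1 - -χ * L with hudef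
  have hue : c ^ (-(0 + χ / K)) = 1 - χ * L + u := by
    rw [show -(0 + χ / K) = -χ / K by ring, rpow_div_eq_exp hc, ← hlcdef, ← hL, hudef]; ring
  have hlog : boxCox 0 (r * c * s) = lc + (Real.log r + Real.log s) := by
    simp only [boxCox, if_true]
    rw [Real.log_mul (by positivity) hs.ne', Real.log_mul hr0.ne' hc.ne']; ring
  have hlog' : boxCox 0 (r * s) = Real.log r + Real.log s := by
    simp only [boxCox, if_true]
    rw [Real.log_mul hr0.ne' hs.ne']
  rw [hlog] at hY
  set ls := Real.log r + Real.log s with hls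
  have hlsb : |ls| ≤ (R + 1) * (1 + |Real.log s|) := by
    have h1 : Real.log m ≤ Real.log r := Real.log_le_log hm hr
    have h2 : Real.log r ≤ Real.log M := Real.log_le_log hr0 hrM
    have h3 : |Real.log r| ≤ R := by
      rw [abs_le]
      constructor
      · linarith [neg_abs_le (Real.log m), abs_nonneg (Real.log M)]
      · linarith [le_abs_self (Real.log M), abs_nonneg (Real.log m)]
    have h4 : 0 ≤ R * |Real.log s| := by positivity
    calc |ls| ≤ |Real.log r| + |Real.log s| := abs_add_le _ _
      _ ≤ _ := by linarith
  set E := Y - (lc + ls) with hE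
  have hYE : Y = lc + ls + E := by rw [hE]; ring
  have h3 : ∀ y : ℝ, |y| ≤ 1 → Real.exp y ≤ 3 := fun y hy =>
    (Real.exp_le_exp.2 (abs_le.1 hy).2).trans (by linarith [Real.exp_one_lt_d9])
  have hEb : |(1 - χ * L + u) * E| ≤ 3 * (Ca * α) := by
    have : 1 - χ * L + u = Real.exp (-χ * L) := by rw [hudef]; ring
    rw [this, abs_mul, abs_of_pos (Real.exp_pos _)]
    have := h3 _ hLχ
    gcongr
  have hmain : gexpr 0 K c θ χ ξ Y - boxCox 0 (r * s) + (θ + 2 * χ) * (1 / 2 * lc ^ 2 / K)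
      = b₁ * (1 + ξ / K) + -(lc + θ * (lc * L) / 2) * (ξ / K)
        + (u * lc + (-χ * L + u) * ls) + (1 - χ * L + u) * E := by
    have e3 : lc ^ 2 / K = lc * L := by rw [hL]; ring
    rw [gexpr, ← hBdef, hue, hlog', hYE, hBe]
    linear_combination ((θ + 2 * χ) * (1 / 2)) * e3
  rw [hmain]
  have hlc0 : 0 < lc := by linarith
  have n1 : |b₁ * (1 + ξ / K)| ≤ θ ^ 2 * (L ^ 2 * lc) * 2 := by
    rw [abs_mul]
    have : |1 + ξ / K| ≤ 2 := by
      have h5 : |ξ / K| ≤ 1 := by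
        have : |ξ / K| ≤ |ξ * L| := by
          rw [div_eq_mul_one_div, abs_mul, abs_mul, abs_of_pos hL0, abs_of_pos (by positivity : 0 < 1 / K)]
          gcongr
        linarith
      calc _ ≤ |(1 : ℝ)| + |ξ / K| := abs_add_le _ _
        _ ≤ 2 := by rw [abs_one]; linarith
    gcongr
  have n2 : |-(lc + θ * (lc * L) / 2) * (ξ / K)| ≤ |ξ| * (1 + |θ|) * L := by
    have e4 : -(lc + θ * (lc * L) / 2) * (ξ / K) = -(ξ * L) * (1 + θ * L / 2) := by
      rw [hL]; field_simp
    rw [e4, abs_mul, abs_neg, abs_mul, abs_of_pos hL0]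
    have : |1 + θ * L / 2| ≤ 1 + |θ| := by
      calc _ ≤ |(1 : ℝ)| + |θ * L / 2| := abs_add_le _ _
        _ ≤ 1 + |θ| * 1 := by
          rw [abs_one, abs_div, abs_mul, abs_of_pos hL0, abs_two]
          have : |θ| * L ≤ |θ| * 1 := by gcongr
          have : 0 ≤ |θ| * L := by positivity
          linarith
        _ = _ := by ring
    calc |ξ| * L * |1 + θ * L / 2| ≤ |ξ| * L * (1 + |θ|) := by gcongr
      _ = _ := by ring
  have hu' : |u| ≤ χ ^ 2 * L ^ 2 := hu.trans_eq (by ring)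
  have n3 : |u * lc + (-χ * L + u) * ls|
      ≤ χ ^ 2 * (L ^ 2 * lc) + (χ ^ 2 + |χ|) * (R + 1) * (L * (1 + |Real.log s|)) := by
    have h6 : |-χ * L + u| ≤ (χ ^ 2 + |χ|) * L := by
      calc _ ≤ |-χ * L| + |u| := abs_add_le _ _
        _ ≤ |χ| * L + χ ^ 2 * (L * 1) := by
          rw [abs_mul, abs_neg, abs_of_pos hL0]
          gcongr
          refine hu'.trans ?_
          rw [sq L]; gcongr
        _ = _ := by ring
    calc _ ≤ |u * lc| + |(-χ * L + u) * ls| := abs_add_le _ _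
      _ ≤ χ ^ 2 * L ^ 2 * lc + (χ ^ 2 + |χ|) * L * ((R + 1) * (1 + |Real.log s|)) := by
        rw [abs_mul, abs_mul, abs_of_pos hlc0]
        gcongr
      _ = _ := by ring
  have t1 : 0 ≤ L ^ 2 * lc := by positivity
  have t2 : L ≤ L * (1 + |Real.log s|) := le_mul_of_one_le_right hL0.le (by linarith [abs_nonneg (Real.log s)])
  set T := L * (1 + |Real.log s|) with hT
  have hT0 : 0 ≤ T := by positivity
  set q₁ := (χ ^ 2 + |χ|) * (R + 1) with hq₁
  have hq₁0 : 0 ≤ q₁ := by positivity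
  set q₂ := |ξ| * (1 + |θ|) with hq₂
  have hq₂0 : 0 ≤ q₂ := by positivity
  set V := L ^ 2 * lc with hV
  have hsum : |b₁ * (1 + ξ / K) + -(lc + θ * (lc * L) / 2) * (ξ / K)
        + (u * lc + (-χ * L + u) * ls) + (1 - χ * L + u) * E|
      ≤ θ ^ 2 * V * 2 + q₂ * L + (χ ^ 2 * V + q₁ * T) + 3 * (Ca * α) :=
    (abs_add_le _ _).trans (add_le_add ((abs_add_le _ _).trans (add_le_add
          ((abs_add_le _ _).trans (add_le_add n1 n2)) n3)) hEb)
  refine hsum.trans ?_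
  have hθ2 := sq_nonneg θ
  have hχ2 := sq_nonneg χ
  have hDe : D = 2 * θ ^ 2 + q₂ + (χ ^ 2 + q₁) + 3 * Ca := rfl
  have hcl1 : 2 * θ ^ 2 + χ ^ 2 ≤ D := by rw [hDe]; linarith
  have hcl2 : q₂ + q₁ ≤ D := by rw [hDe]; linarith
  have hcl3 : 3 * Ca ≤ D := by rw [hDe]; linarith
  calc _ ≤ (2 * θ ^ 2 + χ ^ 2) * V + (q₂ + q₁) * T + 3 * Ca * α := by
        have : q₂ * L ≤ q₂ * T := by gcongr
        linarith
    _ ≤ D * V + D * T + D * α := by gcongr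
    _ = _ := by ring

/-! ## Asymptotics of the sequences -/

/-- The larger of the two weights. -/
def wMax (k d e : ℕ → ℝ) (γ : Fin 2 → ℝ) (n : ℕ) : ℝ :=
  max (weight k d e (γ 0) n) (weight k d e (γ 1) n)

/-- The rate of convergence. -/
def rate (k d e : ℕ → ℝ) (γ : Fin 2 → ℝ) (n : ℕ) : ℝ := wMax k d e γ n / √(k n)

/-- The order of the remainder terms. -/
def remainder (k : ℕ → ℝ) (A : Fin 2 → ℝ → ℝ) (n : ℕ) : ℝ :=
  1 / √(k n) + |A 0 (n / k n)| + |A 1 (n / k n)|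

theorem weight_le_wMax (k d e : ℕ → ℝ) (γ : Fin 2 → ℝ) (i : Fin 2) (n : ℕ) :
    weight k d e (γ i) n ≤ wMax k d e γ n := by
  fin_cases i
  · exact le_max_left _ _
  · exact le_max_right _ _

section Sequences

variable {k d e : ℕ → ℝ} {γ : Fin 2 → ℝ}

theorem SequenceGrowth.sqrt_tendsto (h : SequenceGrowth k d e γ) :
    Tendsto (fun n => √(k n)) atTop atTop :=
  Real.tendsto_sqrt_atTop.comp h.k_tendsto

theorem SequenceGrowth.k_le_cSeq (h : SequenceGrowth k d e γ) :
    ∃ C : ℝ, 0 < C ∧ ∀ᶠ n in atTop, k n ≤ C * cSeq k e n := by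
  obtain ⟨C, hC, hb⟩ := h.n_isBigO.exists_pos
  refine ⟨C, hC, ?_⟩
  filter_upwards [hb.bound, h.k_tendsto.eventually_gt_atTop 0, eventually_gt_atTop 0]
    with n hn hk hn0
  have hn0' : (0 : ℝ) < n := by exact_mod_cast hn0
  rw [Real.norm_of_nonneg hn0'.le, Real.norm_of_nonneg (h.e_pos n).le] at hn
  rw [cSeq, ← mul_div_assoc, le_div_iff₀ hn0']
  calc k n * n ≤ k n * (C * e n) := by gcongr
    _ = _ := by ring

theorem SequenceGrowth.c_tendsto (h : SequenceGrowth k d e γ) :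
    Tendsto (cSeq k e) atTop atTop := by
  obtain ⟨C, hC, hb⟩ := h.k_le_cSeq
  have h1 : Tendsto (fun n => k n / C) atTop atTop := h.k_tendsto.atTop_div_const hC
  refine tendsto_atTop_mono' _ ?_ h1
  filter_upwards [hb] with n hn
  rw [div_le_iff₀ hC]; linarith

theorem SequenceGrowth.ratio_bounds (h : SequenceGrowth k d e γ) :
    ∃ m M : ℝ, 0 < m ∧ m ≤ M ∧ ∀ᶠ n in atTop, m ≤ d n / e n ∧ d n / e n ≤ M := by
  obtain ⟨C₁, hC₁, hb₁⟩ := h.d_isTheta.1.exists_pos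
  obtain ⟨C₂, hC₂, hb₂⟩ := h.d_isTheta.2.exists_pos
  have hev : ∀ᶠ n in atTop, 1 / C₂ ≤ d n / e n ∧ d n / e n ≤ C₁ := by
    filter_upwards [hb₁.bound, hb₂.bound] with n h1 h2
    rw [Real.norm_of_nonneg (h.d_pos n).le, Real.norm_of_nonneg (h.e_pos n).le] at h1 h2
    have he := h.e_pos n
    rw [div_le_iff₀ he, le_div_iff₀ he, div_mul_eq_mul_div, one_mul, div_le_iff₀ hC₂]
    exact ⟨by linarith, h1⟩
  obtain ⟨n, hn⟩ := hev.exists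
  exact ⟨1 / C₂, C₁, by positivity, hn.1.trans hn.2, hev⟩

theorem SequenceGrowth.ratio_mul_cSeq (h : SequenceGrowth k d e γ) (n : ℕ) :
    d n / e n * cSeq k e n = d n * k n / n := by
  have := (h.e_pos n).ne'
  rw [cSeq]; field_simp

theorem SequenceGrowth.log_le_weight (h : SequenceGrowth k d e γ) (i : Fin 2) :
    ∃ C : ℝ, 0 < C ∧ ∀ᶠ n in atTop, Real.log (cSeq k e n) ≤ C * weight k d e (γ i) n := by
  rcases lt_trichotomy (γ i) 0 with hγ | hγ | hγ
  · obtain ⟨m, M, hm, hmM, hr⟩ := h.ratio_bounds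
    have hmp : 0 < m ^ (-γ i) := by positivity
    have hγ' : 0 < -γ i := by linarith
    refine ⟨1 / (-γ i * m ^ (-γ i)), by positivity, ?_⟩
    filter_upwards [hr, h.c_tendsto.eventually_gt_atTop 0] with n hn hc
    simp only [weight, hγ.not_gt, hγ.ne, if_false]
    rw [← h.ratio_mul_cSeq, Real.mul_rpow (by linarith) hc.le]
    have h1 : Real.log (cSeq k e n) ≤ cSeq k e n ^ (-γ i) / -γ i :=
      Real.log_le_rpow_div hc.le (by linarith)
    have h2 : m ^ (-γ i) ≤ (d n / e n) ^ (-γ i) :=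
      Real.rpow_le_rpow hm.le hn.1 (by linarith)
    calc _ ≤ cSeq k e n ^ (-γ i) / -γ i := h1
      _ = 1 / (-γ i * m ^ (-γ i)) * (m ^ (-γ i) * cSeq k e n ^ (-γ i)) := by field_simp
      _ ≤ _ := by gcongr
  · refine ⟨1, one_pos, ?_⟩
    filter_upwards [(Real.tendsto_log_atTop.comp h.c_tendsto).eventually_ge_atTop 2] with n hn
    simp only [Function.comp] at hn
    simp only [weight, hγ, lt_irrefl, if_false, if_true]
    nlinarith
  · refine ⟨1, one_pos, ?_⟩
    filter_upwards with _
    simp [weight, hγ]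

theorem SequenceGrowth.log_tendsto (h : SequenceGrowth k d e γ) :
    Tendsto (fun n => Real.log (cSeq k e n)) atTop atTop :=
  Real.tendsto_log_atTop.comp h.c_tendsto

theorem SequenceGrowth.weight_tendsto (h : SequenceGrowth k d e γ) (i : Fin 2) :
    Tendsto (weight k d e (γ i)) atTop atTop := by
  obtain ⟨C, hC, hb⟩ := h.log_le_weight i
  refine tendsto_atTop_mono' _ ?_ (h.log_tendsto.atTop_div_const hC)
  filter_upwards [hb] with n hn
  rw [div_le_iff₀ hC]; linarith

theorem SequenceGrowth.weight_div_tendsto (h : SequenceGrowth k d e γ) (i : Fin 2) :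
    Tendsto (fun n => weight k d e (γ i) n / √(k n)) atTop (𝓝 0) :=
  (h.weight_isLittleO i).tendsto_div_nhds_zero

theorem SequenceGrowth.log_div_tendsto (h : SequenceGrowth k d e γ) :
    Tendsto (fun n => Real.log (cSeq k e n) / √(k n)) atTop (𝓝 0) := by
  obtain ⟨C, hC, hb⟩ := h.log_le_weight 0
  have h1 := (h.weight_div_tendsto 0).const_mul C
  rw [mul_zero] at h1
  refine squeeze_zero' ?_ ?_ h1
  · filter_upwards [h.log_tendsto.eventually_ge_atTop 0] with n hn
    positivity
  · filter_upwards [hb] with n hn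
    rw [← mul_div_assoc]
    gcongr

theorem SequenceGrowth.wMax_tendsto (h : SequenceGrowth k d e γ) :
    Tendsto (wMax k d e γ) atTop atTop :=
  tendsto_atTop_mono (fun n => le_max_left _ _) (h.weight_tendsto 0)

theorem SequenceGrowth.rate_tendsto (h : SequenceGrowth k d e γ) :
    Tendsto (rate k d e γ) atTop (𝓝 0) := by
  have h1 := (h.weight_div_tendsto 0).max (h.weight_div_tendsto 1)
  rw [max_self] at h1
  refine h1.congr fun n => ?_
  rw [rate, wMax, max_div_div_right (Real.sqrt_nonneg _)]

theorem SequenceGrowth.rate_pos (h : SequenceGrowth k d e γ) :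
    ∀ᶠ n in atTop, 0 < rate k d e γ n := by
  filter_upwards [h.wMax_tendsto.eventually_gt_atTop 0, h.sqrt_tendsto.eventually_gt_atTop 0]
    with n h1 h2
  exact div_pos h1 h2

theorem SequenceGrowth.neg_half_lt (h : SequenceGrowth k d e γ) (i : Fin 2) : -1 / 2 < γ i := by
  by_contra! hγ
  obtain ⟨m, M, hm, hmM, hr⟩ := h.ratio_bounds
  obtain ⟨C, hC, hb⟩ := h.k_le_cSeq
  have hlim := h.weight_div_tendsto i
  have hδ : 0 < (m / C) ^ (1 / 2 : ℝ) := by positivity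
  have hev := hlim.eventually (gt_mem_nhds hδ)
  have h1 : ∀ᶠ _n : ℕ in atTop, False := by
    filter_upwards [hev, hr, hb, h.k_tendsto.eventually_gt_atTop (C / m),
      h.sqrt_tendsto.eventually_gt_atTop 0] with n h2 h3 h4 h5 h6
    have hk : 0 < k n := lt_trans (by positivity) h5
    have hmk : m / C * k n ≤ d n / e n * cSeq k e n := by
      rw [div_mul_eq_mul_div, mul_div_assoc]
      have : k n / C ≤ cSeq k e n := by rw [div_le_iff₀ hC]; linarith
      exact mul_le_mul h3.1 this (by positivity) (hm.le.trans h3.1)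
    have h1k : 1 ≤ m / C * k n := by
      rw [div_lt_iff₀ hm] at h5
      rw [div_mul_eq_mul_div, le_div_iff₀ hC]; linarith
    simp only [weight, (by linarith : ¬ 0 < γ i), (by linarith : γ i ≠ 0), if_false,
      ← h.ratio_mul_cSeq] at h2
    have h7 : (m / C) ^ (1 / 2 : ℝ) * √(k n) ≤ (d n / e n * cSeq k e n) ^ (-γ i) := by
      calc (m / C) ^ (1 / 2 : ℝ) * √(k n) = (m / C * k n) ^ (1 / 2 : ℝ) := by
            rw [Real.sqrt_eq_rpow, Real.mul_rpow (by positivity) hk.le]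
        _ ≤ (m / C * k n) ^ (-γ i) := Real.rpow_le_rpow_of_exponent_le h1k (by linarith)
        _ ≤ _ := Real.rpow_le_rpow (by positivity) hmk (by linarith)
    rw [div_lt_iff₀ h6] at h2
    linarith
  exact h1.exists.elim fun _ => id

theorem SequenceGrowth.inv_sqrt_isLittleO (h : SequenceGrowth k d e γ) :
    Tendsto (fun n => 1 / √(k n) / rate k d e γ n) atTop (𝓝 0) := by
  have h1 : Tendsto (fun n => (wMax k d e γ n)⁻¹) atTop (𝓝 0) := h.wMax_tendsto.inv_tendsto_atTop
  refine h1.congr' ?_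
  filter_upwards [h.sqrt_tendsto.eventually_gt_atTop 0, h.wMax_tendsto.eventually_gt_atTop 0]
    with n h2 h3
  rw [rate]; field_simp

theorem remainder_nonneg (k : ℕ → ℝ) (A : Fin 2 → ℝ → ℝ) (n : ℕ) : 0 ≤ remainder k A n := by
  unfold remainder; positivity

theorem remainder_isLittleO {A : Fin 2 → ℝ → ℝ} {A₀ : ℝ → ℝ} (h : SequenceGrowth k d e γ)
    (hb : SmallBias k d e γ A A₀) :
    Tendsto (fun n => remainder k A n / rate k d e γ n) atTop (𝓝 0) := by
  have hA : ∀ i, Tendsto (fun n => |A i (n / k n)| / rate k d e γ n) atTop (𝓝 0) := fun i => by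
    have h1 := ((hb.marginal i).tendsto_div_nhds_zero).abs
    rw [abs_zero] at h1
    refine squeeze_zero' ?_ ?_ h1
    · filter_upwards [h.rate_pos] with n hn
      positivity
    · filter_upwards [h.rate_pos, (h.weight_tendsto i).eventually_gt_atTop 0,
        h.sqrt_tendsto.eventually_gt_atTop 0] with n h2 h3 h4
      rw [abs_div, abs_of_pos (div_pos h3 h4), rate]
      gcongr
      exact weight_le_wMax k d e γ i n
  have h2 := (h.inv_sqrt_isLittleO.add (hA 0)).add (hA 1)
  rw [add_zero, add_zero] at h2
  refine h2.congr fun n => ?_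
  rw [remainder]; ring

theorem le_remainder (k : ℕ → ℝ) (A : Fin 2 → ℝ → ℝ) (i : Fin 2) (n : ℕ) :
    |A i (n / k n)| ≤ remainder k A n := by
  have : 0 ≤ 1 / √(k n) := by positivity
  unfold remainder
  fin_cases i
  · simp only [Fin.zero_eta]; linarith [abs_nonneg (A 1 (n / k n))]
  · simp only [Fin.mk_one]; linarith [abs_nonneg (A 0 (n / k n))]

theorem inv_sqrt_le_remainder (k : ℕ → ℝ) (A : Fin 2 → ℝ → ℝ) (n : ℕ) :
    1 / √(k n) ≤ remainder k A n := by
  unfold remainder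
  linarith [abs_nonneg (A 1 (n / k n)), abs_nonneg (A 0 (n / k n))]

end Sequences

/-! ## Cut-off sequences and perturbations of the identity -/

/-- Properties of a lower cut-off point: it equals the lower end point `x` of the boundary function if
`x > 0`, and tends to zero at an appropriate rate otherwise. -/
structure CutOff (γ x : ℝ) (η err u : ℕ → ℝ) : Prop where
  pos : ∀ᶠ n in atTop, 0 < u n
  lower : ∀ᶠ n in atTop, η n ^ (3 / 2 : ℝ) ≤ u n
  err_small : 0 < γ → Tendsto (fun n => err n * u n ^ (-γ)) atTop (𝓝 0)
  eq_of_pos : 0 < x → ∀ n, u n = x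
  tendsto_of_zero : x = 0 → Tendsto u atTop (𝓝 0)
  small_of_zero : x = 0 → Tendsto (fun n => u n ^ max γ 1 / η n) atTop (𝓝 0)

theorem exists_cutOff (γ : ℝ) {x : ℝ} (hx : 0 ≤ x) {η err : ℕ → ℝ} (hη0 : ∀ᶠ n in atTop, 0 < η n)
    (hη : Tendsto η atTop (𝓝 0)) (herr0 : ∀ n, 0 ≤ err n)
    (herr : Tendsto (fun n => err n / η n) atTop (𝓝 0)) : ∃ u, CutOff γ x η err u := by
  rcases hx.eq_or_lt with rfl | hx
  · set b := fun n => √(err n / η n + η n) * η n with hb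
    have hb0 : ∀ᶠ n in atTop, 0 < b n := by
      filter_upwards [hη0] with n hn
      have := herr0 n
      have : 0 < err n / η n + η n := by positivity
      positivity
    have hσ : Tendsto (fun n => √(err n / η n + η n)) atTop (𝓝 0) := by
      have := (herr.add hη).sqrt
      simpa using this
    have hbt : Tendsto b atTop (𝓝 0) := by simpa using hσ.mul hη
    have hb1 : ∀ᶠ n in atTop, b n < 1 := hbt.eventually (gt_mem_nhds one_pos)
    have hp : 0 < max γ 1 := by positivity
    have hp1 : 1 ≤ max γ 1 := le_max_right _ _
    set u := fun n => b n ^ (1 / max γ 1) with hu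
    have hu0 : ∀ᶠ n in atTop, 0 < u n := by
      filter_upwards [hb0] with n hn; positivity
    have hbu : ∀ᶠ n in atTop, b n ≤ u n := by
      filter_upwards [hb0, hb1] with n h0 h1
      calc b n = b n ^ (1 : ℝ) := (Real.rpow_one _).symm
        _ ≤ u n := Real.rpow_le_rpow_of_exponent_ge h0 h1.le (by rw [div_le_one hp]; exact hp1)
    have hup : ∀ᶠ n in atTop, u n ^ max γ 1 = b n := by
      filter_upwards [hb0] with n h0
      rw [hu, ← Real.rpow_mul h0.le, one_div_mul_cancel hp.ne', Real.rpow_one]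
    have hu1 : ∀ᶠ n in atTop, u n < 1 := by
      filter_upwards [hb0, hb1] with n h0 h1
      exact Real.rpow_lt_one h0.le h1 (by positivity)
    refine ⟨u, hu0, ?_, fun hγ => ?_, fun h => absurd h (lt_irrefl _), fun _ => ?_, fun _ => ?_⟩
    · filter_upwards [hη0, hbu] with n h0 h1
      refine le_trans ?_ h1
      have : η n ^ (3 / 2 : ℝ) = √(η n) * η n := by
        rw [Real.sqrt_eq_rpow, ← Real.rpow_add_one h0.ne']; norm_num
      rw [this]
      have := herr0 n
      simp only [hb]
      gcongr
      exact le_add_of_nonneg_left (by positivity)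
    · refine squeeze_zero' ?_ ?_ hσ
      · filter_upwards [hu0] with n h0
        have := herr0 n
        positivity
      · filter_upwards [hu0, hu1, hup, hb0, hη0] with n h0 h1 h2 h3 h4
        have h5 : b n ≤ u n ^ γ := by
          rw [← h2]
          exact Real.rpow_le_rpow_of_exponent_ge h0 h1.le (le_max_left _ _)
        rw [Real.rpow_neg h0.le, ← div_eq_mul_inv]
        calc err n / u n ^ γ ≤ err n / b n := by
              have := herr0 n
              gcongr
          _ = err n / η n / √(err n / η n + η n) := by
              simp only [hb]; rw [mul_comm, div_div]
          _ ≤ (err n / η n + η n) / √(err n / η n + η n) := by gcongr; linarith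
          _ = _ := Real.div_sqrt
    · have := hbt.rpow_const (p := 1 / max γ 1) (Or.inr (by positivity))
      rwa [Real.zero_rpow (by positivity)] at this
    · refine hσ.congr' ?_
      filter_upwards [hup, hη0] with n h1 h2
      rw [h1, hb]; field_simp
  · refine ⟨fun _ => x, ?_, ?_, fun _ => ?_, fun _ _ => rfl, fun h => absurd h hx.ne',
      fun h => absurd h hx.ne'⟩
    · filter_upwards with _ using hx
    · have := hη.rpow_const (p := 3 / 2) (Or.inr (by norm_num))
      rw [Real.zero_rpow (by norm_num)] at this
      filter_upwards [this.eventually (gt_mem_nhds hx)] with n hn using hn.le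
    · have h1 : Tendsto err atTop (𝓝 0) := by
        have := herr.mul hη
        rw [zero_mul] at this
        refine this.congr' ?_
        filter_upwards [hη0] with n hn
        field_simp
      simpa using h1.mul_const (x ^ (-γ))

theorem boundaryExponent_eq (γ : ℝ) : boundaryExponent γ = 1 + max (-γ) 0 := by
  unfold boundaryExponent
  split_ifs with h
  · rw [max_eq_left (by linarith)]; ring
  · rw [max_eq_right (by linarith)]; ring

theorem rpow_negPart_le (γ : ℝ) {s : ℝ} (hs : 0 < s) : s ^ max (-γ) 0 ≤ 1 + s ^ (-γ) := by
  rcases le_total 0 (-γ) with h | h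
  · rw [max_eq_left h]; linarith
  · rw [max_eq_right h, Real.rpow_zero]
    have : 0 < s ^ (-γ) := by positivity
    linarith

/-- The functions `h n` are, uniformly on `[u n, η n ^ (-3/2)]`, first order perturbations of the
identity with leading term `-η n * ℓ n * s ^ boundaryExponent γ`. -/
def Perturb (γ : ℝ) (η u : ℕ → ℝ) (h : ℕ → ℝ → ℝ) (ℓ : ℕ → ℝ) : Prop :=
  ∀ ε : ℝ, 0 < ε → ∀ᶠ n in atTop, ∀ s ∈ Icc (u n) (η n ^ (-(3 / 2) : ℝ)),
    |h n s - s + η n * ℓ n * s ^ boundaryExponent γ|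
      ≤ ε * η n * (s * (1 + |Real.log s| + s ^ (-γ)))

theorem exists_perturb {γ x : ℝ} {η err u : ℕ → ℝ} (hγ : -1 / 2 < γ)
    (hη0 : ∀ᶠ n in atTop, 0 < η n) (hη : Tendsto η atTop (𝓝 0)) (herr0 : ∀ n, 0 ≤ err n)
    (herr : Tendsto (fun n => err n / η n) atTop (𝓝 0)) (hu : CutOff γ x η err u)
    {ℓ : ℕ → ℝ} {Lb : ℝ} (hℓ : ∀ᶠ n in atTop, |ℓ n| ≤ Lb) {r : ℕ → ℝ} (hr : ∀ᶠ n in atTop, 0 < r n)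
    {Y : ℕ → ℝ → ℝ} {C : ℝ} (hC : 0 ≤ C)
    (hY : ∀ ε : ℝ, 0 < ε → ∀ᶠ n in atTop, ∀ s ∈ Icc (u n) (η n ^ (-(3 / 2) : ℝ)),
      |(r n * s) ^ (-γ) * (Y n s - boxCox γ (r n * s)) + η n * ℓ n * s ^ max (-γ) 0|
        ≤ ε * η n * (1 + |Real.log s| + s ^ max (-γ) 0) + C * err n * s ^ (-γ)) :
    ∃ h : ℕ → ℝ → ℝ, (∀ᶠ n in atTop, ∀ s ∈ Icc (u n) (η n ^ (-(3 / 2) : ℝ)),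
        0 < h n s ∧ boxCox γ (r n * h n s) = Y n s) ∧
      (∀ ε : ℝ, 0 < ε → ∀ᶠ n in atTop, ∀ s ∈ Icc (u n) (η n ^ (-(3 / 2) : ℝ)),
        |h n s - s| ≤ ε * s) ∧
      Perturb γ η u h ℓ := by
  set κ := fun n s => (r n * s) ^ (-γ) * (Y n s - boxCox γ (r n * s)) with hκ
  set g := max (-γ) 0 with hg
  have hg0 : 0 ≤ g := le_max_right _ _
  have hg1 : g < 1 / 2 := max_lt (by linarith) (by norm_num)
  have hLb : 0 ≤ Lb := hℓ.exists.elim fun n hn => (abs_nonneg _).trans hn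
  have t1 : Tendsto (fun n => η n ^ (1 - 3 / 2 * g)) atTop (𝓝 0) := by
    have := hη.rpow_const (p := 1 - 3 / 2 * g) (Or.inr (by linarith))
    rwa [Real.zero_rpow (by linarith)] at this
  have hη' : Tendsto η atTop (𝓝[>] 0) := tendsto_nhdsWithin_iff.2 ⟨hη, hη0⟩
  have t2 : Tendsto (fun n => η n * |Real.log (η n)|) atTop (𝓝 0) := by
    have h1 := ((tendsto_log_mul_rpow_nhdsGT_zero one_pos).comp hη').abs
    rw [abs_zero] at h1
    refine h1.congr' ?_
    filter_upwards [hη0] with n hn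
    simp only [Function.comp, Real.rpow_one]
    rw [abs_mul, abs_of_pos hn, mul_comm]
  have t3 : Tendsto (fun n => if 0 < γ then err n * u n ^ (-γ) else 0) atTop (𝓝 0) := by
    by_cases h : 0 < γ
    · simpa [h] using hu.err_small h
    · simp [h]
  set B := fun n => (Lb + 1 + C) * η n ^ (1 - 3 / 2 * g) + η n + 3 / 2 * (η n * |Real.log (η n)|)
      + C * (if 0 < γ then err n * u n ^ (-γ) else 0) with hB
  have hBt : Tendsto B atTop (𝓝 0) := by
    have := (((t1.const_mul (Lb + 1 + C)).add hη).add (t2.const_mul (3 / 2))).add (t3.const_mul C)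
    simp only [mul_zero, add_zero] at this
    exact this
  have hη1 : ∀ᶠ n in atTop, η n < 1 := hη.eventually (gt_mem_nhds one_pos)
  have herrη : ∀ᶠ n in atTop, err n ≤ η n := by
    filter_upwards [herr.eventually (gt_mem_nhds one_pos), hη0] with n h1 h2
    rw [div_lt_one h2] at h1; exact h1.le
  have hκB : ∀ᶠ n in atTop, ∀ s ∈ Icc (u n) (η n ^ (-(3 / 2) : ℝ)), |κ n s| ≤ B n := by
    filter_upwards [hY 1 one_pos, hη0, hη1, hu.pos, hu.lower, hℓ, herrη] with n h1 h2 h3 h4 h5 h6 h7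
    intro s hs
    have hs0 : 0 < s := h4.trans_le hs.1
    have hsg : η n * s ^ g ≤ η n ^ (1 - 3 / 2 * g) := by
      have : s ^ g ≤ (η n ^ (-(3 / 2) : ℝ)) ^ g := Real.rpow_le_rpow hs0.le hs.2 hg0
      calc η n * s ^ g ≤ η n * (η n ^ (-(3 / 2) : ℝ)) ^ g := by gcongr
        _ = _ := by
          rw [← Real.rpow_mul h2.le, ← Real.rpow_one_add' h2.le (by linarith)]
          congr 1; ring
    have hlog : |Real.log s| ≤ 3 / 2 * |Real.log (η n)| := by
      have hl : Real.log (η n) < 0 := Real.log_neg h2 h3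
      have a1 := Real.log_le_log (by positivity) (h5.trans hs.1)
      have a2 := Real.log_le_log hs0 hs.2
      rw [Real.log_rpow h2] at a1 a2
      rw [abs_of_neg hl, abs_le]
      constructor <;> linarith
    have herrs : err n * s ^ (-γ) ≤ η n ^ (1 - 3 / 2 * g)
        + (if 0 < γ then err n * u n ^ (-γ) else 0) := by
      have := herr0 n
      by_cases h : 0 < γ
      · rw [if_pos h]
        have : s ^ (-γ) ≤ u n ^ (-γ) := Real.rpow_le_rpow_of_nonpos h4 hs.1 (by linarith)
        have : 0 ≤ η n ^ (1 - 3 / 2 * g) := by positivity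
        have : err n * s ^ (-γ) ≤ err n * u n ^ (-γ) := by gcongr
        linarith
      · rw [if_neg h, add_zero]
        have : g = -γ := max_eq_left (by linarith)
        rw [← this]
        exact (mul_le_mul_of_nonneg_right h7 (by positivity)).trans hsg
    have h8 := h1 s hs
    have h9 : |η n * ℓ n * s ^ g| ≤ Lb * η n ^ (1 - 3 / 2 * g) := by
      rw [abs_mul, abs_mul, abs_of_pos h2, abs_of_pos (by positivity : 0 < s ^ g)]
      calc η n * |ℓ n| * s ^ g = |ℓ n| * (η n * s ^ g) := by ring
        _ ≤ _ := by gcongr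
    have h10 : |κ n s| ≤ |κ n s + η n * ℓ n * s ^ g| + |η n * ℓ n * s ^ g| := by
      have := abs_sub (κ n s + η n * ℓ n * s ^ g) (η n * ℓ n * s ^ g)
      rwa [add_sub_cancel_right] at this
    calc |κ n s| ≤ (1 * η n * (1 + |Real.log s| + s ^ g) + C * err n * s ^ (-γ))
          + Lb * η n ^ (1 - 3 / 2 * g) := h10.trans (add_le_add h8 h9)
      _ = η n + η n * |Real.log s| + η n * s ^ g + C * (err n * s ^ (-γ))
          + Lb * η n ^ (1 - 3 / 2 * g) := by ring
      _ ≤ η n + η n * (3 / 2 * |Real.log (η n)|) + η n ^ (1 - 3 / 2 * g)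
          + C * (η n ^ (1 - 3 / 2 * g) + (if 0 < γ then err n * u n ^ (-γ) else 0))
          + Lb * η n ^ (1 - 3 / 2 * g) := by gcongr
      _ = B n := by simp only [hB]; ring
  have hsmall : ∀ δ : ℝ, 0 < δ → ∀ᶠ n in atTop, ∀ s ∈ Icc (u n) (η n ^ (-(3 / 2) : ℝ)),
      |κ n s| ≤ δ := fun δ hδ => by
    filter_upwards [hκB, hBt.eventually (gt_mem_nhds hδ)] with n h1 h2 s hs
    exact (h1 s hs).trans h2.le
  refine ⟨fun n s => s * gpdReal γ (κ n s), ?_, fun ε hε => ?_, fun ε hε => ?_⟩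
  · obtain ⟨δ, hδ, hexp⟩ := exists_gpdReal_expansion γ one_pos
    filter_upwards [hsmall δ hδ, hu.pos, hr] with n h1 h2 h3 s hs
    have hs0 : 0 < s := h2.trans_le hs.1
    have h4 := (hexp _ (h1 s hs)).1
    refine ⟨mul_pos hs0 (gpdReal_pos h4), ?_⟩
    rw [← mul_assoc]
    exact boxCox_mul_gpdReal (by positivity) h4
  · obtain ⟨δ, hδ, hexp⟩ := exists_gpdReal_expansion γ one_pos
    filter_upwards [hsmall (min δ (ε / 2)) (by positivity), hu.pos] with n h1 h2 s hs
    have hs0 : 0 < s := h2.trans_le hs.1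
    have h4 := (hexp _ ((h1 s hs).trans (min_le_left _ _))).2
    have h5 := (h1 s hs).trans (min_le_right _ _)
    have h6 : |gpdReal γ (κ n s) - 1| ≤ ε := by
      have := abs_add_le (gpdReal γ (κ n s) - 1 - κ n s) (κ n s)
      rw [sub_add_cancel] at this
      linarith
    have : s * gpdReal γ (κ n s) - s = s * (gpdReal γ (κ n s) - 1) := by ring
    rw [this, abs_mul, abs_of_pos hs0, mul_comm]
    gcongr
  · set ε₁ := ε / (2 * (Lb + 4 + C)) with hε₁
    have hε₁0 : 0 < ε₁ := by positivity
    obtain ⟨δ, hδ, hexp⟩ := exists_gpdReal_expansion γ hε₁0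
    have hCerr : ∀ᶠ n in atTop, C * err n ≤ min (ε / 4) C * η n := by
      have h1 : ∀ᶠ n in atTop, C * err n ≤ ε / 4 * η n := by
        have : 0 < ε / 4 / (C + 1) := by positivity
        filter_upwards [herr.eventually (gt_mem_nhds this), hη0] with n h1 h2
        rw [div_lt_iff₀ h2] at h1
        calc C * err n ≤ C * (ε / 4 / (C + 1) * η n) := by gcongr
          _ = C / (C + 1) * (ε / 4 * η n) := by field_simp
          _ ≤ 1 * (ε / 4 * η n) := by
              gcongr; rw [div_le_one (by positivity)]; linarith
          _ = _ := one_mul _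
      filter_upwards [h1, herrη, hη0] with n h1 h2 h3
      rw [min_mul_of_nonneg _ _ h3.le]
      exact le_min h1 (by gcongr)
    have hε4 : 0 < min (ε / 8) 1 := by positivity
    filter_upwards [hsmall δ hδ, hu.pos, hY _ hε4, hCerr, hη0, hℓ] with n h1 h2 h3 h4 h5 h6 s hs
    have hs0 : 0 < s := h2.trans_le hs.1
    set φ := 1 + |Real.log s| + s ^ (-γ) with hφ
    have hsγ : 0 < s ^ (-γ) := by positivity
    have hsg : s ^ g ≤ φ := (rpow_negPart_le γ hs0).trans (by rw [hφ]; linarith [abs_nonneg (Real.log s)])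
    have hφ0 : 0 < φ := by positivity
    have hφ2 : 1 + |Real.log s| + s ^ g ≤ 2 * φ := by rw [hφ] at *; linarith
    have hφ3 : s ^ (-γ) ≤ φ := by rw [hφ]; linarith [abs_nonneg (Real.log s)]
    have h7 := h3 s hs
    have hY1 : |κ n s + η n * ℓ n * s ^ g| ≤ ε / 2 * η n * φ := by
      calc _ ≤ min (ε / 8) 1 * η n * (1 + |Real.log s| + s ^ g) + C * err n * s ^ (-γ) := h7
        _ ≤ ε / 8 * η n * (2 * φ) + ε / 4 * η n * φ := by
            have := min_le_left (ε / 8) 1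
            have := h4.trans (mul_le_mul_of_nonneg_right (min_le_left (ε / 4) C) h5.le)
            gcongr
        _ = _ := by ring
    have hY2 : |κ n s| ≤ (Lb + 2 + C) * η n * φ := by
      have h8 : |κ n s + η n * ℓ n * s ^ g| ≤ 1 * η n * (2 * φ) + C * η n * φ := by
        refine h7.trans ?_
        have := min_le_right (ε / 8) 1
        have := h4.trans (mul_le_mul_of_nonneg_right (min_le_right (ε / 4) C) h5.le)
        gcongr
      have h9 : |η n * ℓ n * s ^ g| ≤ η n * Lb * φ := by
        rw [abs_mul, abs_mul, abs_of_pos h5, abs_of_pos (by positivity : 0 < s ^ g)]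
        gcongr
      have h10 : |κ n s| ≤ |κ n s + η n * ℓ n * s ^ g| + |η n * ℓ n * s ^ g| := by
        have := abs_sub (κ n s + η n * ℓ n * s ^ g) (η n * ℓ n * s ^ g)
        rwa [add_sub_cancel_right] at this
      linarith
    have h8 := (hexp _ (h1 s hs)).2
    have e : s * gpdReal γ (κ n s) - s + η n * ℓ n * s ^ boundaryExponent γ
        = s * ((gpdReal γ (κ n s) - 1 - κ n s) + (κ n s + η n * ℓ n * s ^ g)) := by
      rw [boundaryExponent_eq, Real.rpow_add hs0, Real.rpow_one]; ring
    rw [e, abs_mul, abs_of_pos hs0]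
    have h11 : ε₁ * ((Lb + 2 + C) * η n * φ) ≤ ε / 2 * η n * φ := by
      calc ε₁ * ((Lb + 2 + C) * η n * φ) ≤ ε₁ * ((Lb + 4 + C) * η n * φ) := by gcongr; norm_num
        _ = ε / 2 * η n * φ := by rw [hε₁]; field_simp
    calc s * |gpdReal γ (κ n s) - 1 - κ n s + (κ n s + η n * ℓ n * s ^ g)|
        ≤ s * (ε / 2 * η n * φ + ε / 2 * η n * φ) := by
          gcongr
          refine (abs_add_le _ _).trans (add_le_add (h8.trans ?_) hY1)
          refine le_trans ?_ h11
          gcongr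
      _ = ε * η n * (s * φ) := by ring

section Schemes

variable {k d e : ℕ → ℝ} {γ : Fin 2 → ℝ} {A : Fin 2 → ℝ → ℝ} {A₀ : ℝ → ℝ}

/-- The coefficient of the leading term for given parameters of `hTilde`. -/
def ellParam (γ θ χ ξ : ℝ) : ℝ := if 0 < γ then χ / γ else if γ = 0 then θ + 2 * χ else -ξ / γ

theorem SequenceGrowth.n_div_k_tendsto (h : SequenceGrowth k d e γ) :
    Tendsto (fun n : ℕ => n / k n) atTop atTop := by
  have h1 : Tendsto (fun n : ℕ => k n / n) atTop (𝓝[>] 0) := by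
    refine tendsto_nhdsWithin_iff.2 ⟨h.k_div, ?_⟩
    filter_upwards [h.k_tendsto.eventually_gt_atTop 0, eventually_gt_atTop 0] with n hk hn
    have : (0 : ℝ) < n := by exact_mod_cast hn
    exact div_pos hk this
  refine h1.inv_tendsto_nhdsGT_zero.congr fun n => ?_
  simp

theorem SequenceGrowth.exists_le_c_mul_cutOff (h : SequenceGrowth k d e γ) {g x : ℝ} {err u : ℕ → ℝ}
    (hu : CutOff g x (rate k d e γ) err u) :
    ∃ C : ℝ, 0 < C ∧ ∀ᶠ n in atTop, k n ^ (1 / 4 : ℝ) / C ≤ cSeq k e n * u n := by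
  obtain ⟨C, hC, hb⟩ := h.k_le_cSeq
  refine ⟨C, hC, ?_⟩
  filter_upwards [hb, hu.lower, h.wMax_tendsto.eventually_ge_atTop 1,
    h.k_tendsto.eventually_gt_atTop 0] with n h2 h3 h4 h5
  have h6 : k n ^ (-(1 / 2) : ℝ) ≤ rate k d e γ n := by
    rw [rate, Real.sqrt_eq_rpow, Real.rpow_neg h5.le, inv_eq_one_div]
    gcongr
  have h7 : k n ^ (-(3 / 4) : ℝ) ≤ u n := by
    refine le_trans ?_ h3
    have := Real.rpow_le_rpow (by positivity) h6 (by norm_num : (0 : ℝ) ≤ 3 / 2)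
    rwa [← Real.rpow_mul h5.le, show (-(1 / 2) * (3 / 2) : ℝ) = -(3 / 4) by norm_num] at this
  have h8 : k n / C ≤ cSeq k e n := by rw [div_le_iff₀ hC]; linarith
  calc k n ^ (1 / 4 : ℝ) / C = k n / C * k n ^ (-(3 / 4) : ℝ) := by
        rw [div_mul_eq_mul_div, ← Real.rpow_one_add' h5.le (by norm_num)]; norm_num
    _ ≤ cSeq k e n * u n :=
      mul_le_mul h8 h7 (by positivity) ((by positivity : 0 ≤ k n / C).trans h8)

theorem SequenceGrowth.c_mul_cutOff_tendsto (h : SequenceGrowth k d e γ) {g x : ℝ} {err u : ℕ → ℝ}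
    (hu : CutOff g x (rate k d e γ) err u) :
    Tendsto (fun n => cSeq k e n * u n) atTop atTop := by
  obtain ⟨C, hC, hb⟩ := h.exists_le_c_mul_cutOff hu
  exact tendsto_atTop_mono' _ hb
    (((tendsto_rpow_atTop (by norm_num)).comp h.k_tendsto).atTop_div_const hC)

theorem SequenceGrowth.x_ge (h : SequenceGrowth k d e γ) {g x : ℝ} {err u : ℕ → ℝ}
    (hu : CutOff g x (rate k d e γ) err u) (B : ℝ) :
    ∀ᶠ n in atTop, ∀ s, u n ≤ s → B ≤ d n / e n * cSeq k e n * s := by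
  obtain ⟨m, M, hm, hmM, hr⟩ := h.ratio_bounds
  filter_upwards [hr, (h.c_mul_cutOff_tendsto hu).eventually_ge_atTop (max B 0 / m),
    h.c_tendsto.eventually_gt_atTop 0, hu.pos] with n h1 h2 h3 h4 s hs
  rw [div_le_iff₀ hm] at h2
  calc B ≤ max B 0 := le_max_left _ _
    _ ≤ cSeq k e n * u n * m := h2
    _ ≤ cSeq k e n * u n * (d n / e n) := by gcongr; exact h1.1
    _ = d n / e n * cSeq k e n * u n := by ring
    _ ≤ _ := by
      have := hm.le.trans h1.1
      gcongr

theorem SequenceGrowth.scale_eq (h : SequenceGrowth k d e γ) {n : ℕ} (hn : (n : ℝ) ≠ 0)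
    (hk : k n ≠ 0) (s : ℝ) : n / k n * (d n / e n * cSeq k e n * s) = d n * s := by
  rw [h.ratio_mul_cSeq]; field_simp

theorem SequenceGrowth.tailQ_approx (h : SequenceGrowth k d e γ) {g x ρ : ℝ} {err u : ℕ → ℝ}
    (hu : CutOff g x (rate k d e γ) err u) {F a b B : ℝ → ℝ} (hF : SecondOrder F g ρ a b B) :
    ∃ C : ℝ, 0 ≤ C ∧ ∀ᶠ n : ℕ in atTop, ∀ s, u n ≤ s →
      |(tailQ F (d n * s) - b (n / k n)) / a (n / k n)
          - boxCox g (d n / e n * cSeq k e n * s)|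
        ≤ C * |B (n / k n)| * (d n / e n * cSeq k e n * s) ^ g := by
  obtain ⟨C, t₀, hC, ht₀, hb⟩ := hF.bound one_pos
  refine ⟨C, hC, ?_⟩
  filter_upwards [h.x_ge hu 1, h.n_div_k_tendsto.eventually_gt_atTop t₀,
    eventually_gt_atTop 0, h.k_tendsto.eventually_gt_atTop 0] with n h1 h2 h3 h4 s hs
  have h3' : (n : ℝ) ≠ 0 := by positivity
  have h5 := hb (n / k n) _ (h1 s hs) h2 (h2.trans_le (le_mul_of_one_le_right (by linarith) (h1 s hs)))
  rwa [h.scale_eq h3' h4.ne'] at h5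

theorem eventually_mul_le_of_tendsto {C : ℝ} {f η : ℕ → ℝ} (hη : ∀ᶠ n in atTop, 0 < η n)
    (hf : Tendsto (fun n => f n / η n) atTop (𝓝 0)) {ε : ℝ} (hε : 0 < ε) :
    ∀ᶠ n in atTop, C * f n ≤ ε * η n := by
  have h1 := hf.const_mul C
  rw [mul_zero] at h1
  filter_upwards [h1.eventually (gt_mem_nhds hε), hη] with n h2 h3
  rw [← mul_div_assoc, div_lt_iff₀ h3] at h2
  exact h2.le

/-- The functions that describe the boundary of the transformed failure set on the scale `n / k`. -/
theorem exists_perturb_hTilde (h : SequenceGrowth k d e γ) (hb : SmallBias k d e γ A A₀) (i : Fin 2)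
    {x ρ : ℝ} {u : ℕ → ℝ} {F a b : ℝ → ℝ} (hF : SecondOrder F (γ i) ρ a b (A i))
    (hu : CutOff (γ i) x (rate k d e γ) (remainder k A) u) {θ χ ξ : ℝ}
    (hpar : γ i < 0 → θ = 0 ∧ χ = 0) :
    ∃ H : ℕ → ℝ → ℝ, (∀ᶠ n : ℕ in atTop, ∀ s ∈ Icc (u n) (rate k d e γ n ^ (-(3 / 2) : ℝ)),
        0 < H n s ∧ boxCox (γ i) (d n / e n * H n s) = gexpr (γ i) √(k n) (cSeq k e n) θ χ ξ
          ((tailQ F (d n * s) - b (n / k n)) / a (n / k n))) ∧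
      (∀ ε : ℝ, 0 < ε → ∀ᶠ n in atTop, ∀ s ∈ Icc (u n) (rate k d e γ n ^ (-(3 / 2) : ℝ)),
        |H n s - s| ≤ ε * s) ∧
      Perturb (γ i) (rate k d e γ) u H
        (fun n => ellParam (γ i) θ χ ξ * (weight k d e (γ i) n / wMax k d e γ n)) := by
  obtain ⟨m, M, hm, hmM, hr⟩ := h.ratio_bounds
  obtain ⟨Ca, hCa, hY⟩ := h.tailQ_approx hu hF
  have hηpos := h.rate_pos
  have hrem := remainder_isLittleO h hb
  have hℓ : ∀ᶠ n in atTop, |ellParam (γ i) θ χ ξ * (weight k d e (γ i) n / wMax k d e γ n)|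
      ≤ |ellParam (γ i) θ χ ξ| := by
    filter_upwards [(h.weight_tendsto i).eventually_gt_atTop 0, h.wMax_tendsto.eventually_gt_atTop 0]
      with n h1 h2
    rw [abs_mul, abs_of_pos (div_pos h1 h2)]
    refine mul_le_of_le_one_right (abs_nonneg _) ?_
    rw [div_le_one h2]
    exact weight_le_wMax k d e γ i n
  have hmain : ∀ᶠ n in atTop, rate k d e γ n *
      (ellParam (γ i) θ χ ξ * (weight k d e (γ i) n / wMax k d e γ n))
        = ellParam (γ i) θ χ ξ * (weight k d e (γ i) n / √(k n)) := by
    filter_upwards [h.wMax_tendsto.eventually_gt_atTop 0] with n h2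
    rw [rate]; field_simp
  have hwle : ∀ᶠ n in atTop, weight k d e (γ i) n / √(k n) ≤ rate k d e γ n := by
    filter_upwards with n
    rw [rate]
    gcongr
    exact weight_le_wMax k d e γ i n
  have hAo : Tendsto (fun n : ℕ => |A i (n / k n)| / rate k d e γ n) atTop (𝓝 0) := by
    refine squeeze_zero' ?_ ?_ hrem
    · filter_upwards [hηpos] with n hn; positivity
    · filter_upwards [hηpos] with n hn
      gcongr
      exact le_remainder k A i n
  have hsqrt := h.sqrt_tendsto.eventually_ge_atTop 1
  have hlog1 := h.log_tendsto.eventually_ge_atTop 1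
  have hcpos := h.c_tendsto.eventually_gt_atTop 0
  suffices hmainY : ∃ C : ℝ, 0 ≤ C ∧ ∀ ε : ℝ, 0 < ε → ∀ᶠ n : ℕ in atTop,
      ∀ s ∈ Icc (u n) (rate k d e γ n ^ (-(3 / 2) : ℝ)),
      |(d n / e n * s) ^ (-γ i) * (gexpr (γ i) √(k n) (cSeq k e n) θ χ ξ
          ((tailQ F (d n * s) - b (n / k n)) / a (n / k n)) - boxCox (γ i) (d n / e n * s))
        + ellParam (γ i) θ χ ξ * (weight k d e (γ i) n / √(k n)) * s ^ max (-γ i) 0|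
        ≤ ε * rate k d e γ n * (1 + |Real.log s| + s ^ max (-γ i) 0)
          + C * remainder k A n * s ^ (-γ i) by
    obtain ⟨C, hC, hmainY⟩ := hmainY
    refine exists_perturb (h.neg_half_lt i) hηpos h.rate_tendsto (remainder_nonneg k A) hrem hu hℓ
      (r := fun n => d n / e n) ?_ hC fun ε hε => ?_
    · filter_upwards with n using div_pos (h.d_pos n) (h.e_pos n)
    · filter_upwards [hmainY ε hε, hmain] with n h1 h2 s hs
      rw [h2]
      exact h1 s hs
  rcases lt_trichotomy (γ i) 0 with hγ | hγ | hγ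
  · obtain ⟨rfl, rfl⟩ := hpar hγ
    obtain ⟨C, hC, hexp⟩ := gexpr_expansion_neg ξ Ca m M hγ hCa hm (hm.le.trans hmM)
    refine ⟨C, hC, fun ε hε => ?_⟩
    filter_upwards [hr, hY, hsqrt, hcpos, hu.pos, hηpos,
      eventually_mul_le_of_tendsto (C := C) hηpos hAo hε] with n h1 h2 h3 h4 h5 h6 h7 s hs
    have hs0 : 0 < s := h5.trans_le hs.1
    have h8 := hexp √(k n) _ _ s _ _ h3 h4 h1.1 h1.2 hs0 (abs_nonneg _) (h2 s hs.1)
    rw [h.ratio_mul_cSeq] at h8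
    have e1 : ellParam (γ i) 0 0 ξ * (weight k d e (γ i) n / √(k n)) * s ^ max (-γ i) 0
        = -ξ / γ i * (s ^ (-γ i) * ((d n * k n / n) ^ (-γ i) / √(k n))) := by
      rw [max_eq_left (by linarith)]
      simp only [ellParam, weight, hγ.not_gt, hγ.ne, if_false]; ring
    rw [e1]
    refine h8.trans (add_le_add ?_ ?_)
    · refine h7.trans (le_mul_of_one_le_right (by positivity) ?_)
      have : 0 < s ^ max (-γ i) 0 := by positivity
      linarith [abs_nonneg (Real.log s)]
    · rw [mul_assoc, div_eq_mul_one_div, mul_comm (s ^ (-γ i))]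
      gcongr
      exact inv_sqrt_le_remainder k A n
  · obtain ⟨C, l₀, hC, hl₀, hexp⟩ := gexpr_expansion_zero θ χ ξ Ca m M hCa hm
    refine ⟨0, le_rfl, fun ε hε => ?_⟩
    have hw : ∀ n, weight k d e (γ i) n = 1 / 2 * Real.log (cSeq k e n) ^ 2 := fun n => by
      simp [weight, hγ]
    have hL1 : ∀ᶠ n in atTop, C * ((Real.log (cSeq k e n) / √(k n)) ^ 2 * Real.log (cSeq k e n))
        ≤ ε / 3 * rate k d e γ n := by
      have hl := h.log_div_tendsto.const_mul (C * 2)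
      rw [mul_zero] at hl
      filter_upwards [hl.eventually (gt_mem_nhds (by positivity : 0 < ε / 3)), hwle, hsqrt, hlog1]
        with n h1 h2 h3 h4
      rw [hw] at h2
      have h5 : 0 ≤ C * 2 * (Real.log (cSeq k e n) / √(k n)) := by positivity
      have h6 : 0 ≤ 1 / 2 * Real.log (cSeq k e n) ^ 2 / √(k n) := by positivity
      calc _ = C * 2 * (Real.log (cSeq k e n) / √(k n))
            * (1 / 2 * Real.log (cSeq k e n) ^ 2 / √(k n)) := by ring
        _ ≤ ε / 3 * rate k d e γ n := mul_le_mul h1.le h2 h6 (by positivity)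
    have hL2 : ∀ᶠ n in atTop, C * (Real.log (cSeq k e n) / √(k n)) ≤ ε / 3 * rate k d e γ n := by
      have hl := (h.log_tendsto.inv_tendsto_atTop).const_mul (C * 2)
      rw [mul_zero] at hl
      filter_upwards [hl.eventually (gt_mem_nhds (by positivity : 0 < ε / 3)), hwle, hsqrt, hlog1]
        with n h1 h2 h3 h4
      rw [hw] at h2
      simp only [Pi.inv_apply] at h1
      have h6 : 0 ≤ 1 / 2 * Real.log (cSeq k e n) ^ 2 / √(k n) := by positivity
      calc _ = C * 2 * (Real.log (cSeq k e n))⁻¹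
            * (1 / 2 * Real.log (cSeq k e n) ^ 2 / √(k n)) := by field_simp
        _ ≤ ε / 3 * rate k d e γ n := mul_le_mul h1.le h2 h6 (by positivity)
    filter_upwards [hr, hY, hsqrt, hcpos, hu.pos, hηpos, hlog1,
      eventually_mul_le_of_tendsto (C := C) hηpos hAo (by positivity : 0 < ε / 3),
      h.log_div_tendsto.eventually (gt_mem_nhds hl₀), hL1, hL2]
      with n h1 h2 h3 h4 h5 h6 h7 h8 h9 h10 h11 s hs
    have hs0 : 0 < s := h5.trans_le hs.1
    have hYs := h2 s hs.1
    rw [hγ, Real.rpow_zero, mul_one] at hYs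
    have h12 := hexp √(k n) _ _ s _ _ h3 h7 h4 h9.le h1.1 h1.2 hs0 (abs_nonneg _) hYs
    have e1 : ellParam (γ i) θ χ ξ * (weight k d e (γ i) n / √(k n)) * s ^ max (-γ i) 0
        = (θ + 2 * χ) * (1 / 2 * Real.log (cSeq k e n) ^ 2 / √(k n)) := by
      rw [hw]
      simp [ellParam, hγ]
    have e2 : (d n / e n * s) ^ (-γ i) = 1 := by simp [hγ]
    rw [e1, e2, one_mul, hγ]
    refine h12.trans ?_
    simp only [neg_zero, max_self, Real.rpow_zero, zero_mul, add_zero]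
    have h13 : 0 ≤ |Real.log s| := abs_nonneg _
    have h14 : 0 ≤ ε * rate k d e γ n := by positivity
    calc _ = C * ((Real.log (cSeq k e n) / √(k n)) ^ 2 * Real.log (cSeq k e n))
          + C * (Real.log (cSeq k e n) / √(k n)) * (1 + |Real.log s|) + C * |A i (n / k n)| := by ring
      _ ≤ ε / 3 * rate k d e γ n + ε / 3 * rate k d e γ n * (1 + |Real.log s|)
          + ε / 3 * rate k d e γ n := by gcongr
      _ ≤ ε * rate k d e γ n * (1 + |Real.log s| + 1) := by nlinarith
  · obtain ⟨C, K₀, l₀, hC, hl₀, hexp⟩ := gexpr_expansion_pos θ χ ξ Ca m hγ hCa hm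
    refine ⟨C, hC, fun ε hε => ?_⟩
    have hw : ∀ n, weight k d e (γ i) n = Real.log (cSeq k e n) := fun n => by simp [weight, hγ]
    have hLo : Tendsto (fun n : ℕ => ((Real.log (cSeq k e n) / √(k n)) ^ 2 + |A i (n / k n)|)
        / rate k d e γ n) atTop (𝓝 0) := by
      have h1 := h.log_div_tendsto.add hAo
      rw [add_zero] at h1
      refine squeeze_zero' ?_ ?_ h1
      · filter_upwards [hηpos] with n hn; positivity
      · filter_upwards [hηpos, hwle, hsqrt, hlog1] with n h2 h3 h4 h5
        rw [hw] at h3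
        rw [add_div]
        refine add_le_add ?_ le_rfl
        rw [div_le_iff₀ h2, sq]
        gcongr
    filter_upwards [hr, hY, hsqrt, hcpos, hu.pos, hηpos, hlog1,
      eventually_mul_le_of_tendsto (C := C) hηpos hLo hε,
      h.log_div_tendsto.eventually (gt_mem_nhds hl₀), h.sqrt_tendsto.eventually_ge_atTop K₀]
      with n h1 h2 h3 h4 h5 h6 h7 h8 h9 h10 s hs
    have hs0 : 0 < s := h5.trans_le hs.1
    have h12 := hexp √(k n) _ _ s _ _ h10 h3 h7 h4 h9.le h1.1 hs0 (abs_nonneg _) (h2 s hs.1)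
    have e1 : ellParam (γ i) θ χ ξ * (weight k d e (γ i) n / √(k n)) * s ^ max (-γ i) 0
        = χ / γ i * (Real.log (cSeq k e n) / √(k n)) := by
      rw [hw, max_eq_right (by linarith)]
      simp [ellParam, hγ]
    rw [e1]
    refine h12.trans (add_le_add ?_ ?_)
    · refine h8.trans (le_mul_of_one_le_right (by positivity) ?_)
      have : 0 < s ^ max (-γ i) 0 := by positivity
      linarith [abs_nonneg (Real.log s)]
    · rw [mul_assoc, div_eq_mul_one_div, mul_comm (s ^ (-γ i))]
      gcongr
      exact inv_sqrt_le_remainder k A n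

/-- The functions that describe the boundary of the failure set on the scale `d`. -/
theorem exists_perturb_id (h : SequenceGrowth k d e γ) (hb : SmallBias k d e γ A A₀) (i : Fin 2)
    {x ρ : ℝ} {u : ℕ → ℝ} {F a b : ℝ → ℝ} (hF : SecondOrder F (γ i) ρ a b (A i))
    (hu : CutOff (γ i) x (rate k d e γ) (remainder k A) u) :
    (∃ C : ℝ, 0 ≤ C ∧ ∀ᶠ n : ℕ in atTop, |A i (d n)| ≤ C * remainder k A n) ∧
    ∃ H : ℕ → ℝ → ℝ, (∀ᶠ n in atTop, ∀ s ∈ Icc (u n) (rate k d e γ n ^ (-(3 / 2) : ℝ)),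
        0 < H n s ∧ boxCox (γ i) (1 * H n s) = (tailQ F (d n * s) - b (d n)) / a (d n)) ∧
      (∀ ε : ℝ, 0 < ε → ∀ᶠ n in atTop, ∀ s ∈ Icc (u n) (rate k d e γ n ^ (-(3 / 2) : ℝ)),
        |H n s - s| ≤ ε * s) ∧
      Perturb (γ i) (rate k d e γ) u H (fun _ => 0) := by
  obtain ⟨m, M, hm, hmM, hr⟩ := h.ratio_bounds
  obtain ⟨C, ε₀, t₀, hC, hε₀, ht₀, hch⟩ := hF.change_reference
  have hηpos := h.rate_pos
  have hrem := remainder_isLittleO h hb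
  have hrem0 : Tendsto (remainder k A) atTop (𝓝 0) := by
    have := hrem.mul h.rate_tendsto
    rw [zero_mul] at this
    refine this.congr' ?_
    filter_upwards [hηpos] with n hn
    field_simp
  have hx1 : ∀ᶠ n in atTop, 1 ≤ d n / e n * cSeq k e n := by
    filter_upwards [hr, h.c_tendsto.eventually_ge_atTop (1 / m)] with n h1 h2
    rw [div_le_iff₀ hm] at h2
    have : 0 ≤ cSeq k e n := by nlinarith
    calc 1 ≤ cSeq k e n * m := h2
      _ ≤ cSeq k e n * (d n / e n) := by gcongr; exact h1.1
      _ = _ := mul_comm _ _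
  have hall : ∀ᶠ n : ℕ in atTop, |A i (d n)| ≤ C * |A i (n / k n)| ∧
      ∀ s, u n ≤ s →
        |s ^ (-γ i) * ((tailQ F (d n * s) - b (d n)) / a (d n) - boxCox (γ i) s)|
          ≤ C * |A i (n / k n)| * (1 + |Real.log s| + s ^ (-γ i)) := by
    filter_upwards [hx1, h.n_div_k_tendsto.eventually_gt_atTop t₀, eventually_gt_atTop 0,
      h.k_tendsto.eventually_gt_atTop 0, h.x_ge hu 1, hu.pos,
      hrem0.eventually (gt_mem_nhds hε₀)] with n h1 h2 h3 h4 h5 h6 h7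
    have h3' : (n : ℝ) ≠ 0 := by positivity
    have hd : n / k n * (d n / e n * cSeq k e n) = d n := by
      have := h.scale_eq h3' h4.ne' 1
      rwa [mul_one, mul_one] at this
    obtain ⟨h8, h9⟩ := hch (n / k n) _ h2 h1 ((le_remainder k A i n).trans h7.le)
    rw [hd] at h8 h9
    exact ⟨h8, fun s hs => h9 s (h6.trans_le hs) (h5 s hs)⟩
  refine ⟨⟨C, hC, ?_⟩, ?_⟩
  · filter_upwards [hall] with n h1
    refine h1.1.trans ?_
    gcongr
    exact le_remainder k A i n
  · refine exists_perturb (ℓ := fun _ => 0) (Lb := 0) (h.neg_half_lt i) hηpos h.rate_tendsto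
      (remainder_nonneg k A) hrem hu (by simp) (r := fun _ => 1) (by simp) hC fun ε hε => ?_
    filter_upwards [hall, hu.pos, hηpos, eventually_mul_le_of_tendsto (C := C) hηpos hrem hε]
      with n h1 h2 h3 h4 s hs
    have hs0 : 0 < s := h2.trans_le hs.1
    rw [one_mul, mul_zero, zero_mul, add_zero]
    have hsγ : 0 < s ^ (-γ i) := by positivity
    have hsg : 0 < s ^ max (-γ i) 0 := by positivity
    calc _ ≤ C * |A i (n / k n)| * (1 + |Real.log s| + s ^ (-γ i)) := h1.2 s hs.1
      _ ≤ C * remainder k A n * (1 + |Real.log s| + s ^ (-γ i)) := by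
        gcongr
        exact le_remainder k A i n
      _ = C * remainder k A n * (1 + |Real.log s|) + C * remainder k A n * s ^ (-γ i) := by ring
      _ ≤ ε * rate k d e γ n * (1 + |Real.log s|) + C * remainder k A n * s ^ (-γ i) := by gcongr
      _ ≤ _ := add_le_add (mul_le_mul_of_nonneg_left (by linarith) (by positivity)) le_rfl

end Schemes

/-- The closed quadrant without the origin. -/
abbrev quadrant : Set (ℝ × ℝ) := (Ici 0 ×ˢ Ici 0) \ {0}

/-- The density of an exponent measure with respect to Lebesgue measure on the plane. -/
def quadDens (η : ℝ × ℝ → ℝ) : ℝ × ℝ → ℝ≥0∞ :=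
  indicator quadrant (fun z => ENNReal.ofReal (η z))

theorem mem_quadrant_of_pos {z : ℝ × ℝ} (h₁ : 0 < z.1) (h₂ : 0 ≤ z.2) : z ∈ quadrant :=
  ⟨⟨h₁.le, h₂⟩, fun h => h₁.ne' (congrArg Prod.fst h)⟩

theorem measurableSet_quadrant : MeasurableSet quadrant :=
  (measurableSet_Ici.prod measurableSet_Ici).diff (measurableSet_singleton _)

section Density

variable {ν : Measure (ℝ × ℝ)} {η : ℝ × ℝ → ℝ}

theorem HasPosContDensity.measurable_quadDens (h : HasPosContDensity ν η) :
    Measurable (quadDens η) := by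
  classical
  have h1 : ContinuousOn (fun z => ENNReal.ofReal (η z)) quadrant :=
    ENNReal.continuous_ofReal.comp_continuousOn h.cont
  have := h1.measurable_piecewise (g := fun _ => 0) continuousOn_const measurableSet_quadrant
  convert this using 1
  ext z
  simp [quadDens, indicator, piecewise]

theorem HasPosContDensity.eq_withDensity (h : HasPosContDensity ν η) :
    ν = volume.withDensity (quadDens η) := by
  rw [h.density, quadDens, withDensity_indicator measurableSet_quadrant]
  congr 1
  refine Measure.restrict_congr_set ?_
  exact (sdiff_null_ae_eq_self (by simp)).symm

theorem HasPosContDensity.absolutelyContinuous (h : HasPosContDensity ν η) : ν ≪ volume := by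
  rw [h.eq_withDensity]; exact withDensity_absolutelyContinuous _ _

theorem HasPosContDensity.compl_quadrant (h : HasPosContDensity ν η) :
    ν (Ici 0 ×ˢ Ici 0)ᶜ = 0 := by
  have hm : MeasurableSet (Ici 0 ×ˢ Ici 0 : Set (ℝ × ℝ)) := measurableSet_Ici.prod measurableSet_Ici
  rw [h.density, withDensity_apply _ hm.compl, Measure.restrict_restrict hm.compl]
  simp

theorem volume_fst_eq (x : ℝ) : (volume : Measure (ℝ × ℝ)) {z | z.1 = x} = 0 := by
  have : {z : ℝ × ℝ | z.1 = x} = {x} ×ˢ univ := by ext z; simp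
  rw [this, Measure.volume_eq_prod, Measure.prod_prod]; simp

theorem volume_snd_eq (x : ℝ) : (volume : Measure (ℝ × ℝ)) {z | z.2 = x} = 0 := by
  have : {z : ℝ × ℝ | z.2 = x} = univ ×ˢ {x} := by ext z; simp
  rw [this, Measure.volume_eq_prod, Measure.prod_prod]; simp

theorem HasPosContDensity.frontier_rect (h : HasPosContDensity ν η) (x y : ℝ) :
    ν (frontier (Ici x ×ˢ Ici y)) = 0 := by
  refine h.absolutelyContinuous ?_
  refine measure_mono_null ?_ (measure_union_null (volume_fst_eq x) (volume_snd_eq y))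
  rw [frontier_prod_eq]
  simp only [frontier_Ici, closure_Ici]
  rintro z (⟨_, hz⟩ | ⟨hz, _⟩)
  · right; exact hz
  · left; exact hz

end Density

theorem tailImage_rect (F : Fin 2 → ℝ → ℝ) {s : ℝ} (hs : 0 < s) (t x y : ℝ) :
    tailImage F t (Ici (s * x) ×ˢ Ici (s * y)) = tailImage F (s * t) (Ici x ×ˢ Ici y) := by
  ext z
  constructor
  · rintro ⟨p, ⟨h1, h2⟩, h3, h4⟩
    refine ⟨(p.1 / s, p.2 / s), ⟨?_, ?_⟩, ?_, ?_⟩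
    · exact (le_div_iff₀' hs).2 h1
    · exact (le_div_iff₀' hs).2 h2
    · rw [h3]; congr 1; field_simp
    · rw [h4]; congr 1; field_simp
  · rintro ⟨p, ⟨h1, h2⟩, h3, h4⟩
    refine ⟨(s * p.1, s * p.2), ⟨?_, ?_⟩, ?_, ?_⟩
    · exact mul_le_mul_of_nonneg_left h1 hs.le
    · exact mul_le_mul_of_nonneg_left h2 hs.le
    · rw [h3]; congr 1; ring
    · rw [h4]; congr 1; ring

section Exponent

variable {μ ν : Measure (ℝ × ℝ)} {η : ℝ × ℝ → ℝ}

theorem IsExponentMeasure.tendsto_rect (hν : IsExponentMeasure μ ν) (h : HasPosContDensity ν η)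
    {x y : ℝ} (hx : 0 ≤ x) (hy : 0 ≤ y) (hxy : 0 < max x y) :
    Tendsto (fun t : ℝ => ENNReal.ofReal t * μ (tailImage (margins μ) t (Ici x ×ˢ Ici y))) atTop
      (𝓝 (ν (Ici x ×ˢ Ici y))) := by
  refine hν _ (measurableSet_Ici.prod measurableSet_Ici)
    (prod_mono (Ici_subset_Ici.2 hx) (Ici_subset_Ici.2 hy)) ⟨max x y, hxy, ?_⟩ (h.frontier_rect x y)
  rintro p ⟨h1, h2⟩
  exact max_le_max h1 h2

theorem IsExponentMeasure.measure_rect (hν : IsExponentMeasure μ ν) (h : HasPosContDensity ν η)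
    {x y s : ℝ} (hx : 0 ≤ x) (hy : 0 ≤ y) (hxy : 0 < max x y) (hs : 0 < s) :
    ENNReal.ofReal s * ν (Ici (s * x) ×ˢ Ici (s * y)) = ν (Ici x ×ˢ Ici y) := by
  have h1 := hν.tendsto_rect h hx hy hxy
  have h2 := hν.tendsto_rect h (mul_nonneg hs.le hx) (mul_nonneg hs.le hy)
    (by rw [← mul_max_of_nonneg _ _ hs.le]; positivity)
  have h3 : Tendsto (fun t : ℝ => s * t) atTop atTop := tendsto_id.const_mul_atTop hs
  have h4 := h1.comp h3
  have h5 := ENNReal.Tendsto.const_mul h2 (Or.inr (ENNReal.ofReal_ne_top (r := s)))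
  refine tendsto_nhds_unique (h5.congr fun t => ?_) h4
  simp only [Function.comp]
  rw [tailImage_rect _ hs, ENNReal.ofReal_mul hs.le, mul_assoc]

theorem IsExponentMeasure.measure_upper [IsProbabilityMeasure μ] (hν : IsExponentMeasure μ ν)
    (h : HasPosContDensity ν η) {t₁ t₂ : ℝ} (h₁ : RegularTailQ (μ.map Prod.fst) t₁)
    (h₂ : RegularTailQ (μ.map Prod.snd) t₂) {y : ℝ} (hy : 0 < y) :
    ν (Ici 0 ×ˢ Ici y) = ENNReal.ofReal (1 / y) ∧ ν (Ici y ×ˢ Ici 0) = ENNReal.ofReal (1 / y) := by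
  have := Measure.isProbabilityMeasure_map (μ := μ) measurable_fst.aemeasurable
  have := Measure.isProbabilityMeasure_map (μ := μ) measurable_snd.aemeasurable
  have key : ∀ m : Measure ℝ, IsProbabilityMeasure m → ∀ t₀, RegularTailQ m t₀ → ∀ t, t₀ < t * y →
      ∀ z, cdf m z < 1 → ((∃ p, y ≤ p ∧ (z : EReal) = tailQuantile (cdf m) (t * p)) ↔
        z ∈ Ici (tailQ (cdf m) (t * y))) := by
    intro m _ t₀ hm t ht z hz
    have h0 : 0 < t := pos_of_mul_pos_left (by linarith [hm.one_lt]) hy.le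
    constructor
    · rintro ⟨p, hp, hzp⟩
      rw [coe_eq_tailQuantile_iff] at hzp
      rw [hzp.2]
      exact tailQ_mono m (hm.one_lt.trans ht) (by gcongr)
    · intro hz'
      have h3 : tailQ (cdf m) t₀ ≤ z := (tailQ_mono m hm.one_lt ht.le).trans hz'
      have h4 := hm.tailQ_cdf z h3 hz
      have h5 := (cdf m).mono hz'
      rw [hm.cdf_tailQ _ ht.le] at h5
      have hpos : 0 < 1 - cdf m z := by linarith
      have hty : t * y ≤ 1 / (1 - cdf m z) := by
        rw [le_div_iff₀ hpos]
        have h6 : 0 < t * y := by positivity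
        have : t * y * (1 - cdf m z) ≤ t * y * (1 / (t * y)) := by gcongr; linarith
        rwa [mul_one_div_cancel h6.ne'] at this
      refine ⟨1 / (1 - cdf m z) / t, ?_, ?_⟩
      · rw [le_div_iff₀ h0]; linarith
      · rw [coe_eq_tailQuantile_iff, mul_div_cancel₀ _ h0.ne', h4]
        exact ⟨hm.one_lt.trans (ht.trans_le hty), rfl⟩
  have key2 : ∀ m : Measure ℝ, IsProbabilityMeasure m → ∀ t₀, RegularTailQ m t₀ →
      ∀ t : ℝ, 0 < t → ∀ᵐ z : ℝ ∂m, ∃ p : ℝ, 0 ≤ p ∧ (z : EReal) = tailQuantile (cdf m) (t * p) := by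
    intro m _ t₀ hm t ht
    filter_upwards [ae_exists_tailQuantile m hm] with z ⟨s, hs, hz⟩
    refine ⟨s / t, by positivity, ?_⟩
    rw [coe_eq_tailQuantile_iff, mul_div_cancel₀ _ ht.ne']
    exact ⟨hs, hz⟩
  have lim : ∀ (B : Set (ℝ × ℝ)) (f g : ℝ × ℝ → ℝ) (_ : Measurable f) (_ : Measurable g)
      (_ : IsProbabilityMeasure (μ.map f)) (_ : IsProbabilityMeasure (μ.map g)) (t₁ t₂ : ℝ)
      (_ : RegularTailQ (μ.map f) t₁) (_ : RegularTailQ (μ.map g) t₂)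
      (_ : ∀ t z, z ∈ tailImage (margins μ) t B ↔
        (∃ p, 0 ≤ p ∧ (f z : EReal) = tailQuantile (cdf (μ.map f)) (t * p)) ∧
          ∃ p, y ≤ p ∧ (g z : EReal) = tailQuantile (cdf (μ.map g)) (t * p))
      (_ : Tendsto (fun t : ℝ => ENNReal.ofReal t * μ (tailImage (margins μ) t B)) atTop
        (𝓝 (ν B))), ν B = ENNReal.ofReal (1 / y) := by
    intro B f g hf hg _ _ t₁ t₂ h₁ h₂ hB ht
    refine tendsto_nhds_unique ht (tendsto_const_nhds.congr' ?_)
    filter_upwards [eventually_gt_atTop (t₂ / y), eventually_gt_atTop 0] with t h2 h3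
    rw [div_lt_iff₀ hy] at h2
    have h1 : tailImage (margins μ) t B =ᵐ[μ] g ⁻¹' Ici (tailQ (cdf (μ.map g)) (t * y)) := by
      filter_upwards [ae_of_ae_map hf.aemeasurable (key2 _ inferInstance _ h₁ t h3),
        ae_of_ae_map hg.aemeasurable h₂.cdf_lt_one] with z hz1 hz2
      exact propext ((hB t z).trans
        ((and_iff_right hz1).trans (key _ inferInstance _ h₂ t h2 (g z) hz2)))
    rw [measure_congr h1, ← Measure.map_apply hg measurableSet_Ici]
    have h4 := h₂.measure_Ici _ h2
    rw [measureReal_def] at h4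
    rw [← ENNReal.ofReal_toReal (measure_ne_top _ _), h4, ← ENNReal.ofReal_mul h3.le]
    congr 1; field_simp
  exact ⟨lim _ Prod.fst Prod.snd measurable_fst measurable_snd ‹_› ‹_› _ _ h₁ h₂
      (fun t z => ⟨fun ⟨p, hp, e, e'⟩ => ⟨⟨p.1, hp.1, e⟩, p.2, hp.2, e'⟩,
        fun ⟨⟨p, hp, e⟩, p', hp', e'⟩ => ⟨(p, p'), ⟨hp, hp'⟩, e, e'⟩⟩)
      (hν.tendsto_rect h le_rfl hy.le (lt_max_of_lt_right hy)),
    lim _ Prod.snd Prod.fst measurable_snd measurable_fst ‹_› ‹_› _ _ h₂ h₁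
      (fun t z => ⟨fun ⟨p, hp, e, e'⟩ => ⟨⟨p.2, hp.2, e'⟩, p.1, hp.1, e⟩,
        fun ⟨⟨p, hp, e⟩, p', hp', e'⟩ => ⟨(p', p), ⟨hp', hp⟩, e', e⟩⟩)
      (hν.tendsto_rect h hy.le le_rfl (lt_max_of_lt_left hy))⟩

end Exponent

theorem Measure.ext_of_Ici_prod (m₁ m₂ : Measure (ℝ × ℝ)) [IsFiniteMeasure m₁] [IsFiniteMeasure m₂]
    (h : ∀ x y : ℝ, m₁ (Ici x ×ˢ Ici y) = m₂ (Ici x ×ˢ Ici y)) : m₁ = m₂ := by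
  have step : ∀ y : ℝ, ∀ s : Set ℝ, MeasurableSet s → m₁ (s ×ˢ Ici y) = m₂ (s ×ˢ Ici y) := by
    intro y s hs
    have happ : ∀ m : Measure (ℝ × ℝ), ∀ s : Set ℝ, MeasurableSet s →
        ((m.restrict (univ ×ˢ Ici y)).map Prod.fst) s = m (s ×ˢ Ici y) := by
      intro m s hs
      rw [Measure.map_apply measurable_fst hs, Measure.restrict_apply (measurable_fst hs)]
      congr 1; ext z; simp
    have : (m₁.restrict (univ ×ˢ Ici y)).map Prod.fst = (m₂.restrict (univ ×ˢ Ici y)).map Prod.fst := by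
      refine Measure.ext_of_Ici _ _ fun x => ?_
      rw [happ _ _ measurableSet_Ici, happ _ _ measurableSet_Ici, h]
    rw [← happ m₁ s hs, this, happ m₂ s hs]
  refine Measure.ext_prod fun {s t} hs ht => ?_
  have happ : ∀ m : Measure (ℝ × ℝ), ∀ t : Set ℝ, MeasurableSet t →
      ((m.restrict (s ×ˢ univ)).map Prod.snd) t = m (s ×ˢ t) := by
    intro m t ht
    rw [Measure.map_apply measurable_snd ht, Measure.restrict_apply (measurable_snd ht)]
    congr 1; ext z; simp [and_comm]
  have : (m₁.restrict (s ×ˢ univ)).map Prod.snd = (m₂.restrict (s ×ˢ univ)).map Prod.snd := by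
    refine Measure.ext_of_Ici _ _ fun x => ?_
    rw [happ _ _ measurableSet_Ici, happ _ _ measurableSet_Ici, step _ _ hs]
  rw [← happ m₁ t ht, this, happ m₂ t ht]

theorem lintegral_comp_smul_plane {f : ℝ × ℝ → ℝ≥0∞} (hf : Measurable f) {s : ℝ} (hs : 0 < s) :
    ∫⁻ z, f z = ENNReal.ofReal (s ^ 2) * ∫⁻ z, f (s • z) := by
  have h1 := Measure.map_addHaar_smul (volume : Measure (ℝ × ℝ)) hs.ne'
  have h2 : Measurable (fun z : ℝ × ℝ => s • z) := measurable_const_smul s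
  rw [← lintegral_map hf h2, h1, lintegral_smul_measure, smul_eq_mul, ← mul_assoc]
  have h3 : Module.finrank ℝ (ℝ × ℝ) = 2 := by simp
  rw [h3, abs_of_pos (by positivity), ← ENNReal.ofReal_mul (by positivity),
    mul_inv_cancel₀ (by positivity), ENNReal.ofReal_one, one_mul]

theorem subset_closure_interior_quadrant :
    quadrant ⊆ closure (interior quadrant) := by
  have h1 : (Ioi 0 ×ˢ Ioi 0 : Set (ℝ × ℝ)) ⊆ interior quadrant := by
    refine interior_maximal ?_ (isOpen_Ioi.prod isOpen_Ioi)
    exact fun z hz => mem_quadrant_of_pos hz.1 (mem_Ioi.1 hz.2).le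
  refine fun z hz => closure_mono h1 ?_
  rw [closure_prod_eq, closure_Ioi (0 : ℝ)]
  exact hz.1

section Homogeneity

variable {μ ν : Measure (ℝ × ℝ)} {η : ℝ × ℝ → ℝ}

theorem IsExponentMeasure.density_smul [IsProbabilityMeasure μ] (hν : IsExponentMeasure μ ν)
    (h : HasPosContDensity ν η) {t₁ t₂ : ℝ} (h₁ : RegularTailQ (μ.map Prod.fst) t₁)
    (h₂ : RegularTailQ (μ.map Prod.snd) t₂) {s : ℝ} (hs : 0 < s) {z : ℝ × ℝ}
    (hz : z ∈ quadrant) : s ^ 3 * η (s • z) = η z := by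
  set f := quadDens η
  have hf : Measurable f := h.measurable_quadDens
  set g : ℝ × ℝ → ℝ≥0∞ := fun z => ENNReal.ofReal (s ^ 3) * f (s • z) with hg
  have hgm : Measurable g := (hf.comp (measurable_const_smul s)).const_mul _
  have hνapp : ∀ A, MeasurableSet A → ν A = ∫⁻ z in A, f z := fun A hA => by
    rw [h.eq_withDensity, withDensity_apply _ hA]
  have hgapp : ∀ x y : ℝ, 0 < x → 0 < y →
      ∫⁻ z in Ici x ×ˢ Ici y, g z = ∫⁻ z in Ici x ×ˢ Ici y, f z := by
    intro x y hx hy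
    have hm : ∀ x y : ℝ, MeasurableSet (Ici x ×ˢ Ici y) := fun x y =>
      measurableSet_Ici.prod measurableSet_Ici
    have hcomp : Measurable fun z => (Ici (s * x) ×ˢ Ici (s * y)).indicator f (s • z) :=
      (hf.indicator (hm _ _)).comp (measurable_const_smul s)
    rw [← hνapp _ (hm x y), ← hν.measure_rect h hx.le hy.le (lt_max_of_lt_left hx) hs,
      hνapp _ (hm _ _), ← lintegral_indicator (hm _ _), ← lintegral_indicator (hm _ _),
      lintegral_comp_smul_plane (hf.indicator (hm _ _)) hs,
      ← lintegral_const_mul _ hcomp, ← lintegral_const_mul _ (hcomp.const_mul _)]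
    refine lintegral_congr fun z => ?_
    · have : s • z ∈ Ici (s * x) ×ˢ Ici (s * y) ↔ z ∈ Ici x ×ˢ Ici y := by
        rw [mem_prod, mem_prod, mem_Ici, mem_Ici, mem_Ici, mem_Ici, Prod.smul_fst, Prod.smul_snd,
          smul_eq_mul, smul_eq_mul, mul_le_mul_iff_right₀ hs, mul_le_mul_iff_right₀ hs]
      by_cases hz : z ∈ Ici x ×ˢ Ici y
      · rw [indicator_of_mem hz, indicator_of_mem (this.2 hz)]
        change ENNReal.ofReal (s ^ 3) * f (s • z) = _
        rw [← mul_assoc, ← ENNReal.ofReal_mul hs.le, ← pow_succ']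
      · rw [indicator_of_notMem hz, indicator_of_notMem (fun h => hz (this.1 h)), mul_zero, mul_zero]
  have hae : f =ᵐ[volume.restrict (Ioi 0 ×ˢ Ioi 0)] g := by
    have hcov : (Ioi 0 ×ˢ Ioi 0 : Set (ℝ × ℝ)) ⊆ ⋃ n : ℕ, Ici (1 / ((n : ℝ) + 1)) ×ˢ Ici (1 / ((n : ℝ) + 1)) := by
      rintro z ⟨h1, h2⟩
      obtain ⟨n, hn⟩ := exists_nat_one_div_lt (lt_min (mem_Ioi.1 h1) (mem_Ioi.1 h2))
      exact mem_iUnion.2 ⟨n, (hn.trans_le (min_le_left _ _)).le, (hn.trans_le (min_le_right _ _)).le⟩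
    refine ae_restrict_of_ae_restrict_of_subset hcov ?_
    rw [ae_restrict_iUnion_iff]
    intro n
    set δ : ℝ := 1 / ((n : ℝ) + 1)
    have hδ : 0 < δ := by positivity
    change f =ᵐ[volume.restrict (Ici δ ×ˢ Ici δ)] g
    rw [← withDensity_eq_iff_of_sigmaFinite hf.aemeasurable hgm.aemeasurable]
    have hfin : ν (Ici δ ×ˢ Ici δ) ≠ ⊤ := by
      refine ne_top_of_le_ne_top ?_ (measure_mono (prod_mono (Ici_subset_Ici.2 hδ.le) subset_rfl))
      rw [(hν.measure_upper h h₁ h₂ hδ).1]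
      exact ENNReal.ofReal_ne_top
    have hmδ : MeasurableSet (Ici δ ×ˢ Ici δ) := measurableSet_Ici.prod measurableSet_Ici
    have hfin1 : IsFiniteMeasure ((volume.restrict (Ici δ ×ˢ Ici δ)).withDensity f) := by
      refine isFiniteMeasure_withDensity ?_
      rwa [← hνapp _ hmδ]
    have hfin2 : IsFiniteMeasure ((volume.restrict (Ici δ ×ˢ Ici δ)).withDensity g) := by
      refine isFiniteMeasure_withDensity ?_
      rwa [hgapp _ _ hδ hδ, ← hνapp _ hmδ]
    refine Measure.ext_of_Ici_prod _ _ fun x y => ?_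
    have hm : MeasurableSet (Ici x ×ˢ Ici y) := measurableSet_Ici.prod measurableSet_Ici
    rw [withDensity_apply _ hm, withDensity_apply _ hm, Measure.restrict_restrict hm]
    have : Ici x ×ˢ Ici y ∩ Ici δ ×ˢ Ici δ = Ici (max x δ) ×ˢ Ici (max y δ) := by
      rw [prod_inter_prod, Ici_inter_Ici, Ici_inter_Ici]
    rw [this, hgapp _ _ (lt_max_of_lt_right hδ) (lt_max_of_lt_right hδ)]
  have hscale : ∀ z ∈ quadrant, s • z ∈ quadrant := by
    rintro z ⟨⟨h1, h2⟩, h3⟩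
    refine ⟨⟨mul_nonneg hs.le h1, mul_nonneg hs.le h2⟩, ?_⟩
    simp only [mem_singleton_iff, smul_eq_zero, not_or] at h3 ⊢
    exact ⟨hs.ne', h3⟩
  have heq : EqOn η (fun z => s ^ 3 * η (s • z)) quadrant := by
    refine Measure.eqOn_of_ae_eq (μ := volume) ?_ h.cont ?_ subset_closure_interior_quadrant
    · have hsub : quadrant =ᵐ[volume] (Ioi 0 ×ˢ Ioi 0 : Set (ℝ × ℝ)) := by
        have h0 : ∀ᵐ z : ℝ × ℝ, z.1 ≠ 0 ∧ z.2 ≠ 0 := by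
          have e1 : ∀ᵐ z : ℝ × ℝ, z.1 ≠ 0 := by rw [ae_iff]; simpa using volume_fst_eq 0
          have e2 : ∀ᵐ z : ℝ × ℝ, z.2 ≠ 0 := by rw [ae_iff]; simpa using volume_snd_eq 0
          filter_upwards [e1, e2] with z h1 h2 using ⟨h1, h2⟩
        filter_upwards [h0] with z ⟨h1, h2⟩
        exact propext ⟨fun hz => ⟨lt_of_le_of_ne hz.1.1 h1.symm, lt_of_le_of_ne hz.1.2 h2.symm⟩,
          fun hz => mem_quadrant_of_pos hz.1 (mem_Ioi.1 hz.2).le⟩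
      rw [Measure.restrict_congr_set hsub]
      have hmO : MeasurableSet (Ioi 0 ×ˢ Ioi 0 : Set (ℝ × ℝ)) := measurableSet_Ioi.prod measurableSet_Ioi
      filter_upwards [hae, ae_restrict_mem hmO] with z h1 h2
      have hz : z ∈ quadrant := mem_quadrant_of_pos h2.1 (mem_Ioi.1 h2.2).le
      have hz' := hscale z hz
      simp only [hg, f, quadDens, indicator_of_mem hz, indicator_of_mem hz'] at h1
      rw [← ENNReal.ofReal_mul (by positivity), ENNReal.ofReal_eq_ofReal_iff (h.pos z hz).le
        (mul_nonneg (by positivity) (h.pos _ hz').le)] at h1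
      exact h1
    · exact continuousOn_const.mul (h.cont.comp (continuous_const_smul s).continuousOn hscale)
  exact (heq hz).symm

end Homogeneity

/-- The properties of an exponent measure with a continuous density that are used below. -/
structure ExponentDensity (ν : Measure (ℝ × ℝ)) (η : ℝ × ℝ → ℝ) : Prop
    extends HasPosContDensity ν η where
  density_smul : ∀ s : ℝ, 0 < s → ∀ z ∈ quadrant,
    s ^ 3 * η (s • z) = η z
  measure_upper : ∀ y : ℝ, 0 < y →
    ν (Ici 0 ×ˢ Ici y) = ENNReal.ofReal (1 / y) ∧ ν (Ici y ×ˢ Ici 0) = ENNReal.ofReal (1 / y)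

theorem swap_mem_quadrant {z : ℝ × ℝ} :
    z.swap ∈ quadrant ↔ z ∈ quadrant := by
  rcases z with ⟨x, y⟩
  simp only [Prod.swap_prod_mk, Set.mem_sdiff, mem_prod, mem_singleton_iff, Prod.ext_iff, Prod.fst_zero,
    Prod.snd_zero]
  tauto

section ExponentDensity

variable {ν : Measure (ℝ × ℝ)} {η : ℝ × ℝ → ℝ}

theorem ExponentDensity.swap (h : ExponentDensity ν η) :
    ExponentDensity (ν.map Prod.swap) (η ∘ Prod.swap) where
  density := by
    have hm : MeasurableSet (Ici 0 ×ˢ Ici 0 : Set (ℝ × ℝ)) := measurableSet_Ici.prod measurableSet_Ici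
    refine Measure.ext fun A hA => ?_
    have hswap : MeasurePreserving (Prod.swap : ℝ × ℝ → ℝ × ℝ) volume volume :=
      Measure.measurePreserving_swap
    rw [Measure.map_apply measurable_swap hA, h.density, withDensity_apply _ (measurable_swap hA),
      withDensity_apply _ hA, Measure.restrict_restrict (measurable_swap hA),
      Measure.restrict_restrict hA]
    have hpre : Prod.swap ⁻¹' A ∩ Ici 0 ×ˢ Ici 0 = Prod.swap ⁻¹' (A ∩ Ici (0 : ℝ) ×ˢ Ici (0 : ℝ)) := by
      ext z
      simp only [mem_inter_iff, mem_preimage, mem_prod, Prod.fst_swap, Prod.snd_swap]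
      tauto
    rw [hpre, ← hswap.setLIntegral_comp_preimage_emb MeasurableEquiv.prodComm.measurableEmbedding
      (fun z => ENNReal.ofReal ((η ∘ Prod.swap) z))]
    simp only [Function.comp, Prod.swap_swap]
  cont := by
    refine h.cont.comp continuous_swap.continuousOn fun z hz => ?_
    exact swap_mem_quadrant.2 hz
  pos := fun z hz => h.pos _ (swap_mem_quadrant.2 hz)
  density_smul := fun s hs z hz => h.density_smul s hs _ (swap_mem_quadrant.2 hz)
  measure_upper := by
    intro y hy
    have hpre : ∀ s t : Set ℝ, Prod.swap ⁻¹' (s ×ˢ t) = t ×ˢ s := preimage_swap_prod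
    have hm : ∀ x y : ℝ, MeasurableSet (Ici x ×ˢ Ici y) := fun x y =>
      measurableSet_Ici.prod measurableSet_Ici
    rw [Measure.map_apply measurable_swap (hm _ _), Measure.map_apply measurable_swap (hm _ _),
      hpre, hpre]
    exact (h.measure_upper y hy).symm

theorem ExponentDensity.exists_bound (h : ExponentDensity ν η) :
    ∃ C : ℝ, 0 < C ∧ ∀ z ∈ quadrant, η z ≤ C / max z.1 z.2 ^ 3 := by
  set S : Set (ℝ × ℝ) := (Icc 0 1 ×ˢ Icc 0 1) ∩ {z | max z.1 z.2 = 1} with hS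
  have hSc : IsCompact S := (isCompact_Icc.prod isCompact_Icc).inter_right
    (isClosed_eq (by fun_prop) continuous_const)
  have hSQ : S ⊆ quadrant := by
    rintro z ⟨⟨h1, h2⟩, h3⟩
    refine ⟨⟨h1.1, h2.1⟩, ?_⟩
    rintro rfl
    simp at h3
  obtain ⟨C, hC⟩ := hSc.bddAbove_image (h.cont.mono hSQ)
  refine ⟨max C 1, by positivity, fun z hz => ?_⟩
  have hM : 0 < max z.1 z.2 := by
    by_contra! hle
    rw [max_le_iff] at hle
    refine hz.2 (Prod.ext (le_antisymm hle.1 hz.1.1) (le_antisymm hle.2 hz.1.2))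
  set M := max z.1 z.2 with hMdef
  have h1 := h.density_smul M⁻¹ (inv_pos.2 hM) z hz
  have hmem : M⁻¹ • z ∈ S := by
    have e1 : z.1 ≤ M := le_max_left _ _
    have e2 : z.2 ≤ M := le_max_right _ _
    have p1 : 0 ≤ z.1 := hz.1.1
    have p2 : 0 ≤ z.2 := hz.1.2
    refine ⟨⟨⟨?_, ?_⟩, ⟨?_, ?_⟩⟩, ?_⟩
    · simp only [Prod.smul_fst, smul_eq_mul]; positivity
    · simp only [Prod.smul_fst, smul_eq_mul]
      rw [inv_mul_le_iff₀ hM]; linarith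
    · simp only [Prod.smul_snd, smul_eq_mul]; positivity
    · simp only [Prod.smul_snd, smul_eq_mul]
      rw [inv_mul_le_iff₀ hM]; linarith
    · simp only [mem_ofPred_eq, Prod.smul_fst, Prod.smul_snd, smul_eq_mul]
      rw [← mul_max_of_nonneg _ _ (inv_pos.2 hM).le, ← hMdef, inv_mul_cancel₀ hM.ne']
  have h2 : η (M⁻¹ • z) ≤ C := hC (mem_image_of_mem _ hmem)
  rw [← h1, inv_pow, inv_mul_eq_div]
  gcongr
  exact h2.trans (le_max_left _ _)

theorem ExponentDensity.measure_smul (h : ExponentDensity ν η) {r : ℝ} (hr : 0 < r)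
    {A : Set (ℝ × ℝ)} (hA : MeasurableSet A) :
    ν {z | (r⁻¹ * z.1, r⁻¹ * z.2) ∈ A} = ENNReal.ofReal r⁻¹ * ν A := by
  have hf := h.measurable_quadDens
  set f := quadDens η with hfdef
  have hpre : {z : ℝ × ℝ | (r⁻¹ * z.1, r⁻¹ * z.2) ∈ A} = (fun z : ℝ × ℝ => r⁻¹ • z) ⁻¹' A := rfl
  have hA' : MeasurableSet ((fun z : ℝ × ℝ => r⁻¹ • z) ⁻¹' A) := measurable_const_smul _ hA
  have hcomp : Measurable fun z => ((fun z : ℝ × ℝ => r⁻¹ • z) ⁻¹' A).indicator f (r • z) :=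
    (hf.indicator hA').comp (measurable_const_smul r)
  rw [hpre, h.eq_withDensity, withDensity_apply _ hA', withDensity_apply _ hA,
    ← lintegral_indicator hA', ← lintegral_indicator hA,
    lintegral_comp_smul_plane (hf.indicator hA') hr,
    ← lintegral_const_mul _ hcomp, ← lintegral_const_mul _ (hf.indicator hA)]
  refine lintegral_congr fun z => ?_
  have hz0 : r⁻¹ • r • z = z := by rw [smul_smul, inv_mul_cancel₀ hr.ne', one_smul]
  have hiff : r • z ∈ (fun z : ℝ × ℝ => r⁻¹ • z) ⁻¹' A ↔ z ∈ A := by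
    rw [mem_preimage, hz0]
  by_cases hz : z ∈ A
  · rw [indicator_of_mem hz, indicator_of_mem (hiff.2 hz)]
    have hQ : r • z ∈ quadrant ↔
        z ∈ quadrant := by
      simp only [Set.mem_sdiff, mem_prod, mem_Ici, Prod.smul_fst, Prod.smul_snd, smul_eq_mul,
        mem_singleton_iff, smul_eq_zero, hr.ne', false_or, mul_nonneg_iff_of_pos_left hr]
    by_cases hzQ : z ∈ quadrant
    · simp only [hfdef, quadDens, indicator_of_mem hzQ, indicator_of_mem (hQ.2 hzQ)]
      rw [← ENNReal.ofReal_mul (by positivity), ← ENNReal.ofReal_mul (by positivity),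
        ← h.density_smul r hr z hzQ]
      congr 1
      field_simp
    · simp only [hfdef, quadDens, indicator_of_notMem hzQ, indicator_of_notMem (fun h => hzQ (hQ.1 h)),
        mul_zero]
  · rw [indicator_of_notMem hz, indicator_of_notMem (fun h => hz (hiff.1 h)), mul_zero, mul_zero]

theorem ExponentDensity.strip_le (h : ExponentDensity ν η) :
    ∃ C : ℝ, 0 < C ∧ ∀ a b : ℝ, 0 < a → 0 < b →
      ν (Ico 0 a ×ˢ Ici b) ≤ ENNReal.ofReal (C * (a / b ^ 2)) := by
  obtain ⟨C, hC, hb⟩ := h.exists_bound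
  refine ⟨C, hC, fun a b ha hb0 => ?_⟩
  have hm : MeasurableSet (Ico (0 : ℝ) a ×ˢ Ici b) := measurableSet_Ico.prod measurableSet_Ici
  rw [h.eq_withDensity, withDensity_apply _ hm]
  have h1 : ∫⁻ z in Ico (0 : ℝ) a ×ˢ Ici b, quadDens η z ≤
      ∫⁻ z in Ico (0 : ℝ) a ×ˢ Ici b, ENNReal.ofReal C * ENNReal.ofReal (z.2 ^ (-3 : ℝ)) := by
    refine setLIntegral_mono (by fun_prop) fun z hz => ?_
    have hz1 : 0 ≤ z.1 := hz.1.1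
    have hz2 : 0 < z.2 := hb0.trans_le hz.2
    have hzQ : z ∈ quadrant := by
      refine ⟨⟨hz1, hz2.le⟩, ?_⟩
      rintro rfl
      simp at hz2
    rw [quadDens, indicator_of_mem hzQ, ← ENNReal.ofReal_mul hC.le]
    refine ENNReal.ofReal_le_ofReal ((hb z hzQ).trans ?_)
    rw [Real.rpow_neg hz2.le, ← div_eq_mul_inv]
    norm_cast
    gcongr
    exact le_max_right _ _
  refine h1.trans ?_
  rw [Measure.volume_eq_prod, ← Measure.prod_restrict,
    lintegral_prod_mul (f := fun _ => ENNReal.ofReal C) (g := fun y => ENNReal.ofReal (y ^ (-3 : ℝ)))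
      (by fun_prop) (by fun_prop)]
  have h2 : ∫⁻ y in Ici b, ENNReal.ofReal (y ^ (-3 : ℝ)) = ENNReal.ofReal (b ^ (-2 : ℝ) / 2) := by
    rw [setLIntegral_congr Ioi_ae_eq_Ici.symm, ← ofReal_integral_eq_lintegral_ofReal
      (integrableOn_Ioi_rpow_of_lt (by norm_num) hb0)]
    · rw [integral_Ioi_rpow_of_lt (by norm_num) hb0]
      norm_num
    · filter_upwards [ae_restrict_mem measurableSet_Ioi] with y hy
      have : 0 < y := hb0.trans hy
      positivity
  rw [h2]
  simp only [lintegral_const, MeasurableSet.univ, Measure.restrict_apply, univ_inter, Real.volume_Ico,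
    sub_zero]
  rw [← ENNReal.ofReal_mul hC.le, ← ENNReal.ofReal_mul (by positivity)]
  refine ENNReal.ofReal_le_ofReal ?_
  rw [Real.rpow_neg hb0.le]
  norm_cast
  have : 0 ≤ C * (a / b ^ 2) := by positivity
  have e : C * a * ((b ^ 2)⁻¹ / 2) = C * (a / b ^ 2) / 2 := by field_simp
  rw [e]; linarith

theorem ExponentDensity.measure_away_lt_top (h : ExponentDensity ν η) {δ : ℝ} (hδ : 0 < δ)
    {A : Set (ℝ × ℝ)} (hA : ∀ z ∈ A, 0 ≤ z.1 → 0 ≤ z.2 → δ ≤ max z.1 z.2) : ν A < ⊤ := by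
  have hsub : A ⊆ (Ici 0 ×ˢ Ici δ) ∪ (Ici δ ×ˢ Ici 0) ∪ (Ici 0 ×ˢ Ici 0)ᶜ := by
    intro z hz
    by_cases hQ : z ∈ (Ici 0 ×ˢ Ici 0 : Set (ℝ × ℝ))
    · left
      rcases le_max_iff.1 (hA z hz hQ.1 hQ.2) with h1 | h1
      · right; exact ⟨h1, hQ.2⟩
      · left; exact ⟨hQ.1, h1⟩
    · right; exact hQ
  refine (measure_mono hsub).trans_lt ?_
  refine (measure_union_le _ _).trans_lt (ENNReal.add_lt_top.2 ⟨?_, ?_⟩)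
  · refine (measure_union_le _ _).trans_lt (ENNReal.add_lt_top.2 ⟨?_, ?_⟩)
    · rw [(h.measure_upper δ hδ).1]; exact ENNReal.ofReal_lt_top
    · rw [(h.measure_upper δ hδ).2]; exact ENNReal.ofReal_lt_top
  · rw [h.compl_quadrant]; simp

end ExponentDensity

theorem IsExponentMeasure.exponentDensity {μ ν : Measure (ℝ × ℝ)} {η : ℝ × ℝ → ℝ}
    [IsProbabilityMeasure μ] (hν : IsExponentMeasure μ ν) (h : HasPosContDensity ν η) {t₁ t₂ : ℝ}
    (h₁ : RegularTailQ (μ.map Prod.fst) t₁) (h₂ : RegularTailQ (μ.map Prod.snd) t₂) :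
    ExponentDensity ν η where
  toHasPosContDensity := h
  density_smul := fun _ hs _ hz => hν.density_smul h h₁ h₂ hs hz
  measure_upper := fun _ hy => hν.measure_upper h h₁ h₂ hy

/-- A boundary function `q` of a failure set together with its generalized inverse `p`; the left end
points of the sets where they are finite are `x₀` and `y₀`. -/
structure BoundaryPair (q p : ℝ → ℝ≥0∞) (γ₁ γ₂ x₀ y₀ : ℝ) : Prop where
  galois : ∀ x y : ℝ, 0 ≤ x → 0 ≤ y → (q x ≤ ENNReal.ofReal y ↔ p y ≤ ENNReal.ofReal x)
  anti_left : AntitoneOn q (Ici 0)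
  anti_right : AntitoneOn p (Ici 0)
  pos_left : 0 < q 0
  pos_right : 0 < p 0
  nonneg_left : 0 ≤ x₀
  nonneg_right : 0 ≤ y₀
  top_left : ∀ x, 0 ≤ x → x < x₀ → q x = ⊤
  top_right : ∀ y, 0 ≤ y → y < y₀ → p y = ⊤
  fin_left : ∀ x, x₀ < x → q x < ⊤
  fin_right : ∀ y, y₀ < y → p y < ⊤
  growth_left : ∃ K δ : ℝ, 0 < K ∧ 0 < δ ∧ ∀ x, x₀ < x → x < x₀ + δ →
    x ^ ((1 - γ₁) / 2) * |Real.log x| ≤ K * (q x).toReal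
  growth_right : ∃ K δ : ℝ, 0 < K ∧ 0 < δ ∧ ∀ y, y₀ < y → y < y₀ + δ →
    y ^ ((1 - γ₂) / 2) * |Real.log y| ≤ K * (p y).toReal

theorem BoundaryPair.swap {q p : ℝ → ℝ≥0∞} {γ₁ γ₂ x₀ y₀ : ℝ} (h : BoundaryPair q p γ₁ γ₂ x₀ y₀) :
    BoundaryPair p q γ₂ γ₁ y₀ x₀ where
  galois := fun x y hx hy => (h.galois y x hy hx).symm
  anti_left := h.anti_right
  anti_right := h.anti_left
  pos_left := h.pos_right
  pos_right := h.pos_left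
  nonneg_left := h.nonneg_right
  nonneg_right := h.nonneg_left
  top_left := h.top_right
  top_right := h.top_left
  fin_left := h.fin_right
  fin_right := h.fin_left
  growth_left := h.growth_right
  growth_right := h.growth_left

theorem exists_growth_toReal {f : ℝ → ℝ≥0∞} {x₀ β : ℝ}
    (hfin : ∀ x, x₀ < x → f x < ⊤)
    (h : ∃ K : ℝ≥0, ∀ᶠ x in 𝓝[>] x₀, ENNReal.ofReal (x ^ β * |Real.log x|) ≤ K * f x) :
    ∃ K δ : ℝ, 0 < K ∧ 0 < δ ∧ ∀ x, x₀ < x → x < x₀ + δ →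
      x ^ β * |Real.log x| ≤ K * (f x).toReal := by
  obtain ⟨K, hK⟩ := h
  obtain ⟨y, hy, hsub⟩ := mem_nhdsGT_iff_exists_Ioo_subset.1 hK
  refine ⟨K + 1, y - x₀, by positivity, sub_pos.2 hy, fun x hx hx' => ?_⟩
  have h1 : ENNReal.ofReal (x ^ β * |Real.log x|) ≤ K * f x := hsub ⟨hx, by linarith⟩
  have hne : (K : ℝ≥0∞) * f x ≠ ⊤ := ENNReal.mul_ne_top ENNReal.coe_ne_top (hfin x hx).ne
  have h2 := (ENNReal.ofReal_le_iff_le_toReal hne).1 h1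
  rw [ENNReal.toReal_mul, ENNReal.coe_toReal] at h2
  have : 0 ≤ (f x).toReal := ENNReal.toReal_nonneg
  linarith

theorem BoundaryFun.galois {q : ℝ → ℝ≥0∞} (h : BoundaryFun q) {x y : ℝ} (hx : 0 ≤ x) :
    q x ≤ ENNReal.ofReal y ↔ qInv q y ≤ ENNReal.ofReal x := by
  constructor
  · intro hq
    refine ENNReal.le_of_forall_pos_le_add fun ε hε _ => ?_
    have hε' : (0 : ℝ) < ε := hε
    have hmem : x + ε ∈ {x : ℝ | 0 < x ∧ q x ≤ ENNReal.ofReal y} :=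
      ⟨by linarith, (h.anti hx (mem_Ici.2 (by linarith)) (by linarith)).trans hq⟩
    refine (sInf_le (mem_image_of_mem _ hmem)).trans ?_
    rw [ENNReal.ofReal_add hx hε'.le, ENNReal.ofReal_coe_nnreal]
  · intro hle
    have hlt : ∀ x' ∈ Ioi x, q x' ≤ ENNReal.ofReal y := by
      intro x' hx'
      have h1 : qInv q y < ENNReal.ofReal x' :=
        hle.trans_lt ((ENNReal.ofReal_lt_ofReal_iff (hx.trans_lt hx')).2 hx')
      obtain ⟨_, ⟨w, ⟨hw, hqw⟩, rfl⟩, hw'⟩ := sInf_lt_iff.1 h1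
      have h2 : w < x' := (ENNReal.ofReal_lt_ofReal_iff (hx.trans_lt hx')).1 hw'
      exact (h.anti hw.le (mem_Ici.2 (hw.trans h2).le) h2.le).trans hqw
    exact le_of_tendsto (h.right_cont x hx) (by filter_upwards [self_mem_nhdsWithin] using hlt)

theorem BoundaryFun.boundaryPair {q : ℝ → ℝ≥0∞} {γ : Fin 2 → ℝ} (h : BoundaryFun q)
    (hg : BoundaryGrowth q γ) (hne : ∃ x, 0 ≤ x ∧ q x < ⊤) :
    BoundaryPair q (qInv q) (γ 0) (γ 1) (xl q) (qInf q).toReal := by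
  obtain ⟨w, hw0, hw⟩ := hne
  have hbdd : BddBelow {x : ℝ | 0 ≤ x ∧ q x < ⊤} := ⟨0, fun x hx => hx.1⟩
  have hinf : qInf q < ⊤ := (iInf₂_le w hw0).trans_lt hw
  have fin_left : ∀ x, xl q < x → q x < ⊤ := by
    intro x hx
    obtain ⟨w', ⟨hw0', hw'⟩, hlt⟩ := exists_lt_of_csInf_lt (s := {x : ℝ | 0 ≤ x ∧ q x < ⊤}) ⟨w, hw0, hw⟩ hx
    exact (h.anti hw0' (mem_Ici.2 (hw0'.trans hlt.le)) hlt.le).trans_lt hw'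
  have fin_right : ∀ y, (qInf q).toReal < y → qInv q y < ⊤ := by
    intro y hy
    have h1 : qInf q < ENNReal.ofReal y := (ENNReal.lt_ofReal_iff_toReal_lt hinf.ne).2 hy
    obtain ⟨x, hx⟩ := iInf_lt_iff.1 h1
    obtain ⟨hx0, hx⟩ := iInf_lt_iff.1 hx
    exact ((h.galois hx0).1 hx.le).trans_lt ENNReal.ofReal_lt_top
  have hx0 : 0 ≤ xl q := Real.sInf_nonneg fun x hx => hx.1
  refine ⟨fun x y hx _ => h.galois hx, h.anti, ?_, h.pos, ?_, hx0, ENNReal.toReal_nonneg,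
    ?_, ?_, fin_left, fin_right, exists_growth_toReal fin_left hg.left,
    exists_growth_toReal fin_right hg.right⟩
  · intro y _ y' _ hyy'
    refine sInf_le_sInf (image_mono ?_)
    rintro x ⟨hx1, hx2⟩
    exact ⟨hx1, hx2.trans (ENNReal.ofReal_le_ofReal hyy')⟩
  · by_contra! hle
    have := (h.galois (y := 0) le_rfl).2 (hle.trans zero_le)
    rw [ENNReal.ofReal_zero] at this
    exact absurd h.pos (not_lt.2 this)
  · intro x hx hlt
    by_contra hne
    exact absurd (csInf_le hbdd ⟨hx, lt_top_iff_ne_top.2 hne⟩) (not_le.2 hlt)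
  · intro y _ hlt
    have : {x : ℝ | 0 < x ∧ q x ≤ ENNReal.ofReal y} = ∅ := by
      refine eq_empty_of_forall_notMem fun x hx => ?_
      have h1 : qInf q ≤ ENNReal.ofReal y := (iInf₂_le x (mem_Ici.2 hx.1.le)).trans hx.2
      have h2 := ENNReal.toReal_mono ENNReal.ofReal_ne_top h1
      have hy : 0 ≤ y := by assumption
      rw [ENNReal.toReal_ofReal hy] at h2
      linarith
    rw [qInv, this, image_empty, sInf_empty]

section Pair

variable {q p : ℝ → ℝ≥0∞} {γ₁ γ₂ x₀ y₀ : ℝ}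

theorem BoundaryPair.le_left (h : BoundaryPair q p γ₁ γ₂ x₀ y₀) {x : ℝ} (hx : 0 ≤ x) (hq : q x < ⊤) :
    x₀ ≤ x := by
  by_contra! hlt
  exact absurd (h.top_left x hx hlt) hq.ne

theorem BoundaryPair.inv_apply_le (h : BoundaryPair q p γ₁ γ₂ x₀ y₀) {x : ℝ} (hx : 0 ≤ x)
    (hq : q x < ⊤) : p (q x).toReal ≤ ENNReal.ofReal x := by
  rw [← h.galois x _ hx ENNReal.toReal_nonneg, ENNReal.ofReal_toReal hq.ne]

theorem BoundaryPair.le_apply (h : BoundaryPair q p γ₁ γ₂ x₀ y₀) {x : ℝ} (hx : 0 ≤ x)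
    (hq : q x < ⊤) : y₀ ≤ (q x).toReal :=
  h.swap.le_left ENNReal.toReal_nonneg ((h.inv_apply_le hx hq).trans_lt ENNReal.ofReal_lt_top)

theorem BoundaryPair.exists_lower (h : BoundaryPair q p γ₁ γ₂ x₀ y₀) :
    ∃ c : ℝ, 0 < c ∧ c ≤ 1 ∧ ∀ x, 0 ≤ x → x < c → ENNReal.ofReal c < q x := by
  obtain ⟨y, hy0, hy⟩ := ENNReal.lt_iff_exists_real_btwn.1 h.pos_left
  have hypos : 0 < y := by
    by_contra! hle
    rw [ENNReal.ofReal_eq_zero.2 hle] at hy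
    exact lt_irrefl _ hy.1
  have hp : 0 < p y := by
    rw [pos_iff_ne_zero]
    intro h0
    have := (h.galois 0 y le_rfl hy0).2 (by rw [h0]; exact zero_le)
    exact absurd hy.2 (not_lt.2 this)
  obtain ⟨x, hx0, hx⟩ := ENNReal.lt_iff_exists_real_btwn.1 hp
  have hxpos : 0 < x := by
    by_contra! hle
    rw [ENNReal.ofReal_eq_zero.2 hle] at hx
    exact lt_irrefl _ hx.1
  refine ⟨min 1 (min x y), by positivity, min_le_left _ _, fun w hw hwc => ?_⟩
  by_contra! hle
  have h1 : q w ≤ ENNReal.ofReal y :=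
    hle.trans (ENNReal.ofReal_le_ofReal ((min_le_right _ _).trans (min_le_right _ _)))
  rw [h.galois w y hw hy0] at h1
  have h2 : w ≤ x := hwc.le.trans ((min_le_right _ _).trans (min_le_left _ _))
  exact absurd hx.2 (not_lt.2 (h1.trans (ENNReal.ofReal_le_ofReal h2)))

theorem BoundaryPair.max_ge (h : BoundaryPair q p γ₁ γ₂ x₀ y₀) :
    ∃ c : ℝ, 0 < c ∧ c ≤ 1 ∧ ∀ x y, 0 ≤ x → 0 ≤ y → q x ≤ ENNReal.ofReal y → c ≤ max x y := by
  obtain ⟨c, hc, hc1, hb⟩ := h.exists_lower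
  refine ⟨c, hc, hc1, fun x y hx hy hq => ?_⟩
  by_contra! hlt
  rw [max_lt_iff] at hlt
  exact absurd ((hb x hx hlt.1).trans_le hq) (not_lt.2 (ENNReal.ofReal_le_ofReal hlt.2.le))

/-- Upper bound for the contribution of a point `y` of the boundary to the first order term. -/
def growthFactor (γ s : ℝ) : ℝ := 1 + |Real.log s| + s ^ (-γ)

theorem growthFactor_pos {γ s : ℝ} (hs : 0 < s) : 0 < growthFactor γ s := by
  unfold growthFactor; positivity

theorem mul_growthFactor_le_of_one_le {γ s : ℝ} (hγ : -1 / 2 < γ) (hs : 1 ≤ s) :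
    s * growthFactor γ s ≤ 4 * s ^ (3 / 2 : ℝ) := by
  have hs0 : 0 < s := by linarith
  have h1 : Real.log s ≤ 2 * s ^ (1 / 2 : ℝ) := by
    have := Real.log_le_rpow_div hs0.le (ε := 1 / 2) (by norm_num)
    linarith
  have h2 : s ^ (-γ) ≤ s ^ (1 / 2 : ℝ) := Real.rpow_le_rpow_of_exponent_le hs (by linarith)
  have h3 : 1 ≤ s ^ (1 / 2 : ℝ) := Real.one_le_rpow hs (by norm_num)
  have h4 : s ^ (3 / 2 : ℝ) = s * s ^ (1 / 2 : ℝ) := by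
    rw [← Real.rpow_one_add' hs0.le (by norm_num)]; norm_num
  rw [h4, growthFactor, abs_of_nonneg (Real.log_nonneg hs)]
  nlinarith

theorem mul_growthFactor_le_of_lt_one {γ s : ℝ} (hs0 : 0 < s) (hs : s < 1) :
    s * growthFactor γ s ≤ 2 + s ^ (1 - γ) := by
  have h1 := Real.abs_log_mul_self_lt s hs0 hs.le
  rw [abs_mul, abs_of_pos hs0] at h1
  have h2 : s * s ^ (-γ) = s ^ (1 - γ) := by
    rw [sub_eq_add_neg, Real.rpow_add hs0, Real.rpow_one]
  rw [growthFactor, mul_add, mul_add, h2]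
  linarith

theorem integrableOn_inv_mul_log_sq : IntegrableOn (fun x : ℝ => x⁻¹ * (Real.log x)⁻¹ ^ 2) (Ioi 3) := by
  have hlog : ∀ x : ℝ, 3 ≤ x → 0 < Real.log x := fun x hx => Real.log_pos (by linarith)
  refine integrableOn_Ioi_deriv_of_nonneg' (g := fun x => -(Real.log x)⁻¹) (l := 0) ?_ ?_ ?_
  · intro x hx
    have hx' : (3 : ℝ) ≤ x := hx
    have h1 := (Real.hasDerivAt_log (show x ≠ 0 by linarith)).inv (hlog x hx').ne'
    exact h1.neg.congr_deriv (by rw [inv_pow, neg_div, neg_neg, div_eq_mul_inv])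
  · intro x hx
    have hx' : (3 : ℝ) ≤ x := (mem_Ioi.1 hx).le
    have := hlog x hx'
    have : 0 < x := by linarith
    positivity
  · simpa using (Real.tendsto_log_atTop.inv_tendsto_atTop).neg

theorem integrableOn_max_rpow {c : ℝ} (hc : 0 < c) :
    IntegrableOn (fun x : ℝ => (max x c) ^ (-(3 / 2) : ℝ)) (Ioi 0) := by
  rw [← Ioc_union_Ioi_eq_Ioi hc.le]
  refine IntegrableOn.union ?_ ?_
  · refine (ContinuousOn.integrableOn_Icc ?_).mono_set Ioc_subset_Icc_self
    refine ContinuousOn.rpow_const (by fun_prop) fun x _ => Or.inl ?_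
    exact (lt_max_of_lt_right hc).ne'
  · refine (integrableOn_Ioi_rpow_of_lt (by norm_num : (-(3 / 2) : ℝ) < -1) hc).congr_fun ?_
      measurableSet_Ioi
    intro x hx
    simp only [max_eq_left (le_of_lt (mem_Ioi.1 hx))]

theorem BoundaryPair.exists_domination (h : BoundaryPair q p γ₁ γ₂ x₀ y₀) (hγ : -1 / 2 < γ₂) :
    ∃ B : ℝ → ℝ, IntegrableOn B (Ioi 0) ∧ ∀ x x' : ℝ, 0 < x → 0 ≤ x' → x' ≤ 2 * x → x ≤ 2 * x' →
      q x' < ⊤ → 0 < q x' →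
      (q x').toReal * growthFactor γ₂ (q x').toReal / max x (q x').toReal ^ 3 ≤ B x := by
  obtain ⟨c₁, hc₁, hc₁', hc₁b⟩ := h.exists_lower
  obtain ⟨K, δ, hK, hδ, hKb⟩ := h.growth_right
  obtain ⟨C, hC, hCb⟩ : ∃ C : ℝ, 0 ≤ C ∧ ∀ x x' : ℝ, 0 < x → 0 ≤ x' → x' ≤ 2 * x →
      q x' < ⊤ → 0 < (q x').toReal → (q x').toReal < 1 →
      (q x').toReal ^ (1 - γ₂) ≤ C + x + (if 3 < x then C * (x ^ 2 * (Real.log x)⁻¹ ^ 2) else 0) := by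
    by_cases hγ1 : γ₂ ≤ 1
    · refine ⟨1, by norm_num, fun x x' hx hx' _ _ hQ hQ1 => ?_⟩
      have h1 : (q x').toReal ^ (1 - γ₂) ≤ 1 := Real.rpow_le_one hQ.le hQ1.le (by linarith)
      have h2 : 0 ≤ if 3 < x then 1 * (x ^ 2 * (Real.log x)⁻¹ ^ 2) else 0 := by
        split_ifs <;> positivity
      linarith
    · push Not at hγ1
      by_cases hy : 0 < y₀
      · refine ⟨y₀ ^ (1 - γ₂), by positivity, fun x x' hx hx' _ hq hQ _ => ?_⟩
        have h1 : (q x').toReal ^ (1 - γ₂) ≤ y₀ ^ (1 - γ₂) :=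
          Real.rpow_le_rpow_of_nonpos hy (h.le_apply hx' hq) (by linarith)
        have h2 : 0 ≤ if 3 < x then y₀ ^ (1 - γ₂) * (x ^ 2 * (Real.log x)⁻¹ ^ 2) else 0 := by
          split_ifs <;> positivity
        linarith
      · have hy0 : y₀ = 0 := le_antisymm (not_lt.1 hy) h.nonneg_right
        subst hy0
        set δ' := min δ (Real.exp (-1)) with hδ'
        have hδ'0 : 0 < δ' := lt_min hδ (Real.exp_pos _)
        set C := max (δ' ^ (1 - γ₂)) (max ((6 * K) ^ 2) ((2 * K * (γ₂ - 1)) ^ 2)) with hCdef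
        have hC1 : δ' ^ (1 - γ₂) ≤ C := le_max_left _ _
        have hC2 : (6 * K) ^ 2 ≤ C := (le_max_left _ _).trans (le_max_right _ _)
        have hC3 : (2 * K * (γ₂ - 1)) ^ 2 ≤ C := (le_max_right _ _).trans (le_max_right _ _)
        clear_value C
        have hC0 : 0 ≤ C := (sq_nonneg _).trans hC2
        refine ⟨C, hC0, fun x x' hx hx' hx2 hq hQ hQ1 => ?_⟩
        have hnn : 0 ≤ if 3 < x then C * (x ^ 2 * (Real.log x)⁻¹ ^ 2) else 0 := by
          split_ifs <;> positivity
        set Q := (q x').toReal with hQdef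
        clear_value Q
        rcases le_or_gt δ' Q with hQd | hQd
        · have h1 : Q ^ (1 - γ₂) ≤ δ' ^ (1 - γ₂) :=
            Real.rpow_le_rpow_of_nonpos hδ'0 hQd (by linarith)
          linarith
        · have hlog1 : 1 ≤ |Real.log Q| := by
            have h1 : Q < Real.exp (-1) := hQd.trans_le (min_le_right _ _)
            have h2 : Real.log Q < -1 := by rwa [Real.log_lt_iff_lt_exp hQ]
            rw [abs_of_neg (by linarith)]; linarith
          have hb := hKb Q hQ (by rw [zero_add]; exact hQd.trans_le (min_le_left _ _))
          have hp : (p Q).toReal ≤ 2 * x := by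
            have h1 := h.inv_apply_le hx' hq
            rw [← hQdef] at h1
            have h2 := ENNReal.toReal_mono ENNReal.ofReal_ne_top h1
            rw [ENNReal.toReal_ofReal hx'] at h2
            linarith
          have hpow : (Q ^ ((1 - γ₂) / 2)) ^ 2 = Q ^ (1 - γ₂) := by
            rw [← Real.rpow_natCast, ← Real.rpow_mul hQ.le]; congr 1; push_cast; ring
          have hpos : 0 < Q ^ ((1 - γ₂) / 2) := by positivity
          have hb2 : Q ^ ((1 - γ₂) / 2) * |Real.log Q| ≤ 2 * K * x := by nlinarith
          have hb3 : Q ^ (1 - γ₂) * |Real.log Q| ^ 2 ≤ (2 * K * x) ^ 2 := by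
            rw [← hpow, ← mul_pow]
            exact pow_le_pow_left₀ (by positivity) hb2 2
          have hpos2 : 0 < Q ^ (1 - γ₂) := by positivity
          rcases le_or_gt x 3 with hx3 | hx3
          · have h1 : Q ^ (1 - γ₂) ≤ (2 * K * x) ^ 2 := by
              refine le_trans ?_ hb3
              exact le_mul_of_one_le_right hpos2.le (one_le_pow₀ hlog1)
            have h2 : (2 * K * x) ^ 2 ≤ (6 * K) ^ 2 :=
              pow_le_pow_left₀ (by positivity) (by nlinarith) 2
            linarith
          · rw [if_pos hx3]
            rcases le_or_gt (Q ^ (1 - γ₂)) x with hQx | hQx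
            · have : 0 ≤ C * (x ^ 2 * (Real.log x)⁻¹ ^ 2) := by positivity
              linarith
            · have hlx : 0 < Real.log x := Real.log_pos (by linarith)
              have h1 : Real.log x ≤ (γ₂ - 1) * |Real.log Q| := by
                have h2 := Real.log_lt_log hx hQx
                rw [Real.log_rpow hQ] at h2
                have h3 : (1 - γ₂) * Real.log Q ≤ (γ₂ - 1) * |Real.log Q| := by
                  have := neg_abs_le (Real.log Q)
                  nlinarith
                linarith
              have h4 : Q ^ (1 - γ₂) * Real.log x ^ 2 ≤ (2 * K * (γ₂ - 1)) ^ 2 * x ^ 2 := by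
                calc Q ^ (1 - γ₂) * Real.log x ^ 2
                    ≤ Q ^ (1 - γ₂) * ((γ₂ - 1) * |Real.log Q|) ^ 2 := by gcongr
                  _ = (γ₂ - 1) ^ 2 * (Q ^ (1 - γ₂) * |Real.log Q| ^ 2) := by ring
                  _ ≤ (γ₂ - 1) ^ 2 * (2 * K * x) ^ 2 := by gcongr
                  _ = _ := by ring
              have h5 : Q ^ (1 - γ₂) ≤ (2 * K * (γ₂ - 1)) ^ 2 * (x ^ 2 * (Real.log x)⁻¹ ^ 2) := by
                rw [inv_pow, ← mul_assoc, ← div_eq_mul_inv, le_div_iff₀ (by positivity)]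
                exact h4
              have h6 : (2 * K * (γ₂ - 1)) ^ 2 * (x ^ 2 * (Real.log x)⁻¹ ^ 2) ≤
                  C * (x ^ 2 * (Real.log x)⁻¹ ^ 2) := by gcongr
              linarith
  set c := c₁ / 2 with hc
  have hc0 : 0 < c := by positivity
  refine ⟨fun x => (4 + (2 + C) * c ^ (-(3 / 2) : ℝ) + c ^ (-(1 / 2) : ℝ)) * (max x c) ^ (-(3 / 2) : ℝ) +
    (Ioi 3).indicator (fun x => C * (x⁻¹ * (Real.log x)⁻¹ ^ 2)) x, ?_, ?_⟩
  · refine IntegrableOn.add ((integrableOn_max_rpow hc0).const_mul _) ?_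
    refine IntegrableOn.mono_set ?_ (subset_univ _)
    rw [integrableOn_univ, integrable_indicator_iff measurableSet_Ioi]
    exact integrableOn_inv_mul_log_sq.const_mul _
  · intro x x' hx hx' hx2 hx3 hq hq0
    beta_reduce
    have hQ0 : 0 < (q x').toReal := ENNReal.toReal_pos hq0.ne' hq.ne
    have hlow : x' < c₁ → c₁ < (q x').toReal := fun hlt =>
      (ENNReal.ofReal_lt_iff_lt_toReal hc₁.le hq.ne).1 (hc₁b x' hx' hlt)
    have hCb' := hCb x x' hx hx' hx2 hq hQ0
    set Q := (q x').toReal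
    clear_value Q
    set m := max x c with hm
    have hmpos : 0 < m := lt_max_of_lt_left hx
    have hmM : m ≤ max x Q := by
      refine max_le (le_max_left _ _) ?_
      by_cases hlt : x' < c₁
      · exact le_max_of_le_right (by have := hlow hlt; linarith)
      · exact le_max_of_le_left (by linarith)
    have hcm : c ≤ m := le_max_right _ _
    have hxm : x ≤ m := le_max_left _ _
    set M := max x Q with hM
    have hQM : Q ≤ M := le_max_right _ _
    have hxM : x ≤ M := le_max_left _ _
    have hMpos : 0 < M := hmpos.trans_le hmM
    clear_value m M
    have hM3 : M ^ 3 = M ^ (3 / 2 : ℝ) * M ^ (3 / 2 : ℝ) := by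
      rw [← Real.rpow_add hMpos]; norm_num
    have hm3 : m ^ 3 = m ^ (3 / 2 : ℝ) * m ^ (3 / 2 : ℝ) := by
      rw [← Real.rpow_add hmpos]; norm_num
    have hem : m ^ (-(3 / 2) : ℝ) = (m ^ (3 / 2 : ℝ))⁻¹ := Real.rpow_neg hmpos.le _
    have hE : 0 < m ^ (-(3 / 2) : ℝ) := by positivity
    have hA1 : 0 ≤ (2 + C) * c ^ (-(3 / 2) : ℝ) := by positivity
    have hA2 : 0 < c ^ (-(1 / 2) : ℝ) := by positivity
    have hind : 0 ≤ (Ioi 3).indicator (fun x => C * (x⁻¹ * (Real.log x)⁻¹ ^ 2)) x := by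
      refine indicator_nonneg (fun y hy => ?_) _
      have : (0 : ℝ) < y := lt_trans (by norm_num) hy
      positivity
    rcases le_or_gt 1 Q with h1 | h1
    · have h2 := mul_growthFactor_le_of_one_le hγ h1
      have h3 : Q * growthFactor γ₂ Q / M ^ 3 ≤ 4 * m ^ (-(3 / 2) : ℝ) := by
        rw [div_le_iff₀ (by positivity), hem, hM3]
        have e1 : Q ^ (3 / 2 : ℝ) ≤ M ^ (3 / 2 : ℝ) := by gcongr
        have e2 : 1 ≤ (m ^ (3 / 2 : ℝ))⁻¹ * M ^ (3 / 2 : ℝ) := by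
          rw [inv_mul_eq_div, one_le_div (by positivity)]
          gcongr
        have e3 : 0 < M ^ (3 / 2 : ℝ) := by positivity
        calc Q * growthFactor γ₂ Q ≤ 4 * Q ^ (3 / 2 : ℝ) := h2
          _ ≤ 4 * M ^ (3 / 2 : ℝ) := by linarith
          _ ≤ 4 * (((m ^ (3 / 2 : ℝ))⁻¹ * M ^ (3 / 2 : ℝ)) * M ^ (3 / 2 : ℝ)) := by
            have := mul_le_mul_of_nonneg_right e2 e3.le
            linarith
          _ = _ := by ring
      have h4 : 0 ≤ (2 + C) * c ^ (-(3 / 2) : ℝ) * m ^ (-(3 / 2) : ℝ) := by positivity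
      have h5 : 0 ≤ c ^ (-(1 / 2) : ℝ) * m ^ (-(3 / 2) : ℝ) := by positivity
      linarith [add_mul (4 + (2 + C) * c ^ (-(3 / 2) : ℝ)) (c ^ (-(1 / 2) : ℝ)) (m ^ (-(3 / 2) : ℝ)),
        add_mul 4 ((2 + C) * c ^ (-(3 / 2) : ℝ)) (m ^ (-(3 / 2) : ℝ))]
    · have h2 := mul_growthFactor_le_of_lt_one (γ := γ₂) hQ0 h1
      have h3 := hCb' h1
      have t1 : (2 + C) / M ^ 3 ≤ (2 + C) * c ^ (-(3 / 2) : ℝ) * m ^ (-(3 / 2) : ℝ) := by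
        have e1 : (2 + C) / M ^ 3 ≤ (2 + C) / m ^ 3 := by gcongr
        have e2 : m ^ (-(3 / 2) : ℝ) ≤ c ^ (-(3 / 2) : ℝ) :=
          Real.rpow_le_rpow_of_nonpos hc0 hcm (by norm_num)
        have e3 : (2 + C) / m ^ 3 = (2 + C) * m ^ (-(3 / 2) : ℝ) * m ^ (-(3 / 2) : ℝ) := by
          rw [hm3, hem]; field_simp
        rw [e3] at e1
        refine e1.trans ?_
        gcongr
      have t2 : x / M ^ 3 ≤ c ^ (-(1 / 2) : ℝ) * m ^ (-(3 / 2) : ℝ) := by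
        have e1 : x / M ^ 3 ≤ m / m ^ 3 := by gcongr
        have e2 : m ^ (-(1 / 2) : ℝ) ≤ c ^ (-(1 / 2) : ℝ) :=
          Real.rpow_le_rpow_of_nonpos hc0 hcm (by norm_num)
        have e3 : m / m ^ 3 = m ^ (-(1 / 2) : ℝ) * m ^ (-(3 / 2) : ℝ) := by
          rw [← Real.rpow_add hmpos]
          norm_num
          field_simp
        rw [e3] at e1
        refine e1.trans ?_
        gcongr
      have t3 : (if 3 < x then C * (x ^ 2 * (Real.log x)⁻¹ ^ 2) else 0) / M ^ 3 ≤
          (Ioi 3).indicator (fun x => C * (x⁻¹ * (Real.log x)⁻¹ ^ 2)) x := by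
        by_cases hx3 : 3 < x
        · rw [if_pos hx3, indicator_of_mem (mem_Ioi.2 hx3)]
          have e1 : C * (x ^ 2 * (Real.log x)⁻¹ ^ 2) / M ^ 3 ≤ C * (x ^ 2 * (Real.log x)⁻¹ ^ 2) / x ^ 3 := by
            gcongr
          refine e1.trans (le_of_eq ?_)
          field_simp
        · rw [if_neg hx3, zero_div]; exact hind
      have hle : Q * growthFactor γ₂ Q / M ^ 3 ≤
          (2 + C) / M ^ 3 + x / M ^ 3 + (if 3 < x then C * (x ^ 2 * (Real.log x)⁻¹ ^ 2) else 0) / M ^ 3 := by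
        rw [← add_div, ← add_div]
        gcongr
        linarith
      have h4 : 0 ≤ 4 * m ^ (-(3 / 2) : ℝ) := by positivity
      linarith [add_mul (4 + (2 + C) * c ^ (-(3 / 2) : ℝ)) (c ^ (-(1 / 2) : ℝ)) (m ^ (-(3 / 2) : ℝ)),
        add_mul 4 ((2 + C) * c ^ (-(3 / 2) : ℝ)) (m ^ (-(3 / 2) : ℝ))]

end Pair

/-- The set of all points `z` in the quadrant with `(h₁⁻¹ z₁, h₂⁻¹ z₂)` in the failure set. -/
def distSet (q : ℝ → ℝ≥0∞) (h₁ h₂ : ℝ ≃o ℝ) : Set (ℝ × ℝ) :=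
  {z | 0 ≤ z.1 ∧ 0 ≤ z.2 ∧ q (h₁.symm z.1) ≤ ENNReal.ofReal (h₂.symm z.2)}

/-- The mass of the section of `A` at `x`. -/
def sectionMass (η : ℝ × ℝ → ℝ) (A : Set (ℝ × ℝ)) (x : ℝ) : ℝ :=
  (∫⁻ y, A.indicator (quadDens η) (x, y)).toReal

section Sections

variable {ν : Measure (ℝ × ℝ)} {η : ℝ × ℝ → ℝ} {q p : ℝ → ℝ≥0∞} {γ₁ γ₂ x₀ y₀ : ℝ}

theorem ExponentDensity.measureReal_eq_integral (h : ExponentDensity ν η) {A : Set (ℝ × ℝ)}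
    (hA : MeasurableSet A) (hfin : ν A ≠ ⊤) (hpos : ∀ z ∈ A, 0 ≤ z.1) :
    IntegrableOn (sectionMass η A) (Ioi 0) ∧ ν.real A = ∫ x in Ioi 0, sectionMass η A x := by
  have hm : Measurable (A.indicator (quadDens η)) := h.measurable_quadDens.indicator hA
  have hms : Measurable fun x => ∫⁻ y, A.indicator (quadDens η) (x, y) := hm.lintegral_prod_right'
  have hνA : ν A = ∫⁻ x in Ioi 0, ∫⁻ y, A.indicator (quadDens η) (x, y) := by
    rw [h.eq_withDensity, withDensity_apply _ hA, ← lintegral_indicator hA, Measure.volume_eq_prod,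
      lintegral_prod _ hm.aemeasurable, setLIntegral_congr Ioi_ae_eq_Ici,
      ← lintegral_indicator measurableSet_Ici]
    refine lintegral_congr fun x => ?_
    by_cases hx : x ∈ Ici (0 : ℝ)
    · rw [indicator_of_mem hx]
    · rw [indicator_of_notMem hx]
      have : ∀ y : ℝ, A.indicator (quadDens η) (x, y) = 0 := fun y =>
        indicator_of_notMem (fun hmem => hx (mem_Ici.2 (hpos (x, y) hmem))) _
      simp [this]
  rw [hνA] at hfin
  refine ⟨integrable_toReal_of_lintegral_ne_top hms.aemeasurable hfin, ?_⟩
  rw [measureReal_def, hνA]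
  exact (integral_toReal hms.aemeasurable (ae_lt_top hms hfin)).symm

theorem ExponentDensity.continuousOn_section (h : ExponentDensity ν η) {x : ℝ} (hx : 0 < x) :
    ContinuousOn (fun y => η (x, y)) (Ici 0) := by
  refine h.cont.comp (by fun_prop) fun y hy => ⟨⟨hx.le, hy⟩, ?_⟩
  intro h0
  exact hx.ne' (congrArg Prod.fst h0)

theorem ExponentDensity.integrableOn_section (h : ExponentDensity ν η) {x a : ℝ} (hx : 0 < x)
    (ha : 0 ≤ a) : IntegrableOn (fun y => η (x, y)) (Ici a) := by
  obtain ⟨C, hC, hb⟩ := h.exists_bound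
  refine IntegrableOn.mono_set ?_ (Ici_subset_Ici.2 ha)
  rw [integrableOn_Ici_iff_integrableOn_Ioi]
  refine Integrable.mono' ((integrableOn_max_rpow hx).const_mul (C * x ^ (-(3 / 2) : ℝ))) ?_ ?_
  · exact ((h.continuousOn_section hx).mono Ioi_subset_Ici_self).aestronglyMeasurable measurableSet_Ioi
  · filter_upwards [ae_restrict_mem measurableSet_Ioi] with y hy
    have hz : (x, y) ∈ quadrant := mem_quadrant_of_pos hx (mem_Ioi.1 hy).le
    rw [Real.norm_of_nonneg (h.pos _ hz).le]
    refine (hb _ hz).trans ?_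
    have hM : 0 < max x y := lt_max_of_lt_left hx
    have e1 : max x y ^ 3 = max x y ^ (3 / 2 : ℝ) * max x y ^ (3 / 2 : ℝ) := by
      rw [← Real.rpow_add hM]; norm_num
    have e2 : max x y ^ (-(3 / 2) : ℝ) ≤ x ^ (-(3 / 2) : ℝ) :=
      Real.rpow_le_rpow_of_nonpos hx (le_max_left _ _) (by norm_num)
    have e3 : C / max x y ^ 3 = C * max x y ^ (-(3 / 2) : ℝ) * max x y ^ (-(3 / 2) : ℝ) := by
      rw [e1, Real.rpow_neg hM.le]; field_simp
    simp only
    rw [e3, max_comm y x]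
    gcongr

theorem ExponentDensity.sectionMass_eq (h : ExponentDensity ν η) {A : Set (ℝ × ℝ)} {x a : ℝ}
    (hx : 0 < x) (ha : 0 ≤ a) (hA : ∀ y, (x, y) ∈ A ↔ a ≤ y) :
    sectionMass η A x = ∫ y in Ici a, η (x, y) := by
  have hQ : ∀ y ∈ Ici a, (x, y) ∈ quadrant := fun y hy =>
    mem_quadrant_of_pos hx (ha.trans hy)
  have h1 : ∀ y, A.indicator (quadDens η) (x, y) = (Ici a).indicator (fun y => ENNReal.ofReal (η (x, y))) y := by
    intro y
    by_cases hy : a ≤ y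
    · rw [indicator_of_mem ((hA y).2 hy), indicator_of_mem (mem_Ici.2 hy), quadDens,
        indicator_of_mem (hQ y hy)]
    · rw [indicator_of_notMem (fun h => hy ((hA y).1 h)), indicator_of_notMem (by simpa using hy)]
  rw [sectionMass, lintegral_congr h1, lintegral_indicator measurableSet_Ici,
    integral_eq_lintegral_of_nonneg_ae]
  · filter_upwards [ae_restrict_mem measurableSet_Ici] with y hy using (h.pos _ (hQ y hy)).le
  · exact (h.integrableOn_section hx ha).aestronglyMeasurable

theorem sectionMass_eq_zero {A : Set (ℝ × ℝ)} {x : ℝ} (hA : ∀ y, (x, y) ∉ A) :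
    sectionMass η A x = 0 := by
  have : ∀ y, A.indicator (quadDens η) (x, y) = 0 := fun y => indicator_of_notMem (hA y) _
  simp [sectionMass, this]

theorem BoundaryPair.measurable_comp_max (h : BoundaryPair q p γ₁ γ₂ x₀ y₀) :
    Measurable fun x => q (max x 0) := by
  refine Antitone.measurable fun x y hxy => ?_
  exact h.anti_left (mem_Ici.2 (le_max_right _ _)) (mem_Ici.2 (le_max_right _ _))
    (max_le_max hxy le_rfl)

theorem OrderIso.symm_nonneg {h : ℝ ≃o ℝ} (h0 : h 0 = 0) {x : ℝ} (hx : 0 ≤ x) : 0 ≤ h.symm x := by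
  rw [OrderIso.le_symm_apply, h0]; exact hx

theorem BoundaryPair.measurableSet_distSet (h : BoundaryPair q p γ₁ γ₂ x₀ y₀) {h₁ h₂ : ℝ ≃o ℝ}
    (h₁0 : h₁ 0 = 0) : MeasurableSet (distSet q h₁ h₂) := by
  have heq : distSet q h₁ h₂ = (Ici 0 ×ˢ Ici 0) ∩
      {z | q (max (h₁.symm z.1) 0) ≤ ENNReal.ofReal (h₂.symm z.2)} := by
    ext z
    constructor
    · rintro ⟨a, b, c⟩
      refine ⟨⟨a, b⟩, ?_⟩
      rwa [mem_ofPred_eq, max_eq_left (OrderIso.symm_nonneg h₁0 a)]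
    · rintro ⟨⟨a, b⟩, c⟩
      refine ⟨a, b, ?_⟩
      rwa [mem_ofPred_eq, max_eq_left (OrderIso.symm_nonneg h₁0 a)] at c
  rw [heq]
  refine (measurableSet_Ici.prod measurableSet_Ici).inter (measurableSet_le ?_ ?_)
  · exact h.measurable_comp_max.comp (h₁.symm.continuous.measurable.comp measurable_fst)
  · exact (h₂.symm.continuous.measurable.comp measurable_snd).ennreal_ofReal

theorem BoundaryPair.distSet_lt_top (h : BoundaryPair q p γ₁ γ₂ x₀ y₀) (hν : ExponentDensity ν η)
    {h₁ h₂ : ℝ ≃o ℝ} (h₁0 : h₁ 0 = 0) (h₂0 : h₂ 0 = 0) : ν (distSet q h₁ h₂) < ⊤ := by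
  obtain ⟨c, hc, -, hb⟩ := h.max_ge
  refine hν.measure_away_lt_top (δ := min (h₁ c) (h₂ c)) ?_ ?_
  · refine lt_min ?_ ?_
    · rw [← h₁0]; exact h₁.strictMono hc
    · rw [← h₂0]; exact h₂.strictMono hc
  · rintro z ⟨a, b, hz⟩ _ _
    rcases le_max_iff.1 (hb _ _ (OrderIso.symm_nonneg h₁0 a) (OrderIso.symm_nonneg h₂0 b) hz)
      with h1 | h1
    · rw [OrderIso.le_symm_apply] at h1
      exact (min_le_left _ _).trans (h1.trans (le_max_left _ _))
    · rw [OrderIso.le_symm_apply] at h1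
      exact (min_le_right _ _).trans (h1.trans (le_max_right _ _))

theorem mem_distSet_iff {h₁ h₂ : ℝ ≃o ℝ} (h₂0 : h₂ 0 = 0) {x y : ℝ} (hx : 0 ≤ x)
    (hq : q (h₁.symm x) < ⊤) :
    (x, y) ∈ distSet q h₁ h₂ ↔ h₂ (q (h₁.symm x)).toReal ≤ y := by
  constructor
  · rintro ⟨_, hy, hz⟩
    have := ENNReal.toReal_mono ENNReal.ofReal_ne_top hz
    rw [ENNReal.toReal_ofReal (OrderIso.symm_nonneg h₂0 hy)] at this
    rwa [OrderIso.le_symm_apply] at this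
  · intro hy
    have hy0 : 0 ≤ y := by
      refine le_trans ?_ hy
      rw [← h₂0]; exact h₂.monotone ENNReal.toReal_nonneg
    refine ⟨hx, hy0, ?_⟩
    simp only
    rw [← ENNReal.ofReal_toReal hq.ne]
    exact ENNReal.ofReal_le_ofReal ((OrderIso.le_symm_apply _).2 hy)

theorem ExponentDensity.sectionMass_sub (hν : ExponentDensity ν η) {h₁ h₂ : ℝ ≃o ℝ}
    (h₂0 : h₂ 0 = 0) {x : ℝ} (hx : 0 < x) (hq : q (h₁.symm x) < ⊤) :
    sectionMass η (distSet q h₁ h₂) x - sectionMass η (distSet q h₁ (OrderIso.refl ℝ)) x =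
      ∫ y in h₂ (q (h₁.symm x)).toReal..(q (h₁.symm x)).toReal, η (x, y) := by
  have h0 : 0 ≤ (q (h₁.symm x)).toReal := ENNReal.toReal_nonneg
  have h1 : 0 ≤ h₂ (q (h₁.symm x)).toReal := by rw [← h₂0]; exact h₂.monotone h0
  rw [hν.sectionMass_eq hx h1 fun y => mem_distSet_iff h₂0 hx.le hq,
    hν.sectionMass_eq hx h0 fun y => mem_distSet_iff (h₂ := OrderIso.refl ℝ) rfl hx.le hq,
    intervalIntegral.integral_Ici_sub_Ici' (hν.integrableOn_section hx h1)
      (hν.integrableOn_section hx h0)]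

end Sections

/-- Order isomorphisms `h n` of the line that are close to the identity, with first order expansion
`s - r n * ℓ n * s ^ boundaryExponent γ`. -/
structure Distort (γ x₀ : ℝ) (r ℓ : ℕ → ℝ) (h : ℕ → ℝ ≃o ℝ) : Prop where
  zero : ∀ᶠ n in atTop, h n 0 = 0
  bounded : ∃ L : ℝ, 0 ≤ L ∧ ∀ᶠ n in atTop, |ℓ n| ≤ L
  close : ∀ ε : ℝ, 0 < ε → ∀ᶠ n in atTop, ∀ s, 0 ≤ s → |h n s - s| ≤ ε * s
  dom : ∃ C : ℝ, 0 ≤ C ∧ ∀ᶠ n in atTop, ∀ s, 0 < s → x₀ ≤ s →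
    |h n s - s| ≤ C * r n * (s * growthFactor γ s)
  expand : ∀ (s : ℕ → ℝ) (s₀ : ℝ), 0 < s₀ → (∀ᶠ n in atTop, x₀ ≤ s n) → Tendsto s atTop (𝓝 s₀) →
    Tendsto (fun n => (h n (s n) - s n) / r n + ℓ n * s n ^ boundaryExponent γ) atTop (𝓝 0)

theorem Distort.refl (γ x₀ : ℝ) (r : ℕ → ℝ) :
    Distort γ x₀ r (fun _ => 0) (fun _ => OrderIso.refl ℝ) where
  zero := by simp
  bounded := ⟨0, le_rfl, by simp⟩
  close := fun ε hε => Eventually.of_forall fun n s hs => by simpa using mul_nonneg hε.le hs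
  dom := ⟨0, le_rfl, by simp⟩
  expand := by simp

theorem abs_symm_sub_le {h : ℝ ≃o ℝ} (h0 : h 0 = 0) {ε : ℝ} (hε0 : 0 ≤ ε)
    (hε : ε ≤ 1 / 2)     (hc : ∀ s, 0 ≤ s → |h s - s| ≤ ε * s) {x : ℝ} (hx : 0 ≤ x) :
    |h.symm x - x| ≤ 2 * ε * x := by
  have hs := OrderIso.symm_nonneg h0 hx
  have h1 := hc _ hs
  rw [OrderIso.apply_symm_apply] at h1
  have h2 := abs_le.1 h1
  have h3 : h.symm x ≤ 2 * x := by nlinarith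
  rw [abs_sub_comm]
  nlinarith

theorem mul_growthFactor_tendsto_zero {γ : ℝ} (hγ : γ < 1) {s : ℕ → ℝ} (hs : ∀ᶠ n in atTop, 0 ≤ s n)
    (hs0 : Tendsto s atTop (𝓝 0)) : Tendsto (fun n => s n * growthFactor γ (s n)) atTop (𝓝 0) := by
  have h1 : Tendsto (fun n => s n + |s n * Real.log (s n)| + s n ^ (1 - γ)) atTop (𝓝 0) := by
    have e1 := (Real.continuous_mul_log.tendsto 0).comp hs0
    have e2 := ((Real.continuousAt_rpow_const 0 (1 - γ) (Or.inr (by linarith))).tendsto).comp hs0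
    rw [Real.zero_rpow (by linarith)] at e2
    simp only [zero_mul] at e1
    simpa using (hs0.add e1.abs).add e2
  refine h1.congr' ?_
  filter_upwards [hs] with n hn
  rcases hn.eq_or_lt with h0 | h0
  · rw [← h0]; simp [Real.zero_rpow (show 1 - γ ≠ 0 by linarith)]
  · rw [growthFactor, abs_mul, abs_of_pos h0, sub_eq_add_neg, Real.rpow_add h0, Real.rpow_one]
    ring

theorem rpow_boundaryExponent_le {γ s : ℝ} (hs : 0 ≤ s) :
    s ^ boundaryExponent γ ≤ s * growthFactor γ s := by
  rcases hs.eq_or_lt with rfl | hs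
  · have : boundaryExponent γ ≠ 0 := by
      rw [boundaryExponent_eq]; positivity
    simp [Real.zero_rpow this]
  · rw [boundaryExponent_eq, Real.rpow_add hs, Real.rpow_one]
    have := rpow_negPart_le γ hs
    have h2 := abs_nonneg (Real.log s)
    rw [growthFactor]
    gcongr
    linarith

section Expansion

variable {ν : Measure (ℝ × ℝ)} {η : ℝ × ℝ → ℝ} {q p : ℝ → ℝ≥0∞} {γ₁ γ₂ x₀ y₀ : ℝ}

theorem BoundaryPair.boundaryIntegrand_bound (h : BoundaryPair q p γ₁ γ₂ x₀ y₀)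
    (hγ : -1 / 2 < γ₂) {C : ℝ} (hC : 0 ≤ C)
    (hη : ∀ z ∈ quadrant, 0 ≤ η z ∧ η z ≤ C / max z.1 z.2 ^ 3) :
    ∃ B : ℝ → ℝ, IntegrableOn B (Ioi 0) ∧ (∀ x, 0 < x → 0 ≤ B x) ∧
      (∀ x x' : ℝ, 0 < x → 0 ≤ x' → x' ≤ 2 * x → x ≤ 2 * x' → q x' < ⊤ →
        (q x').toReal * growthFactor γ₂ (q x').toReal / max x (q x').toReal ^ 3 ≤ B x) ∧
      ∀ x, 0 < x → q x < ⊤ → |boundaryIntegrand₂ q η γ₂ x| ≤ C * B x := by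
  obtain ⟨B, hB, hb⟩ := h.exists_domination hγ
  have key : ∀ x x' : ℝ, 0 < x → 0 ≤ x' → x' ≤ 2 * x → x ≤ 2 * x' → q x' < ⊤ →
      (q x').toReal * growthFactor γ₂ (q x').toReal / max x (q x').toReal ^ 3 ≤ max (B x) 0 := by
    intro x x' h1 h2 h3 h4 h5
    rcases eq_or_ne (q x') 0 with h0 | h0
    · simp [h0]
    · exact (hb x x' h1 h2 h3 h4 h5 (pos_iff_ne_zero.2 h0)).trans (le_max_left _ _)
  refine ⟨fun x => max (B x) 0, hB.pos_part, fun x _ => le_max_right _ _, key, fun x hx hq => ?_⟩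
  have h1 := key x x hx hx.le (by linarith) (by linarith) hq
  have hQ : 0 ≤ (q x).toReal := ENNReal.toReal_nonneg
  have h2 := rpow_boundaryExponent_le (γ := γ₂) hQ
  have hz : (x, (q x).toReal) ∈ quadrant :=
    mem_quadrant_of_pos hx hQ
  obtain ⟨h3, h4⟩ := hη _ hz
  simp only at h4
  have h5 : 0 ≤ (q x).toReal ^ boundaryExponent γ₂ := by positivity
  rw [boundaryIntegrand₂, abs_of_nonneg (mul_nonneg h5 h3)]
  have hM : 0 < max x (q x).toReal := lt_max_of_lt_left hx
  calc (q x).toReal ^ boundaryExponent γ₂ * η (x, (q x).toReal)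
      ≤ (q x).toReal * growthFactor γ₂ (q x).toReal * (C / max x (q x).toReal ^ 3) :=
        mul_le_mul h2 h4 h3 (h5.trans h2)
    _ = C * ((q x).toReal * growthFactor γ₂ (q x).toReal / max x (q x).toReal ^ 3) := by ring
    _ ≤ _ := by gcongr

theorem BoundaryPair.integrableOn_boundaryIntegrand (h : BoundaryPair q p γ₁ γ₂ x₀ y₀)
    (hγ : -1 / 2 < γ₂) (hν : ExponentDensity ν η) :
    IntegrableOn (boundaryIntegrand₂ q η γ₂) (Ioi x₀) := by
  obtain ⟨C, hC, hb⟩ := hν.exists_bound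
  obtain ⟨B, hB, -, -, hbB⟩ := h.boundaryIntegrand_bound hγ hC.le
    fun z hz => ⟨(hν.pos z hz).le, hb z hz⟩
  have hsub : Ioi x₀ ⊆ Ioi (0 : ℝ) := Ioi_subset_Ioi h.nonneg_left
  refine Integrable.mono' ((hB.mono_set hsub).const_mul C) ?_ ?_
  · have hm : Measurable fun x => (q (max x 0)).toReal := h.measurable_comp_max.ennreal_toReal
    have hm2 : Measurable fun x => (q (max x 0)).toReal ^ boundaryExponent γ₂ *
        (quadDens η (x, (q (max x 0)).toReal)).toReal :=
      (hm.pow_const _).mul (hν.measurable_quadDens.comp (measurable_id.prodMk hm)).ennreal_toReal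
    refine hm2.aestronglyMeasurable.congr ?_
    filter_upwards [ae_restrict_mem measurableSet_Ioi] with x hx
    have hx0 : 0 < x := hsub hx
    have hz : (x, (q x).toReal) ∈ quadrant :=
      mem_quadrant_of_pos hx0 ENNReal.toReal_nonneg
    rw [max_eq_left hx0.le, quadDens, indicator_of_mem hz, boundaryIntegrand₂,
      ENNReal.toReal_ofReal (hν.pos _ hz).le]
  · filter_upwards [ae_restrict_mem measurableSet_Ioi] with x hx
    exact hbB x (hsub hx) (h.fin_left x hx)

theorem BoundaryPair.gamma_lt_one (h : BoundaryPair q p γ₁ γ₂ x₀ y₀) {x : ℝ} (hx : 0 ≤ x)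
    (hq : q x = 0) : γ₂ < 1 := by
  by_contra! hγ
  have hy0 : y₀ = 0 := by
    refine le_antisymm ?_ h.nonneg_right
    have := h.le_apply hx (by rw [hq]; exact ENNReal.zero_lt_top)
    simpa [hq] using this
  subst hy0
  obtain ⟨K, δ, hK, hδ, hb⟩ := h.growth_right
  set y := min (δ / 2) (Real.exp (-(K * x + 1))) with hy
  have hypos : 0 < y := lt_min (by positivity) (Real.exp_pos _)
  have hyδ : y < δ := (min_le_left _ _).trans_lt (by linarith)
  have hyexp : y ≤ Real.exp (-(K * x + 1)) := min_le_right _ _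
  have hlog : K * x + 1 ≤ |Real.log y| := by
    have h1 : Real.log y ≤ -(K * x + 1) := (Real.log_le_iff_le_exp hypos).2 hyexp
    have : -Real.log y ≤ |Real.log y| := neg_le_abs _
    linarith
  have hp : (p y).toReal ≤ x := by
    have h1 := (h.galois x y hx hypos.le).1 (by rw [hq]; exact zero_le)
    have h2 := ENNReal.toReal_mono ENNReal.ofReal_ne_top h1
    rwa [ENNReal.toReal_ofReal hx] at h2
  have h1 := hb y hypos (by linarith)
  have hy1 : y ≤ 1 := hyexp.trans (Real.exp_le_one_iff.2 (by nlinarith))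
  have h2 : 1 ≤ y ^ ((1 - γ₂) / 2) := Real.one_le_rpow_of_pos_of_le_one_of_nonpos hypos hy1 (by linarith)
  have h3 : |Real.log y| ≤ y ^ ((1 - γ₂) / 2) * |Real.log y| := le_mul_of_one_le_left (abs_nonneg _) h2
  nlinarith

theorem ExponentDensity.tendsto_average (hν : ExponentDensity ν η) {x Q : ℝ} (hx : 0 < x)
    (hQ : 0 < Q) {a b r : ℕ → ℝ} (ha : Tendsto a atTop (𝓝 Q)) (hb : Tendsto b atTop (𝓝 Q))
    {L : ℝ} (hL : ∀ᶠ n in atTop, |(b n - a n) / r n| ≤ L) :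
    Tendsto (fun n => (∫ y in a n..b n, η (x, y)) / r n - (b n - a n) / r n * η (x, Q)) atTop (𝓝 0) := by
  rw [Metric.tendsto_nhds]
  intro ε hε
  have hL0 : 0 ≤ L := by
    obtain ⟨n, hn⟩ := hL.exists
    exact (abs_nonneg _).trans hn
  have hcont : ContinuousAt (fun y => η (x, y)) Q :=
    (hν.continuousOn_section hx).continuousAt (Ici_mem_nhds hQ)
  obtain ⟨δ, hδ, hball⟩ := Metric.continuousAt_iff.1 hcont (ε / (L + 1)) (by positivity)
  have hδQ : 0 < min δ Q := lt_min hδ hQ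
  filter_upwards [hL, ha.eventually (Metric.ball_mem_nhds Q hδQ),
    hb.eventually (Metric.ball_mem_nhds Q hδQ)] with n hn han hbn
  have hsub : uIcc (a n) (b n) ⊆ Metric.ball Q (min δ Q) := by
    have han' : a n ∈ Metric.ball Q (min δ Q) := han
    have hbn' : b n ∈ Metric.ball Q (min δ Q) := hbn
    rw [Real.ball_eq_Ioo] at *
    exact ordConnected_Ioo.uIcc_subset han' hbn'
  have hint : IntervalIntegrable (fun y => η (x, y)) volume (a n) (b n) := by
    refine ContinuousOn.intervalIntegrable ((hν.continuousOn_section hx).mono fun y hy => ?_)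
    have := hsub hy
    rw [Real.ball_eq_Ioo] at this
    have h1 := min_le_right δ Q
    exact mem_Ici.2 (by linarith [this.1])
  have h1 : (∫ y in a n..b n, η (x, y)) - (b n - a n) * η (x, Q) =
      ∫ y in a n..b n, (η (x, y) - η (x, Q)) := by
    rw [intervalIntegral.integral_sub hint intervalIntegrable_const,
      intervalIntegral.integral_const, smul_eq_mul]
  have h2 : ‖∫ y in a n..b n, (η (x, y) - η (x, Q))‖ ≤ ε / (L + 1) * |b n - a n| := by
    refine intervalIntegral.norm_integral_le_of_norm_le_const fun y hy => ?_
    have h3 := hsub (uIoc_subset_uIcc hy)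
    have h4 : dist y Q < δ := (Metric.mem_ball.1 h3).trans_le (min_le_left _ _)
    exact (hball h4).le
  rw [Real.dist_eq, sub_zero]
  have h5 : (∫ y in a n..b n, η (x, y)) / r n - (b n - a n) / r n * η (x, Q) =
      (∫ y in a n..b n, (η (x, y) - η (x, Q))) / r n := by
    rw [← h1]; ring
  rw [h5, abs_div]
  rw [abs_div] at hn
  calc |∫ y in a n..b n, (η (x, y) - η (x, Q))| / |r n| ≤ ε / (L + 1) * |b n - a n| / |r n| := by
        gcongr; exact h2
    _ = ε / (L + 1) * (|b n - a n| / |r n|) := by ring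
    _ ≤ ε / (L + 1) * L := by gcongr
    _ < ε := by
        rw [div_mul_eq_mul_div, div_lt_iff₀ (by positivity)]
        nlinarith

theorem ExponentDensity.abs_integral_le (hν : ExponentDensity ν η) {C : ℝ} (hC : 0 ≤ C)
    (hη : ∀ z ∈ quadrant, η z ≤ C / max z.1 z.2 ^ 3) {x Q a : ℝ}
    (hx : 0 < x) (hQ : 0 ≤ Q) (ha : |a - Q| ≤ 1 / 2 * Q) :
    |∫ y in a..Q, η (x, y)| ≤ 8 * C * |a - Q| / max x Q ^ 3 := by
  have hM : 0 < max x Q := lt_max_of_lt_left hx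
  have h1 : ‖∫ y in a..Q, η (x, y)‖ ≤ 8 * C / max x Q ^ 3 * |Q - a| := by
    refine intervalIntegral.norm_integral_le_of_norm_le_const fun y hy => ?_
    have hy' := uIoc_subset_uIcc hy
    rw [mem_uIcc] at hy'
    have h2 := abs_le.1 ha
    have hyQ : Q / 2 ≤ y := by rcases hy' with h | h <;> linarith [h.1]
    have hz : (x, y) ∈ quadrant :=
      mem_quadrant_of_pos hx (by simp only; linarith)
    rw [Real.norm_of_nonneg (hν.pos _ hz).le]
    have h3 := hη _ hz
    simp only at h3
    have h4 : max x Q / 2 ≤ max x y := by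
      rcases le_total x Q with h | h
      · rw [max_eq_right h]; exact hyQ.trans (le_max_right _ _)
      · rw [max_eq_left h]; exact le_trans (by linarith) (le_max_left _ _)
    calc η (x, y) ≤ C / max x y ^ 3 := h3
      _ ≤ C / (max x Q / 2) ^ 3 := by gcongr
      _ = _ := by field_simp; norm_num
  rw [Real.norm_eq_abs, abs_sub_comm] at h1
  calc _ ≤ _ := h1
    _ = _ := by ring

theorem ExponentDensity.expansion_snd (hν : ExponentDensity ν η) (h : BoundaryPair q p γ₁ γ₂ x₀ y₀)
    (hγ : -1 / 2 < γ₂) {r ℓ₁ ℓ₂ : ℕ → ℝ} {h₁ h₂ : ℕ → ℝ ≃o ℝ} (hr : ∀ᶠ n in atTop, 0 < r n)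
    (hd₁ : Distort γ₁ x₀ r ℓ₁ h₁) (hd₂ : Distort γ₂ y₀ r ℓ₂ h₂) :
    Tendsto (fun n => (ν.real (distSet q (h₁ n) (h₂ n)) -
        ν.real (distSet q (h₁ n) (OrderIso.refl ℝ))) / r n -
      ℓ₂ n * ∫ x in Ioi x₀, boundaryIntegrand₂ q η γ₂ x) atTop (𝓝 0) := by
  obtain ⟨Cη, hCη, hbη⟩ := hν.exists_bound
  obtain ⟨B, hB, hB0, hBb, hBI⟩ := h.boundaryIntegrand_bound hγ hCη.le
    fun z hz => ⟨(hν.pos z hz).le, hbη z hz⟩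
  obtain ⟨Cd, hCd, hdom⟩ := hd₂.dom
  obtain ⟨L, hL, hℓ⟩ := hd₂.bounded
  have hI := h.integrableOn_boundaryIntegrand hγ hν
  set I := boundaryIntegrand₂ q η γ₂ with hIdef
  set A := fun n => distSet q (h₁ n) (h₂ n) with hA
  set A' := fun n => distSet q (h₁ n) (OrderIso.refl ℝ) with hA'
  set F : ℕ → ℝ → ℝ := fun n x => (sectionMass η (A n) x - sectionMass η (A' n) x) / r n with hF
  have hsub : Ioi x₀ ⊆ Ioi (0 : ℝ) := Ioi_subset_Ioi h.nonneg_left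
  have hIi : Integrable ((Ioi x₀).indicator I) (volume.restrict (Ioi 0)) := by
    rw [integrable_indicator_iff measurableSet_Ioi, IntegrableOn,
      Measure.restrict_restrict measurableSet_Ioi, inter_eq_left.2 hsub]
    exact hI
  have hint : ∀ᶠ n in atTop, IntegrableOn (F n) (Ioi 0) ∧
      (ν.real (A n) - ν.real (A' n)) / r n = ∫ x in Ioi 0, F n x := by
    filter_upwards [hd₁.zero, hd₂.zero] with n hn1 hn2
    obtain ⟨e1, e2⟩ := hν.measureReal_eq_integral (h.measurableSet_distSet (h₂ := h₂ n) hn1)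
      (h.distSet_lt_top hν hn1 hn2).ne fun z hz => hz.1
    obtain ⟨e3, e4⟩ := hν.measureReal_eq_integral
      (h.measurableSet_distSet (h₂ := OrderIso.refl ℝ) hn1)
      (h.distSet_lt_top hν hn1 (h₂ := OrderIso.refl ℝ) rfl).ne fun z hz => hz.1
    refine ⟨(e1.sub e3).div_const _, ?_⟩
    rw [e2, e4, ← integral_sub e1 e3, integral_div]
  have hFval : ∀ᶠ n in atTop, ∀ x, 0 < x → (q ((h₁ n).symm x) = ⊤ → F n x = 0) ∧
      (q ((h₁ n).symm x) < ⊤ → F n x =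
        (∫ y in h₂ n (q ((h₁ n).symm x)).toReal..(q ((h₁ n).symm x)).toReal, η (x, y)) / r n) := by
    filter_upwards [hd₁.zero, hd₂.zero] with n hn1 hn2 x hx
    refine ⟨fun hq => ?_, fun hq => ?_⟩
    · have e : ∀ g : ℝ ≃o ℝ, sectionMass η (distSet q (h₁ n) g) x = 0 := fun g => by
        refine sectionMass_eq_zero fun y hy => ?_
        have := hy.2.2
        simp only [hq, top_le_iff] at this
        exact ENNReal.ofReal_ne_top this
      simp only [hF, hA, hA', e, sub_self, zero_div]
    · simp only [hF, hA, hA']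
      rw [hν.sectionMass_sub hn2 hx hq]
  have hFbound : ∀ᶠ n in atTop, ∀ x, 0 < x → q ((h₁ n).symm x) < ⊤ →
      |F n x| ≤ 8 * Cη * Cd * ((q ((h₁ n).symm x)).toReal *
        growthFactor γ₂ (q ((h₁ n).symm x)).toReal / max x (q ((h₁ n).symm x)).toReal ^ 3) := by
    filter_upwards [hFval, hr, hdom, hd₁.zero, hd₂.zero, hd₂.close (1 / 2) (by norm_num)]
      with n hn hrn hdn hn1 hn2 hcn x hx hq
    have hs := OrderIso.symm_nonneg hn1 hx.le
    have hQy := h.le_apply hs hq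
    rw [(hn x hx).2 hq]
    set Q := (q ((h₁ n).symm x)).toReal with hQdef
    have hQ : 0 ≤ Q := ENNReal.toReal_nonneg
    clear_value Q
    rcases hQ.eq_or_lt with h0 | h0
    · rw [← h0, hn2]; simp
    · have e1 := hν.abs_integral_le hCη.le hbη hx hQ (hcn Q hQ)
      have e2 := hdn Q h0 hQy
      have hM : 0 < max x Q := lt_max_of_lt_left hx
      rw [abs_div, abs_of_pos hrn, div_le_iff₀ hrn]
      calc |∫ y in h₂ n Q..Q, η (x, y)| ≤ 8 * Cη * |h₂ n Q - Q| / max x Q ^ 3 := e1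
        _ ≤ 8 * Cη * (Cd * r n * (Q * growthFactor γ₂ Q)) / max x Q ^ 3 := by gcongr
        _ = _ := by ring
  have hlim : Tendsto (fun n => ∫ x in Ioi 0, (F n x - ℓ₂ n * (Ioi x₀).indicator I x)) atTop
      (𝓝 (∫ x in Ioi (0 : ℝ), (0 : ℝ))) := by
    refine tendsto_integral_filter_of_dominated_convergence
      (fun x => 8 * Cη * Cd * B x + L * (Cη * B x)) ?_ ?_ ?_ ?_
    · filter_upwards [hint] with n hn
      exact (hn.1.sub (hIi.const_mul _)).aestronglyMeasurable
    · filter_upwards [hFbound, hFval, hℓ, hd₁.zero, hd₁.close (1 / 4) (by norm_num)]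
        with n hn1 hn2 hn3 hn4 hn5
      filter_upwards [ae_restrict_mem measurableSet_Ioi] with x hx
      have hx : 0 < x := hx
      have hBx := hB0 x hx
      have e1 : |F n x| ≤ 8 * Cη * Cd * B x := by
        by_cases hq : q ((h₁ n).symm x) = ⊤
        · rw [(hn2 x hx).1 hq, abs_zero]; positivity
        · have hq' := lt_top_iff_ne_top.2 hq
          refine (hn1 x hx hq').trans ?_
          have e2 := abs_le.1 (abs_symm_sub_le hn4 (by norm_num) (by norm_num) hn5 hx.le)
          have e3 := hBb x _ hx (OrderIso.symm_nonneg hn4 hx.le) (by linarith [e2.2])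
            (by linarith [e2.1]) hq'
          gcongr
      have e2 : |ℓ₂ n * (Ioi x₀).indicator I x| ≤ L * (Cη * B x) := by
        rw [abs_mul]
        refine mul_le_mul hn3 ?_ (abs_nonneg _) hL
        by_cases hxx : x ∈ Ioi x₀
        · rw [indicator_of_mem hxx]; exact hBI x hx (h.fin_left x hxx)
        · rw [indicator_of_notMem hxx, abs_zero]; positivity
      exact (norm_sub_le _ _).trans (add_le_add e1 e2)
    · exact (hB.const_mul _).add ((hB.const_mul _).const_mul _)
    · have hcount : {x : ℝ | x ∈ Ioi 0 ∧ ¬ ContinuousWithinAt q (Ioi 0) x}.Countable :=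
        (h.anti_left.mono Ioi_subset_Ici_self).countable_not_continuousWithinAt
      have hne : ∀ᵐ x ∂(volume.restrict (Ioi (0 : ℝ))), x ≠ x₀ :=
        ae_restrict_of_ae (by simp [ae_iff])
      filter_upwards [ae_restrict_mem measurableSet_Ioi, hne,
        ae_restrict_of_ae (hcount.ae_notMem volume)] with x hx hxx hc
      have hx : 0 < x := hx
      have hqc : ContinuousAt q x := by
        by_contra hcon
        refine hc ⟨hx, fun hw => hcon (hw.continuousAt (Ioi_mem_nhds hx))⟩
      have hs : Tendsto (fun n => (h₁ n).symm x) atTop (𝓝 x) := by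
        rw [Metric.tendsto_nhds]
        intro ε hε
        have hε' : 0 < min (1 / 2) (ε / (4 * x)) := by positivity
        filter_upwards [hd₁.zero, hd₁.close _ hε'] with n hn1 hn2
        have := abs_symm_sub_le hn1 hε'.le (min_le_left _ _) hn2 hx.le
        rw [Real.dist_eq]
        refine this.trans_lt ?_
        calc 2 * min (1 / 2) (ε / (4 * x)) * x ≤ 2 * (ε / (4 * x)) * x := by
              gcongr; exact min_le_right _ _
          _ = ε / 2 := by field_simp; norm_num
          _ < ε := by linarith
      have hs0 : ∀ᶠ n in atTop, 0 ≤ (h₁ n).symm x := by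
        filter_upwards [hd₁.zero] with n hn using OrderIso.symm_nonneg hn hx.le
      rcases lt_or_gt_of_ne hxx with hlt | hgt
      · have hni : x ∉ Ioi x₀ := by simpa using hlt.le
        rw [indicator_of_notMem hni]
        simp only [mul_zero, sub_zero]
        refine tendsto_const_nhds.congr' ?_
        filter_upwards [hs.eventually (gt_mem_nhds hlt), hFval, hs0] with n hn1 hn2 hn3
        exact ((hn2 x hx).1 (h.top_left _ hn3 hn1)).symm
      · rw [indicator_of_mem (mem_Ioi.2 hgt)]
        have hqx := h.fin_left x hgt
        have hQt : Tendsto (fun n => q ((h₁ n).symm x)) atTop (𝓝 (q x)) := hqc.tendsto.comp hs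
        have hfin : ∀ᶠ n in atTop, q ((h₁ n).symm x) < ⊤ := by
          filter_upwards [hs.eventually (lt_mem_nhds hgt)] with n hn using h.fin_left _ hn
        have hQr : Tendsto (fun n => (q ((h₁ n).symm x)).toReal) atTop (𝓝 (q x).toReal) :=
          (ENNReal.tendsto_toReal hqx.ne).comp hQt
        have hQy : ∀ᶠ n in atTop, y₀ ≤ (q ((h₁ n).symm x)).toReal := by
          filter_upwards [hs0, hfin] with n hn1 hn2 using h.le_apply hn1 hn2
        have hQ0 : ∀ᶠ n in atTop, 0 ≤ (q ((h₁ n).symm x)).toReal :=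
          Eventually.of_forall fun n => ENNReal.toReal_nonneg
        have hbe : 0 < boundaryExponent γ₂ := by rw [boundaryExponent_eq]; positivity
        rcases (ENNReal.toReal_nonneg (a := q x)).eq_or_lt with h0 | h0
        · -- the boundary function vanishes at `x`
          have hqz : q x = 0 := by
            rcases (ENNReal.toReal_eq_zero_iff _).1 h0.symm with h1 | h1
            · exact h1
            · exact absurd h1 hqx.ne
          have hγ1 := h.gamma_lt_one hx.le hqz
          rw [← h0] at hQr
          have hIx : I x = 0 := by
            rw [hIdef, boundaryIntegrand₂, ← h0, Real.zero_rpow hbe.ne', zero_mul]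
          simp only [hIx, mul_zero, sub_zero]
          have h1 := (mul_growthFactor_tendsto_zero hγ1 hQ0 hQr).const_mul (8 * Cη * Cd / x ^ 3)
          rw [mul_zero] at h1
          refine squeeze_zero_norm' ?_ h1
          filter_upwards [hFbound, hfin] with n hn1 hn2
          refine (hn1 x hx hn2).trans ?_
          set Q := (q ((h₁ n).symm x)).toReal
          have hQ : 0 ≤ Q := ENNReal.toReal_nonneg
          have hQg : 0 ≤ Q * growthFactor γ₂ Q := by
            rw [growthFactor]; positivity
          calc 8 * Cη * Cd * (Q * growthFactor γ₂ Q / max x Q ^ 3)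
              ≤ 8 * Cη * Cd * (Q * growthFactor γ₂ Q / x ^ 3) := by
                gcongr; exact le_max_left _ _
            _ = _ := by ring
        · set Q₀ := (q x).toReal with hQ₀
          have hexp := hd₂.expand _ Q₀ h0 hQy hQr
          have hpow : Tendsto (fun n => (q ((h₁ n).symm x)).toReal ^ boundaryExponent γ₂) atTop
              (𝓝 (Q₀ ^ boundaryExponent γ₂)) := hQr.rpow_const (Or.inl h0.ne')
          have hdiff : Tendsto (fun n => ℓ₂ n * ((q ((h₁ n).symm x)).toReal ^ boundaryExponent γ₂ -
              Q₀ ^ boundaryExponent γ₂)) atTop (𝓝 0) := by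
            have e1 := (hpow.sub_const (Q₀ ^ boundaryExponent γ₂)).abs.const_mul L
            simp only [sub_self, abs_zero, mul_zero] at e1
            refine squeeze_zero_norm' ?_ e1
            filter_upwards [hℓ] with n hn
            rw [Real.norm_eq_abs, abs_mul]
            gcongr
          set b := fun n => (q ((h₁ n).symm x)).toReal with hb
          set a := fun n => h₂ n (b n) with ha
          have hat : Tendsto a atTop (𝓝 Q₀) := by
            have e1 : Tendsto (fun n => a n - b n) atTop (𝓝 0) := by
              rw [Metric.tendsto_nhds]
              intro ε hε
              have hbb : ∀ᶠ n in atTop, b n < Q₀ + 1 := hQr.eventually (gt_mem_nhds (by linarith))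
              filter_upwards [hbb, hd₂.close (ε / (Q₀ + 1)) (by positivity)] with n hn1 hn2
              rw [Real.dist_eq, sub_zero]
              refine (hn2 (b n) ENNReal.toReal_nonneg).trans_lt ?_
              rw [div_mul_eq_mul_div, div_lt_iff₀ (by positivity)]
              gcongr
            have := e1.add hQr
            simpa using this
          have hslope : Tendsto (fun n => (b n - a n) / r n - ℓ₂ n * Q₀ ^ boundaryExponent γ₂) atTop
              (𝓝 0) := by
            have e1 := hdiff.sub hexp
            rw [sub_zero] at e1
            refine e1.congr fun n => ?_
            simp only [ha, hb]
            ring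
          have hLb : ∀ᶠ n in atTop, |(b n - a n) / r n| ≤ L * Q₀ ^ boundaryExponent γ₂ + 1 := by
            have e1 : ∀ᶠ n in atTop, |(b n - a n) / r n - ℓ₂ n * Q₀ ^ boundaryExponent γ₂| < 1 := by
              have := hslope.abs
              rw [abs_zero] at this
              exact this.eventually (gt_mem_nhds one_pos)
            filter_upwards [e1, hℓ] with n hn1 hn2
            have hp : 0 ≤ Q₀ ^ boundaryExponent γ₂ := by positivity
            have e2 : |ℓ₂ n * Q₀ ^ boundaryExponent γ₂| ≤ L * Q₀ ^ boundaryExponent γ₂ := by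
              rw [abs_mul, abs_of_nonneg hp]; gcongr
            have := abs_add_le ((b n - a n) / r n - ℓ₂ n * Q₀ ^ boundaryExponent γ₂)
              (ℓ₂ n * Q₀ ^ boundaryExponent γ₂)
            rw [sub_add_cancel] at this
            linarith
          have havg := hν.tendsto_average hx h0 hat hQr hLb
          have htot := havg.add (hslope.mul_const (η (x, Q₀)))
          rw [zero_mul, add_zero] at htot
          refine htot.congr' ?_
          filter_upwards [hFval, hfin] with n hn1 hn2
          rw [(hn1 x hx).2 hn2]
          simp only [hIdef, boundaryIntegrand₂, ← hQ₀, ha, hb]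
          ring
  rw [integral_zero] at hlim
  refine hlim.congr' ?_
  filter_upwards [hint] with n hn
  rw [integral_sub hn.1 (hIi.const_mul _), hn.2, integral_const_mul]
  congr 2
  rw [integral_indicator measurableSet_Ioi, Measure.restrict_restrict measurableSet_Ioi,
    inter_eq_left.2 hsub]

end Expansion

section FullExpansion

variable {ν : Measure (ℝ × ℝ)} {η : ℝ × ℝ → ℝ} {q p : ℝ → ℝ≥0∞} {γ₁ γ₂ x₀ y₀ : ℝ}

theorem BoundaryPair.preimage_swap_distSet (h : BoundaryPair q p γ₁ γ₂ x₀ y₀) {g₁ g₂ : ℝ ≃o ℝ}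
    (h₁ : g₁ 0 = 0) (h₂ : g₂ 0 = 0) : Prod.swap ⁻¹' distSet p g₂ g₁ = distSet q g₁ g₂ :=
  ext fun _ => ⟨fun ⟨a, b, c⟩ => ⟨b, a, (h.galois _ _ (OrderIso.symm_nonneg h₁ b)
    (OrderIso.symm_nonneg h₂ a)).2 c⟩, fun ⟨a, b, c⟩ => ⟨b, a, (h.galois _ _
    (OrderIso.symm_nonneg h₁ a) (OrderIso.symm_nonneg h₂ b)).1 c⟩⟩

theorem BoundaryPair.measureReal_swap (h : BoundaryPair q p γ₁ γ₂ x₀ y₀) {g : ℝ ≃o ℝ}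
    (hg : g 0 = 0) : ν.real (distSet q g (OrderIso.refl ℝ)) =
      (ν.map Prod.swap).real (distSet p (OrderIso.refl ℝ) g) := by
  rw [measureReal_def, measureReal_def, Measure.map_apply measurable_swap
    (h.swap.measurableSet_distSet rfl), h.preimage_swap_distSet hg rfl]

theorem ExponentDensity.expansion (hν : ExponentDensity ν η) (h : BoundaryPair q p γ₁ γ₂ x₀ y₀)
    (hγ₁ : -1 / 2 < γ₁) (hγ₂ : -1 / 2 < γ₂) {r ℓ₁ ℓ₂ : ℕ → ℝ} {h₁ h₂ : ℕ → ℝ ≃o ℝ}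
    (hr : ∀ᶠ n in atTop, 0 < r n) (hd₁ : Distort γ₁ x₀ r ℓ₁ h₁) (hd₂ : Distort γ₂ y₀ r ℓ₂ h₂) :
    Tendsto (fun n => (ν.real (distSet q (h₁ n) (h₂ n)) - ν.real (failSet q)) / r n -
      (ℓ₁ n * ∫ v in Ioi y₀, boundaryIntegrand₂ p (η ∘ Prod.swap) γ₁ v) -
      ℓ₂ n * ∫ x in Ioi x₀, boundaryIntegrand₂ q η γ₂ x) atTop (𝓝 0) := by
  have e1 := hν.expansion_snd h hγ₂ hr hd₁ hd₂
  have e2 := hν.swap.expansion_snd h.swap hγ₁ hr (Distort.refl γ₂ y₀ r) hd₁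
  have e3 := e1.add e2
  rw [add_zero] at e3
  refine e3.congr' ?_
  filter_upwards [hd₁.zero] with n hn
  have e4 : ν.real (failSet q) = ν.real (distSet q (OrderIso.refl ℝ) (OrderIso.refl ℝ)) := rfl
  rw [e4, h.measureReal_swap (ν := ν) hn, h.measureReal_swap (ν := ν) (g := OrderIso.refl ℝ) rfl]
  ring

end FullExpansion

theorem gpdReal_boxCox {γ x : ℝ} (hx : 0 < x) : gpdReal γ (boxCox γ x) = x := by
  by_cases h : γ = 0
  · simp [gpdReal, boxCox, h, Real.exp_log hx]
  · simp only [gpdReal, h, if_false, one_add_mul_boxCox h]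
    rw [← Real.rpow_mul hx.le, mul_one_div_cancel h, Real.rpow_one]

theorem one_add_mul_boxCox_pos {γ x : ℝ} (hx : 0 < x) : 0 < 1 + γ * boxCox γ x := by
  by_cases h : γ = 0
  · simp [h]
  · rw [one_add_mul_boxCox h]; positivity

theorem continuousAt_gpdReal {γ v : ℝ} (h : 0 < 1 + γ * v) : ContinuousAt (gpdReal γ) v := by
  by_cases hγ : γ = 0
  · have : gpdReal γ = Real.exp := by funext v; simp [gpdReal, hγ]
    rw [this]; exact Real.continuous_exp.continuousAt
  · have : gpdReal γ = fun v => (1 + γ * v) ^ (1 / γ) := by funext v; simp [gpdReal, hγ]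
    rw [this]
    exact ContinuousAt.rpow_const (by fun_prop) (Or.inl h.ne')

theorem strictMonoOn_of_boxCox {γ r : ℝ} {H Y : ℝ → ℝ} {S : Set ℝ} (hr : 0 < r)
    (hH : ∀ s ∈ S, 0 < H s ∧ boxCox γ (r * H s) = Y s) (hY : StrictMonoOn Y S) :
    StrictMonoOn H S := by
  intro s hs t ht hst
  by_contra! hle
  have h1 : boxCox γ (r * H t) ≤ boxCox γ (r * H s) :=
    (boxCox_le_iff (mul_pos hr (hH t ht).1) (mul_pos hr (hH s hs).1)).2
      (mul_le_mul_of_nonneg_left hle hr.le)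
  rw [(hH s hs).2, (hH t ht).2] at h1
  exact absurd (hY hs ht hst) (not_lt.2 h1)

theorem continuousOn_of_boxCox {γ r : ℝ} {H Y : ℝ → ℝ} {S : Set ℝ} (hr : 0 < r)
    (hH : ∀ s ∈ S, 0 < H s ∧ boxCox γ (r * H s) = Y s) (hY : ContinuousOn Y S) :
    ContinuousOn H S := by
  have h1 : ContinuousOn (fun s => r⁻¹ * gpdReal γ (Y s)) S := by
    intro s hs
    have hpos : 0 < 1 + γ * Y s := by
      rw [← (hH s hs).2]; exact one_add_mul_boxCox_pos (mul_pos hr (hH s hs).1)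
    exact ContinuousWithinAt.mul continuousWithinAt_const
      ((continuousAt_gpdReal hpos).comp_continuousWithinAt (hY s hs))
  refine h1.congr fun s hs => ?_
  beta_reduce
  rw [← (hH s hs).2, gpdReal_boxCox (mul_pos hr (hH s hs).1), inv_mul_cancel_left₀ hr.ne']

theorem exists_orderIso_extend {H : ℝ → ℝ} {u X : ℝ} (hu : 0 < u) (huX : u < X)
    (hH : StrictMonoOn H (Icc u X)) (hc : ContinuousOn H (Icc u X)) (hpos : 0 < H u) :
    ∃ h : ℝ ≃o ℝ, h 0 = 0 ∧ (∀ s ∈ Icc u X, h s = H s) ∧ (∀ s, s ≤ u → h s = s * (H u / u)) ∧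
      ∀ s, X ≤ s → h s = s * (H X / X) := by
  have hX : 0 < X := hu.trans huX
  have hHX : H u < H X := hH ⟨le_rfl, huX.le⟩ ⟨huX.le, le_rfl⟩ huX
  have hHX0 : 0 < H X := hpos.trans hHX
  set g : ℝ → ℝ := fun s => H (max u (min s X)) + (min s u - u) * (H u / u) + (max s X - X) * (H X / X)
    with hg
  have hclamp : ∀ s, max u (min s X) ∈ Icc u X := fun s =>
    ⟨le_max_left _ _, max_le huX.le (min_le_right _ _)⟩
  have hgc : Continuous g := by
    have h1 : Continuous fun s => H (max u (min s X)) :=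
      hc.comp_continuous (by fun_prop) hclamp
    exact (h1.add (by fun_prop)).add (by fun_prop)
  have hlow : ∀ s, s ≤ u → g s = s * (H u / u) := by
    intro s hs
    have e1 : min s X = s := min_eq_left (by linarith)
    simp only [hg, e1, max_eq_left hs, min_eq_left hs, max_eq_right (show s ≤ X by linarith)]
    field_simp; ring
  have hmid : ∀ s ∈ Icc u X, g s = H s := by
    intro s hs
    simp only [hg, min_eq_left hs.2, max_eq_right hs.1, min_eq_right hs.1, max_eq_right hs.2]
    ring
  have hup : ∀ s, X ≤ s → g s = s * (H X / X) := by
    intro s hs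
    simp only [hg, min_eq_right hs, max_eq_right huX.le, min_eq_right (show u ≤ s by linarith),
      max_eq_left hs]
    field_simp; ring
  have hmono : StrictMono g := by
    have hm1 : StrictMonoOn g (Iic u) := by
      intro s hs t ht hst
      rw [hlow s hs, hlow t ht]
      have : 0 < H u / u := by positivity
      gcongr
    have hm2 : StrictMonoOn g (Icc u X) := hH.congr fun s hs => (hmid s hs).symm
    have hm3 : StrictMonoOn g (Ici X) := by
      intro s hs t ht hst
      rw [hup s hs, hup t ht]
      have : 0 < H X / X := by positivity
      gcongr
    have hm12 : StrictMonoOn g (Iic X) := by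
      rw [← Iic_union_Icc_eq_Iic huX.le]
      exact hm1.union hm2 isGreatest_Iic (isLeast_Icc huX.le)
    rw [← strictMonoOn_univ, ← Iic_union_Ici (a := X)]
    exact hm12.union hm3 isGreatest_Iic isLeast_Ici
  have hsurj : Function.Surjective g := by
    refine hgc.surjective ?_ ?_
    · have h1 : Tendsto (fun s : ℝ => s * (H X / X)) atTop atTop :=
        tendsto_id.atTop_mul_const (by positivity)
      refine h1.congr' ?_
      filter_upwards [eventually_ge_atTop X] with s hs using (hup s hs).symm
    · have h1 : Tendsto (fun s : ℝ => s * (H u / u)) atBot atBot :=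
        tendsto_id.atBot_mul_const (by positivity)
      refine h1.congr' ?_
      filter_upwards [eventually_le_atBot u] with s hs using (hlow s hs).symm
  refine ⟨hmono.orderIsoOfSurjective g hsurj, ?_, hmid, hlow, hup⟩
  change g 0 = 0
  rw [hlow 0 hu.le, zero_mul]

theorem growthFactor_le_of_ge {γ X s : ℝ} (hX : 1 ≤ X) (hs : X ≤ s) :
    growthFactor γ X ≤ 2 * growthFactor γ s := by
  have hs1 : 1 ≤ s := hX.trans hs
  have hl : |Real.log X| ≤ |Real.log s| := by
    rw [abs_of_nonneg (Real.log_nonneg hX), abs_of_nonneg (Real.log_nonneg hs1)]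
    exact Real.log_le_log (by linarith) hs
  have hp : X ^ (-γ) ≤ 1 + s ^ (-γ) := by
    have : 0 < s ^ (-γ) := by positivity
    rcases le_total 0 γ with h | h
    · have := Real.rpow_le_one_of_one_le_of_nonpos hX (show -γ ≤ 0 by linarith)
      linarith
    · have := Real.rpow_le_rpow (by linarith) hs (show 0 ≤ -γ by linarith)
      linarith
  have h0 : 0 < s ^ (-γ) := by positivity
  have h1 := abs_nonneg (Real.log s)
  rw [growthFactor, growthFactor]
  linarith

theorem growthFactor_le_of_le {γ u s : ℝ} (hs0 : 0 < s) (hu : u ≤ 1) (hs : s ≤ u) :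
    growthFactor γ u ≤ 2 * growthFactor γ s := by
  have hu0 : 0 < u := hs0.trans_le hs
  have hl : |Real.log u| ≤ |Real.log s| := by
    rw [abs_of_nonpos (Real.log_nonpos hu0.le hu), abs_of_nonpos (Real.log_nonpos hs0.le (hs.trans hu))]
    have := Real.log_le_log hs0 hs
    linarith
  have hp : u ^ (-γ) ≤ 1 + s ^ (-γ) := by
    have : 0 < s ^ (-γ) := by positivity
    rcases le_total 0 γ with h | h
    · have := Real.rpow_le_rpow_of_nonpos hs0 hs (show -γ ≤ 0 by linarith)
      linarith
    · have := Real.rpow_le_one hu0.le hu (show 0 ≤ -γ by linarith)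
      linarith
  have h0 : 0 < s ^ (-γ) := by positivity
  have h1 := abs_nonneg (Real.log s)
  rw [growthFactor, growthFactor]
  linarith

theorem CutOff.eventually_le {γ x : ℝ} {η err u : ℕ → ℝ} (hu : CutOff γ x η err u) (hx : 0 ≤ x)
    {s : ℕ → ℝ} {s₀ : ℝ} (hs₀ : 0 < s₀) (hs : ∀ᶠ n in atTop, x ≤ s n) (hlim : Tendsto s atTop (𝓝 s₀)) :
    ∀ᶠ n in atTop, u n ≤ s n := by
  rcases hx.eq_or_lt with h0 | h0
  · filter_upwards [(hu.tendsto_of_zero h0.symm).eventually (gt_mem_nhds (half_pos hs₀)),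
      hlim.eventually (lt_mem_nhds (half_lt_self hs₀))] with n h1 h2
    linarith
  · filter_upwards [hs] with n hn
    rwa [hu.eq_of_pos h0]

theorem tendsto_rpow_neg_three_halves {η : ℕ → ℝ} (hη0 : ∀ᶠ n in atTop, 0 < η n)
    (hη : Tendsto η atTop (𝓝 0)) : Tendsto (fun n => η n ^ (-(3 / 2) : ℝ)) atTop atTop := by
  have h1 : Tendsto (fun n => η n ^ (3 / 2 : ℝ)) atTop (𝓝[>] 0) := by
    refine tendsto_nhdsWithin_iff.2 ⟨?_, ?_⟩
    · have := hη.rpow_const (p := 3 / 2) (Or.inr (by norm_num))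
      rwa [Real.zero_rpow (by norm_num)] at this
    · filter_upwards [hη0] with n hn
      exact Real.rpow_pos_of_pos hn _
  refine h1.inv_tendsto_nhdsGT_zero.congr' ?_
  filter_upwards [hη0] with n hn
  rw [Real.rpow_neg hn.le]; rfl

theorem exists_distort {γ x : ℝ} {η err u ℓ : ℕ → ℝ} {H : ℕ → ℝ → ℝ} (hx : 0 ≤ x)
    (hη0 : ∀ᶠ n in atTop, 0 < η n) (hη : Tendsto η atTop (𝓝 0)) (hu : CutOff γ x η err u)
    (hℓ : ∃ L : ℝ, 0 ≤ L ∧ ∀ᶠ n in atTop, |ℓ n| ≤ L)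
    (hmono : ∀ᶠ n in atTop, StrictMonoOn (H n) (Icc (u n) (η n ^ (-(3 / 2) : ℝ))))
    (hcont : ∀ᶠ n in atTop, ContinuousOn (H n) (Icc (u n) (η n ^ (-(3 / 2) : ℝ))))
    (hpos : ∀ᶠ n in atTop, ∀ s ∈ Icc (u n) (η n ^ (-(3 / 2) : ℝ)), 0 < H n s)
    (hclose : ∀ ε : ℝ, 0 < ε → ∀ᶠ n in atTop, ∀ s ∈ Icc (u n) (η n ^ (-(3 / 2) : ℝ)),
      |H n s - s| ≤ ε * s) (hpert : Perturb γ η u H ℓ) :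
    ∃ h : ℕ → ℝ ≃o ℝ, Distort γ x η ℓ h ∧
      ∀ᶠ n in atTop, ∀ s ∈ Icc (u n) (η n ^ (-(3 / 2) : ℝ)), h n s = H n s := by
  have hXt := tendsto_rpow_neg_three_halves hη0 hη
  set X := fun n => η n ^ (-(3 / 2) : ℝ) with hX
  obtain ⟨L, hL, hℓ⟩ := hℓ
  have huX : ∀ᶠ n in atTop, u n < X n := by
    rcases hx.eq_or_lt with h0 | h0
    · filter_upwards [(hu.tendsto_of_zero h0.symm).eventually (gt_mem_nhds one_pos),
        hXt.eventually_gt_atTop 1] with n h1 h2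
      linarith
    · filter_upwards [hXt.eventually_gt_atTop x] with n hn
      rwa [hu.eq_of_pos h0]
  have hex : ∀ᶠ n in atTop, ∃ h : ℝ ≃o ℝ, h 0 = 0 ∧ (∀ s ∈ Icc (u n) (X n), h s = H n s) ∧
      (∀ s, s ≤ u n → h s = s * (H n (u n) / u n)) ∧ ∀ s, X n ≤ s → h s = s * (H n (X n) / X n) := by
    filter_upwards [huX, hu.pos, hmono, hcont, hpos] with n h1 h2 h3 h4 h5
    exact exists_orderIso_extend h2 h1 h3 h4 (h5 _ ⟨le_rfl, h1.le⟩)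
  obtain ⟨N, hN⟩ := eventually_atTop.1 hex
  choose! h hh using hN
  have hh' : ∀ᶠ n in atTop, h n 0 = 0 ∧ (∀ s ∈ Icc (u n) (X n), h n s = H n s) ∧
      (∀ s, s ≤ u n → h n s = s * (H n (u n) / u n)) ∧
      ∀ s, X n ≤ s → h n s = s * (H n (X n) / X n) := by
    filter_upwards [eventually_ge_atTop N] with n hn using hh n hn
  have hscale : ∀ {s v w ε : ℝ}, 0 ≤ s → 0 < v → |w - v| ≤ ε * v → |s * (w / v) - s| ≤ ε * s := by
    intro s v w ε hs hv hw
    have e : s * (w / v) - s = s / v * (w - v) := by field_simp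
    rw [e, abs_mul, abs_of_nonneg (by positivity)]
    calc s / v * |w - v| ≤ s / v * (ε * v) := by gcongr
      _ = ε * s := by field_simp
  refine ⟨h, ⟨?_, ⟨L, hL, hℓ⟩, ?_, ⟨(L + 1) * 2, by positivity, ?_⟩, ?_⟩, ?_⟩
  · filter_upwards [hh'] with n hn using hn.1
  · intro ε hε
    filter_upwards [hh', hclose ε hε, huX, hu.pos] with n ⟨_, h1, h2, h3⟩ h4 h5 h6 s hs
    rcases le_or_gt s (u n) with hsu | hsu
    · rw [h2 s hsu]
      exact hscale hs h6 (h4 _ ⟨le_rfl, h5.le⟩)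
    · rcases le_or_gt s (X n) with hsX | hsX
      · rw [h1 s ⟨hsu.le, hsX⟩]; exact h4 s ⟨hsu.le, hsX⟩
      · rw [h3 s hsX.le]
        exact hscale hs (h6.trans h5) (h4 _ ⟨h5.le, le_rfl⟩)
  · have hu1 : x = 0 → ∀ᶠ n in atTop, u n ≤ 1 := fun h0 => by
      filter_upwards [(hu.tendsto_of_zero h0).eventually (gt_mem_nhds one_pos)] with n hn using hn.le
    have hu1' : ∀ᶠ n in atTop, x = 0 → u n ≤ 1 := by
      by_cases h0 : x = 0
      · filter_upwards [hu1 h0] with n hn _ using hn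
      · exact Eventually.of_forall fun n h => absurd h h0
    filter_upwards [hh', hpert 1 one_pos, huX, hu.pos, hη0, hℓ, hu1', hXt.eventually_ge_atTop 1]
      with n ⟨_, h1, h2, h3⟩ h4 h5 h6 h7 h8 h9 h10 s hs hxs
    have hmid : ∀ s ∈ Icc (u n) (X n), |H n s - s| ≤ (L + 1) * η n * growthFactor γ s * s := by
      intro s hs
      have hs0 : 0 < s := h6.trans_le hs.1
      have e1 := h4 s hs
      have e2 := rpow_boundaryExponent_le (γ := γ) hs0.le
      have e3 : |η n * ℓ n * s ^ boundaryExponent γ| ≤ η n * L * (s * growthFactor γ s) := by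
        rw [abs_mul, abs_mul, abs_of_pos h7, abs_of_nonneg (by positivity : 0 ≤ s ^ boundaryExponent γ)]
        gcongr
      have e4 := abs_sub (H n s - s + η n * ℓ n * s ^ boundaryExponent γ) (η n * ℓ n * s ^ boundaryExponent γ)
      rw [add_sub_cancel_right] at e4
      have e5 : 1 * η n * (s * (1 + |Real.log s| + s ^ (-γ))) = η n * (s * growthFactor γ s) := by
        rw [growthFactor]; ring
      rw [e5] at e1
      calc |H n s - s| ≤ _ := e4
        _ ≤ η n * (s * growthFactor γ s) + η n * L * (s * growthFactor γ s) := add_le_add e1 e3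
        _ = _ := by ring
    have hfac : ∀ v ∈ Icc (u n) (X n), growthFactor γ v ≤ 2 * growthFactor γ s →
        |s * (H n v / v) - s| ≤ (L + 1) * 2 * η n * (s * growthFactor γ s) := by
      intro v hv hle
      have hv0 : 0 < v := h6.trans_le hv.1
      refine (hscale hs.le hv0 (hmid v hv)).trans ?_
      calc (L + 1) * η n * growthFactor γ v * s ≤ (L + 1) * η n * (2 * growthFactor γ s) * s := by
            gcongr
        _ = _ := by ring
    rcases le_or_gt (u n) s with hsu | hsu
    · rcases le_or_gt s (X n) with hsX | hsX
      · rw [h1 s ⟨hsu, hsX⟩]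
        refine (hmid s ⟨hsu, hsX⟩).trans ?_
        have : 0 ≤ (L + 1) * η n * growthFactor γ s * s := (abs_nonneg _).trans (hmid s ⟨hsu, hsX⟩)
        linarith
      · rw [h3 s hsX.le]
        exact hfac _ ⟨h5.le, le_rfl⟩ (growthFactor_le_of_ge h10 hsX.le)
    · have hx0 : x = 0 := by
        by_contra hne
        have := hu.eq_of_pos (lt_of_le_of_ne hx (Ne.symm hne)) n
        linarith
      rw [h2 s hsu.le]
      exact hfac _ ⟨le_rfl, h5.le⟩ (growthFactor_le_of_le hs (h9 hx0) hsu.le)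
  · intro s s₀ hs₀ hs hlim
    have hgf : Tendsto (fun n => s n * growthFactor γ (s n)) atTop (𝓝 (s₀ * growthFactor γ s₀)) := by
      refine hlim.mul (((tendsto_const_nhds (x := (1 : ℝ))).add (hlim.log hs₀.ne').abs).add ?_)
      exact hlim.rpow_const (Or.inl hs₀.ne')
    rw [Metric.tendsto_nhds]
    intro ε hε
    set G := s₀ * growthFactor γ s₀ + 1 with hG
    have hG0 : 0 < G := by
      have := growthFactor_pos (γ := γ) hs₀
      positivity
    filter_upwards [hh', hpert (ε / (2 * G)) (by positivity), hu.eventually_le hx hs₀ hs hlim,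
      hlim.eventually (gt_mem_nhds (lt_add_one s₀)), hXt.eventually_gt_atTop (s₀ + 1), hη0,
      hgf.eventually (gt_mem_nhds (lt_add_one _))] with n ⟨_, h1, _, _⟩ h4 h5 h6 h7 h8 h9
    have hmem : s n ∈ Icc (u n) (X n) := ⟨h5, (h6.trans h7).le⟩
    have e1 := h4 _ hmem
    rw [← h1 _ hmem] at e1
    have e2 : (h n (s n) - s n) / η n + ℓ n * s n ^ boundaryExponent γ =
        (h n (s n) - s n + η n * ℓ n * s n ^ boundaryExponent γ) / η n := by
      field_simp
    rw [Real.dist_eq, sub_zero, e2, abs_div, abs_of_pos h8, div_lt_iff₀ h8]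
    refine e1.trans_lt ?_
    have e3 : s n * (1 + |Real.log (s n)| + s n ^ (-γ)) < G := h9
    calc ε / (2 * G) * η n * (s n * (1 + |Real.log (s n)| + s n ^ (-γ)))
        ≤ ε / (2 * G) * η n * G := by gcongr
      _ = ε / 2 * η n := by field_simp
      _ < ε * η n := by gcongr; linarith
  · filter_upwards [hh'] with n hn using hn.2.1

/-- The coordinates of a point in the plane. -/
def coord : Fin 2 → ℝ × ℝ → ℝ := ![Prod.fst, Prod.snd]

theorem coord_zero (z : ℝ × ℝ) : coord 0 z = z.1 := rfl

theorem coord_one (z : ℝ × ℝ) : coord 1 z = z.2 := rfl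

theorem measurable_coord (i : Fin 2) : Measurable (coord i) := by
  fin_cases i
  · exact measurable_fst
  · exact measurable_snd

theorem margins_eq (μ : Measure (ℝ × ℝ)) (i : Fin 2) : margins μ i = cdf (μ.map (coord i)) := by
  fin_cases i <;> rfl

/-- `f` is of smaller order than `rt`. -/
def Negl (rt f : ℕ → ℝ) : Prop := Tendsto (fun n => f n / rt n) atTop (𝓝 0)

section Negl

variable {rt f g : ℕ → ℝ}

theorem Negl.zero (rt : ℕ → ℝ) : Negl rt (fun _ => 0) := by simp [Negl]

theorem Negl.add (hf : Negl rt f) (hg : Negl rt g) : Negl rt (fun n => f n + g n) := by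
  simpa [Negl, add_div] using Tendsto.add hf hg

theorem Negl.const_mul (c : ℝ) (hf : Negl rt f) : Negl rt (fun n => c * f n) := by
  simpa [Negl, mul_div_assoc] using Tendsto.const_mul c hf

theorem Negl.mono (hrt : ∀ᶠ n in atTop, 0 < rt n) (hg : Negl rt g)
    (h : ∀ᶠ n in atTop, |f n| ≤ g n) : Negl rt f := by
  refine squeeze_zero_norm' ?_ hg
  filter_upwards [h, hrt] with n h1 h2
  rw [Real.norm_eq_abs, abs_div, abs_of_pos h2]
  gcongr

theorem Negl.mul_bounded (hrt : ∀ᶠ n in atTop, 0 < rt n) (hf : Negl rt f) {M : ℝ}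
    (hg : ∀ᶠ n in atTop, |g n| ≤ M) : Negl rt (fun n => g n * f n) := by
  have h1 : Negl rt (fun n => M * |f n|) := by
    have : Negl rt (fun n => |f n|) := by
      have h2 := Tendsto.abs hf
      rw [abs_zero] at h2
      refine h2.congr' ?_
      filter_upwards [hrt] with n hn
      rw [abs_div, abs_of_pos hn]
    exact this.const_mul M
  refine h1.mono hrt ?_
  filter_upwards [hg] with n hn
  rw [abs_mul]
  gcongr

theorem Negl.tendsto_zero (hrt : ∀ᶠ n in atTop, 0 < rt n) (hrt0 : Tendsto rt atTop (𝓝 0))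
    (hf : Negl rt f) : Tendsto f atTop (𝓝 0) := by
  have := Tendsto.mul hf hrt0
  rw [zero_mul] at this
  refine this.congr' ?_
  filter_upwards [hrt] with n hn
  field_simp

end Negl

/-- The assumptions on the law, the exponent measure and the boundary function, together with cut-off
sequences `u` for the rate `rt`. -/
structure Base (μ ν : Measure (ℝ × ℝ)) (η : ℝ × ℝ → ℝ) (γ ρ : Fin 2 → ℝ) (a b A : Fin 2 → ℝ → ℝ)
    (q p : ℝ → ℝ≥0∞) (x₀ : Fin 2 → ℝ) (rt err : ℕ → ℝ) (u : Fin 2 → ℕ → ℝ) : Prop where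
  regular : ∀ i, ∃ t₀, RegularTailQ (μ.map (coord i)) t₀
  second : ∀ i, SecondOrder (margins μ i) (γ i) (ρ i) (a i) (b i) (A i)
  density : ExponentDensity ν η
  pair : BoundaryPair q p (γ 0) (γ 1) (x₀ 0) (x₀ 1)
  index : ∀ i, -1 / 2 < γ i
  rt_pos : ∀ᶠ n in atTop, 0 < rt n
  rt_tendsto : Tendsto rt atTop (𝓝 0)
  cut : ∀ i, CutOff (γ i) (x₀ i) rt err (u i)

/-- The upper cut-off point. -/
def topCut (rt : ℕ → ℝ) (n : ℕ) : ℝ := rt n ^ (-(3 / 2) : ℝ)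

/-- The standardized image of `U(d C)` under increasing coordinatewise transformations. -/
def transImage (μ : Measure (ℝ × ℝ)) (γ a b : Fin 2 → ℝ) (d : ℝ) (f g : ℝ → ℝ) (C : Set (ℝ × ℝ)) :
    Set (ℝ≥0∞ × ℝ≥0∞) :=
  (fun z : ℝ × ℝ => standardize γ a b (f z.1, g z.2)) '' tailImage (margins μ) d C

/-- A standardization of the observations at level `t n`, applied to increasing transformations `aff` of
the points `U (d s)`, with the expansion `H` of the standardized points. -/
structure Scheme (μ ν : Measure (ℝ × ℝ)) (γ : Fin 2 → ℝ) (a b A : Fin 2 → ℝ → ℝ)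
    (q : ℝ → ℝ≥0∞) (rt : ℕ → ℝ) (u : Fin 2 → ℕ → ℝ) (d t r : ℕ → ℝ)
    (aff H : Fin 2 → ℕ → ℝ → ℝ) (ℓ : Fin 2 → ℕ → ℝ) : Prop where
  ratio : ∃ m M : ℝ, 0 < m ∧ ∀ᶠ n in atTop, m ≤ r n ∧ r n ≤ M
  t_tendsto : Tendsto t atTop atTop
  d_large : ∀ B : ℝ, ∀ i, ∀ᶠ n in atTop, ∀ s, u i n ≤ s → B ≤ d n * s
  d_pos : ∀ n, 0 < d n
  aff_mono : ∀ i, ∀ᶠ n in atTop, StrictMono (aff i n)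
  aff_cont : ∀ i n, Continuous (aff i n)
  value : ∀ i, ∀ᶠ n in atTop, ∀ s ∈ Icc (u i n) (topCut rt n), 0 < H i n s ∧
    boxCox (γ i) (r n * H i n s) = (aff i n (tailQ (margins μ i) (d n * s)) - b i (t n)) / a i (t n)
  close : ∀ i, ∀ ε : ℝ, 0 < ε → ∀ᶠ n in atTop, ∀ s ∈ Icc (u i n) (topCut rt n),
    |H i n s - s| ≤ ε * s
  pert : ∀ i, Perturb (γ i) rt (u i) (H i) (ℓ i)
  bounded : ∀ i, ∃ L : ℝ, 0 ≤ L ∧ ∀ᶠ n in atTop, |ℓ i n| ≤ L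
  err : ∀ i, Negl rt (fun n => |A i (t n)|)
  bias : ∀ M : ℝ, 0 < M → ∃ f : ℕ → ℝ, Negl rt f ∧ ∀ᶠ n in atTop, ∀ C ∈ testSets q,
    (∀ z ∈ C, 1 / M ≤ max z.1 z.2) → BiasBound μ ν γ a b (t n) (f n)
      (transImage μ γ (fun i => a i (t n)) (fun i => b i (t n)) (d n) (aff 0 n) (aff 1 n) C)

section Scheme

variable {μ ν : Measure (ℝ × ℝ)} {η : ℝ × ℝ → ℝ} {γ ρ : Fin 2 → ℝ}
  {a b A : Fin 2 → ℝ → ℝ} {q p : ℝ → ℝ≥0∞} {x₀ : Fin 2 → ℝ} {rt err : ℕ → ℝ} {u : Fin 2 → ℕ → ℝ}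
  {d t r : ℕ → ℝ} {aff H : Fin 2 → ℕ → ℝ → ℝ} {ℓ : Fin 2 → ℕ → ℝ}

theorem isProbabilityMeasure_coord (μ : Measure (ℝ × ℝ)) [IsProbabilityMeasure μ] (i : Fin 2) :
    IsProbabilityMeasure (μ.map (coord i)) :=
  Measure.isProbabilityMeasure_map (measurable_coord i).aemeasurable

theorem Base.nonneg (hB : Base μ ν η γ ρ a b A q p x₀ rt err u) (i : Fin 2) : 0 ≤ x₀ i := by
  fin_cases i
  · exact hB.pair.nonneg_left
  · exact hB.pair.nonneg_right

theorem Base.topCut_tendsto (hB : Base μ ν η γ ρ a b A q p x₀ rt err u) :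
    Tendsto (topCut rt) atTop atTop := tendsto_rpow_neg_three_halves hB.rt_pos hB.rt_tendsto

theorem Base.cut_lt_topCut (hB : Base μ ν η γ ρ a b A q p x₀ rt err u) (i : Fin 2) :
    ∀ᶠ n in atTop, u i n < topCut rt n := by
  rcases (hB.nonneg i).eq_or_lt with h0 | h0
  · filter_upwards [((hB.cut i).tendsto_of_zero h0.symm).eventually (gt_mem_nhds one_pos),
      hB.topCut_tendsto.eventually_gt_atTop 1] with n h1 h2
    linarith
  · filter_upwards [hB.topCut_tendsto.eventually_gt_atTop (x₀ i)] with n hn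
    rwa [(hB.cut i).eq_of_pos h0]

theorem Base.negl_inv_topCut (hB : Base μ ν η γ ρ a b A q p x₀ rt err u) :
    Negl rt (fun n => 1 / topCut rt n) := by
  have h1 := hB.rt_tendsto.rpow_const (p := 1 / 2) (Or.inr (by norm_num))
  rw [Real.zero_rpow (by norm_num)] at h1
  refine h1.congr' ?_
  filter_upwards [hB.rt_pos] with n hn
  rw [topCut, Real.rpow_neg hn.le, div_inv_eq_mul, one_mul,
    show (3 / 2 : ℝ) = 1 / 2 + 1 by norm_num, Real.rpow_add hn, Real.rpow_one]
  field_simp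

theorem Scheme.r_pos (hS : Scheme μ ν γ a b A q rt u d t r aff H ℓ) : ∀ᶠ n in atTop, 0 < r n := by
  obtain ⟨m, M, hm, h⟩ := hS.ratio
  filter_upwards [h] with n hn using hm.trans_le hn.1

theorem Base.a_pos (hB : Base μ ν η γ ρ a b A q p x₀ rt err u)
    (hS : Scheme μ ν γ a b A q rt u d t r aff H ℓ) (i : Fin 2) : ∀ᶠ n in atTop, 0 < a i (t n) := by
  filter_upwards [hS.t_tendsto.eventually_gt_atTop 0] with n hn using (hB.second i).a_pos _ hn

theorem Scheme.negl_inv_top (hB : Base μ ν η γ ρ a b A q p x₀ rt err u)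
    (hS : Scheme μ ν γ a b A q rt u d t r aff H ℓ) (i : Fin 2) :
    Negl rt (fun n => 1 / (r n * H i n (topCut rt n))) := by
  obtain ⟨m, M, hm, hmM⟩ := hS.ratio
  refine ((hB.negl_inv_topCut).const_mul (2 / m)).mono hB.rt_pos ?_
  filter_upwards [hmM, hS.close i (1 / 2) (by norm_num), hB.cut_lt_topCut i,
    hB.topCut_tendsto.eventually_gt_atTop 0, hS.value i] with n h1 h2 h3 h4 h5
  have hmem : topCut rt n ∈ Icc (u i n) (topCut rt n) := ⟨h3.le, le_rfl⟩
  have h6 : topCut rt n / 2 ≤ H i n (topCut rt n) := by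
    have := (abs_le.1 (h2 _ hmem)).1; linarith
  have h7 := (h5 _ hmem).1
  have hr : 0 < r n := hm.trans_le h1.1
  rw [abs_of_nonneg (by positivity)]
  calc 1 / (r n * H i n (topCut rt n)) ≤ 1 / (m * (topCut rt n / 2)) := by
        gcongr; exact h1.1
    _ = _ := by field_simp

variable [IsProbabilityMeasure μ]

/-- The transformed quantiles are strictly increasing and continuous above the cut-off point. -/
theorem Scheme.strictMonoOn (hB : Base μ ν η γ ρ a b A q p x₀ rt err u)
    (hS : Scheme μ ν γ a b A q rt u d t r aff H ℓ) (i : Fin 2) :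
    ∀ᶠ n in atTop, StrictMonoOn (fun s => aff i n (tailQ (margins μ i) (d n * s))) (Ici (u i n)) ∧
      ContinuousOn (fun s => aff i n (tailQ (margins μ i) (d n * s))) (Ici (u i n)) := by
  have := isProbabilityMeasure_coord μ i
  obtain ⟨t₀, ht₀⟩ := hB.regular i
  filter_upwards [hS.aff_mono i, hS.d_large t₀ i] with n h1 h2
  rw [margins_eq]
  have hd := hS.d_pos n
  have hmaps : MapsTo (fun s => d n * s) (Ici (u i n)) (Ici t₀) := fun s hs => h2 s hs
  refine ⟨fun s hs s' hs' hlt => h1 (ht₀.strictMono (hmaps hs) (hmaps hs') ?_), ?_⟩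
  · exact mul_lt_mul_of_pos_left hlt hd
  · exact (hS.aff_cont i n).comp_continuousOn (ht₀.cont.comp (by fun_prop) hmaps)

theorem Scheme.exists_distort (hB : Base μ ν η γ ρ a b A q p x₀ rt err u)
    (hS : Scheme μ ν γ a b A q rt u d t r aff H ℓ) (i : Fin 2) :
    ∃ h : ℕ → ℝ ≃o ℝ, Distort (γ i) (x₀ i) rt (ℓ i) h ∧
      ∀ᶠ n in atTop, ∀ s ∈ Icc (u i n) (topCut rt n), h n s = H i n s := by
  have key : ∀ᶠ n in atTop, StrictMonoOn (H i n) (Icc (u i n) (topCut rt n)) ∧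
      ContinuousOn (H i n) (Icc (u i n) (topCut rt n)) := by
    filter_upwards [hS.strictMonoOn hB i, hS.value i, hB.a_pos hS i, hS.r_pos] with n h1 h2 h3 h4
    refine ⟨strictMonoOn_of_boxCox h4 h2 ?_, continuousOn_of_boxCox h4 h2 ?_⟩
    · intro s hs s' hs' hlt
      have := h1.1 (mem_Ici.2 hs.1) (mem_Ici.2 hs'.1) hlt
      beta_reduce at this ⊢
      gcongr
    · exact ((h1.2.mono Icc_subset_Ici_self).sub continuousOn_const).div_const _
  refine FailureProb.exists_distort (hB.nonneg i) hB.rt_pos hB.rt_tendsto (hB.cut i) (hS.bounded i)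
    ?_ ?_ ?_ (hS.close i) (hS.pert i)
  · filter_upwards [key] with n hn using hn.1
  · filter_upwards [key] with n hn using hn.2
  · filter_upwards [hS.value i] with n hn s hs using (hn s hs).1

theorem exists_boxCox_one_add_ge (γ : ℝ) :
    ∃ δ₀ : ℝ, 0 < δ₀ ∧ ∀ δ : ℝ, 0 ≤ δ → δ ≤ δ₀ → δ / 2 ≤ boxCox γ (1 + δ) := by
  have hd : HasDerivAt (boxCox γ) 1 1 := by
    by_cases h : γ = 0
    · have : boxCox γ = Real.log := by funext x; simp [boxCox, h]
      rw [this]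
      simpa using Real.hasDerivAt_log (one_ne_zero)
    · have : boxCox γ = fun x => (x ^ γ - 1) / γ := by funext x; simp [boxCox, h]
      rw [this]
      have h1 := ((Real.hasDerivAt_rpow_const (x := 1) (p := γ) (Or.inl one_ne_zero)).sub_const 1).div_const γ
      simpa [h] using h1
  have h1 := (hasDerivAt_iff_isLittleO_nhds_zero.1 hd).bound (show (0 : ℝ) < 1 / 2 by norm_num)
  obtain ⟨ε, hε, hball⟩ := Metric.eventually_nhds_iff.1 h1
  refine ⟨ε / 2, by positivity, fun δ hδ0 hδ => ?_⟩
  have h2 := hball (y := δ) (by rw [Real.dist_eq, sub_zero, abs_of_nonneg hδ0]; linarith)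
  rw [boxCox_one, smul_eq_mul, mul_one, sub_zero, Real.norm_eq_abs, Real.norm_eq_abs,
    abs_of_nonneg hδ0] at h2
  have := (abs_le.1 h2).1
  linarith

theorem Scheme.marginal_le (hB : Base μ ν η γ ρ a b A q p x₀ rt err u)
    (hS : Scheme μ ν γ a b A q rt u d t r aff H ℓ) (i : Fin 2) {c : ℝ} (hc : 0 < c) :
    ∃ g : ℕ → ℝ, Negl rt g ∧ ∀ᶠ n in atTop, ∀ s ∈ Icc (u i n) (topCut rt n), c ≤ s →
      t n * μ.real {z | aff i n (tailQ (margins μ i) (d n * s)) ≤ coord i z} ≤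
        1 / (r n * H i n s) + g n := by
  have := isProbabilityMeasure_coord μ i
  obtain ⟨t₀, ht₀⟩ := hB.regular i
  obtain ⟨m, M, hm, hmM⟩ := hS.ratio
  have hc₁ : 0 < m * c / 4 := by positivity
  obtain ⟨C, t₁, hC, ht₁, hb⟩ := (hB.second i).bound hc₁
  obtain ⟨δ₀, hδ₀, hbox⟩ := exists_boxCox_one_add_ge (γ i)
  have herr0 := (hS.err i).tendsto_zero hB.rt_pos hB.rt_tendsto
  have hδ : Tendsto (fun n => 2 * C * |A i (t n)|) atTop (𝓝 0) := by
    simpa using herr0.const_mul (2 * C)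
  refine ⟨fun n => (2 * C / (m * c / 2)) * |A i (t n)|, (hS.err i).const_mul _, ?_⟩
  filter_upwards [hmM, hS.value i, hS.close i (1 / 2) (by norm_num), hB.a_pos hS i,
    hS.t_tendsto.eventually_gt_atTop (max t₁ (max t₀ t₁ / (m * c / 4))),
    hδ.eventually (gt_mem_nhds (lt_min hδ₀ one_pos))] with n h1 h2 h3 h4 h5 h6 s hs hcs
  have ht1 : t₁ < t n := (le_max_left _ _).trans_lt h5
  have ht2 : max t₀ t₁ < t n * (m * c / 4) := by
    rw [← div_lt_iff₀ hc₁]; exact (le_max_right _ _).trans_lt h5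
  have ht0 : 0 < t n := by linarith
  obtain ⟨hHpos, hHeq⟩ := h2 s hs
  have hHs : s / 2 ≤ H i n s := by have := (abs_le.1 (h3 s hs)).1; linarith
  set δ := 2 * C * |A i (t n)| with hδdef
  have hδ0 : 0 ≤ δ := by positivity
  have hr : 0 < r n := hm.trans_le h1.1
  set y := r n * H i n s with hy
  have hy0 : 0 < y := mul_pos hr hHpos
  have hyc : m * c / 2 ≤ y := by
    have : m * (c / 2) ≤ r n * H i n s := mul_le_mul h1.1 (by linarith) (by positivity) hr.le
    linarith
  have hδ1 : δ < 1 := h6.trans_le (min_le_right _ _)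
  set x := y / (1 + δ) with hx
  have hx0 : 0 < x := by positivity
  have hxc : m * c / 4 ≤ x := by
    rw [hx, le_div_iff₀ (by positivity)]
    nlinarith
  have htx : max t₀ t₁ < t n * x := ht2.trans_le (by gcongr)
  have e1 := hb (t n) x hxc ht1 ((le_max_right _ _).trans_lt htx)
  have e2 : boxCox (γ i) y = x ^ γ i * boxCox (γ i) (1 + δ) + boxCox (γ i) x := by
    rw [← boxCox_mul hx0 (by positivity), hx, div_mul_cancel₀ _ (by positivity)]
  have e3 : C * |A i (t n)| * x ^ γ i ≤ x ^ γ i * boxCox (γ i) (1 + δ) := by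
    have h7 := hbox δ hδ0 (h6.trans_le (min_le_left _ _)).le
    have h8 : 0 < x ^ γ i := by positivity
    have h9 : C * |A i (t n)| ≤ boxCox (γ i) (1 + δ) := by
      refine le_trans (le_of_eq ?_) h7
      rw [hδdef]; ring
    nlinarith
  have e4 : tailQ (margins μ i) (t n * x) ≤ aff i n (tailQ (margins μ i) (d n * s)) := by
    have h7 : (tailQ (margins μ i) (t n * x) - b i (t n)) / a i (t n) ≤
        (aff i n (tailQ (margins μ i) (d n * s)) - b i (t n)) / a i (t n) := by
      rw [← hHeq, e2]
      have := (abs_le.1 e1).2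
      linarith
    rw [div_le_div_iff_of_pos_right h4] at h7
    linarith
  have e5 : μ.real {z | aff i n (tailQ (margins μ i) (d n * s)) ≤ coord i z} ≤ 1 / (t n * x) := by
    rw [← ht₀.measure_Ici _ ((le_max_left _ _).trans_lt htx), ← margins_eq,
      map_measureReal_apply (measurable_coord i) measurableSet_Ici]
    exact measureReal_mono fun z hz => e4.trans hz
  have e6 : t n * (1 / (t n * x)) = 1 / x := by field_simp
  calc t n * μ.real {z | aff i n (tailQ (margins μ i) (d n * s)) ≤ coord i z}
      ≤ t n * (1 / (t n * x)) := by gcongr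
    _ = 1 / y + δ / y := by rw [e6, hx]; field_simp
    _ ≤ 1 / y + δ / (m * c / 2) := by gcongr
    _ = _ := by rw [hδdef]; ring

theorem Scheme.negl_top (hB : Base μ ν η γ ρ a b A q p x₀ rt err u)
    (hS : Scheme μ ν γ a b A q rt u d t r aff H ℓ) (i : Fin 2) :
    Negl rt (fun n => t n *
      μ.real {z | aff i n (tailQ (margins μ i) (d n * topCut rt n)) ≤ coord i z}) := by
  obtain ⟨g, hg, hb⟩ := hS.marginal_le hB i one_pos
  refine ((hS.negl_inv_top hB i).add hg).mono hB.rt_pos ?_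
  filter_upwards [hb, hB.cut_lt_topCut i, hB.topCut_tendsto.eventually_ge_atTop 1,
    hS.t_tendsto.eventually_ge_atTop 0] with n h1 h2 h3 h4
  rw [abs_of_nonneg (mul_nonneg h4 measureReal_nonneg)]
  exact h1 _ ⟨h2.le, le_rfl⟩ h3

end Scheme

section Strips

variable {ν : Measure (ℝ × ℝ)} {η : ℝ × ℝ → ℝ} {q p : ℝ → ℝ≥0∞} {γ₁ γ₂ x₀ y₀ : ℝ}
  {rt err u : ℕ → ℝ}

theorem BoundaryPair.cut_strip (h : BoundaryPair q p γ₁ γ₂ x₀ y₀) (hx₀ : x₀ = 0)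
    (hrt : ∀ᶠ n in atTop, 0 < rt n) (hu : CutOff γ₁ x₀ rt err u) :
    (∃ c : ℝ, 0 < c ∧ ∀ᶠ n in atTop, q (u n) < ⊤ ∧ c ≤ (q (u n)).toReal) ∧
      Negl rt (fun n => u n / (q (u n)).toReal ^ 2) := by
  obtain ⟨c, hc, -, hcb⟩ := h.exists_lower
  have hu0 := hu.tendsto_of_zero hx₀
  have hlow : ∀ᶠ n in atTop, q (u n) < ⊤ ∧ c ≤ (q (u n)).toReal := by
    filter_upwards [hu.pos, hu0.eventually (gt_mem_nhds hc)] with n h1 h2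
    have h3 := h.fin_left (u n) (by rw [hx₀]; exact h1)
    exact ⟨h3, ((ENNReal.ofReal_lt_iff_lt_toReal hc.le h3.ne).1 (hcb _ h1.le h2)).le⟩
  refine ⟨⟨c, hc, hlow⟩, ?_⟩
  have hsm : Negl rt (fun n => u n ^ max γ₁ 1) := hu.small_of_zero hx₀
  rcases le_or_gt γ₁ 1 with hγ | hγ
  · refine (hsm.const_mul (1 / c ^ 2)).mono hrt ?_
    filter_upwards [hlow, hu.pos] with n h1 h2
    rw [abs_of_nonneg (by positivity), max_eq_right hγ, Real.rpow_one, one_div_mul_eq_div]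
    gcongr
    exact h1.2
  · obtain ⟨K, δ, hK, hδ, hb⟩ := h.growth_left
    refine (hsm.const_mul (K ^ 2)).mono hrt ?_
    filter_upwards [hlow, hu.pos, hu0.eventually (gt_mem_nhds hδ),
      hu0.eventually (gt_mem_nhds (Real.exp_pos (-1)))] with n h1 h2 h3 h4
    have e1 := hb (u n) (by rw [hx₀]; exact h2) (by rw [hx₀]; linarith)
    have e2 : 1 ≤ |Real.log (u n)| := by
      have : Real.log (u n) < -1 := by rwa [Real.log_lt_iff_lt_exp h2]
      rw [abs_of_neg (by linarith)]; linarith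
    have hp : 0 < u n ^ ((1 - γ₁) / 2) := by positivity
    have e3 : u n ^ ((1 - γ₁) / 2) ≤ K * (q (u n)).toReal := by nlinarith
    have e4 : (u n ^ ((1 - γ₁) / 2)) ^ 2 = u n ^ (1 - γ₁) := by
      rw [← Real.rpow_natCast, ← Real.rpow_mul h2.le]; congr 1; push_cast; ring
    have e5 : u n ^ (1 - γ₁) ≤ K ^ 2 * (q (u n)).toReal ^ 2 := by
      rw [← e4, ← mul_pow]; exact pow_le_pow_left₀ hp.le e3 2
    have e6 : u n ^ (1 - γ₁) * u n ^ γ₁ = u n := by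
      rw [← Real.rpow_add h2]; norm_num
    have hw : 0 < (q (u n)).toReal := hc.trans_le h1.2
    have hg : 0 < u n ^ γ₁ := by positivity
    rw [abs_of_nonneg (by positivity), max_eq_left hγ.le, div_le_iff₀ (by positivity)]
    calc u n = u n ^ (1 - γ₁) * u n ^ γ₁ := e6.symm
      _ ≤ K ^ 2 * (q (u n)).toReal ^ 2 * u n ^ γ₁ := by gcongr
      _ = _ := by ring

theorem ExponentDensity.strip_distSet (hν : ExponentDensity ν η) (h : BoundaryPair q p γ₁ γ₂ x₀ y₀)
    (hrt : ∀ᶠ n in atTop, 0 < rt n) (hu : CutOff γ₁ x₀ rt err u) {ℓ₁ ℓ₂ : ℕ → ℝ}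
    {h₁ h₂ : ℕ → ℝ ≃o ℝ} (hd₁ : Distort γ₁ x₀ rt ℓ₁ h₁) (hd₂ : Distort γ₂ y₀ rt ℓ₂ h₂) :
    ∃ σ : ℕ → ℝ, Negl rt σ ∧ ∀ᶠ n in atTop, 0 ≤ σ n ∧
      ν {z | z ∈ distSet q (h₁ n) (h₂ n) ∧ z.1 < h₁ n (u n)} ≤ ENNReal.ofReal (σ n) := by
  rcases h.nonneg_left.eq_or_lt with h0 | h0
  · obtain ⟨⟨c, hc, hlow⟩, hneg⟩ := h.cut_strip h0.symm hrt hu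
    obtain ⟨C, hC, hstrip⟩ := hν.strip_le
    refine ⟨fun n => C * 8 * (u n / (q (u n)).toReal ^ 2), hneg.const_mul _, ?_⟩
    filter_upwards [hlow, hu.pos, hd₁.zero, hd₂.zero, hd₁.close 1 one_pos,
      hd₂.close (1 / 2) (by norm_num)] with n ⟨h1, h2⟩ h3 h4 h5 h6 h7
    set w := (q (u n)).toReal with hw
    have hw0 : 0 < w := hc.trans_le h2
    refine ⟨by positivity, ?_⟩
    have e1 : h₁ n (u n) ≤ 2 * u n := by have := (abs_le.1 (h6 _ h3.le)).2; linarith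
    have e2 : w / 2 ≤ h₂ n w := by have := (abs_le.1 (h7 _ hw0.le)).1; linarith
    refine le_trans (measure_mono ?_) ((hstrip (2 * u n) (w / 2) (by positivity) (by positivity)).trans
      (ENNReal.ofReal_le_ofReal (le_of_eq (by field_simp; norm_num))))
    rintro z ⟨⟨a1, a2, a3⟩, a4⟩
    refine ⟨⟨a1, a4.trans_le e1⟩, e2.trans ?_⟩
    have e3 : (h₁ n).symm z.1 ≤ u n := by
      rw [OrderIso.symm_apply_le]; exact a4.le
    have e4 : q (u n) ≤ ENNReal.ofReal ((h₂ n).symm z.2) :=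
      (h.anti_left (mem_Ici.2 (OrderIso.symm_nonneg h4 a1)) (mem_Ici.2 h3.le) e3).trans a3
    have e5 := ENNReal.toReal_mono ENNReal.ofReal_ne_top e4
    rw [ENNReal.toReal_ofReal (OrderIso.symm_nonneg h5 a2), OrderIso.le_symm_apply] at e5
    exact e5
  · refine ⟨fun _ => 0, Negl.zero rt, ?_⟩
    filter_upwards [hd₁.zero] with n h4
    refine ⟨le_rfl, ?_⟩
    have : {z | z ∈ distSet q (h₁ n) (h₂ n) ∧ z.1 < h₁ n (u n)} = ∅ := by
      refine eq_empty_of_forall_notMem ?_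
      rintro z ⟨⟨a1, a2, a3⟩, a4⟩
      rw [hu.eq_of_pos h0] at a4
      have e1 := h.top_left _ (OrderIso.symm_nonneg h4 a1) ((OrderIso.symm_apply_lt _).2 a4)
      rw [e1, top_le_iff] at a3
      exact ENNReal.ofReal_ne_top a3
    rw [this]; simp

theorem ExponentDensity.strip_distSet_right (hν : ExponentDensity ν η)
    (h : BoundaryPair q p γ₁ γ₂ x₀ y₀)
    (hrt : ∀ᶠ n in atTop, 0 < rt n) (hu : CutOff γ₂ y₀ rt err u) {ℓ₁ ℓ₂ : ℕ → ℝ}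
    {h₁ h₂ : ℕ → ℝ ≃o ℝ} (hd₁ : Distort γ₁ x₀ rt ℓ₁ h₁) (hd₂ : Distort γ₂ y₀ rt ℓ₂ h₂) :
    ∃ σ : ℕ → ℝ, Negl rt σ ∧ ∀ᶠ n in atTop, 0 ≤ σ n ∧
      ν {z | z ∈ distSet q (h₁ n) (h₂ n) ∧ z.2 < h₂ n (u n)} ≤ ENNReal.ofReal (σ n) := by
  obtain ⟨σ, h1, h2⟩ := hν.swap.strip_distSet h.swap hrt hu hd₂ hd₁
  refine ⟨σ, h1, ?_⟩
  filter_upwards [h2, hd₁.zero, hd₂.zero] with n ⟨a1, a2⟩ h3 h4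
  refine ⟨a1, le_trans (le_of_eq ?_) a2⟩
  have hm : MeasurableSet {z | z ∈ distSet p (h₂ n) (h₁ n) ∧ z.1 < h₂ n (u n)} :=
    (h.swap.measurableSet_distSet h4).inter (measurableSet_lt measurable_fst measurable_const)
  rw [Measure.map_apply measurable_swap hm, ← h.preimage_swap_distSet h3 h4]
  rfl

end Strips

/-- The image of the part of the failure set between the cut-off points. -/
def mainSet (q : ℝ → ℝ≥0∞) (u v X : ℝ) (f g : ℝ → ℝ) : Set (ℝ × ℝ) :=
  (fun s : ℝ × ℝ => (f s.1, g s.2)) '' (failSet q ∩ Icc u X ×ˢ Icc v X)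

theorem mem_transImage_iff {μ : Measure (ℝ × ℝ)} [IsProbabilityMeasure μ] {γ a b : Fin 2 → ℝ} {d : ℝ}
    {f g : ℝ → ℝ} {C : Set (ℝ × ℝ)} {w : ℝ≥0∞ × ℝ≥0∞} :
    w ∈ transImage μ γ a b d f g C ↔ ∃ s ∈ C, 1 < d * s.1 ∧ 1 < d * s.2 ∧
      w.1 = gpdInv (γ 0) ((f (tailQ (margins μ 0) (d * s.1)) - b 0) / a 0) ∧
      w.2 = gpdInv (γ 1) ((g (tailQ (margins μ 1) (d * s.2)) - b 1) / a 1) := by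
  have := isProbabilityMeasure_coord μ 0
  have := isProbabilityMeasure_coord μ 1
  constructor
  · rintro ⟨z, ⟨s, hs, h1, h2⟩, rfl⟩
    rw [margins_eq, coe_eq_tailQuantile_iff] at h1 h2
    refine ⟨s, hs, h1.1, h2.1, ?_, ?_⟩
    · rw [margins_eq, ← h1.2]; rfl
    · rw [margins_eq, ← h2.2]; rfl
  · rintro ⟨s, hs, h1, h2, h3, h4⟩
    refine ⟨(tailQ (margins μ 0) (d * s.1), tailQ (margins μ 1) (d * s.2)), ⟨s, hs, ?_, ?_⟩, ?_⟩
    · rw [margins_eq μ 0, coe_eq_tailQuantile_iff]; exact ⟨h1, rfl⟩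
    · rw [margins_eq μ 1, coe_eq_tailQuantile_iff]; exact ⟨h2, rfl⟩
    · exact Prod.ext h3.symm h4.symm

section Scheme

variable {μ ν : Measure (ℝ × ℝ)} [IsProbabilityMeasure μ] {η : ℝ × ℝ → ℝ} {γ ρ : Fin 2 → ℝ}
  {a b A : Fin 2 → ℝ → ℝ} {q p : ℝ → ℝ≥0∞} {x₀ : Fin 2 → ℝ} {rt err : ℕ → ℝ} {u : Fin 2 → ℕ → ℝ}
  {d t r : ℕ → ℝ} {aff H : Fin 2 → ℕ → ℝ → ℝ} {ℓ : Fin 2 → ℕ → ℝ}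

/-- Values of the standardized transformed quantiles. -/
theorem Scheme.gpdInv_value (hB : Base μ ν η γ ρ a b A q p x₀ rt err u)
    (hS : Scheme μ ν γ a b A q rt u d t r aff H ℓ) (i : Fin 2) :
    ∀ᶠ n in atTop, (∀ s, u i n ≤ s → 1 < d n * s) ∧
      (∀ s ∈ Icc (u i n) (topCut rt n),
        gpdInv (γ i) ((aff i n (tailQ (margins μ i) (d n * s)) - b i (t n)) / a i (t n)) =
          ENNReal.ofReal (r n * H i n s)) ∧
      (∀ s, topCut rt n ≤ s → ENNReal.ofReal (r n * H i n (topCut rt n)) ≤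
        gpdInv (γ i) ((aff i n (tailQ (margins μ i) (d n * s)) - b i (t n)) / a i (t n))) ∧
      (∀ s ∈ Icc (u i n) (topCut rt n), ∀ y, (gpdInv (γ i) ((y - b i (t n)) / a i (t n)) =
          ENNReal.ofReal (r n * H i n s) → y = aff i n (tailQ (margins μ i) (d n * s))) ∧
        (ENNReal.ofReal (r n * H i n s) ≤ gpdInv (γ i) ((y - b i (t n)) / a i (t n)) →
          aff i n (tailQ (margins μ i) (d n * s)) ≤ y)) ∧
      (∀ x ∈ Icc (u i n) (topCut rt n), ∀ s, x ≤ s → ENNReal.ofReal (r n * H i n x) ≤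
        gpdInv (γ i) ((aff i n (tailQ (margins μ i) (d n * s)) - b i (t n)) / a i (t n))) := by
  filter_upwards [hS.value i, hS.strictMonoOn hB i, hB.a_pos hS i, hS.r_pos, hB.cut_lt_topCut i,
    hS.d_large 2 i] with n h1 h2 h3 h4 h5 h6
  have hval : ∀ s ∈ Icc (u i n) (topCut rt n),
      gpdInv (γ i) ((aff i n (tailQ (margins μ i) (d n * s)) - b i (t n)) / a i (t n)) =
        ENNReal.ofReal (r n * H i n s) := by
    intro s hs
    rw [← (h1 s hs).2, gpdInv_boxCox (mul_pos h4 (h1 s hs).1)]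
  have hmono : ∀ s s', u i n ≤ s → s ≤ s' →
      gpdInv (γ i) ((aff i n (tailQ (margins μ i) (d n * s)) - b i (t n)) / a i (t n)) ≤
      gpdInv (γ i) ((aff i n (tailQ (margins μ i) (d n * s')) - b i (t n)) / a i (t n)) := by
    intro s s' hs hss'
    refine gpdInv_mono _ ?_
    have := h2.1.monotoneOn (mem_Ici.2 hs) (mem_Ici.2 (hs.trans hss')) hss'
    beta_reduce at this
    gcongr
  refine ⟨fun s hs => by linarith [h6 s hs], hval, ?_, ?_, ?_⟩
  · intro s hs
    rw [← hval _ ⟨h5.le, le_rfl⟩]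
    exact hmono _ _ h5.le hs
  · intro s hs y
    have hpos := mul_pos h4 (h1 s hs).1
    refine ⟨fun hy => ?_, fun hy => ?_⟩
    · rw [gpdInv_eq_ofReal_iff hpos, (h1 s hs).2, div_left_inj' h3.ne'] at hy
      linarith
    · rw [ofReal_le_gpdInv_iff hpos, (h1 s hs).2, div_le_div_iff_of_pos_right h3] at hy
      linarith
  · intro x hx s hs
    rw [← hval _ hx]
    exact hmono _ _ hx.1 hs

theorem Base.mainSet_measurable (hB : Base μ ν η γ ρ a b A q p x₀ rt err u)
    (hS : Scheme μ ν γ a b A q rt u d t r aff H ℓ) :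
    ∀ᶠ n in atTop, MeasurableSet (mainSet q (u 0 n) (u 1 n) (topCut rt n)
      (fun s => aff 0 n (tailQ (margins μ 0) (d n * s)))
      (fun s => aff 1 n (tailQ (margins μ 1) (d n * s)))) := by
  filter_upwards [hS.strictMonoOn hB 0, hS.strictMonoOn hB 1] with n h1 h2
  refine MeasurableSet.image_of_continuousOn_injOn
    ((hB.pair.measurableSet_distSet (h₁ := OrderIso.refl ℝ) (h₂ := OrderIso.refl ℝ) rfl).inter
      (measurableSet_Icc.prod measurableSet_Icc)) (ContinuousOn.prodMk ?_ ?_) ?_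
  · exact h1.2.comp continuousOn_fst fun s hs => hs.2.1.1
  · exact h2.2.comp continuousOn_snd fun s hs => hs.2.2.1
  · exact fun s hs s' hs' h => Prod.ext (h1.1.injOn hs.2.1.1 hs'.2.1.1 (Prod.ext_iff.1 h).1)
      (h2.1.injOn hs.2.2.1 hs'.2.2.1 (Prod.ext_iff.1 h).2)

theorem ExponentDensity.measureReal_le_add {ν : Measure (ℝ × ℝ)} {η : ℝ × ℝ → ℝ}
    (hν : ExponentDensity ν η) {c₀ c₁ : ℝ} (h₀ : 0 < c₀) (h₁ : 0 < c₁) {V R : Set (ℝ × ℝ)}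
    (hR : ν R ≠ ⊤) (h : ∀ z ∈ V, 0 ≤ z.1 → 0 ≤ z.2 → z ∈ R ∨ c₀ ≤ z.1 ∨ c₁ ≤ z.2) :
    ν.real V ≤ ν.real R + 1 / c₀ + 1 / c₁ := by
  have hsub : V ⊆ R ∪ Ici c₀ ×ˢ Ici 0 ∪ Ici 0 ×ˢ Ici c₁ ∪ (Ici 0 ×ˢ Ici 0)ᶜ := fun z hz => by
    by_cases hQ : z ∈ (Ici 0 ×ˢ Ici 0 : Set (ℝ × ℝ))
    · rcases h z hz hQ.1 hQ.2 with h | h | h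
      · exact Or.inl (Or.inl (Or.inl h))
      · exact Or.inl (Or.inl (Or.inr ⟨h, hQ.2⟩))
      · exact Or.inl (Or.inr ⟨hQ.1, h⟩)
    · exact Or.inr hQ
  refine ENNReal.toReal_le_of_le_ofReal (by positivity) ((measure_mono hsub).trans ?_)
  rw [ENNReal.ofReal_add (by positivity) (by positivity),
    ENNReal.ofReal_add (by positivity) (by positivity), ofReal_measureReal hR,
    ← (hν.measure_upper c₀ h₀).2, ← (hν.measure_upper c₁ h₁).1]
  refine (measure_union_le _ _).trans ?_
  rw [hν.compl_quadrant, add_zero]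
  exact (measure_union_le _ _).trans (add_le_add_left (measure_union_le _ _) _)

/-- Points whose `i`-th coordinate exceeds the transformed upper cut-off point. -/
def topSet (μ : Measure (ℝ × ℝ)) (rt d : ℕ → ℝ) (aff : Fin 2 → ℕ → ℝ → ℝ) (i : Fin 2) (n : ℕ) :
    Set (ℝ × ℝ) := {z | aff i n (tailQ (margins μ i) (d n * topCut rt n)) ≤ coord i z}

/-- The main set of a scheme. -/
def kernelSet (μ : Measure (ℝ × ℝ)) (q : ℝ → ℝ≥0∞) (rt d : ℕ → ℝ) (u : Fin 2 → ℕ → ℝ)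
    (aff : Fin 2 → ℕ → ℝ → ℝ) (n : ℕ) : Set (ℝ × ℝ) :=
  mainSet q (u 0 n) (u 1 n) (topCut rt n) (fun s => aff 0 n (tailQ (margins μ 0) (d n * s)))
    (fun s => aff 1 n (tailQ (margins μ 1) (d n * s)))

/-- Comparison of the sets `{z | standardize z ∈ B}` and `{z | z ∈ B}` for the image `B` of a set above
the cut-off points with explicit sets. -/
theorem Scheme.transImage_subset (hB : Base μ ν η γ ρ a b A q p x₀ rt err u)
    (hS : Scheme μ ν γ a b A q rt u d t r aff H ℓ) :
    ∀ᶠ n in atTop, ∀ C : Set (ℝ × ℝ), C ⊆ Ici (u 0 n) ×ˢ Ici (u 1 n) →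
      let B := transImage μ γ (fun i => a i (t n)) (fun i => b i (t n)) (d n) (aff 0 n) (aff 1 n) C
      let E := {z | standardize γ (fun i => a i (t n)) (fun i => b i (t n)) z ∈ B}
      let V := {z : ℝ × ℝ | (ENNReal.ofReal z.1, ENNReal.ofReal z.2) ∈ B}
      (∀ s ∈ C, (aff 0 n (tailQ (margins μ 0) (d n * s.1)),
        aff 1 n (tailQ (margins μ 1) (d n * s.2))) ∈ E) ∧
      (∀ z ∈ E, (∃ s ∈ C, s.1 ≤ topCut rt n ∧ s.2 ≤ topCut rt n ∧
          z = (aff 0 n (tailQ (margins μ 0) (d n * s.1)), aff 1 n (tailQ (margins μ 1) (d n * s.2)))) ∨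
        z ∈ topSet μ rt d aff 0 n ∪ topSet μ rt d aff 1 n) ∧
      (∀ z ∈ E, ∀ i, ∀ x ∈ Icc (u i n) (topCut rt n), (∀ s ∈ C, x ≤ coord i s) →
        aff i n (tailQ (margins μ i) (d n * x)) ≤ coord i z) ∧
      (∀ s ∈ C, s.1 ≤ topCut rt n → s.2 ≤ topCut rt n → (r n * H 0 n s.1, r n * H 1 n s.2) ∈ V) ∧
      (∀ z ∈ V, 0 ≤ z.1 → 0 ≤ z.2 → (∃ s ∈ C, s.1 ≤ topCut rt n ∧ s.2 ≤ topCut rt n ∧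
          z = (r n * H 0 n s.1, r n * H 1 n s.2)) ∨
        r n * H 0 n (topCut rt n) ≤ z.1 ∨ r n * H 1 n (topCut rt n) ≤ z.2) := by
  filter_upwards [hS.gpdInv_value hB 0, hS.gpdInv_value hB 1, hS.value 0, hS.value 1, hS.r_pos,
    hB.cut_lt_topCut 0, hB.cut_lt_topCut 1]
    with n ⟨a1, a2, a3, a4, a5⟩ ⟨b1, b2, b3, b4, b5⟩ v0 v1 hr c0 c1 C hC
  have pos0 : ∀ s ∈ Icc (u 0 n) (topCut rt n), 0 ≤ r n * H 0 n s := fun s hs =>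
    (mul_pos hr (v0 s hs).1).le
  have pos1 : ∀ s ∈ Icc (u 1 n) (topCut rt n), 0 ≤ r n * H 1 n s := fun s hs =>
    (mul_pos hr (v1 s hs).1).le
  intro B E V
  refine ⟨?_, ?_, ?_, ?_, ?_⟩
  · intro s hs
    exact mem_transImage_iff.2 ⟨s, hs, a1 _ (hC hs).1, b1 _ (hC hs).2, rfl, rfl⟩
  · intro z hz
    obtain ⟨s, hs, -, -, h1, h2⟩ := mem_transImage_iff.1 hz
    simp only [standardize] at h1 h2
    rcases le_or_gt s.1 (topCut rt n) with hs1 | hs1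
    · rcases le_or_gt s.2 (topCut rt n) with hs2 | hs2
      · left
        rw [a2 _ ⟨(hC hs).1, hs1⟩] at h1
        rw [b2 _ ⟨(hC hs).2, hs2⟩] at h2
        exact ⟨s, hs, hs1, hs2, Prod.ext ((a4 _ ⟨(hC hs).1, hs1⟩ _).1 h1)
          ((b4 _ ⟨(hC hs).2, hs2⟩ _).1 h2)⟩
      · right; right
        refine (b4 _ ⟨c1.le, le_rfl⟩ z.2).2 ?_
        rw [h2]; exact b3 _ hs2.le
    · right; left
      refine (a4 _ ⟨c0.le, le_rfl⟩ z.1).2 ?_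
      rw [h1]; exact a3 _ hs1.le
  · intro z hz i x hx hxC
    obtain ⟨s, hs, -, -, h1, h2⟩ := mem_transImage_iff.1 hz
    simp only [standardize] at h1 h2
    fin_cases i
    · refine (a4 _ hx z.1).2 ?_
      rw [h1]; exact a5 _ hx _ (hxC s hs)
    · refine (b4 _ hx z.2).2 ?_
      rw [h2]; exact b5 _ hx _ (hxC s hs)
  · intro s hs hs1 hs2
    refine mem_transImage_iff.2 ⟨s, hs, a1 _ (hC hs).1, b1 _ (hC hs).2, ?_, ?_⟩
    · exact (a2 _ ⟨(hC hs).1, hs1⟩).symm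
    · exact (b2 _ ⟨(hC hs).2, hs2⟩).symm
  · intro z hz hz1 hz2
    obtain ⟨s, hs, -, -, h1, h2⟩ := mem_transImage_iff.1 hz
    simp only at h1 h2
    rcases le_or_gt s.1 (topCut rt n) with hs1 | hs1
    · rcases le_or_gt s.2 (topCut rt n) with hs2 | hs2
      · left
        rw [a2 _ ⟨(hC hs).1, hs1⟩, ENNReal.ofReal_eq_ofReal_iff hz1 (pos0 _ ⟨(hC hs).1, hs1⟩)] at h1
        rw [b2 _ ⟨(hC hs).2, hs2⟩, ENNReal.ofReal_eq_ofReal_iff hz2 (pos1 _ ⟨(hC hs).2, hs2⟩)] at h2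
        exact ⟨s, hs, hs1, hs2, Prod.ext h1 h2⟩
      · right; right
        have := b3 _ hs2.le
        rwa [← h2, ENNReal.ofReal_le_ofReal_iff hz2] at this
    · right; left
      have := a3 _ hs1.le
      rwa [← h1, ENNReal.ofReal_le_ofReal_iff hz1] at this

theorem Scheme.mem_or_top_le (hB : Base μ ν η γ ρ a b A q p x₀ rt err u)
    (hS : Scheme μ ν γ a b A q rt u d t r aff H ℓ) {h₀ h₁ : ℕ → ℝ ≃o ℝ}
    (hh₀ : ∀ᶠ n in atTop, ∀ s ∈ Icc (u 0 n) (topCut rt n), h₀ n s = H 0 n s)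
    (hh₁ : ∀ᶠ n in atTop, ∀ s ∈ Icc (u 1 n) (topCut rt n), h₁ n s = H 1 n s) :
    ∀ᶠ n in atTop, ∀ (V : Set (ℝ × ℝ)) (z s : ℝ × ℝ), s.1 = (h₀ n).symm ((r n)⁻¹ * z.1) →
      s.2 = (h₁ n).symm ((r n)⁻¹ * z.2) → u 0 n ≤ s.1 → u 1 n ≤ s.2 →
      (s.1 ≤ topCut rt n → s.2 ≤ topCut rt n → (r n * H 0 n s.1, r n * H 1 n s.2) ∈ V) →
      z ∈ V ∨ r n * H 0 n (topCut rt n) ≤ z.1 ∨ r n * H 1 n (topCut rt n) ≤ z.2 := by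
  filter_upwards [hh₀, hh₁, hS.r_pos, hB.cut_lt_topCut 0, hB.cut_lt_topCut 1]
    with n e0 e1 hr hX0 hX1 V z s hs1 hs2 g1 g2 hV
  have w1 : z.1 = r n * h₀ n s.1 := by
    rw [hs1, OrderIso.apply_symm_apply, mul_inv_cancel_left₀ hr.ne']
  have w2 : z.2 = r n * h₁ n s.2 := by
    rw [hs2, OrderIso.apply_symm_apply, mul_inv_cancel_left₀ hr.ne']
  rcases le_or_gt s.1 (topCut rt n) with l1 | l1
  · rcases le_or_gt s.2 (topCut rt n) with l2 | l2
    · left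
      have := hV l1 l2
      rwa [← e0 _ ⟨g1, l1⟩, ← e1 _ ⟨g2, l2⟩, ← w1, ← w2] at this
    · right; right
      rw [w2, ← e1 _ ⟨hX1.le, le_rfl⟩]
      exact mul_le_mul_of_nonneg_left ((h₁ n).monotone l2.le) hr.le
  · right; left
    rw [w1, ← e0 _ ⟨hX0.le, le_rfl⟩]
    exact mul_le_mul_of_nonneg_left ((h₀ n).monotone l1.le) hr.le

/-- Mass of the main set of a scheme. -/
theorem Scheme.expansion (hB : Base μ ν η γ ρ a b A q p x₀ rt err u)
    (hS : Scheme μ ν γ a b A q rt u d t r aff H ℓ) :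
    Tendsto (fun n => (r n * (t n * μ.real (kernelSet μ q rt d u aff n)) - ν.real (failSet q)) / rt n -
      (ℓ 0 n * ∫ v in Ioi (x₀ 1), boundaryIntegrand₂ p (η ∘ Prod.swap) (γ 0) v) -
      ℓ 1 n * ∫ x in Ioi (x₀ 0), boundaryIntegrand₂ q η (γ 1) x) atTop (𝓝 0) := by
  obtain ⟨h₀, hd₀, hh₀⟩ := hS.exists_distort hB 0
  obtain ⟨h₁, hd₁, hh₁⟩ := hS.exists_distort hB 1
  have hexp := hB.density.expansion hB.pair (hB.index 0) (hB.index 1) hB.rt_pos hd₀ hd₁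
  obtain ⟨σ₀, hσ₀, hs₀⟩ := hB.density.strip_distSet hB.pair hB.rt_pos (hB.cut 0) hd₀ hd₁
  obtain ⟨σ₁, hσ₁, hs₁⟩ := hB.density.strip_distSet_right hB.pair hB.rt_pos (hB.cut 1) hd₀ hd₁
  obtain ⟨c, hc, -, hmax⟩ := hB.pair.max_ge
  obtain ⟨f, hf, hbias⟩ := hS.bias (1 / c) (by positivity)
  obtain ⟨m, M, hm, hmM⟩ := hS.ratio
  set D := fun n => distSet q (h₀ n) (h₁ n) with hD
  set τ := fun i n => 1 / (r n * H i n (topCut rt n)) with hτ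
  set T := fun i n => t n * μ.real (topSet μ rt d aff i n) with hT
  have hτn : ∀ i, Negl rt (τ i) := fun i => hS.negl_inv_top hB i
  have hTn : ∀ i, Negl rt (T i) := fun i => hS.negl_top hB i
  have hrem : Negl rt (fun n => r n * (f n + T 0 n + T 1 n + τ 0 n + τ 1 n) + (σ₀ n + σ₁ n)) := by
    refine Negl.add ?_ (hσ₀.add hσ₁)
    refine Negl.mul_bounded (M := M) hB.rt_pos ((((hf.add (hTn 0)).add (hTn 1)).add (hτn 0)).add (hτn 1)) ?_
    filter_upwards [hmM] with n hn
    rw [abs_of_pos (hm.trans_le hn.1)]; exact hn.2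
  have hmain : Negl rt (fun n => r n * (t n * μ.real (kernelSet μ q rt d u aff n)) - ν.real (D n)) := by
    refine hrem.mono hB.rt_pos ?_
    filter_upwards [hS.transImage_subset hB, hbias, hs₀, hs₁, hS.r_pos, hd₀.zero, hd₁.zero, hh₀, hh₁,
      hS.t_tendsto.eventually_gt_atTop 0, (hB.cut 0).pos, (hB.cut 1).pos, hB.cut_lt_topCut 0,
      hB.cut_lt_topCut 1, hS.value 0, hS.value 1, hS.mem_or_top_le hB hh₀ hh₁] with n hsub hbn hs0 hs1 hr hz0 hz1 e0 e1 ht hu0 hu1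
      hX0 hX1 hv0 hv1 hcov
    set C := failSet q ∩ Ici (u 0 n) ×ˢ Ici (u 1 n) with hC
    have hCtest : C ∈ testSets q := ⟨u 0 n, u 1 n, hu0, hu1, Or.inl rfl⟩
    obtain ⟨hVfin, hbb⟩ := hbn C hCtest (fun z hz => by
      rw [one_div_one_div]; exact hmax _ _ hz.1.1 hz.1.2.1 hz.1.2.2)
    obtain ⟨k1, k2, -, k4, k5⟩ := hsub C inter_subset_right
    set B := transImage μ γ (fun i => a i (t n)) (fun i => b i (t n)) (d n) (aff 0 n) (aff 1 n) C
    set E := {z | standardize γ (fun i => a i (t n)) (fun i => b i (t n)) z ∈ B}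
    set V := {z : ℝ × ℝ | (ENNReal.ofReal z.1, ENNReal.ofReal z.2) ∈ B}
    set K := kernelSet μ q rt d u aff n with hK
    have hKE : K ⊆ E := by
      rintro z ⟨s, ⟨hsS, hs1, hs2⟩, rfl⟩
      exact k1 s ⟨hsS, hs1.1, hs2.1⟩
    have hEK : E ⊆ K ∪ topSet μ rt d aff 0 n ∪ topSet μ rt d aff 1 n := by
      intro z hz
      rcases k2 z hz with ⟨s, hs, hs1, hs2, rfl⟩ | h
      · exact Or.inl (Or.inl ⟨s, ⟨hs.1, ⟨hs.2.1, hs1⟩, ⟨hs.2.2, hs2⟩⟩, rfl⟩)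
      · rcases h with h | h
        · exact Or.inl (Or.inr h)
        · exact Or.inr h
    have mKE : μ.real K ≤ μ.real E := measureReal_mono hKE
    have mEK : μ.real E ≤ μ.real K + μ.real (topSet μ rt d aff 0 n) + μ.real (topSet μ rt d aff 1 n) :=
      (measureReal_mono hEK).trans ((measureReal_union_le _ _).trans
        (add_le_add_left (measureReal_union_le _ _) _))
    have hDfin : ν (D n) ≠ ⊤ := (hB.pair.distSet_lt_top hB.density hz0 hz1).ne
    have hDm : MeasurableSet (D n) := hB.pair.measurableSet_distSet hz0
    set D' := {z | z ∈ D n ∧ h₀ n (u 0 n) ≤ z.1 ∧ h₁ n (u 1 n) ≤ z.2} with hD'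
    have hD'm : MeasurableSet D' := hDm.inter
      ((measurableSet_le measurable_const measurable_fst).inter
        (measurableSet_le measurable_const measurable_snd))
    have hD'sub : D' ⊆ D n := fun z hz => hz.1
    have hD'fin : ν D' ≠ ⊤ := ne_top_of_le_ne_top hDfin (measure_mono hD'sub)
    have mDD' : ν.real (D n) ≤ ν.real D' + (σ₀ n + σ₁ n) := by
      have hsub' : D n ⊆ D' ∪ ({z | z ∈ D n ∧ z.1 < h₀ n (u 0 n)} ∪
          {z | z ∈ D n ∧ z.2 < h₁ n (u 1 n)}) := by
        intro z hz
        rcases lt_or_ge z.1 (h₀ n (u 0 n)) with h1 | h1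
        · exact Or.inr (Or.inl ⟨hz, h1⟩)
        · rcases lt_or_ge z.2 (h₁ n (u 1 n)) with h2 | h2
          · exact Or.inr (Or.inr ⟨hz, h2⟩)
          · exact Or.inl ⟨hz, h1, h2⟩
      refine ENNReal.toReal_le_of_le_ofReal (by linarith [measureReal_nonneg (μ := ν) (s := D'), hs0.1, hs1.1])
        ((measure_mono hsub').trans ?_)
      rw [ENNReal.ofReal_add measureReal_nonneg (add_nonneg hs0.1 hs1.1),
        ENNReal.ofReal_add hs0.1 hs1.1, ofReal_measureReal hD'fin]
      exact (measure_union_le _ _).trans (add_le_add le_rfl ((measure_union_le _ _).trans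
        (add_le_add hs0.2 hs1.2)))
    have mD'D : ν.real D' ≤ ν.real (D n) := measureReal_mono hD'sub hDfin
    set R := {z : ℝ × ℝ | ((r n)⁻¹ * z.1, (r n)⁻¹ * z.2) ∈ D'} with hR
    have mR : ν R = ENNReal.ofReal (r n)⁻¹ * ν D' := hB.density.measure_smul hr hD'm
    have mR' : ν.real R = (r n)⁻¹ * ν.real D' := by
      rw [measureReal_def, mR, ENNReal.toReal_mul, ENNReal.toReal_ofReal (by positivity)]; rfl
    have hRfin : ν R ≠ ⊤ := by
      rw [mR]; exact ENNReal.mul_ne_top ENNReal.ofReal_ne_top hD'fin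
    have pos0 : 0 < r n * H 0 n (topCut rt n) := mul_pos hr (hv0 _ ⟨hX0.le, le_rfl⟩).1
    have pos1 : 0 < r n * H 1 n (topCut rt n) := mul_pos hr (hv1 _ ⟨hX1.le, le_rfl⟩).1
    have mRV : ν.real R ≤ ν.real V + τ 0 n + τ 1 n := by
      refine hB.density.measureReal_le_add pos0 pos1 hVfin fun z hz z1 z2 => ?_
      obtain ⟨⟨-, -, a3⟩, a4, a5⟩ := hz
      have g1 := (OrderIso.le_symm_apply (h₀ n)).2 a4
      have g2 := (OrderIso.le_symm_apply (h₁ n)).2 a5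
      exact hcov V z (_, _) rfl rfl g1 g2 fun l1 l2 =>
        k4 (_, _) ⟨⟨hu0.le.trans g1, hu1.le.trans g2, a3⟩, g1, g2⟩ l1 l2
    have mVR : ν.real V ≤ ν.real R + τ 0 n + τ 1 n := by
      refine hB.density.measureReal_le_add pos0 pos1 hRfin fun z hz z1 z2 => ?_
      rcases k5 z hz z1 z2 with ⟨s, hs, l1, l2, rfl⟩ | h
      · left
        have g1 : s.1 ∈ Icc (u 0 n) (topCut rt n) := ⟨hs.2.1, l1⟩
        have g2 : s.2 ∈ Icc (u 1 n) (topCut rt n) := ⟨hs.2.2, l2⟩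
        have w1 : (r n)⁻¹ * (r n * H 0 n s.1) = h₀ n s.1 := by
          rw [inv_mul_cancel_left₀ hr.ne', e0 _ g1]
        have w2 : (r n)⁻¹ * (r n * H 1 n s.2) = h₁ n s.2 := by
          rw [inv_mul_cancel_left₀ hr.ne', e1 _ g2]
        simp only [hR, mem_ofPred_eq, w1, w2, hD']
        refine ⟨⟨?_, ?_, ?_⟩, (h₀ n).monotone g1.1, (h₁ n).monotone g2.1⟩
        · rw [← hz0]; exact (h₀ n).monotone hs.1.1
        · rw [← hz1]; exact (h₁ n).monotone hs.1.2.1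
        · simp only [OrderIso.symm_apply_apply]; exact hs.1.2.2
      · exact Or.inr h
    obtain ⟨bb1, bb2⟩ := abs_le.1 hbb
    have t1 : t n * μ.real K ≤ t n * μ.real E := by gcongr
    have t2 : t n * μ.real E ≤ t n * μ.real K + T 0 n + T 1 n := by
      have := mul_le_mul_of_nonneg_left mEK ht.le
      simp only [hT]
      linarith
    have hrR : r n * ν.real R = ν.real D' := by rw [mR', mul_inv_cancel_left₀ hr.ne']
    have hS0 : 0 ≤ σ₀ n + σ₁ n := add_nonneg hs0.1 hs1.1
    have hT0 : 0 ≤ T 0 n := mul_nonneg ht.le measureReal_nonneg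
    have hT1 : 0 ≤ T 1 n := mul_nonneg ht.le measureReal_nonneg
    have up : t n * μ.real K - ν.real R ≤ f n + T 0 n + T 1 n + τ 0 n + τ 1 n := by linarith
    have lo : -(f n + T 0 n + T 1 n + τ 0 n + τ 1 n) ≤ t n * μ.real K - ν.real R := by linarith
    have up' := mul_le_mul_of_nonneg_left up hr.le
    have lo' := mul_le_mul_of_nonneg_left lo hr.le
    rw [mul_sub, hrR] at up' lo'
    rw [abs_le]
    constructor <;> linarith
  have htot := hexp.add hmain
  rw [add_zero] at htot
  refine htot.congr fun n => ?_
  ring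

/-- Lower bound for the probability of quadrants inside the failure region. -/
theorem Scheme.rect_le (hB : Base μ ν η γ ρ a b A q p x₀ rt err u)
    (hS : Scheme μ ν γ a b A q rt u d t r aff H ℓ) :
    ∃ f : ℕ → ℝ, Negl rt f ∧ ∀ᶠ n in atTop, ∀ x ∈ Icc (u 0 n) (topCut rt n),
      ∀ y ∈ Icc (u 1 n) (topCut rt n), q x ≤ ENNReal.ofReal y →
      ν.real (Ici (r n * H 0 n x) ×ˢ Ici (r n * H 1 n y)) ≤
        t n * μ.real {z | aff 0 n (tailQ (margins μ 0) (d n * x)) ≤ z.1 ∧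
          aff 1 n (tailQ (margins μ 1) (d n * y)) ≤ z.2} + f n := by
  obtain ⟨h₀, hd₀, hh₀⟩ := hS.exists_distort hB 0
  obtain ⟨h₁, hd₁, hh₁⟩ := hS.exists_distort hB 1
  obtain ⟨c, hc, -, hmax⟩ := hB.pair.max_ge
  obtain ⟨f, hf, hbias⟩ := hS.bias (1 / c) (by positivity)
  set τ := fun i n => 1 / (r n * H i n (topCut rt n)) with hτ
  have hτn : ∀ i, Negl rt (τ i) := fun i => hS.negl_inv_top hB i
  refine ⟨fun n => f n + τ 0 n + τ 1 n, (hf.add (hτn 0)).add (hτn 1), ?_⟩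
  filter_upwards [hS.transImage_subset hB, hbias, hS.r_pos, hh₀, hh₁,
    hS.t_tendsto.eventually_gt_atTop 0, (hB.cut 0).pos, (hB.cut 1).pos, hB.cut_lt_topCut 0,
    hB.cut_lt_topCut 1, hS.value 0, hS.value 1, hS.mem_or_top_le hB hh₀ hh₁] with n hsub hbn hr e0 e1
    ht hu0 hu1 hX0 hX1 hv0 hv1 hcov x hx y hy hxy
  have hx0 : 0 < x := hu0.trans_le hx.1
  have hy0 : 0 < y := hu1.trans_le hy.1
  set C := failSet q ∩ Ici x ×ˢ Ici y with hC
  have hCtest : C ∈ testSets q := ⟨x, y, hx0, hy0, Or.inl rfl⟩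
  have hCmem : ∀ s1 s2, x ≤ s1 → y ≤ s2 → (s1, s2) ∈ C := fun s1 s2 h1 h2 =>
    ⟨⟨hx0.le.trans h1, hy0.le.trans h2, (hB.pair.anti_left (mem_Ici.2 hx0.le)
      (mem_Ici.2 (hx0.le.trans h1)) h1).trans (hxy.trans (ENNReal.ofReal_le_ofReal h2))⟩, h1, h2⟩
  obtain ⟨hVfin, hbb⟩ := hbn C hCtest (fun z hz => by
    rw [one_div_one_div]; exact hmax _ _ hz.1.1 hz.1.2.1 hz.1.2.2)
  obtain ⟨-, -, k3, k4, -⟩ := hsub C (fun s hs => ⟨hx.1.trans hs.2.1, hy.1.trans hs.2.2⟩)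
  set B := transImage μ γ (fun i => a i (t n)) (fun i => b i (t n)) (d n) (aff 0 n) (aff 1 n) C
  set E := {z | standardize γ (fun i => a i (t n)) (fun i => b i (t n)) z ∈ B}
  set V := {z : ℝ × ℝ | (ENNReal.ofReal z.1, ENNReal.ofReal z.2) ∈ B}
  have pos0 : 0 < r n * H 0 n (topCut rt n) := mul_pos hr (hv0 _ ⟨hX0.le, le_rfl⟩).1
  have pos1 : 0 < r n * H 1 n (topCut rt n) := mul_pos hr (hv1 _ ⟨hX1.le, le_rfl⟩).1
  have mRV : ν.real (Ici (r n * H 0 n x) ×ˢ Ici (r n * H 1 n y)) ≤ ν.real V + τ 0 n + τ 1 n := by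
    refine hB.density.measureReal_le_add pos0 pos1 hVfin fun z hz _ _ => ?_
    have a1 : r n * H 0 n x ≤ z.1 := hz.1
    have a2 : r n * H 1 n y ≤ z.2 := hz.2
    have g1 : x ≤ (h₀ n).symm ((r n)⁻¹ * z.1) := by
      rw [OrderIso.le_symm_apply, e0 x hx, inv_mul_eq_div, le_div_iff₀ hr]; linarith
    have g2 : y ≤ (h₁ n).symm ((r n)⁻¹ * z.2) := by
      rw [OrderIso.le_symm_apply, e1 y hy, inv_mul_eq_div, le_div_iff₀ hr]; linarith
    exact hcov V z (_, _) rfl rfl (hx.1.trans g1) (hy.1.trans g2) fun l1 l2 =>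
      k4 (_, _) (hCmem _ _ g1 g2) l1 l2
  have hE : E ⊆ {z | aff 0 n (tailQ (margins μ 0) (d n * x)) ≤ z.1 ∧
      aff 1 n (tailQ (margins μ 1) (d n * y)) ≤ z.2} := fun z hz =>
    ⟨k3 z hz 0 x hx fun s hs => hs.2.1, k3 z hz 1 y hy fun s hs => hs.2.2⟩
  have mE := mul_le_mul_of_nonneg_left (measureReal_mono hE (μ := μ)) ht.le
  have := (abs_le.1 hbb).1
  linarith

/-- Points near the second coordinate axis that may enter the transformed failure set. -/
def sideLeft (μ : Measure (ℝ × ℝ)) (q : ℝ → ℝ≥0∞) (d : ℕ → ℝ) (u : ℕ → ℝ) (f g : ℕ → ℝ → ℝ)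
    (n : ℕ) : Set (ℝ × ℝ) :=
  {z | z.1 < f n (tailQ (margins μ 0) (d n * u n)) ∧
    g n (tailQ (margins μ 1) (d n * (q (u n)).toReal)) ≤ z.2}

/-- Points near the first coordinate axis that may enter the transformed failure set. -/
def sideRight (μ : Measure (ℝ × ℝ)) (p : ℝ → ℝ≥0∞) (d : ℕ → ℝ) (u : ℕ → ℝ) (f g : ℕ → ℝ → ℝ)
    (n : ℕ) : Set (ℝ × ℝ) :=
  {z | z.2 < g n (tailQ (margins μ 1) (d n * u n)) ∧
    f n (tailQ (margins μ 0) (d n * (p (u n)).toReal)) ≤ z.1}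

theorem BoundaryPair.cut_le_apply {γ₁ γ₂ x₀ y₀ : ℝ} {u v : ℕ → ℝ} (h : BoundaryPair q p γ₁ γ₂ x₀ y₀)
    (hx₀ : x₀ = 0) (hrt : ∀ᶠ n in atTop, 0 < rt n) (hu : CutOff γ₁ x₀ rt err u)
    (hv : CutOff γ₂ y₀ rt err v) : ∀ᶠ n in atTop, v n ≤ (q (u n)).toReal := by
  obtain ⟨⟨c, hc, hlow⟩, -⟩ := h.cut_strip hx₀ hrt hu
  rcases h.swap.nonneg_left.eq_or_lt with h1 | h1
  · filter_upwards [hlow, (hv.tendsto_of_zero h1.symm).eventually (gt_mem_nhds hc)] with n hn1 hn2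
    linarith [hn1.2]
  · filter_upwards [hlow, hu.pos] with n hn1 hn2
    rw [hv.eq_of_pos h1]
    exact h.le_apply hn2.le hn1.1

theorem Negl.abs {f : ℕ → ℝ} (hf : Negl rt f) (hrt : ∀ᶠ n in atTop, 0 < rt n) :
    Negl rt (fun n => |f n|) := by
  have h : Tendsto (fun n => |f n / rt n|) atTop (𝓝 0) := by simpa using Tendsto.abs hf
  refine h.congr' ?_
  filter_upwards [hrt] with n hn
  rw [abs_div, abs_of_pos hn]

/-- Points near an axis that may enter the transformed failure set have negligible mass. -/
theorem Scheme.negl_side (hB : Base μ ν η γ ρ a b A q p x₀ rt err u)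
    (hS : Scheme μ ν γ a b A q rt u d t r aff H ℓ) (i j : Fin 2) {Q : ℝ → ℝ≥0∞} {c C : ℝ}
    (hc : 0 < c) (hlow : ∀ᶠ n in atTop, Q (u i n) < ⊤ ∧ c ≤ (Q (u i n)).toReal)
    (hstr : Negl rt (fun n => u i n / (Q (u i n)).toReal ^ 2))
    (hw : ∀ᶠ n in atTop, u j n ≤ (Q (u i n)).toReal) {f : ℕ → ℝ} (hf : Negl rt f)
    (hrect : ∀ᶠ n in atTop, ∀ x ∈ Icc (u i n) (topCut rt n), ∀ y ∈ Icc (u j n) (topCut rt n),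
      Q x ≤ ENNReal.ofReal y →
      ν.real {z | r n * H i n x ≤ coord i z ∧ r n * H j n y ≤ coord j z} ≤
        t n * μ.real {z | aff i n (tailQ (margins μ i) (d n * x)) ≤ coord i z ∧
          aff j n (tailQ (margins μ j) (d n * y)) ≤ coord j z} + f n)
    (hC : 0 < C) (hstrip : ∀ a b : ℝ, 0 < a → 0 < b →
      ν {z | coord i z ∈ Ico 0 a ∧ b ≤ coord j z} ≤ ENNReal.ofReal (C * (a / b ^ 2)))
    (hup : ∀ y : ℝ, 0 < y → ν {z | 0 ≤ coord i z ∧ y ≤ coord j z} = ENNReal.ofReal (1 / y)) :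
    Negl rt (fun n => t n * μ.real {z | coord i z < aff i n (tailQ (margins μ i) (d n * u i n)) ∧
      aff j n (tailQ (margins μ j) (d n * (Q (u i n)).toReal)) ≤ coord j z}) := by
  obtain ⟨g, hg, hmarg⟩ := hS.marginal_le hB j hc
  obtain ⟨m, M, hm, hmM⟩ := hS.ratio
  refine ((((hf.abs hB.rt_pos).add (hg.abs hB.rt_pos)).add (hstr.const_mul (C * 8 / m))).add
    (hS.negl_top hB j)).mono hB.rt_pos ?_
  filter_upwards [hlow, hrect, hmarg, hmM, hw, hS.t_tendsto.eventually_gt_atTop 0, (hB.cut i).pos,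
    hB.cut_lt_topCut i, hB.cut_lt_topCut j, hS.value i, hS.value j, hS.close i 1 one_pos,
    hS.close j (1 / 2) (by norm_num), hS.strictMonoOn hB j]
    with n ⟨hq1, hq2⟩ h1 h2 h3 h4 ht hu0 hX0 hX1 hv0 hv1 hc0 hc1 hY
  set w := (Q (u i n)).toReal with hwdef
  have hw0 : 0 < w := hc.trans_le hq2
  have hr : 0 < r n := hm.trans_le h3.1
  rw [abs_of_nonneg (mul_nonneg ht.le measureReal_nonneg)]
  have hT0 : 0 ≤ t n * μ.real {z | aff j n (tailQ (margins μ j) (d n * topCut rt n)) ≤ coord j z} :=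
    mul_nonneg ht.le measureReal_nonneg
  have hs0 : 0 ≤ C * 8 / m * (u i n / w ^ 2) := by positivity
  have hf0 := le_abs_self (f n)
  have hg0 := le_abs_self (g n)
  rcases le_or_gt w (topCut rt n) with hwX | hwX
  · have hmemu : u i n ∈ Icc (u i n) (topCut rt n) := ⟨le_rfl, hX0.le⟩
    have hmemw : w ∈ Icc (u j n) (topCut rt n) := ⟨h4, hwX⟩
    have e1 := h1 _ hmemu _ hmemw (by rw [hwdef, ENNReal.ofReal_toReal hq1.ne])
    have e2 := h2 w hmemw hq2
    set Y0 := aff i n (tailQ (margins μ i) (d n * u i n))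
    set Y1 := aff j n (tailQ (margins μ j) (d n * w))
    set y0 := r n * H i n (u i n)
    set y1 := r n * H j n w
    have y0pos : 0 < y0 := mul_pos hr (hv0 _ hmemu).1
    have y1pos : 0 < y1 := mul_pos hr (hv1 _ hmemw).1
    have y0le : y0 ≤ r n * (2 * u i n) :=
      mul_le_mul_of_nonneg_left (by linarith [(abs_le.1 (hc0 _ hmemu)).2]) hr.le
    have y1ge : r n * (w / 2) ≤ y1 :=
      mul_le_mul_of_nonneg_left (by linarith [(abs_le.1 (hc1 _ hmemw)).1]) hr.le
    have e3 : 1 / y1 ≤ ν.real {z | y0 ≤ coord i z ∧ y1 ≤ coord j z} + C * 8 / m * (u i n / w ^ 2) := by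
      have hsub : {z | 0 ≤ coord i z ∧ y1 ≤ coord j z} ⊆ {z | y0 ≤ coord i z ∧ y1 ≤ coord j z} ∪
          {z | coord i z ∈ Ico 0 y0 ∧ y1 ≤ coord j z} := by
        rintro z ⟨z1, z2⟩
        rcases lt_or_ge (coord i z) y0 with h | h
        · exact Or.inr ⟨⟨z1, h⟩, z2⟩
        · exact Or.inl ⟨h, z2⟩
      have hfin1 : ν {z | y0 ≤ coord i z ∧ y1 ≤ coord j z} ≠ ⊤ := by
        have := hup y1 y1pos ▸ ENNReal.ofReal_ne_top
        exact ne_top_of_le_ne_top this (measure_mono fun z hz => ⟨y0pos.le.trans hz.1, hz.2⟩)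
      have hst := hstrip y0 y1 y0pos y1pos
      have hfin2 := ne_top_of_le_ne_top ENNReal.ofReal_ne_top hst
      have hst' := ENNReal.toReal_le_of_le_ofReal (by positivity) hst
      have e4 : ν.real {z | 0 ≤ coord i z ∧ y1 ≤ coord j z} = 1 / y1 := by
        rw [measureReal_def, hup y1 y1pos, ENNReal.toReal_ofReal (by positivity)]
      have e5 : C * (y0 / y1 ^ 2) ≤ C * 8 / m * (u i n / w ^ 2) := by
        calc C * (y0 / y1 ^ 2) ≤ C * (r n * (2 * u i n) / (r n * (w / 2)) ^ 2) := by gcongr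
          _ = C * 8 / r n * (u i n / w ^ 2) := by field_simp; norm_num
          _ ≤ _ := by gcongr; exact h3.1
      rw [← e4]
      refine (measureReal_mono hsub (measure_union_lt_top hfin1.lt_top hfin2.lt_top).ne).trans
        ((measureReal_union_le _ _).trans (add_le_add le_rfl (hst'.trans e5)))
    have e6 : μ.real {z | coord i z < Y0 ∧ Y1 ≤ coord j z} +
        μ.real {z | Y0 ≤ coord i z ∧ Y1 ≤ coord j z} ≤ μ.real {z | Y1 ≤ coord j z} := by
      have hm : MeasurableSet {z | Y0 ≤ coord i z ∧ Y1 ≤ coord j z} :=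
        (measurableSet_le measurable_const (measurable_coord i)).inter
          (measurableSet_le measurable_const (measurable_coord j))
      rw [← measureReal_union ?_ hm]
      · exact measureReal_mono (union_subset (fun z h => h.2) fun z h => h.2)
      · exact Set.disjoint_left.2 fun z h h' => (not_lt.2 h'.1) h.1
    have e7 := mul_le_mul_of_nonneg_left e6 ht.le
    rw [mul_add] at e7
    linarith
  · have hsub : {z | coord i z < aff i n (tailQ (margins μ i) (d n * u i n)) ∧
        aff j n (tailQ (margins μ j) (d n * w)) ≤ coord j z} ⊆
        {z | aff j n (tailQ (margins μ j) (d n * topCut rt n)) ≤ coord j z} := fun z hz =>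
      (hY.1.monotoneOn (mem_Ici.2 hX1.le) (mem_Ici.2 h4) hwX.le).trans hz.2
    have := mul_le_mul_of_nonneg_left (measureReal_mono hsub (μ := μ)) ht.le
    linarith [abs_nonneg (f n), abs_nonneg (g n)]

theorem Scheme.negl_sideLeft (hB : Base μ ν η γ ρ a b A q p x₀ rt err u)
    (hS : Scheme μ ν γ a b A q rt u d t r aff H ℓ) (hx₀ : x₀ 0 = 0) :
    Negl rt (fun n => t n * μ.real (sideLeft μ q d (u 0) (aff 0) (aff 1) n)) := by
  obtain ⟨⟨c, hc, hlow⟩, hstr⟩ := hB.pair.cut_strip hx₀ hB.rt_pos (hB.cut 0)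
  obtain ⟨f, hf, hrect⟩ := hS.rect_le hB
  obtain ⟨C, hC, hstrip⟩ := hB.density.strip_le
  exact hS.negl_side hB 0 1 hc hlow hstr (hB.pair.cut_le_apply hx₀ hB.rt_pos (hB.cut 0) (hB.cut 1))
    hf hrect hC hstrip fun y hy => (hB.density.measure_upper y hy).1

theorem Scheme.negl_sideRight (hB : Base μ ν η γ ρ a b A q p x₀ rt err u)
    (hS : Scheme μ ν γ a b A q rt u d t r aff H ℓ) (hx₀ : x₀ 1 = 0) :
    Negl rt (fun n => t n * μ.real (sideRight μ p d (u 1) (aff 0) (aff 1) n)) := by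
  obtain ⟨⟨c, hc, hlow⟩, hstr⟩ := hB.pair.swap.cut_strip hx₀ hB.rt_pos (hB.cut 1)
  obtain ⟨f, hf, hrect⟩ := hS.rect_le hB
  obtain ⟨C, hC, hstrip⟩ := hB.density.swap.strip_le
  have hsw : ∀ s t : Set ℝ, {z : ℝ × ℝ | coord 1 z ∈ t ∧ coord 0 z ∈ s} = s ×ˢ t := fun s t => by
    ext z; exact and_comm
  refine hS.negl_side hB 1 0 hc hlow hstr
    (hB.pair.swap.cut_le_apply hx₀ hB.rt_pos (hB.cut 1) (hB.cut 0)) hf ?_ hC (fun a b ha hb => ?_)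
    fun y hy => (congrArg ν (hsw (Ici y) (Ici 0))).trans (hB.density.measure_upper y hy).2
  · filter_upwards [hrect, (hB.cut 0).pos, (hB.cut 1).pos] with n h h0 h1 x hx y hy hxy
    have := h y hy x hx ((hB.pair.galois _ _ (h0.le.trans hy.1) (h1.le.trans hx.1)).2 hxy)
    have e : ∀ s t, {z : ℝ × ℝ | s ≤ coord 1 z ∧ t ≤ coord 0 z} = Ici t ×ˢ Ici s := fun s t =>
      hsw (Ici t) (Ici s)
    rw [e, e]; exact this
  · have := hstrip a b ha hb
    rw [Measure.map_apply measurable_swap (measurableSet_Ico.prod measurableSet_Ici),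
      preimage_swap_prod] at this
    exact (congrArg ν (hsw (Ici b) (Ico 0 a))).trans_le this

end Scheme

section BuildSchemes

variable {μ ν : Measure (ℝ × ℝ)} {η : ℝ × ℝ → ℝ} {γ ρ : Fin 2 → ℝ}
  {a b A : Fin 2 → ℝ → ℝ} {A₀ : ℝ → ℝ} {q p : ℝ → ℝ≥0∞} {x₀ : Fin 2 → ℝ} {u : Fin 2 → ℕ → ℝ}
  {k d e : ℕ → ℝ}

theorem exists_base [IsProbabilityMeasure μ] (hM1 : ∀ i, RegularUpperTail (margins μ i))
    (hM2 : ∀ i, SecondOrder (margins μ i) (γ i) (ρ i) (a i) (b i) (A i))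
    (hQ1 : BoundaryFun q) (hQ2 : BoundaryGrowth q γ) (hne : ∃ x, 0 ≤ x ∧ q x < ⊤)
    (hν : IsExponentMeasure μ ν) (hD2 : HasPosContDensity ν η)
    (hS1 : SequenceGrowth k d e γ) (hS2 : SmallBias k d e γ A A₀) :
    ∃ u, Base μ ν η γ ρ a b A q (qInv q) ![xl q, (qInf q).toReal] (rate k d e γ)
      (remainder k A) u := by
  have hpair := hQ1.boundaryPair hQ2 hne
  have hreg : ∀ i, ∃ t₀, RegularTailQ (μ.map (coord i)) t₀ := fun i => by
    have := isProbabilityMeasure_coord μ i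
    refine exists_regularTailQ _ ?_
    rw [← margins_eq]
    exact hM1 i
  obtain ⟨t₁, h₁⟩ := hreg 0
  obtain ⟨t₂, h₂⟩ := hreg 1
  have hx : ∀ i, 0 ≤ (![xl q, (qInf q).toReal] : Fin 2 → ℝ) i := fun i => by
    fin_cases i
    · exact hpair.nonneg_left
    · exact hpair.nonneg_right
  choose u hu using fun i => exists_cutOff (γ i) (hx i) hS1.rate_pos hS1.rate_tendsto
    (remainder_nonneg k A) (remainder_isLittleO hS1 hS2)
  exact ⟨u, hreg, hM2, hν.exponentDensity hD2 h₁ h₂, hpair, hS1.neg_half_lt, hS1.rate_pos,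
    hS1.rate_tendsto, hu⟩

/-- The affine transformation that turns the standardization into `hTilde`. -/
def paramAff (γ a b k c θ χ ξ y : ℝ) : ℝ := a * gexpr γ √k c θ χ ξ ((y - b) / a) + b

theorem paramAff_value {γ a b k c θ χ ξ y : ℝ} (ha : a ≠ 0) :
    (paramAff γ a b k c θ χ ξ y - b) / a = gexpr γ √k c θ χ ξ ((y - b) / a) := by
  rw [paramAff, add_sub_cancel_right, mul_div_cancel_left₀ _ ha]

theorem continuous_paramAff (γ a b k c θ χ ξ : ℝ) : Continuous (paramAff γ a b k c θ χ ξ) := by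
  unfold paramAff gexpr
  fun_prop

theorem strictMono_paramAff (γ b k θ χ ξ : ℝ) {a c : ℝ} (ha : 0 < a) (hc : 0 < c) :
    StrictMono (paramAff γ a b k c θ χ ξ) := by
  intro y y' h
  unfold paramAff gexpr
  have : 0 < c ^ (-(γ + χ / √k)) := by positivity
  gcongr

/-- The transformations belonging to the parameters `θ`, `χ`, `ξ`. -/
def affSeq (γ : Fin 2 → ℝ) (a b : Fin 2 → ℝ → ℝ) (k e : ℕ → ℝ) (θ χ ξ : Fin 2 → ℝ) (i : Fin 2)
    (n : ℕ) : ℝ → ℝ :=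
  paramAff (γ i) (a i (n / k n)) (b i (n / k n)) (k n) (cSeq k e n) (θ i) (χ i) (ξ i)

theorem SequenceGrowth.d_large (h : SequenceGrowth k d e γ)
    (hB : Base μ ν η γ ρ a b A q p x₀ (rate k d e γ) (remainder k A) u) (B : ℝ) (i : Fin 2) :
    ∀ᶠ n in atTop, ∀ s, u i n ≤ s → B ≤ d n * s := by
  filter_upwards [h.x_ge (hB.cut i) (max B 0), h.n_div_k_tendsto.eventually_ge_atTop 1,
    eventually_gt_atTop 0, h.k_tendsto.eventually_gt_atTop 0] with n h1 h2 h3 h4 s hs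
  have h3' : (n : ℝ) ≠ 0 := by positivity
  have h5 := h1 s hs
  rw [← h.scale_eq h3' h4.ne' s]
  exact (le_max_left _ _).trans (h5.trans
    (le_mul_of_one_le_left ((le_max_right _ _).trans h5) h2))

theorem exists_scheme_params (hS1 : SequenceGrowth k d e γ) (hS2 : SmallBias k d e γ A A₀)
    (hD1 : DependenceRate μ ν γ a b q k d e A₀)
    (hB : Base μ ν η γ ρ a b A q p x₀ (rate k d e γ) (remainder k A) u) {θ χ ξ : Fin 2 → ℝ}
    (hpar : ∀ i, γ i < 0 → θ i = 0 ∧ χ i = 0) :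
    ∃ H, Scheme μ ν γ a b A q (rate k d e γ) u d (fun n => n / k n) (fun n => d n / e n)
      (affSeq γ a b k e θ χ ξ) H
      (fun i n => ellParam (γ i) (θ i) (χ i) (ξ i) * (weight k d e (γ i) n / wMax k d e γ n)) := by
  choose H hval hclose hpert using fun i =>
    exists_perturb_hTilde hS1 hS2 i (hB.second i) (hB.cut i) (ξ := ξ i) (hpar i)
  have ha : ∀ i, ∀ᶠ n : ℕ in atTop, 0 < a i (n / k n) := fun i => by
    filter_upwards [hS1.n_div_k_tendsto.eventually_gt_atTop 0] with n hn
    exact (hB.second i).a_pos _ hn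
  refine ⟨H, ?_, hS1.n_div_k_tendsto, fun B i => hS1.d_large hB B i, hS1.d_pos, fun i => ?_,
    fun i n => continuous_paramAff _ _ _ _ _ _ _ _, fun i => ?_, hclose, hpert, fun i => ?_,
    fun i => ?_, fun M hM => ?_⟩
  · obtain ⟨m, M, hm, -, h⟩ := hS1.ratio_bounds
    exact ⟨m, M, hm, h⟩
  · filter_upwards [ha i, hS1.c_tendsto.eventually_gt_atTop 0] with n h1 h2
    exact strictMono_paramAff _ _ _ _ _ _ h1 h2
  · filter_upwards [hval i, ha i] with n h1 h2 s hs
    refine ⟨(h1 s hs).1, ?_⟩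
    rw [(h1 s hs).2, affSeq, paramAff_value h2.ne']
  · refine ⟨|ellParam (γ i) (θ i) (χ i) (ξ i)|, abs_nonneg _, ?_⟩
    filter_upwards [(hS1.weight_tendsto i).eventually_gt_atTop 0,
      hS1.wMax_tendsto.eventually_gt_atTop 0] with n h1 h2
    rw [abs_mul, abs_of_pos (div_pos h1 h2)]
    refine mul_le_of_le_one_right (abs_nonneg _) ?_
    rw [div_le_one h2]
    exact weight_le_wMax k d e γ i n
  · refine Negl.mono hS1.rate_pos (remainder_isLittleO hS1 hS2 : Negl _ _) ?_
    filter_upwards with n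
    rw [abs_abs]
    exact le_remainder k A i n
  · set M' := max M (∑ i, (|θ i| + |χ i| + |ξ i|)) with hM'
    obtain ⟨K, hK⟩ := hD1.rate_k M' (hM.trans_le (le_max_left _ _))
    have hle : ∀ i, |θ i| ≤ M' ∧ |χ i| ≤ M' ∧ |ξ i| ≤ M' := fun i => by
      have h1 := Finset.single_le_sum (f := fun i => |θ i| + |χ i| + |ξ i|)
        (fun i _ => by positivity) (Finset.mem_univ i)
      have h2 : |θ i| + |χ i| + |ξ i| ≤ M' := h1.trans (le_max_right _ _)
      have := abs_nonneg (θ i)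
      have := abs_nonneg (χ i)
      have := abs_nonneg (ξ i)
      exact ⟨by linarith, by linarith, by linarith⟩
    refine ⟨fun n => K * A₀ (n / k n),
      Negl.const_mul K hS2.dependence.tendsto_div_nhds_zero, ?_⟩
    filter_upwards [hK, ha 0, ha 1] with n h1 h2 h3 C hC hCM
    have h4 := h1 C hC (fun z hz => le_trans (by gcongr; exact le_max_left _ _) (hCM z hz)) θ χ ξ hle
    convert h4 using 2
    refine congrArg (· '' _) (funext fun z => ?_)
    simp only [standardize, affSeq, paramAff_value h2.ne', paramAff_value h3.ne']
    rfl

theorem exists_scheme_id (hS1 : SequenceGrowth k d e γ) (hS2 : SmallBias k d e γ A A₀)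
    (hD1 : DependenceRate μ ν γ a b q k d e A₀)
    (hB : Base μ ν η γ ρ a b A q p x₀ (rate k d e γ) (remainder k A) u) :
    ∃ H, Scheme μ ν γ a b A q (rate k d e γ) u d d (fun _ => 1) (fun _ _ y => y) H
      (fun _ _ => 0) := by
  choose herr H hval hclose hpert using fun i =>
    exists_perturb_id hS1 hS2 i (hB.second i) (hB.cut i)
  refine ⟨H, ⟨1, 1, one_pos, by simp⟩, hS1.d_tendsto, fun B i => hS1.d_large hB B i, hS1.d_pos,
    fun i => Eventually.of_forall fun n => strictMono_id, fun i n => continuous_id,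
    hval, hclose, hpert, fun i => ⟨0, le_rfl, by simp⟩, fun i => ?_, fun M hM => ?_⟩
  · obtain ⟨C, hC, h⟩ := herr i
    refine Negl.mono hS1.rate_pos (Negl.const_mul C (remainder_isLittleO hS1 hS2 : Negl _ _)) ?_
    filter_upwards [h] with n hn
    rwa [abs_abs]
  · obtain ⟨K, hK⟩ := hD1.rate_d M hM
    obtain ⟨C, hC⟩ := hS2.dependence_d.bound
    have h1 : Negl (rate k d e γ) (fun n => A₀ (n / k n)) :=
      hS2.dependence.tendsto_div_nhds_zero
    refine ⟨fun n => K * A₀ (d n), Negl.const_mul K (Negl.mono hS1.rate_pos (h1.const_mul C) ?_), hK⟩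
    filter_upwards [hC, hS1.n_div_k_tendsto.eventually_gt_atTop 0] with n h2 h3
    rwa [Real.norm_eq_abs, Real.norm_of_nonneg (hD1.pos _ h3).le] at h2

end BuildSchemes

section Sandwich

variable {μ ν : Measure (ℝ × ℝ)} {η : ℝ × ℝ → ℝ} {γ ρ : Fin 2 → ℝ}
  {a b A : Fin 2 → ℝ → ℝ} {q p : ℝ → ℝ≥0∞} {x₀ : Fin 2 → ℝ} {rt err : ℕ → ℝ} {u : Fin 2 → ℕ → ℝ}
  {d t r : ℕ → ℝ} {aff H : Fin 2 → ℕ → ℝ → ℝ} {ℓ : Fin 2 → ℕ → ℝ}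

/-- The set of points where a transformed failure set may exceed the main set of a scheme. -/
def junkSet (μ : Measure (ℝ × ℝ)) (q p : ℝ → ℝ≥0∞) (x₀ : Fin 2 → ℝ) (rt d : ℕ → ℝ)
    (u : Fin 2 → ℕ → ℝ) (aff : Fin 2 → ℕ → ℝ → ℝ) (n : ℕ) : Set (ℝ × ℝ) :=
  topSet μ rt d aff 0 n ∪ topSet μ rt d aff 1 n ∪
    ({_z | x₀ 0 = 0} ∩ sideLeft μ q d (u 0) (aff 0) (aff 1) n) ∪
    ({_z | x₀ 1 = 0} ∩ sideRight μ p d (u 1) (aff 0) (aff 1) n)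

theorem measurableSet_junkSet (n : ℕ) : MeasurableSet (junkSet μ q p x₀ rt d u aff n) := by
  have h : ∀ i, MeasurableSet (topSet μ rt d aff i n) := fun i =>
    measurableSet_le measurable_const (measurable_coord i)
  refine (((h 0).union (h 1)).union ((MeasurableSet.const _).inter ?_)).union
    ((MeasurableSet.const _).inter ?_)
  · exact (measurableSet_lt measurable_fst measurable_const).inter
      (measurableSet_le measurable_const measurable_snd)
  · exact (measurableSet_lt measurable_snd measurable_const).inter
      (measurableSet_le measurable_const measurable_fst)

variable [IsProbabilityMeasure μ]

theorem Scheme.negl_junkSet (hB : Base μ ν η γ ρ a b A q p x₀ rt err u)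
    (hS : Scheme μ ν γ a b A q rt u d t r aff H ℓ) :
    Negl rt (fun n => t n * μ.real (junkSet μ q p x₀ rt d u aff n)) := by
  have hL : Negl rt (fun n => t n *
      μ.real ({_z | x₀ 0 = 0} ∩ sideLeft μ q d (u 0) (aff 0) (aff 1) n)) := by
    by_cases h : x₀ 0 = 0
    · simpa [h] using hS.negl_sideLeft hB h
    · simpa [h] using Negl.zero rt
  have hR : Negl rt (fun n => t n *
      μ.real ({_z | x₀ 1 = 0} ∩ sideRight μ p d (u 1) (aff 0) (aff 1) n)) := by
    by_cases h : x₀ 1 = 0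
    · simpa [h] using hS.negl_sideRight hB h
    · simpa [h] using Negl.zero rt
  refine Negl.mono hB.rt_pos ((((hS.negl_top hB 0).add (hS.negl_top hB 1)).add hL).add hR) ?_
  filter_upwards [hS.t_tendsto.eventually_ge_atTop 0] with n hn
  rw [abs_of_nonneg (mul_nonneg hn measureReal_nonneg), ← mul_add, ← mul_add, ← mul_add]
  refine mul_le_mul_of_nonneg_left ?_ hn
  refine (measureReal_union_le _ _).trans (add_le_add ((measureReal_union_le _ _).trans
    (add_le_add (measureReal_union_le _ _) le_rfl)) le_rfl)

theorem exists_eq_of_strictMonoOn {f : ℝ → ℝ} {u X s z : ℝ} (huX : u ≤ X)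
    (hf : StrictMonoOn f (Ici u)) (hc : ContinuousOn f (Ici u)) (hu : f u ≤ z) (hX : z < f X)
    (hs : ∀ w ∈ Icc u X, w ≤ s → f w ≤ z) : ∃ σ ∈ Icc u X, f σ = z ∧ s ≤ σ := by
  obtain ⟨σ, hσ, hσz⟩ := intermediate_value_Icc huX (hc.mono Icc_subset_Ici_self) ⟨hu, hX.le⟩
  refine ⟨σ, hσ, hσz, ?_⟩
  by_contra! hlt
  have hσX : σ < X := hσ.2.lt_of_ne (by rintro rfl; exact hX.ne' hσz)
  have h1 : σ < min s X := lt_min hlt hσX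
  have h2 := hs (min s X) ⟨hσ.1.trans h1.le, min_le_right _ _⟩ (min_le_left _ _)
  have h3 := hf (mem_Ici.2 hσ.1) (mem_Ici.2 (hσ.1.trans h1.le)) h1
  linarith

/-- A set whose points dominate transformed points of the failure set is contained in the main set, up to
the exceptional set. -/
theorem Scheme.subset_kernelSet_union (hB : Base μ ν η γ ρ a b A q p x₀ rt err u)
    (hS : Scheme μ ν γ a b A q rt u d t r aff H ℓ) :
    ∀ᶠ n in atTop, ∀ E : Set (ℝ × ℝ),
      (∀ z ∈ E, ∃ s ∈ failSet q, ∀ i, ∀ w ∈ Icc (u i n) (topCut rt n), w ≤ coord i s →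
        aff i n (tailQ (margins μ i) (d n * w)) ≤ coord i z) →
      E ⊆ kernelSet μ q rt d u aff n ∪ junkSet μ q p x₀ rt d u aff n := by
  have hL : x₀ 0 = 0 → ∀ᶠ n in atTop, u 1 n ≤ (q (u 0 n)).toReal := fun h =>
    hB.pair.cut_le_apply h hB.rt_pos (hB.cut 0) (hB.cut 1)
  have hR : x₀ 1 = 0 → ∀ᶠ n in atTop, u 0 n ≤ (p (u 1 n)).toReal := fun h =>
    hB.pair.swap.cut_le_apply h hB.rt_pos (hB.cut 1) (hB.cut 0)
  rw [← eventually_imp_distrib_left] at hL hR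
  filter_upwards [hL, hR, hS.strictMonoOn hB 0, hS.strictMonoOn hB 1, hB.cut_lt_topCut 0,
    hB.cut_lt_topCut 1, (hB.cut 0).pos, (hB.cut 1).pos] with n hL hR m0 m1 hX0 hX1 hu0 hu1 E hE z hz
  obtain ⟨s, hs, hsz⟩ := hE z hz
  have hsz0 := hsz 0
  have hsz1 := hsz 1
  simp only [coord_zero, coord_one] at hsz0 hsz1
  by_cases hT0 : aff 0 n (tailQ (margins μ 0) (d n * topCut rt n)) ≤ z.1
  · right; left; left; left; exact hT0
  by_cases hT1 : aff 1 n (tailQ (margins μ 1) (d n * topCut rt n)) ≤ z.2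
  · right; left; left; right; exact hT1
  have hs0X : s.1 ≤ topCut rt n := by
    by_contra! h; exact hT0 (hsz0 _ ⟨hX0.le, le_rfl⟩ h.le)
  have hs1X : s.2 ≤ topCut rt n := by
    by_contra! h; exact hT1 (hsz1 _ ⟨hX1.le, le_rfl⟩ h.le)
  push Not at hT0 hT1
  have hp : p s.2 ≤ ENNReal.ofReal s.1 := (hB.pair.galois _ _ hs.1 hs.2.1).1 hs.2.2
  by_cases hA : z.1 < aff 0 n (tailQ (margins μ 0) (d n * u 0 n))
  · have hlt : s.1 < u 0 n := by
      by_contra! h; exact absurd (hsz0 _ ⟨le_rfl, hX0.le⟩ h) (not_le.2 hA)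
    have hx₀ : x₀ 0 = 0 := by
      by_contra h
      have h0 := lt_of_le_of_ne (hB.nonneg 0) (Ne.symm h)
      rw [(hB.cut 0).eq_of_pos h0] at hlt
      have := hs.2.2
      rw [hB.pair.top_left _ hs.1 hlt, top_le_iff] at this
      exact ENNReal.ofReal_ne_top this
    have hle : (q (u 0 n)).toReal ≤ s.2 :=
      ENNReal.toReal_le_of_le_ofReal hs.2.1
        ((hB.pair.anti_left (mem_Ici.2 hs.1) (mem_Ici.2 hu0.le) hlt.le).trans hs.2.2)
    right; left; right
    exact ⟨hx₀, hA, hsz1 _ ⟨hL hx₀, hle.trans hs1X⟩ hle⟩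
  by_cases hA' : z.2 < aff 1 n (tailQ (margins μ 1) (d n * u 1 n))
  · have hlt : s.2 < u 1 n := by
      by_contra! h; exact absurd (hsz1 _ ⟨le_rfl, hX1.le⟩ h) (not_le.2 hA')
    have hx₀ : x₀ 1 = 0 := by
      by_contra h
      have h0 := lt_of_le_of_ne (hB.nonneg 1) (Ne.symm h)
      rw [(hB.cut 1).eq_of_pos h0] at hlt
      rw [hB.pair.top_right _ hs.2.1 hlt, top_le_iff] at hp
      exact ENNReal.ofReal_ne_top hp
    have hle : (p (u 1 n)).toReal ≤ s.1 :=
      ENNReal.toReal_le_of_le_ofReal hs.1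
        ((hB.pair.anti_right (mem_Ici.2 hs.2.1) (mem_Ici.2 hu1.le) hlt.le).trans hp)
    right; right
    exact ⟨hx₀, hA', hsz0 _ ⟨hR hx₀, hle.trans hs0X⟩ hle⟩
  push Not at hA hA'
  obtain ⟨σ₀, hσ₀, e0, l0⟩ := exists_eq_of_strictMonoOn hX0.le m0.1 m0.2 hA hT0 hsz0
  obtain ⟨σ₁, hσ₁, e1, l1⟩ := exists_eq_of_strictMonoOn hX1.le m1.1 m1.2 hA' hT1 hsz1
  left
  refine ⟨(σ₀, σ₁), ⟨⟨hs.1.trans l0, hs.2.1.trans l1, ?_⟩, hσ₀, hσ₁⟩, Prod.ext e0 e1⟩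
  exact (hB.pair.anti_left (mem_Ici.2 hs.1) (mem_Ici.2 (hs.1.trans l0)) l0).trans
    (hs.2.2.trans (ENNReal.ofReal_le_ofReal l1))

/-- A set that contains the images of all points of the failure set is at least as large as a main set
that is further away from the origin, up to the exceptional set. -/
theorem kernelSet_sdiff_subset (hq : AntitoneOn q (Ici 0)) {aff' : Fin 2 → ℕ → ℝ → ℝ} {n : ℕ}
    {E : Set (ℝ × ℝ)} {φ : Fin 2 → ℝ → ℝ} (hu : ∀ i, 0 < u i n)
    (hE : ∀ s ∈ failSet q, s.1 ∈ Icc (u 0 n) (topCut rt n) → s.2 ∈ Icc (u 1 n) (topCut rt n) →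
      (φ 0 s.1, φ 1 s.2) ∈ E)
    (hc : ∀ i, ContinuousOn (φ i) (Icc (u i n) (topCut rt n)))
    (hle : ∀ i, ∀ w ∈ Icc (u i n) (topCut rt n),
      φ i w ≤ aff i n (tailQ (margins μ i) (d n * w)))
    (hge : ∀ i, ∀ w ∈ Icc (u i n) (topCut rt n),
      aff' i n (tailQ (margins μ i) (d n * w)) ≤ φ i w) :
    kernelSet μ q rt d u aff n \ junkSet μ q p x₀ rt d u aff' n ⊆ E := by
  rintro z ⟨⟨s, ⟨hs, hs0, hs1⟩, rfl⟩, hz⟩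
  have key : ∀ i, coord i s ∈ Icc (u i n) (topCut rt n) →
      aff i n (tailQ (margins μ i) (d n * coord i s)) <
        aff' i n (tailQ (margins μ i) (d n * topCut rt n)) →
      ∃ σ ∈ Icc (u i n) (topCut rt n), coord i s ≤ σ ∧
        φ i σ = aff i n (tailQ (margins μ i) (d n * coord i s)) := fun i hi hlt => by
    have hX : topCut rt n ∈ Icc (u i n) (topCut rt n) := ⟨hi.1.trans hi.2, le_rfl⟩
    obtain ⟨σ, hσ, h⟩ := intermediate_value_Icc hi.2 ((hc i).mono (Icc_subset_Icc_left hi.1))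
      ⟨hle i _ hi, hlt.le.trans (hge i _ hX)⟩
    exact ⟨σ, ⟨hi.1.trans hσ.1, hσ.2⟩, hσ.1, h⟩
  obtain ⟨σ₀, h0, l0, e0⟩ := key 0 hs0 (not_le.1 fun h => hz (Or.inl (Or.inl (Or.inl h))))
  obtain ⟨σ₁, h1, l1, e1⟩ := key 1 hs1 (not_le.1 fun h => hz (Or.inl (Or.inl (Or.inr h))))
  have p0 : 0 ≤ s.1 := (hu 0).le.trans hs0.1
  have p1 : 0 ≤ s.2 := (hu 1).le.trans hs1.1
  have := hE (σ₀, σ₁) ⟨p0.trans l0, p1.trans l1, (hq (mem_Ici.2 p0) (mem_Ici.2 (p0.trans l0)) l0).trans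
    (hs.2.2.trans (ENNReal.ofReal_le_ofReal l1))⟩ h0 h1
  rw [e0, e1] at this
  exact this

end Sandwich

section Bracket

/-- The transformation of the observations that is inverse to multiplication of the estimated standardized
observations by `c`. -/
def estAff (gh ah bh c y : ℝ) : ℝ := ah * (c ^ (-gh) * ((y - bh) / ah) + boxCox gh c⁻¹) + bh

theorem continuous_estAff (gh ah bh c : ℝ) : Continuous (estAff gh ah bh c) := by
  unfold estAff; fun_prop

theorem mul_boxCox_inv {γ c : ℝ} (hc : 0 < c) : γ * boxCox γ c⁻¹ = c ^ (-γ) - 1 := by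
  by_cases h : γ = 0
  · simp [h]
  · have := one_add_mul_boxCox (x := c⁻¹) h
    rw [Real.inv_rpow hc.le, ← Real.rpow_neg hc.le] at this
    linarith

theorem estAff_value {gh ah bh c y a b : ℝ} (ha : a ≠ 0) (hah : ah ≠ 0) (hc : 0 < c) :
    (estAff gh ah bh c y - b) / a = c ^ (-gh) * ((y - b) / a) +
      boxCox gh c⁻¹ * (ah / a - gh * ((bh - b) / a)) := by
  have h := mul_boxCox_inv (γ := gh) hc
  have h' : c ^ (-gh) = gh * boxCox gh c⁻¹ + 1 := by linarith
  rw [estAff, h']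
  field_simp
  ring

theorem gexpr_antitone {γ K c θ θ' χ χ' ξ ξ' y : ℝ} (hK : 0 < K) (hc : 1 ≤ c) (hy : 0 ≤ y)
    (hθ : θ ≤ θ') (hχ : χ ≤ χ') (hξ : ξ ≤ ξ') (hξ0 : 0 ≤ 1 + ξ / K) :
    gexpr γ K c θ' χ' ξ' y ≤ gexpr γ K c θ χ ξ y := by
  have hc0 : 0 < c := by linarith
  have h1 : boxCox (γ - θ' / K) c⁻¹ ≤ boxCox (γ - θ / K) c⁻¹ :=
    boxCox_mono_index (by positivity) (by gcongr)
  have h2 : boxCox (γ - θ / K) c⁻¹ ≤ 0 := by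
    rw [← boxCox_one (γ - θ / K)]
    exact (boxCox_le_iff (by positivity) one_pos).2 (inv_le_one_of_one_le₀ hc)
  have h3 : 1 + ξ / K ≤ 1 + ξ' / K := by gcongr
  unfold gexpr
  refine add_le_add ?_ (mul_le_mul_of_nonneg_right
    (Real.rpow_le_rpow_of_exponent_le hc (by gcongr)) hy)
  nlinarith

theorem abs_rpow_sub_one_le {c x : ℝ} (hc : 1 ≤ c) (hx : |x| * Real.log c ≤ 1) :
    |c ^ x - 1| ≤ 2 * (|x| * Real.log c) := by
  have hc0 : 0 < c := by linarith
  have hl := Real.log_nonneg hc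
  have h1 : |Real.log c * x| ≤ 1 := by rwa [abs_mul, abs_of_nonneg hl, mul_comm]
  rw [Real.rpow_def_of_pos hc0]
  have := Real.abs_exp_sub_one_le h1
  rwa [abs_mul, abs_of_nonneg hl, mul_comm (Real.log c) |x|] at this

/-- Comparison of the estimated transformation with `gexpr` for negative extreme value index. -/
theorem bracket_neg {γ gh K c Γ' ξ' p' P G ε M y : ℝ} (hγ : γ < 0) (hK : 0 < K) (hc : 1 ≤ c)
    (hD : 2 ≤ c ^ (-γ)) (hgh : gh = γ + Γ' / K) (hgh0 : gh < 0) (hM : |Γ'| ≤ M)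
    (hlog : M / K * Real.log c ≤ 1) (hp' : p' = (γ * ξ' - Γ') / gh) (hpG : |p' - G| ≤ 3 / 2 * ε)
    (hpP : |p'| ≤ P) (hPe : P / K < 1 + γ * y)
    (hsmall : 4 * M * Real.log c * (P / K + (1 + γ * y)) ≤ ε / 2) :
    0 < 1 + ξ' / K + gh * y ∧
    gexpr γ K c 0 0 (G + 2 * ε) y ≤ c ^ (-gh) * y + boxCox gh c⁻¹ * (1 + ξ' / K) ∧
    c ^ (-gh) * y + boxCox gh c⁻¹ * (1 + ξ' / K) ≤ gexpr γ K c 0 0 (G + -(2 * ε)) y := by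
  have hc0 : 0 < c := by linarith
  have hγ' := hγ.ne
  have hgh' := hgh0.ne
  have hm : 1 + ξ' / K = gh * (1 + p' / K) / γ := by
    rw [hp', eq_div_iff hγ.ne]
    have : gh * (1 + (γ * ξ' - Γ') / gh / K) = gh + (γ * ξ' - Γ') / K := by
      field_simp
    rw [this, hgh]; field_simp; ring
  have hpK : |p' / K| ≤ P / K := by rw [abs_div, abs_of_pos hK]; gcongr
  have hpos : 0 < p' / K + (1 + γ * y) := by
    have := (abs_le.1 hpK).1; linarith
  have hB : ∀ g, g ≠ 0 → boxCox g c⁻¹ = (c ^ (-g) - 1) / g := fun g hg => by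
    rw [eq_div_iff hg, mul_comm, mul_boxCox_inv hc0]
  have hlogc := Real.log_nonneg hc
  have hDD : |c ^ (-gh) - c ^ (-γ)| ≤ c ^ (-γ) * (2 * (M / K * Real.log c)) := by
    have h1 : c ^ (-gh) = c ^ (-γ) * c ^ (-(Γ' / K)) := by
      rw [← Real.rpow_add hc0, hgh]; congr 1; ring
    have h2 : |-(Γ' / K)| ≤ M / K := by rw [abs_neg, abs_div, abs_of_pos hK]; gcongr
    have h3 : |-(Γ' / K)| * Real.log c ≤ M / K * Real.log c := by gcongr
    rw [h1, ← mul_sub_one, abs_mul, abs_of_pos (by positivity : 0 < c ^ (-γ))]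
    gcongr
    exact (abs_rpow_sub_one_le hc (h3.trans hlog)).trans (by linarith)
  have hM0 : 0 ≤ M := (abs_nonneg _).trans hM
  have key : ∀ ξ, γ * (c ^ (-gh) * y + boxCox gh c⁻¹ * (1 + ξ' / K) - gexpr γ K c 0 0 ξ y) =
      (c ^ (-γ) - 1) * (p' - ξ) / K + (c ^ (-gh) - c ^ (-γ)) * (p' / K + (1 + γ * y)) := fun ξ => by
    rw [gexpr, hm, hB gh hgh0.ne]
    simp only [zero_div, sub_zero, add_zero]
    rw [hB γ hγ.ne]
    field_simp
    ring
  have herr : |(c ^ (-gh) - c ^ (-γ)) * (p' / K + (1 + γ * y))| ≤ (c ^ (-γ) - 1) * (ε / 2) / K := by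
    have h1 : p' / K + (1 + γ * y) ≤ P / K + (1 + γ * y) := by linarith [le_abs_self (p' / K)]
    have h0 : 0 ≤ P / K + (1 + γ * y) := hpos.le.trans h1
    rw [abs_mul, abs_of_pos hpos]
    calc _ ≤ c ^ (-γ) * (2 * (M / K * Real.log c)) * (P / K + (1 + γ * y)) := by gcongr
      _ ≤ (2 * (c ^ (-γ) - 1)) * (2 * (M / K * Real.log c)) * (P / K + (1 + γ * y)) := by
        gcongr; linarith
      _ = (c ^ (-γ) - 1) * (4 * M * Real.log c * (P / K + (1 + γ * y))) / K := by ring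
      _ ≤ _ := by gcongr; linarith
  have herr' := abs_le.1 herr
  have hpG' := abs_le.1 hpG
  have hD1 : 0 ≤ c ^ (-γ) - 1 := by linarith
  refine ⟨?_, ?_, ?_⟩
  · have : 1 + ξ' / K + gh * y = gh / γ * (p' / K + (1 + γ * y)) := by
      rw [hm]; field_simp; ring
    rw [this]
    exact mul_pos (div_pos_of_neg_of_neg hgh0 hγ) hpos
  · have h1 := key (G + 2 * ε)
    have h2 : (c ^ (-γ) - 1) * (p' - (G + 2 * ε)) / K ≤ (c ^ (-γ) - 1) * (-(ε / 2)) / K := by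
      gcongr; linarith
    have h3 : (c ^ (-γ) - 1) * (-(ε / 2)) / K = -((c ^ (-γ) - 1) * (ε / 2) / K) := by ring
    nlinarith
  · have h1 := key (G + -(2 * ε))
    have h2 : (c ^ (-γ) - 1) * (ε / 2) / K ≤ (c ^ (-γ) - 1) * (p' - (G + -(2 * ε))) / K := by
      gcongr; linarith
    nlinarith

/-- Comparison of the estimated transformation with `gexpr` for non-negative extreme value index. -/
theorem bracket_nonneg {γ gh K c Γ' ξ' G ε N y : ℝ} (hK : 0 < K) (hc : 1 ≤ c) (hy : 0 ≤ y)
    (hgh : gh = γ + Γ' / K) (hG : |Γ' - G| ≤ 2 * ε) (hξ : |ξ'| ≤ N) (hN : N ≤ K) :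
    gexpr γ K c (-G + 2 * ε) (G + 2 * ε) N y ≤ c ^ (-gh) * y + boxCox gh c⁻¹ * (1 + ξ' / K) ∧
    c ^ (-gh) * y + boxCox gh c⁻¹ * (1 + ξ' / K) ≤
      gexpr γ K c (-G + -(2 * ε)) (G + -(2 * ε)) (-N) y := by
  have h0 : c ^ (-gh) * y + boxCox gh c⁻¹ * (1 + ξ' / K) = gexpr γ K c (-Γ') Γ' ξ' y := by
    rw [gexpr, hgh]; ring_nf
  have h1 := abs_le.1 hG
  have h2 := abs_le.1 hξ
  have h3 : -1 ≤ -N / K := by rw [le_div_iff₀ hK]; linarith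
  have h4 : -N / K ≤ ξ' / K := by gcongr; exact h2.1
  rw [h0]
  exact ⟨gexpr_antitone hK hc hy (by linarith) (by linarith) h2.2 (by linarith),
    gexpr_antitone hK hc hy (by linarith) (by linarith) h2.1 (by linarith)⟩

end Bracket

section QuantileBounds

variable {k d e : ℕ → ℝ} {γ : Fin 2 → ℝ} {A : Fin 2 → ℝ → ℝ} {A₀ : ℝ → ℝ}

theorem SmallBias.marginal_tendsto (h : SequenceGrowth k d e γ) (hb : SmallBias k d e γ A A₀)
    (i : Fin 2) : Tendsto (fun n : ℕ => |A i (n / k n)|) atTop (𝓝 0) := by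
  have h1 : Negl (rate k d e γ) (fun n => |A i (n / k n)|) := by
    refine Negl.mono h.rate_pos (remainder_isLittleO h hb : Negl _ _) ?_
    filter_upwards with n
    rw [abs_abs]
    exact le_remainder k A i n
  exact h1.tendsto_zero h.rate_pos h.rate_tendsto

theorem exists_mul_rpow_le_boxCox {γ : ℝ} (hγ : 0 ≤ γ) :
    ∃ δ B : ℝ, 0 < δ ∧ 1 ≤ B ∧ ∀ x, B ≤ x → δ * x ^ γ ≤ boxCox γ x := by
  rcases hγ.eq_or_lt with rfl | h
  · refine ⟨1, Real.exp 1, one_pos, by linarith [Real.add_one_le_exp (1 : ℝ)], fun x hx => ?_⟩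
    have hx0 : 0 < x := (Real.exp_pos _).trans_le hx
    rw [Real.rpow_zero, boxCox, if_pos rfl, mul_one, Real.le_log_iff_exp_le hx0]
    exact hx
  · refine ⟨1 / (2 * γ), 2 ^ (1 / γ), by positivity,
      Real.one_le_rpow (by norm_num) (by positivity), fun x hx => ?_⟩
    have h1 : 2 ≤ x ^ γ := by
      have := Real.rpow_le_rpow (by positivity) hx h.le
      rwa [← Real.rpow_mul (by norm_num), one_div_mul_cancel h.ne', Real.rpow_one] at this
    rw [boxCox, if_neg h.ne', le_div_iff₀ h]
    field_simp
    linarith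

variable {x ρ : ℝ} {u : ℕ → ℝ} {i : Fin 2} {F a b : ℝ → ℝ}

theorem SequenceGrowth.quantile_nonneg (h : SequenceGrowth k d e γ) (hb : SmallBias k d e γ A A₀)
    (hF : SecondOrder F (γ i) ρ a b (A i)) (hu : CutOff (γ i) x (rate k d e γ) (remainder k A) u)
    (hγ : 0 ≤ γ i) :
    ∀ᶠ n : ℕ in atTop, ∀ s, u n ≤ s → 0 ≤ (tailQ F (d n * s) - b (n / k n)) / a (n / k n) := by
  obtain ⟨C, hC, hY⟩ := h.tailQ_approx hu hF
  obtain ⟨δ, B, hδ, hB, hbox⟩ := exists_mul_rpow_le_boxCox hγ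
  have hA := (hb.marginal_tendsto h i).const_mul C
  rw [mul_zero] at hA
  filter_upwards [hY, h.x_ge hu B, hA.eventually (gt_mem_nhds hδ)] with n h1 h2 h3 s hs
  have h4 := (abs_le.1 (h1 s hs)).1
  have h5 := hbox _ (h2 s hs)
  have hx : 0 < d n / e n * cSeq k e n * s := by linarith [h2 s hs]
  have h6 : C * |A i (n / k n)| * (d n / e n * cSeq k e n * s) ^ γ i ≤
      δ * (d n / e n * cSeq k e n * s) ^ γ i := by gcongr
  linarith

theorem SequenceGrowth.quantile_le_log (h : SequenceGrowth k d e γ) (hb : SmallBias k d e γ A A₀)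
    (hF : SecondOrder F (γ i) ρ a b (A i)) (hu : CutOff (γ i) x (rate k d e γ) (remainder k A) u)
    (hγ : γ i = 0) :
    ∀ᶠ n : ℕ in atTop, ∀ s, u n ≤ s → (tailQ F (d n * s) - b (n / k n)) / a (n / k n) ≤
      Real.log (d n / e n * cSeq k e n * s) + 1 := by
  obtain ⟨C, hC, hY⟩ := h.tailQ_approx hu hF
  have hA := (hb.marginal_tendsto h i).const_mul C
  rw [mul_zero] at hA
  filter_upwards [hY, hA.eventually (gt_mem_nhds one_pos)] with n h1 h3 s hs
  have h4 := (abs_le.1 (h1 s hs)).2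
  rw [hγ, Real.rpow_zero, boxCox, if_pos rfl] at h4
  linarith

theorem SequenceGrowth.quantile_neg (h : SequenceGrowth k d e γ) (hb : SmallBias k d e γ A A₀)
    (hF : SecondOrder F (γ i) ρ a b (A i)) (hu : CutOff (γ i) x (rate k d e γ) (remainder k A) u)
    (hγ : γ i < 0) :
    ∀ᶠ n : ℕ in atTop, ∀ s, u n ≤ s →
      1 / 2 * (d n / e n * cSeq k e n * s) ^ γ i ≤
        1 + γ i * ((tailQ F (d n * s) - b (n / k n)) / a (n / k n)) ∧
      1 + γ i * ((tailQ F (d n * s) - b (n / k n)) / a (n / k n)) ≤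
        2 * (d n / e n * cSeq k e n * s) ^ γ i := by
  obtain ⟨C, hC, hY⟩ := h.tailQ_approx hu hF
  have hA := (hb.marginal_tendsto h i).const_mul (-γ i * C)
  rw [mul_zero] at hA
  filter_upwards [hY, hA.eventually (gt_mem_nhds (by norm_num : (0 : ℝ) < 1 / 2)),
    h.x_ge hu 1] with n h1 h3 h2 s hs
  set X := d n / e n * cSeq k e n * s
  have hX : 0 < X := by linarith [h2 s hs]
  have hXγ : 0 < X ^ γ i := by positivity
  have h4 := abs_le.1 (h1 s hs)
  have h5 := one_add_mul_boxCox (x := X) hγ.ne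
  have h6 : -γ i * (C * |A i (n / k n)| * X ^ γ i) ≤ 1 / 2 * X ^ γ i := by
    rw [← mul_assoc, ← mul_assoc]; gcongr
  constructor <;> nlinarith

/-- The weight for negative index dominates a power of `c`. -/
theorem SequenceGrowth.log_mul_rpow_tendsto (h : SequenceGrowth k d e γ) {err : ℕ → ℝ}
    (hu : CutOff (γ i) x (rate k d e γ) err u) (hγ : γ i < 0) :
    Tendsto (fun n => Real.log (cSeq k e n) * (d n / e n * cSeq k e n * u n) ^ γ i) atTop (𝓝 0) := by
  obtain ⟨C, hC, hlow⟩ := h.exists_le_c_mul_cutOff hu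
  obtain ⟨m, M, hm, hmM, hr⟩ := h.ratio_bounds
  set g := -γ i with hg
  have hg0 : 0 < g := by linarith
  have hγg : γ i = -g := by simp [hg]
  set C₂ := (1 / m ^ g) ^ (g / 4) / (g * (g / 4)) with hC₂
  set C₃ := (m / C) ^ γ i with hC₃
  have hlim : Tendsto (fun n => C₂ * C₃ * k n ^ (-(g / 8))) atTop (𝓝 0) := by
    have := ((tendsto_rpow_neg_atTop (by positivity : 0 < g / 8)).comp h.k_tendsto).const_mul (C₂ * C₃)
    rwa [mul_zero] at this
  refine squeeze_zero' ?_ ?_ hlim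
  · filter_upwards [h.log_tendsto.eventually_ge_atTop 0, h.x_ge hu 0] with n h1 h2
    exact mul_nonneg h1 (Real.rpow_nonneg (h2 _ le_rfl) _)
  · filter_upwards [h.log_tendsto.eventually_ge_atTop 0, hr, hlow,
      h.c_tendsto.eventually_ge_atTop 1, h.k_tendsto.eventually_gt_atTop 0,
      (h.weight_div_tendsto i).eventually (gt_mem_nhds one_pos), hu.pos] with n h1 h2 h3 h4 h5 h6 h7
    have hc0 : 0 < cSeq k e n := by linarith
    have hk : 0 < √(k n) := Real.sqrt_pos.2 h5
    have hcg : cSeq k e n ^ g ≤ 1 / m ^ g * √(k n) := by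
      rw [div_lt_one hk] at h6
      simp only [weight, hγ.not_gt, hγ.ne, if_false] at h6
      rw [← h.ratio_mul_cSeq, ← hg, Real.mul_rpow (hm.le.trans h2.1) hc0.le] at h6
      have h8 : m ^ g ≤ (d n / e n) ^ g := Real.rpow_le_rpow hm.le h2.1 hg0.le
      rw [div_mul_eq_mul_div, one_mul, le_div_iff₀ (by positivity), mul_comm]
      refine le_trans ?_ h6.le
      gcongr
    have hlog : Real.log (cSeq k e n) ≤ C₂ * k n ^ (g / 8) := by
      refine (Real.log_le_rpow_div hc0.le (by positivity : 0 < g * (g / 4))).trans ?_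
      rw [hC₂, div_mul_eq_mul_div]
      gcongr
      rw [Real.rpow_mul hc0.le]
      calc (cSeq k e n ^ g) ^ (g / 4) ≤ (1 / m ^ g * √(k n)) ^ (g / 4) := by gcongr
        _ = _ := by
          rw [Real.mul_rpow (by positivity) hk.le, Real.sqrt_eq_rpow, ← Real.rpow_mul h5.le]
          ring_nf
    have hx : (d n / e n * cSeq k e n * u n) ^ γ i ≤ C₃ * k n ^ (-(g / 4)) := by
      have h8 : m / C * k n ^ (1 / 4 : ℝ) ≤ d n / e n * cSeq k e n * u n := by
        calc m / C * k n ^ (1 / 4 : ℝ) = m * (k n ^ (1 / 4 : ℝ) / C) := by ring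
          _ ≤ d n / e n * (cSeq k e n * u n) :=
            mul_le_mul h2.1 h3 (by positivity) (hm.le.trans h2.1)
          _ = _ := by ring
      calc _ ≤ (m / C * k n ^ (1 / 4 : ℝ)) ^ γ i :=
            Real.rpow_le_rpow_of_nonpos (by positivity) h8 hγ.le
        _ = _ := by
          rw [Real.mul_rpow (by positivity) (by positivity), ← Real.rpow_mul h5.le, hC₃, hγg]
          ring_nf
    calc _ ≤ C₂ * k n ^ (g / 8) * (C₃ * k n ^ (-(g / 4))) :=
          mul_le_mul hlog hx (Real.rpow_nonneg (by have := hm.le.trans h2.1; positivity) _) (h1.trans hlog)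
      _ = C₂ * C₃ * (k n ^ (g / 8) * k n ^ (-(g / 4))) := by ring
      _ = _ := by rw [← Real.rpow_add h5]; congr 2; ring

theorem SequenceGrowth.sqrt_mul_rpow_tendsto (h : SequenceGrowth k d e γ) (hγ : γ i < 0) :
    Tendsto (fun n => √(k n) * (d n / e n * cSeq k e n * topCut (rate k d e γ) n) ^ γ i)
      atTop atTop := by
  have hg : 0 < 1 + 3 / 2 * γ i := by have := h.neg_half_lt i; linarith
  have h1 : Tendsto (fun n => (rate k d e γ n)⁻¹ ^ (1 + 3 / 2 * γ i)) atTop atTop := by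
    refine (tendsto_rpow_atTop hg).comp ?_
    exact (tendsto_nhdsWithin_iff.2 ⟨h.rate_tendsto, h.rate_pos⟩).inv_tendsto_nhdsGT_zero
  obtain ⟨m, M, hm, hmM, hr⟩ := h.ratio_bounds
  refine tendsto_atTop_mono' _ ?_ h1
  filter_upwards [h.rate_pos, (h.weight_tendsto i).eventually_gt_atTop 0, hr,
    h.c_tendsto.eventually_gt_atTop 0, h.sqrt_tendsto.eventually_gt_atTop 0] with n h2 h3 h4 h5 h6
  have hX : 0 < topCut (rate k d e γ) n := by unfold topCut; positivity
  have hrc : 0 < d n / e n * cSeq k e n := mul_pos (hm.trans_le h4.1) h5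
  have h7 : weight k d e (γ i) n = ((d n / e n * cSeq k e n) ^ γ i)⁻¹ := by
    simp only [weight, hγ.not_gt, hγ.ne, if_false]
    rw [← h.ratio_mul_cSeq, Real.rpow_neg hrc.le]
  have h8 : (rate k d e γ n)⁻¹ ≤ √(k n) * (d n / e n * cSeq k e n) ^ γ i := by
    have := weight_le_wMax k d e γ i n
    rw [rate, inv_div, div_le_iff₀ (h3.trans_le this)]
    calc √(k n) = √(k n) * (d n / e n * cSeq k e n) ^ γ i * weight k d e (γ i) n := by
          rw [h7, mul_assoc, mul_inv_cancel₀ (by positivity), mul_one]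
      _ ≤ _ := by gcongr
  rw [Real.mul_rpow hrc.le hX.le, ← mul_assoc]
  calc _ = (rate k d e γ n)⁻¹ * topCut (rate k d e γ) n ^ γ i := by
        rw [topCut, ← Real.rpow_mul h2.le, Real.inv_rpow h2.le, ← Real.rpow_neg h2.le,
          ← Real.rpow_neg_one, ← Real.rpow_add h2]
        congr 1; ring
    _ ≤ _ := by gcongr

theorem SequenceGrowth.log_topCut_div_tendsto (h : SequenceGrowth k d e γ) :
    Tendsto (fun n => (Real.log (d n / e n * cSeq k e n * topCut (rate k d e γ) n) + 1) / √(k n))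
      atTop (𝓝 0) := by
  obtain ⟨m, M, hm, hmM, hr⟩ := h.ratio_bounds
  have h1 : Tendsto (fun n => Real.log √(k n) / √(k n)) atTop (𝓝 0) :=
    Real.isLittleO_log_id_atTop.tendsto_div_nhds_zero.comp h.sqrt_tendsto
  have h2 : Tendsto (fun n => (Real.log M + 1) / √(k n)) atTop (𝓝 0) :=
    h.sqrt_tendsto.const_div_atTop _
  have h3 := (h2.add h.log_div_tendsto).add (h1.const_mul (3 / 2))
  simp only [mul_zero, add_zero] at h3
  have hX := tendsto_rpow_neg_three_halves h.rate_pos h.rate_tendsto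
  refine squeeze_zero' ?_ ?_ h3
  · filter_upwards [hr, h.c_tendsto.eventually_ge_atTop (1 / m), hX.eventually_ge_atTop 1]
      with n h4 h5 h6
    have h7 : 1 ≤ d n / e n * cSeq k e n := by
      calc 1 = m * (1 / m) := by field_simp
        _ ≤ _ := mul_le_mul h4.1 h5 (by positivity) (hm.le.trans h4.1)
    have h8 : 1 ≤ d n / e n * cSeq k e n * topCut (rate k d e γ) n := one_le_mul_of_one_le_of_one_le h7 h6
    have := Real.log_nonneg h8
    positivity
  · filter_upwards [hr, h.c_tendsto.eventually_gt_atTop 0, h.rate_pos,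
      h.wMax_tendsto.eventually_ge_atTop 1, h.sqrt_tendsto.eventually_gt_atTop 0] with n h4 h5 h6 h7 h8
    have h9 : 0 < d n / e n := hm.trans_le h4.1
    have h10 : (√(k n))⁻¹ ≤ rate k d e γ n := by
      rw [rate, inv_eq_one_div]; gcongr
    have h11 : -Real.log √(k n) ≤ Real.log (rate k d e γ n) := by
      rw [← Real.log_inv]; exact Real.log_le_log (by positivity) h10
    have h12 : Real.log (d n / e n) ≤ Real.log M := Real.log_le_log h9 h4.2
    rw [topCut, Real.log_mul (by positivity) (by positivity), Real.log_mul h9.ne' h5.ne',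
      Real.log_rpow h6, mul_div_assoc', ← add_div, ← add_div]
    exact div_le_div_of_nonneg_right (by linarith) h8.le

end QuantileBounds

section EstimatorBracket

/-- The linear combination of the errors of the marginal estimators that determines the parameters of the
comparison functions. -/
def gridVar (γ α β Γ : ℝ) : ℝ := if γ < 0 then α - γ * β - Γ / γ else Γ

/-- The parameter `θ` of the comparison functions. -/
def parTheta (γ G δ : ℝ) : ℝ := if γ < 0 then 0 else -G + δ

/-- The parameter `χ` of the comparison functions. -/
def parChi (γ G δ : ℝ) : ℝ := if γ < 0 then 0 else G + δ

/-- The parameter `ξ` of the comparison functions. -/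
def parXi (γ G δ N : ℝ) : ℝ := if γ < 0 then G + δ else N

theorem paramAff_le_iff {γ a b k c θ χ ξ y v : ℝ} (ha : 0 < a) :
    paramAff γ a b k c θ χ ξ y ≤ v ↔ gexpr γ √k c θ χ ξ ((y - b) / a) ≤ (v - b) / a := by
  rw [paramAff, le_div_iff₀ ha]
  constructor <;> intro h <;> linarith

theorem le_paramAff_iff {γ a b k c θ χ ξ y v : ℝ} (ha : 0 < a) :
    v ≤ paramAff γ a b k c θ χ ξ y ↔ (v - b) / a ≤ gexpr γ √k c θ χ ξ ((y - b) / a) := by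
  rw [paramAff, div_le_iff₀ ha]
  constructor <;> intro h <;> linarith

variable {k d e : ℕ → ℝ} {γ : Fin 2 → ℝ} {A : Fin 2 → ℝ → ℝ} {A₀ : ℝ → ℝ}
  {x ρ : ℝ} {u : ℕ → ℝ} {i : Fin 2} {F a b : ℝ → ℝ}

theorem SequenceGrowth.bracket_of_nonneg (h : SequenceGrowth k d e γ) (hb : SmallBias k d e γ A A₀)
    (hF : SecondOrder F (γ i) ρ a b (A i)) (hu : CutOff (γ i) x (rate k d e γ) (remainder k A) u)
    (hγ : 0 ≤ γ i) {M N ε : ℝ} (hM : 0 < M) (hN : 0 < N) (hε : 0 < ε) :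
    ∀ᶠ n : ℕ in atTop, ∀ gh ξ' Γ' G : ℝ, gh = γ i + Γ' / √(k n) → |Γ'| ≤ M → |ξ'| ≤ N →
      |Γ' - G| ≤ ε → ∀ s ∈ Icc (u n) (topCut (rate k d e γ) n),
      let Y := (tailQ F (d n * s) - b (n / k n)) / a (n / k n)
      let c := cSeq k e n
      0 < 1 + ξ' / √(k n) + gh * Y ∧
      gexpr (γ i) √(k n) c (-G + 2 * ε) (G + 2 * ε) N Y ≤
        c ^ (-gh) * Y + boxCox gh c⁻¹ * (1 + ξ' / √(k n)) ∧
      c ^ (-gh) * Y + boxCox gh c⁻¹ * (1 + ξ' / √(k n)) ≤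
        gexpr (γ i) √(k n) c (-G + -(2 * ε)) (G + -(2 * ε)) (-N) Y := by
  have hlogX : ∀ᶠ n : ℕ in atTop, γ i = 0 → ∀ s ∈ Icc (u n) (topCut (rate k d e γ) n),
      M / √(k n) * ((tailQ F (d n * s) - b (n / k n)) / a (n / k n)) < 1 / 2 := by
    rw [eventually_imp_distrib_left]
    intro hγ0
    have h1 := h.log_topCut_div_tendsto.const_mul M
    rw [mul_zero] at h1
    filter_upwards [h.quantile_le_log hb hF hu hγ0, h1.eventually (gt_mem_nhds one_half_pos),
      h.x_ge hu 1, h.sqrt_tendsto.eventually_gt_atTop 0,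
      h.c_tendsto.eventually_gt_atTop 0] with n h2 h3 h4 h5 h6 s hs
    have h7 := h4 s hs.1
    have h8 : 0 < d n / e n * cSeq k e n := mul_pos (div_pos (h.d_pos n) (h.e_pos n)) h6
    refine lt_of_le_of_lt ?_ h3
    rw [div_mul_eq_mul_div, mul_div_assoc]
    refine mul_le_mul_of_nonneg_left (div_le_div_of_nonneg_right ?_ h5.le) hM.le
    refine (h2 s hs.1).trans ?_
    have := Real.log_le_log (by linarith) (mul_le_mul_of_nonneg_left hs.2 h8.le)
    linarith
  have hMK : ∀ᶠ n : ℕ in atTop, 0 < γ i → M / √(k n) ≤ γ i := by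
    rw [eventually_imp_distrib_left]
    intro hγ0
    exact (h.sqrt_tendsto.const_div_atTop M).eventually (ge_mem_nhds hγ0)
  filter_upwards [h.quantile_nonneg hb hF hu hγ, hlogX, hMK, h.c_tendsto.eventually_ge_atTop 1,
    h.sqrt_tendsto.eventually_gt_atTop (2 * N)] with n h1 h2 h3 h4 h5 gh ξ' Γ' G hgh hΓ hξ hG s hs Y c
  have hK : 0 < √(k n) := by linarith
  have hY : 0 ≤ Y := h1 s hs.1
  have hm : 1 / 2 < 1 + ξ' / √(k n) := by
    have h6 : -(1 / 2) < -N / √(k n) := by rw [lt_div_iff₀ hK]; linarith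
    have h7 : -N / √(k n) ≤ ξ' / √(k n) := by gcongr; exact (abs_le.1 hξ).1
    linarith
  refine ⟨?_, bracket_nonneg hK h4 hY hgh (by linarith) hξ (by linarith)⟩
  have hghM : -(M / √(k n)) ≤ Γ' / √(k n) := by
    rw [← neg_div]; gcongr; exact (abs_le.1 hΓ).1
  rcases hγ.eq_or_lt with h0 | h0
  · have h6 := h2 h0.symm s hs
    have h7 : -(M / √(k n)) * Y ≤ gh * Y := by
      gcongr; rw [hgh, ← h0]; linarith
    linarith
  · have h6 := h3 h0
    have h7 : 0 ≤ gh * Y := mul_nonneg (by rw [hgh]; linarith) hY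
    linarith

theorem SequenceGrowth.bracket_of_neg (h : SequenceGrowth k d e γ) (hb : SmallBias k d e γ A A₀)
    (hF : SecondOrder F (γ i) ρ a b (A i)) (hu : CutOff (γ i) x (rate k d e γ) (remainder k A) u)
    (hγ : γ i < 0) {M N ε : ℝ} (hM : 0 < M) (hN : 0 < N) (hε : 0 < ε) :
    ∀ᶠ n : ℕ in atTop, ∀ gh α' β' ξ' Γ' G : ℝ, gh = γ i + Γ' / √(k n) → ξ' = α' - gh * β' →
      |Γ'| ≤ M → |β'| ≤ M → |ξ'| ≤ N → |α' - γ i * β' - Γ' / γ i - G| ≤ ε →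
      ∀ s ∈ Icc (u n) (topCut (rate k d e γ) n),
      let Y := (tailQ F (d n * s) - b (n / k n)) / a (n / k n)
      let c := cSeq k e n
      0 < 1 + ξ' / √(k n) + gh * Y ∧
      gexpr (γ i) √(k n) c 0 0 (G + 2 * ε) Y ≤
        c ^ (-gh) * Y + boxCox gh c⁻¹ * (1 + ξ' / √(k n)) ∧
      c ^ (-gh) * Y + boxCox gh c⁻¹ * (1 + ξ' / √(k n)) ≤
        gexpr (γ i) √(k n) c 0 0 (G + -(2 * ε)) Y := by
  set g := -γ i with hg
  have hg0 : 0 < g := by linarith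
  set P := 2 * (g * N + M) / g with hP
  have hP0 : 0 < P := by positivity
  have hinv : ∀ B : ℝ, Tendsto (fun n => B / √(k n)) atTop (𝓝 0) :=
    fun B => h.sqrt_tendsto.const_div_atTop B
  have hlogK := h.log_div_tendsto.const_mul M
  rw [mul_zero] at hlogK
  have hsm := ((h.log_div_tendsto.const_mul P).add ((h.log_mul_rpow_tendsto hu hγ).const_mul 2)).const_mul
    (4 * M)
  simp only [mul_zero, add_zero] at hsm
  have hcD : Tendsto (fun n => cSeq k e n ^ g) atTop atTop :=
    (tendsto_rpow_atTop hg0).comp h.c_tendsto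
  filter_upwards [h.quantile_neg hb hF hu hγ, h.c_tendsto.eventually_ge_atTop 1,
    hcD.eventually_ge_atTop 2, h.sqrt_tendsto.eventually_gt_atTop 0, h.x_ge hu 1,
    (hinv M).eventually (ge_mem_nhds (half_pos hg0)),
    (hinv (P * M / g + M * M)).eventually (ge_mem_nhds (half_pos hε)),
    hlogK.eventually (ge_mem_nhds one_pos), hsm.eventually (ge_mem_nhds (half_pos hε)),
    (h.sqrt_mul_rpow_tendsto (i := i) hγ).eventually_gt_atTop (2 * P), hu.pos]
    with n h1 h2 h3 hK h4 h5 h6 h7 h8 h9 h10 gh α' β' ξ' Γ' G hgh hξ' hΓ hβ hξ hG s hs Y c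
  have hΓK : |Γ' / √(k n)| ≤ M / √(k n) := by rw [abs_div, abs_of_pos hK]; gcongr
  have hghle : gh ≤ -(g / 2) := by have := (abs_le.1 hΓK).2; rw [hgh]; linarith
  have hgh0 : gh < 0 := by linarith
  have hpP : |(γ i * ξ' - Γ') / gh| ≤ P := by
    have e1 : |γ i * ξ' - Γ'| ≤ g * N + M := by
      refine (abs_sub _ _).trans ?_
      rw [abs_mul, abs_of_neg hγ]
      gcongr
    rw [abs_div, abs_of_neg hgh0, hP, div_le_div_iff₀ (by linarith) hg0]
    have e2 : 0 ≤ g * N + M := by positivity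
    nlinarith
  have hpG : |(γ i * ξ' - Γ') / gh - G| ≤ 3 / 2 * ε := by
    have e1 : (γ i * ξ' - Γ') / gh - (α' - γ i * β' - Γ' / γ i) =
        -((γ i * ξ' - Γ') / gh * (Γ' / γ i) + Γ' * β') / √(k n) := by
      have hγ' := hγ.ne
      have hgh' := hgh0.ne
      rw [eq_div_iff hK.ne', hξ']
      field_simp
      rw [hgh]
      field_simp
      ring
    have e2 : |(γ i * ξ' - Γ') / gh - (α' - γ i * β' - Γ' / γ i)| ≤ (P * M / g + M * M) / √(k n) := by
      rw [e1, abs_div, abs_neg, abs_of_pos hK]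
      gcongr
      refine (abs_add_le _ _).trans (add_le_add ?_ ?_)
      · rw [abs_mul, abs_div Γ', abs_of_neg hγ, mul_div_assoc]; gcongr
      · rw [abs_mul]; gcongr
    have e3 := abs_le.1 (e2.trans h6)
    have e4 := abs_le.1 hG
    rw [abs_le]; constructor <;> linarith
  have hx1 : 1 ≤ d n / e n * cSeq k e n * s := h4 s hs.1
  have hrc : 0 < d n / e n * cSeq k e n :=
    mul_pos (div_pos (h.d_pos n) (h.e_pos n)) (by linarith)
  have hY := h1 s hs.1
  have hs0 : 0 < s := h10.trans_le hs.1
  have hlogc : 0 ≤ Real.log (cSeq k e n) := Real.log_nonneg h2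
  refine bracket_neg hγ hK h2 h3 hgh hgh0 hΓ ?_ rfl hpG hpP ?_ ?_
  · rw [div_mul_eq_mul_div, mul_div_assoc]; exact h7
  · refine lt_of_lt_of_le ?_ hY.1
    have e1 : (d n / e n * cSeq k e n * topCut (rate k d e γ) n) ^ γ i ≤
        (d n / e n * cSeq k e n * s) ^ γ i :=
      Real.rpow_le_rpow_of_nonpos (by positivity) (mul_le_mul_of_nonneg_left hs.2 hrc.le) hγ.le
    have e2 : P / √(k n) < 1 / 2 * (d n / e n * cSeq k e n * topCut (rate k d e γ) n) ^ γ i := by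
      rw [div_lt_iff₀ hK]; linarith
    linarith
  · refine le_trans ?_ h8
    have e1 : (d n / e n * cSeq k e n * s) ^ γ i ≤ (d n / e n * cSeq k e n * u n) ^ γ i :=
      Real.rpow_le_rpow_of_nonpos (by positivity) (mul_le_mul_of_nonneg_left hs.1 hrc.le) hγ.le
    have e2 := hY.2.trans (mul_le_mul_of_nonneg_left e1 zero_le_two)
    calc 4 * M * Real.log (cSeq k e n) * (P / √(k n) + (1 + γ i * Y))
        ≤ 4 * M * Real.log (cSeq k e n) * (P / √(k n) +
          2 * (d n / e n * cSeq k e n * u n) ^ γ i) := by gcongr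
      _ = _ := by ring

/-- The estimated transformation lies between two transformations with fixed parameters. -/
theorem SequenceGrowth.estimator_bracket (h : SequenceGrowth k d e γ) (hb : SmallBias k d e γ A A₀)
    (hF : SecondOrder F (γ i) ρ a b (A i)) (hu : CutOff (γ i) x (rate k d e γ) (remainder k A) u)
    {M ε : ℝ} (hM : 0 < M) (hε : 0 < ε) :
    ∀ᶠ n : ℕ in atTop, ∀ gh ah bh G : ℝ, |√(k n) * (ah / a (n / k n) - 1)| ≤ M →
      |√(k n) * ((bh - b (n / k n)) / a (n / k n))| ≤ M → |√(k n) * (gh - γ i)| ≤ M →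
      |gridVar (γ i) (√(k n) * (ah / a (n / k n) - 1)) (√(k n) * ((bh - b (n / k n)) / a (n / k n)))
        (√(k n) * (gh - γ i)) - G| ≤ ε →
      0 < ah ∧ ∀ s ∈ Icc (u n) (topCut (rate k d e γ) n),
        0 < 1 + gh * ((tailQ F (d n * s) - bh) / ah) ∧
        paramAff (γ i) (a (n / k n)) (b (n / k n)) (k n) (cSeq k e n) (parTheta (γ i) G (2 * ε))
          (parChi (γ i) G (2 * ε)) (parXi (γ i) G (2 * ε) ((|γ i| + 2) * M)) (tailQ F (d n * s)) ≤
          estAff gh ah bh (cSeq k e n) (tailQ F (d n * s)) ∧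
        estAff gh ah bh (cSeq k e n) (tailQ F (d n * s)) ≤
          paramAff (γ i) (a (n / k n)) (b (n / k n)) (k n) (cSeq k e n) (parTheta (γ i) G (-(2 * ε)))
          (parChi (γ i) G (-(2 * ε))) (parXi (γ i) G (-(2 * ε)) (-((|γ i| + 2) * M)))
          (tailQ F (d n * s)) := by
  set N := (|γ i| + 2) * M with hN
  have hN0 : 0 < N := by positivity
  have hpos : ∀ᶠ n : ℕ in atTop, 0 ≤ γ i → _ := eventually_imp_distrib_left.2 fun hγ =>
    h.bracket_of_nonneg hb hF hu hγ hM hN0 hε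
  have hneg : ∀ᶠ n : ℕ in atTop, γ i < 0 → _ := eventually_imp_distrib_left.2 fun hγ =>
    h.bracket_of_neg hb hF hu hγ hM hN0 hε
  filter_upwards [hpos, hneg, h.sqrt_tendsto.eventually_gt_atTop M,
    h.n_div_k_tendsto.eventually_gt_atTop 0, h.c_tendsto.eventually_gt_atTop 0]
    with n hpos hneg hK ht hc gh ah bh G hα hβ hΓ hG
  have ha : 0 < a (n / k n) := hF.a_pos _ ht
  have hK0 : 0 < √(k n) := hM.trans hK
  set α' := √(k n) * (ah / a (n / k n) - 1) with hα'
  set β' := √(k n) * ((bh - b (n / k n)) / a (n / k n)) with hβ'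
  set Γ' := √(k n) * (gh - γ i) with hΓ'
  have eα : ah / a (n / k n) = 1 + α' / √(k n) := by rw [hα', mul_div_cancel_left₀ _ hK0.ne']; ring
  have eβ : (bh - b (n / k n)) / a (n / k n) = β' / √(k n) := by
    rw [hβ', mul_div_cancel_left₀ _ hK0.ne']
  have eΓ : gh = γ i + Γ' / √(k n) := by rw [hΓ', mul_div_cancel_left₀ _ hK0.ne']; ring
  clear_value α' β' Γ'
  have hahpos : 0 < ah / a (n / k n) := by
    have h1 : -1 < -M / √(k n) := by rw [lt_div_iff₀ hK0]; linarith
    have h2 : -M / √(k n) ≤ α' / √(k n) := by gcongr; exact (abs_le.1 hα).1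
    rw [eα]; linarith
  have hah : 0 < ah := by
    have := mul_pos hahpos ha
    rwa [div_mul_cancel₀ _ ha.ne'] at this
  set ξ' := α' - gh * β' with hξ'
  have hξ : |ξ'| ≤ N := by
    have h1 : |gh| ≤ |γ i| + 1 := by
      rw [eΓ]
      refine (abs_add_le _ _).trans ?_
      gcongr
      rw [abs_div, abs_of_pos hK0, div_le_one hK0]; exact hΓ.trans hK.le
    calc |ξ'| ≤ |α'| + |gh * β'| := abs_sub _ _
      _ ≤ M + (|γ i| + 1) * M := by rw [abs_mul]; gcongr
      _ = N := by rw [hN]; ring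
  have hm : ah / a (n / k n) - gh * ((bh - b (n / k n)) / a (n / k n)) = 1 + ξ' / √(k n) := by
    rw [eα, eβ, hξ']; ring
  have hval : ∀ y, (estAff gh ah bh (cSeq k e n) y - b (n / k n)) / a (n / k n) =
      cSeq k e n ^ (-gh) * ((y - b (n / k n)) / a (n / k n)) +
        boxCox gh (cSeq k e n)⁻¹ * (1 + ξ' / √(k n)) := fun y => by
    rw [estAff_value ha.ne' hah.ne' hc, hm]
  have hposv : ∀ y, 0 < 1 + ξ' / √(k n) + gh * ((y - b (n / k n)) / a (n / k n)) →
      0 < 1 + gh * ((y - bh) / ah) := fun y hy => by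
    have : 1 + gh * ((y - bh) / ah) =
        (1 + ξ' / √(k n) + gh * ((y - b (n / k n)) / a (n / k n))) / (ah / a (n / k n)) := by
      rw [← hm]; field_simp; ring
    rw [this]
    exact div_pos hy hahpos
  refine ⟨hah, fun s hs => ?_⟩
  rw [paramAff_le_iff ha, le_paramAff_iff ha, hval]
  rcases lt_or_ge (γ i) 0 with hγ | hγ
  · simp only [parTheta, parChi, parXi, gridVar, hγ, if_true] at hG ⊢
    obtain ⟨h1, h2, h3⟩ := hneg hγ gh α' β' ξ' Γ' G eΓ rfl hΓ hβ hξ hG s hs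
    exact ⟨hposv _ h1, h2, h3⟩
  · simp only [parTheta, parChi, parXi, gridVar, hγ.not_gt, if_false] at hG ⊢
    obtain ⟨h1, h2, h3⟩ := hpos hγ gh ξ' Γ' G eΓ hΓ hξ hG s hs
    exact ⟨hposv _ h1, h2, h3⟩

end EstimatorBracket

section EstimatedSet

variable {gh ah bh c y z : ℝ}

theorem estAff_gpdInv (hc : 0 < c) (hah : 0 < ah) (hv : 0 < 1 + gh * ((y - bh) / ah)) :
    ∃ x, 0 < x ∧ ENNReal.ofReal c⁻¹ * gpdInv gh ((y - bh) / ah) = ENNReal.ofReal x ∧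
      boxCox gh x = (estAff gh ah bh c y - bh) / ah := by
  have hζ := gpdReal_pos hv
  refine ⟨c⁻¹ * gpdReal gh ((y - bh) / ah), by positivity, ?_, ?_⟩
  · nth_rw 1 [← boxCox_gpdReal hv]
    rw [gpdInv_boxCox hζ, ENNReal.ofReal_mul (by positivity)]
  · rw [boxCox_mul (by positivity) hζ, boxCox_gpdReal hv, Real.inv_rpow hc.le,
      ← Real.rpow_neg hc.le, estAff, add_sub_cancel_right, mul_div_cancel_left₀ _ hah.ne']

theorem estAff_le (hc : 0 < c) (hah : 0 < ah) (hv : 0 < 1 + gh * ((y - bh) / ah))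
    (h : ENNReal.ofReal c⁻¹ * gpdInv gh ((y - bh) / ah) ≤ gpdInv gh ((z - bh) / ah)) :
    estAff gh ah bh c y ≤ z := by
  obtain ⟨x, hx, h1, h2⟩ := estAff_gpdInv hc hah hv
  rw [h1, ofReal_le_gpdInv_iff hx, h2, div_le_div_iff_of_pos_right hah] at h
  linarith

theorem gpdInv_estAff (hc : 0 < c) (hah : 0 < ah) (hv : 0 < 1 + gh * ((y - bh) / ah)) :
    gpdInv gh ((estAff gh ah bh c y - bh) / ah) =
      ENNReal.ofReal c⁻¹ * gpdInv gh ((y - bh) / ah) := by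
  obtain ⟨x, hx, h1, h2⟩ := estAff_gpdInv hc hah hv
  rw [h1, ← h2, gpdInv_boxCox hx]

/-- The points that are counted by the estimator of the failure probability. -/
def estSet (gh ah bh : Fin 2 → ℝ) (σ : ℝ) (D : Set (ℝ × ℝ)) : Set (ℝ × ℝ) :=
  {z | standardize gh ah bh z ∈ (fun w : ℝ≥0∞ × ℝ≥0∞ =>
    (ENNReal.ofReal σ * w.1, ENNReal.ofReal σ * w.2)) '' (standardize gh ah bh '' D)}

theorem mem_tailImage_iff {μ : Measure (ℝ × ℝ)} [IsProbabilityMeasure μ] {t : ℝ} {C : Set (ℝ × ℝ)}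
    {z : ℝ × ℝ} : z ∈ tailImage (margins μ) t C ↔ ∃ s ∈ C, ∀ i, 1 < t * coord i s ∧
      coord i z = tailQ (margins μ i) (t * coord i s) := by
  have := isProbabilityMeasure_coord μ 0
  have := isProbabilityMeasure_coord μ 1
  simp only [tailImage, mem_ofPred_eq, margins_eq, coe_eq_tailQuantile_iff, Fin.forall_fin_two]
  rfl

theorem mem_estSet_iff {μ : Measure (ℝ × ℝ)} [IsProbabilityMeasure μ] {gh ah bh : Fin 2 → ℝ}
    {σ t : ℝ} {C : Set (ℝ × ℝ)} {z : ℝ × ℝ} :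
    z ∈ estSet gh ah bh σ (tailImage (margins μ) t C) ↔ ∃ s ∈ C, ∀ i, 1 < t * coord i s ∧
      gpdInv (gh i) ((coord i z - bh i) / ah i) = ENNReal.ofReal σ *
        gpdInv (gh i) ((tailQ (margins μ i) (t * coord i s) - bh i) / ah i) := by
  constructor
  · rintro ⟨_, ⟨w, hw, rfl⟩, hz⟩
    obtain ⟨s, hs, hsw⟩ := mem_tailImage_iff.1 hw
    refine ⟨s, hs, fun i => ⟨(hsw i).1, ?_⟩⟩
    rw [← (hsw i).2]
    fin_cases i
    · exact (congrArg Prod.fst hz).symm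
    · exact (congrArg Prod.snd hz).symm
  · rintro ⟨s, hs, hsz⟩
    refine ⟨_, ⟨(tailQ (margins μ 0) (t * s.1), tailQ (margins μ 1) (t * s.2)),
      mem_tailImage_iff.2 ⟨s, hs, fun i => ⟨(hsz i).1, ?_⟩⟩, rfl⟩, ?_⟩
    · fin_cases i <;> rfl
    · exact Prod.ext (hsz 0).2.symm (hsz 1).2.symm

variable {μ ν : Measure (ℝ × ℝ)} {η : ℝ × ℝ → ℝ} {γ ρ : Fin 2 → ℝ}
  {a b A : Fin 2 → ℝ → ℝ} {A₀ : ℝ → ℝ} {q p : ℝ → ℝ≥0∞} {x₀ : Fin 2 → ℝ} {u : Fin 2 → ℕ → ℝ}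
  {k d e : ℕ → ℝ}

/-- The comparison transformations. -/
def bracketAff (γ : Fin 2 → ℝ) (a b : Fin 2 → ℝ → ℝ) (k e : ℕ → ℝ) (G : Fin 2 → ℝ) (δ M : ℝ) :
    Fin 2 → ℕ → ℝ → ℝ :=
  affSeq γ a b k e (fun i => parTheta (γ i) (G i) δ) (fun i => parChi (γ i) (G i) δ)
    (fun i => parXi (γ i) (G i) δ ((|γ i| + 2) * M))

theorem exists_scheme_bracket (hS1 : SequenceGrowth k d e γ) (hS2 : SmallBias k d e γ A A₀)
    (hD1 : DependenceRate μ ν γ a b q k d e A₀)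
    (hB : Base μ ν η γ ρ a b A q p x₀ (rate k d e γ) (remainder k A) u) (G : Fin 2 → ℝ) (δ M : ℝ) :
    ∃ H, Scheme μ ν γ a b A q (rate k d e γ) u d (fun n => n / k n) (fun n => d n / e n)
      (bracketAff γ a b k e G δ M) H
      (fun i n => ellParam (γ i) (parTheta (γ i) (G i) δ) (parChi (γ i) (G i) δ)
        (parXi (γ i) (G i) δ ((|γ i| + 2) * M)) * (weight k d e (γ i) n / wMax k d e γ n)) :=
  exists_scheme_params hS1 hS2 hD1 hB fun i hi => by simp [parTheta, parChi, hi]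

variable [IsProbabilityMeasure μ]

theorem estSet_sandwich (hS1 : SequenceGrowth k d e γ) (hS2 : SmallBias k d e γ A A₀)
    (hD1 : DependenceRate μ ν γ a b q k d e A₀)
    (hB : Base μ ν η γ ρ a b A q p x₀ (rate k d e γ) (remainder k A) u) {M ε : ℝ} (hM : 0 < M)
    (hε : 0 < ε) (G : Fin 2 → ℝ) :
    ∀ᶠ n : ℕ in atTop, ∀ gh ah bh : Fin 2 → ℝ,
      (∀ i, |√(k n) * (ah i / a i (n / k n) - 1)| ≤ M ∧
        |√(k n) * ((bh i - b i (n / k n)) / a i (n / k n))| ≤ M ∧ |√(k n) * (gh i - γ i)| ≤ M ∧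
        |gridVar (γ i) (√(k n) * (ah i / a i (n / k n) - 1))
          (√(k n) * ((bh i - b i (n / k n)) / a i (n / k n))) (√(k n) * (gh i - γ i)) - G i| ≤ ε) →
      kernelSet μ q (rate k d e γ) d u (bracketAff γ a b k e G (-(2 * ε)) (-M)) n \
          junkSet μ q p x₀ (rate k d e γ) d u (bracketAff γ a b k e G (2 * ε) M) n ⊆
        estSet gh ah bh (n / (k n * e n)) (tailImage (margins μ) (d n) (failSet q)) ∧
      estSet gh ah bh (n / (k n * e n)) (tailImage (margins μ) (d n) (failSet q)) ⊆
        kernelSet μ q (rate k d e γ) d u (bracketAff γ a b k e G (2 * ε) M) n ∪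
          junkSet μ q p x₀ (rate k d e γ) d u (bracketAff γ a b k e G (2 * ε) M) n := by
  obtain ⟨H, hS⟩ := exists_scheme_bracket hS1 hS2 hD1 hB G (2 * ε) M
  obtain ⟨H', hS'⟩ := exists_scheme_id hS1 hS2 hD1 hB
  have hbr : ∀ᶠ n : ℕ in atTop, ∀ i, _ := eventually_all.2 fun i =>
    hS1.estimator_bracket hS2 (i := i) (hB.second i) (hB.cut i) hM hε
  have hcont : ∀ᶠ n : ℕ in atTop, ∀ i, _ := eventually_all.2 fun i => hS'.strictMonoOn hB i
  have hu : ∀ᶠ n : ℕ in atTop, ∀ i, _ := eventually_all.2 fun i => (hB.cut i).pos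
  have hdl : ∀ᶠ n : ℕ in atTop, ∀ i, _ := eventually_all.2 fun i => hS1.d_large hB 2 i
  filter_upwards [hbr, hcont, hu, hdl, hS.subset_kernelSet_union hB,
    hS1.c_tendsto.eventually_gt_atTop 0] with n hbr hcont hu hdl hsub hc gh ah bh hest
  have hσ : (n : ℝ) / (k n * e n) = (cSeq k e n)⁻¹ := by rw [cSeq, inv_div]
  have hi := fun i => hbr i (gh i) (ah i) (bh i) (G i) (hest i).1 (hest i).2.1 (hest i).2.2.1
    (hest i).2.2.2
  rw [hσ]
  refine ⟨kernelSet_sdiff_subset (φ := fun i s =>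
    estAff (gh i) (ah i) (bh i) (cSeq k e n) (tailQ (margins μ i) (d n * s))) hB.pair.anti_left hu
    ?_ ?_ ?_ ?_, hsub _ ?_⟩
  · intro s hs h0 h1
    refine mem_estSet_iff.2 ⟨s, hs, fun i => ?_⟩
    have hsi : coord i s ∈ Icc (u i n) (topCut (rate k d e γ) n) := by
      fin_cases i
      · exact h0
      · exact h1
    refine ⟨by linarith [hdl i _ hsi.1], ?_⟩
    rw [← gpdInv_estAff hc (hi i).1 ((hi i).2 _ hsi).1]
    fin_cases i <;> rfl
  · intro i
    exact (continuous_estAff _ _ _ _).comp_continuousOn ((hcont i).2.mono Icc_subset_Ici_self)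
  · intro i w hw
    have := ((hi i).2 w hw).2.2
    rw [← mul_neg (|γ i| + 2) M] at this
    exact this
  · intro i w hw
    exact ((hi i).2 w hw).2.1
  · intro z hz
    obtain ⟨s, hs, hsz⟩ := mem_estSet_iff.1 hz
    refine ⟨s, hs, fun i w hw hws => ?_⟩
    have := isProbabilityMeasure_coord μ i
    refine le_trans ((hi i).2 w hw).2.1 (estAff_le hc (hi i).1 ((hi i).2 w hw).1 ?_)
    rw [(hsz i).2]
    refine mul_le_mul_right (gpdInv_mono _ ?_) _
    have h1 : tailQ (margins μ i) (d n * w) ≤ tailQ (margins μ i) (d n * coord i s) := by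
      rw [margins_eq]
      exact tailQ_mono _ (by linarith [hdl i _ hw.1])
        (mul_le_mul_of_nonneg_left hws (hS1.d_pos n).le)
    have := (hi i).1
    gcongr

theorem tailImage_sandwich (hS1 : SequenceGrowth k d e γ) (hS2 : SmallBias k d e γ A A₀)
    (hD1 : DependenceRate μ ν γ a b q k d e A₀)
    (hB : Base μ ν η γ ρ a b A q p x₀ (rate k d e γ) (remainder k A) u) :
    ∀ᶠ n : ℕ in atTop,
      kernelSet μ q (rate k d e γ) d u (fun _ _ y => y) n ⊆
        tailImage (margins μ) (d n) (failSet q) ∧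
      tailImage (margins μ) (d n) (failSet q) ⊆
        kernelSet μ q (rate k d e γ) d u (fun _ _ y => y) n ∪
          junkSet μ q p x₀ (rate k d e γ) d u (fun _ _ y => y) n := by
  obtain ⟨H', hS'⟩ := exists_scheme_id hS1 hS2 hD1 hB
  have hdl : ∀ᶠ n : ℕ in atTop, ∀ i, _ := eventually_all.2 fun i => hS1.d_large hB 2 i
  filter_upwards [hdl, hS'.subset_kernelSet_union hB] with n hdl hsub
  refine ⟨?_, hsub _ ?_⟩
  · rintro _ ⟨s, ⟨hs, h0, h1⟩, rfl⟩
    refine mem_tailImage_iff.2 ⟨s, hs, fun i => ?_⟩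
    fin_cases i
    · exact ⟨one_lt_two.trans_le (hdl 0 _ h0.1), rfl⟩
    · exact ⟨one_lt_two.trans_le (hdl 1 _ h1.1), rfl⟩
  · intro z hz
    obtain ⟨s, hs, hsz⟩ := mem_tailImage_iff.1 hz
    refine ⟨s, hs, fun i w hw hws => ?_⟩
    have := isProbabilityMeasure_coord μ i
    rw [(hsz i).2, margins_eq]
    exact tailQ_mono _ (by linarith [hdl i _ hw.1]) (mul_le_mul_of_nonneg_left hws (hS1.d_pos n).le)

end EstimatedSet

section Counting

variable {Ω : Type*} [MeasurableSpace Ω] {P : Measure Ω} [IsProbabilityMeasure P]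

/-- The number of points in a set. -/
def count {n : ℕ} (z : Fin n → ℝ × ℝ) (E : Set (ℝ × ℝ)) : ℝ := ({i | z i ∈ E} : Set (Fin n)).ncard

theorem count_mono {n : ℕ} (z : Fin n → ℝ × ℝ) {E E' : Set (ℝ × ℝ)} (h : E ⊆ E') :
    count z E ≤ count z E' := by
  have : {i | z i ∈ E} ⊆ {i | z i ∈ E'} := fun i hi => h hi
  exact Nat.cast_le.2 (Set.ncard_le_ncard this (Set.toFinite _))

theorem count_eq_sum {n : ℕ} (z : Fin n → ℝ × ℝ) (E : Set (ℝ × ℝ)) :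
    count z E = ∑ i, E.indicator (fun _ => (1 : ℝ)) (z i) := by
  classical
  have h : ∀ i, E.indicator (fun _ => (1 : ℝ)) (z i) = if z i ∈ E then 1 else 0 := fun i => by
    simp [indicator]
  simp only [h, Finset.sum_boole, count]
  rw [Set.ncard_eq_toFinset_card']
  congr 2
  ext i
  simp

theorem count_chebyshev {μ : Measure (ℝ × ℝ)} [IsProbabilityMeasure μ] {n : ℕ}
    {Z : Fin n → Ω → ℝ × ℝ} (hm : ∀ i, Measurable (Z i)) (hlaw : ∀ i, P.map (Z i) = μ)
    (hind : iIndepFun Z P) {E : Set (ℝ × ℝ)} (hE : MeasurableSet E) {s : ℝ} (hs : 0 < s) :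
    P {ω | s ≤ |count (fun i => Z i ω) E - n * μ.real E|} ≤ ENNReal.ofReal (n * μ.real E / s ^ 2) := by
  set f : ℝ × ℝ → ℝ := E.indicator (fun _ => (1 : ℝ)) with hf
  have hfm : Measurable f := measurable_const.indicator hE
  have hf0 : ∀ z, 0 ≤ f z := fun z => indicator_nonneg (fun _ _ => zero_le_one) z
  have hf1 : ∀ z, f z ≤ 1 := fun z => indicator_le_self' (fun _ _ => zero_le_one) z
  have hf2 : ∀ z, f z ^ 2 = f z := fun z => by
    by_cases h : z ∈ E <;> simp [hf, h]
  set X : Fin n → Ω → ℝ := fun i => f ∘ Z i with hX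
  have hXm : ∀ i, Measurable (X i) := fun i => hfm.comp (hm i)
  have hXL : ∀ i, MemLp (X i) 2 P := fun i => by
    refine MemLp.of_bound (hXm i).aestronglyMeasurable 1 (Eventually.of_forall fun ω => ?_)
    exact (abs_of_nonneg (hf0 (Z i ω))).le.trans (hf1 _)
  have hmean : ∀ i, P[X i] = μ.real E := fun i => by
    have h1 : ∫ ω, X i ω ∂P = ∫ z, f z ∂(P.map (Z i)) :=
      (integral_map (hm i).aemeasurable hfm.aestronglyMeasurable).symm
    rw [h1, hlaw i, hf, integral_indicator_const _ hE, smul_eq_mul, mul_one]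
  have hvar : ∀ i, Var[X i; P] ≤ μ.real E := fun i => by
    refine (variance_le_expectation_sq (hXm i).aestronglyMeasurable).trans (le_of_eq ?_)
    rw [← hmean i]
    refine integral_congr_ae (Eventually.of_forall fun ω => ?_)
    exact hf2 _
  have hsum : (∑ i, X i) = fun ω => count (fun i => Z i ω) E := by
    funext ω
    rw [count_eq_sum, Finset.sum_apply]
    rfl
  have hVar : Var[∑ i, X i; P] ≤ n * μ.real E := by
    rw [IndepFun.variance_sum (fun i _ => hXL i)]
    · refine (Finset.sum_le_sum fun i _ => hvar i).trans (le_of_eq ?_)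
      simp
    · intro i _ j _ hij
      exact (hind.indepFun hij).comp hfm hfm
  have hMean : P[∑ i, X i] = n * μ.real E := by
    have h1 : ∫ ω, (∑ i, X i) ω ∂P = ∑ i, ∫ ω, X i ω ∂P := by
      simp only [Finset.sum_apply]
      exact integral_finsetSum _ fun i _ => (hXL i).integrable one_le_two
    rw [h1]
    simp [hmean]
  have hL : MemLp (∑ i, X i) 2 P := memLp_finsetSum' _ fun i _ => hXL i
  have h2 := meas_ge_le_variance_div_sq hL hs
  rw [hMean, hsum] at h2
  rw [hsum] at hVar
  refine h2.trans (ENNReal.ofReal_le_ofReal ?_)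
  gcongr

end Counting

section RareEvents

variable {Ω : Type*} [MeasurableSpace Ω] {P : Measure Ω}

/-- Events whose probabilities tend to zero. -/
def Rare (P : Measure Ω) (s : ℕ → Set Ω) : Prop := Tendsto (fun n => P (s n)) atTop (𝓝 0)

theorem Rare.mono {s s' : ℕ → Set Ω} (h : Rare P s) (hs : ∀ᶠ n in atTop, s' n ⊆ s n) : Rare P s' := by
  refine tendsto_of_tendsto_of_tendsto_of_le_of_le' tendsto_const_nhds h
    (Eventually.of_forall fun _ => zero_le) ?_
  filter_upwards [hs] with n hn using measure_mono hn

theorem Rare.union {s s' : ℕ → Set Ω} (h : Rare P s) (h' : Rare P s') :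
    Rare P (fun n => s n ∪ s' n) := by
  have h1 := Tendsto.add h h'
  rw [add_zero] at h1
  exact tendsto_of_tendsto_of_tendsto_of_le_of_le tendsto_const_nhds h1
    (fun _ => zero_le) fun n => measure_union_le _ _

theorem Rare.biUnion {ι : Type*} {T : Set ι} (hT : T.Finite) {s : ι → ℕ → Set Ω}
    (h : ∀ i ∈ T, Rare P (s i)) : Rare P (fun n => ⋃ i ∈ T, s i n) := by
  have h1 : Tendsto (fun n => ∑ i ∈ hT.toFinset, P (s i n)) atTop (𝓝 0) := by
    have := tendsto_finsetSum hT.toFinset fun i hi => h i (hT.mem_toFinset.1 hi)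
    simpa using this
  refine tendsto_of_tendsto_of_tendsto_of_le_of_le tendsto_const_nhds h1
    (fun _ => zero_le) fun n => ?_
  refine le_trans (measure_mono ?_) (measure_biUnion_finset_le _ _)
  simp

theorem rare_of_forall {t : ℕ → Set Ω} (h : ∀ δ : ℝ≥0∞, 0 < δ → ∃ (B : Set Ω) (s : ℕ → Set Ω),
    P B ≤ δ ∧ Rare P s ∧ ∀ᶠ n in atTop, t n ⊆ B ∪ s n) : Rare P t := by
  rw [Rare, ENNReal.tendsto_nhds_zero]
  intro δ hδ
  obtain ⟨B, s, hB, hs, hsub⟩ := h (δ / 2) (ENNReal.half_pos hδ.ne')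
  filter_upwards [hsub, (ENNReal.tendsto_nhds_zero.1 hs) (δ / 2) (ENNReal.half_pos hδ.ne')]
    with n h1 h2
  calc P (t n) ≤ P B + P (s n) := (measure_mono h1).trans (measure_union_le _ _)
    _ ≤ δ / 2 + δ / 2 := add_le_add hB h2
    _ = δ := ENNReal.add_halves δ

theorem exists_measure_abs_gt_le [IsFiniteMeasure P] {X : Ω → ℝ} (hX : Measurable X) {δ : ℝ≥0∞}
    (hδ : 0 < δ) : ∃ M : ℝ, 0 < M ∧ P {ω | M < |X ω|} ≤ δ := by
  have h1 : Tendsto (fun m : ℕ => P {ω | (m : ℝ) < |X ω|}) atTop (𝓝 0) := by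
    have hempty : (⋂ m : ℕ, {ω | (m : ℝ) < |X ω|}) = ∅ := by
      refine eq_empty_of_forall_notMem fun ω hω => ?_
      obtain ⟨m, hm⟩ := exists_nat_ge |X ω|
      exact absurd (mem_iInter.1 hω m) (not_lt.2 hm)
    have := tendsto_measure_iInter_atTop (μ := P) (s := fun m : ℕ => {ω | (m : ℝ) < |X ω|})
      (fun m => (measurableSet_lt measurable_const hX.abs).nullMeasurableSet)
      (fun m m' h ω hω => lt_of_le_of_lt (Nat.cast_le.2 h) (mem_ofPred_eq ▸ hω)) ⟨0, measure_ne_top _ _⟩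
    rwa [hempty, measure_empty] at this
  obtain ⟨m, hm, hm0⟩ := (((ENNReal.tendsto_nhds_zero.1 h1) δ hδ).and (eventually_gt_atTop 0)).exists
  exact ⟨m, by exact_mod_cast hm0, hm⟩

end RareEvents

section CountExpansion

variable {Ω : Type*} [MeasurableSpace Ω] {P : Measure Ω} [IsProbabilityMeasure P]
  {μ ν : Measure (ℝ × ℝ)} [IsProbabilityMeasure μ] {η : ℝ × ℝ → ℝ} {γ ρ : Fin 2 → ℝ}
  {a b A : Fin 2 → ℝ → ℝ} {q p : ℝ → ℝ≥0∞} {x₀ : Fin 2 → ℝ} {rt err : ℕ → ℝ} {u : Fin 2 → ℕ → ℝ}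
  {k d e t r : ℕ → ℝ} {aff H : Fin 2 → ℕ → ℝ → ℝ} {ℓ : Fin 2 → ℕ → ℝ}

/-- The expansion of the mass of the main set carries over to sets that differ from it by a negligible
set only. -/
theorem Scheme.expansion_of_close (hB : Base μ ν η γ ρ a b A q p x₀ rt err u)
    (hS : Scheme μ ν γ a b A q rt u d t r aff H ℓ) {E J : ℕ → Set (ℝ × ℝ)}
    (hJ : Negl rt (fun n => t n * μ.real (J n)))
    (hE : ∀ᶠ n in atTop, |μ.real (E n) - μ.real (kernelSet μ q rt d u aff n)| ≤ μ.real (J n)) :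
    Tendsto (fun n => (r n * (t n * μ.real (E n)) - ν.real (failSet q)) / rt n -
      (ℓ 0 n * (∫ v in Ioi (x₀ 1), boundaryIntegrand₂ p (η ∘ Prod.swap) (γ 0) v) +
        ℓ 1 n * ∫ x in Ioi (x₀ 0), boundaryIntegrand₂ q η (γ 1) x)) atTop (𝓝 0) := by
  obtain ⟨m, M, hm, hmM⟩ := hS.ratio
  have h1 : Negl rt (fun n => r n * (t n * (μ.real (E n) - μ.real (kernelSet μ q rt d u aff n)))) := by
    refine Negl.mono hB.rt_pos (hJ.const_mul M) ?_
    filter_upwards [hE, hmM, hS.t_tendsto.eventually_ge_atTop 0] with n h2 h3 h4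
    have h5 : 0 ≤ r n := hm.le.trans h3.1
    rw [abs_mul, abs_mul, abs_of_nonneg h5, abs_of_nonneg h4]
    have : 0 ≤ M := h5.trans h3.2
    gcongr
    exact h3.2
  have h2 := (hS.expansion hB).add h1
  rw [add_zero] at h2
  refine h2.congr fun n => ?_
  ring

/-- Convergence in probability of standardized empirical masses of varying sets. -/
theorem SequenceGrowth.count_rare (h : SequenceGrowth k d e γ) {Z : (n : ℕ) → Fin n → Ω → ℝ × ℝ}
    (hm : ∀ n i, Measurable (Z n i)) (hlaw : ∀ n i, P.map (Z n i) = μ)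
    (hind : ∀ n, iIndepFun (Z n) P) {E : ℕ → Set (ℝ × ℝ)} (hE : ∀ᶠ n in atTop, MeasurableSet (E n))
    {v : ℝ} {l : ℕ → ℝ} (hl : ∃ L : ℝ, ∀ᶠ n in atTop, |l n| ≤ L)
    (hlim : Tendsto (fun n : ℕ => (d n / e n * (n / k n * μ.real (E n)) - v) / rate k d e γ n - l n)
      atTop (𝓝 0)) {ε : ℝ} (hε : 0 < ε) :
    Rare P (fun n => {ω | ε ≤ |(d n / e n * (count (fun i => Z n i ω) (E n) / k n) - v) /
      rate k d e γ n - l n|}) := by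
  obtain ⟨m, M, hm0, hmM, hr⟩ := h.ratio_bounds
  obtain ⟨L, hL⟩ := hl
  have hM0 : 0 < M := hm0.trans_le hmM
  set B := (|v| + 1 + L) / m with hB
  have hbound : ∀ᶠ n : ℕ in atTop, n / k n * μ.real (E n) ≤ B := by
    filter_upwards [hL, hr, (hlim.abs).eventually (ge_mem_nhds (by simp : |(0 : ℝ)| < 1)), h.rate_pos,
      h.rate_tendsto.eventually (ge_mem_nhds one_pos), h.n_div_k_tendsto.eventually_ge_atTop 0]
      with n h1 h2 h3 h4 h5 h6
    have h7 : (d n / e n * (n / k n * μ.real (E n)) - v) / rate k d e γ n ≤ 1 + L := by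
      have := (abs_le.1 h3).2
      have := (abs_le.1 h1).2
      linarith
    rw [div_le_iff₀ h4] at h7
    have h8 : (1 + L) * rate k d e γ n ≤ 1 + L := by
      have : 0 ≤ L := (abs_nonneg _).trans h1
      nlinarith
    have h9 : m * (n / k n * μ.real (E n)) ≤ d n / e n * (n / k n * μ.real (E n)) := by
      have : 0 ≤ n / k n * μ.real (E n) := mul_nonneg h6 measureReal_nonneg
      gcongr
      exact h2.1
    rw [hB, le_div_iff₀ hm0]
    linarith [le_abs_self v]
  have hlim2 : Tendsto (fun n => ENNReal.ofReal (B * (4 * M ^ 2 / ε ^ 2) * ((wMax k d e γ n)⁻¹) ^ 2))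
      atTop (𝓝 0) := by
    have h1 : Tendsto (fun n => B * (4 * M ^ 2 / ε ^ 2) * ((wMax k d e γ n)⁻¹) ^ 2) atTop (𝓝 0) := by
      simpa using (h.wMax_tendsto.inv_tendsto_atTop.pow 2).const_mul (B * (4 * M ^ 2 / ε ^ 2))
    simpa using ENNReal.tendsto_ofReal h1
  refine tendsto_of_tendsto_of_tendsto_of_le_of_le' tendsto_const_nhds hlim2
    (Eventually.of_forall fun _ => zero_le) ?_
  filter_upwards [hE, hbound, hr, h.rate_pos, h.k_tendsto.eventually_gt_atTop 0,
    h.wMax_tendsto.eventually_gt_atTop 0,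
    (hlim.abs).eventually (gt_mem_nhds (by simpa using half_pos hε : |(0 : ℝ)| < ε / 2))]
    with n h1 h2 h3 h4 h5 h6 h7
  set s := ε / 2 * rate k d e γ n * k n / M with hs
  have hs0 : 0 < s := by positivity
  have hsub : {ω | ε ≤ |(d n / e n * (count (fun i => Z n i ω) (E n) / k n) - v) /
      rate k d e γ n - l n|} ⊆ {ω | s ≤ |count (fun i => Z n i ω) (E n) - n * μ.real (E n)|} := by
    intro ω hω
    simp only [mem_ofPred_eq] at hω ⊢
    set c := count (fun i => Z n i ω) (E n)
    have hr0 : 0 < d n / e n := hm0.trans_le h3.1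
    have e1 : (d n / e n * (c / k n) - v) / rate k d e γ n - l n =
        ((d n / e n * (n / k n * μ.real (E n)) - v) / rate k d e γ n - l n) +
          d n / e n * (c - n * μ.real (E n)) / (k n * rate k d e γ n) := by
      have := (h.e_pos n).ne'
      field_simp; ring
    rw [e1] at hω
    have e2 := (hω.trans (abs_add_le _ _))
    have e3 : ε / 2 ≤ |d n / e n * (c - n * μ.real (E n)) / (k n * rate k d e γ n)| := by linarith
    rw [abs_div, abs_mul, abs_of_pos hr0, abs_of_pos (by positivity : 0 < k n * rate k d e γ n),
      le_div_iff₀ (by positivity)] at e3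
    have e4 : d n / e n * |c - n * μ.real (E n)| ≤ M * |c - n * μ.real (E n)| := by
      gcongr; exact h3.2
    rw [hs, div_le_iff₀ hM0]
    linarith
  refine (measure_mono hsub).trans ((count_chebyshev (hm n) (hlaw n) (hind n) h1 hs0).trans
    (ENNReal.ofReal_le_ofReal ?_))
  have hW : rate k d e γ n ^ 2 * k n = wMax k d e γ n ^ 2 := by
    rw [rate, div_pow, Real.sq_sqrt h5.le, div_mul_cancel₀ _ h5.ne']
  have e1 : n * μ.real (E n) / s ^ 2 =
      n / k n * μ.real (E n) * (4 * M ^ 2 / ε ^ 2) * (1 / (rate k d e γ n ^ 2 * k n)) := by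
    rw [hs]; field_simp; ring
  rw [e1, hW, inv_pow, one_div]
  gcongr

end CountExpansion

section Coefficients

theorem exists_ellParam_sub_le (γ : ℝ) : ∃ κ : ℝ, 0 < κ ∧ ∀ G δ N α β Γ : ℝ,
    |ellParam γ (parTheta γ G δ) (parChi γ G δ) (parXi γ G δ N) - limitCoeff γ α β Γ| ≤
      κ * (|G - gridVar γ α β Γ| + |δ|) := by
  rcases lt_trichotomy γ 0 with h | h | h
  · refine ⟨-1 / γ, div_pos_of_neg_of_neg (by norm_num) h, fun G δ N α β Γ => ?_⟩
    have e : -(G + δ) / γ - (β + Γ / γ ^ 2 - α / γ) = -1 / γ * (G - (α - γ * β - Γ / γ) + δ) := by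
      have := h.ne
      field_simp; ring
    simp only [ellParam, parTheta, parChi, parXi, gridVar, limitCoeff, h, h.not_gt, h.ne, if_true,
      if_false, e]
    rw [abs_mul, abs_of_pos (div_pos_of_neg_of_neg (by norm_num) h)]
    exact mul_le_mul_of_nonneg_left (abs_add_le _ _) (div_pos_of_neg_of_neg (by norm_num) h).le
  · refine ⟨3, by norm_num, fun G δ N α β Γ => ?_⟩
    simp only [ellParam, parTheta, parChi, gridVar, limitCoeff, h, lt_irrefl, if_true, if_false]
    have e : -G + δ + 2 * (G + δ) - Γ = (G - Γ) + 3 * δ := by ring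
    rw [e]
    refine (abs_add_le _ _).trans ?_
    rw [abs_mul, abs_of_pos (by norm_num : (0 : ℝ) < 3)]
    linarith [abs_nonneg (G - Γ)]
  · refine ⟨1 / γ, by positivity, fun G δ N α β Γ => ?_⟩
    have e : (G + δ) / γ - Γ / γ = 1 / γ * (G - Γ + δ) := by ring
    simp only [ellParam, parTheta, parChi, gridVar, limitCoeff, h, h.not_gt, if_true, if_false, e]
    rw [abs_mul, abs_of_pos (by positivity : 0 < 1 / γ)]
    gcongr
    exact abs_add_le _ _

theorem gridVar_sub_le {γ α β Γ α' β' Γ' ε : ℝ} (hα : |α - α'| ≤ ε) (hβ : |β - β'| ≤ ε)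
    (hΓ : |Γ - Γ'| ≤ ε) :
    |gridVar γ α β Γ - gridVar γ α' β' Γ'| ≤ (1 + |γ| + |γ|⁻¹) * ε := by
  have hε : 0 ≤ ε := (abs_nonneg _).trans hα
  unfold gridVar
  split_ifs with h
  · have e : α - γ * β - Γ / γ - (α' - γ * β' - Γ' / γ) =
        (α - α') - γ * (β - β') - (Γ - Γ') * γ⁻¹ := by rw [div_eq_mul_inv, div_eq_mul_inv]; ring
    rw [e]
    refine (abs_sub _ _).trans ?_
    have h1 := abs_sub (α - α') (γ * (β - β'))
    rw [abs_mul] at h1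
    rw [abs_mul, abs_inv]
    have h2 : |γ| * |β - β'| ≤ |γ| * ε := by gcongr
    have h3 : |Γ - Γ'| * |γ|⁻¹ ≤ ε * |γ|⁻¹ := by gcongr
    linarith
  · have : 0 ≤ (|γ| + |γ|⁻¹) * ε := by positivity
    linarith

end Coefficients

section EstimatorExpansion

variable {Ω : Type*} [MeasurableSpace Ω] {P : Measure Ω} [IsProbabilityMeasure P]
  {μ ν : Measure (ℝ × ℝ)} [IsProbabilityMeasure μ] {η : ℝ × ℝ → ℝ} {γ ρ : Fin 2 → ℝ}
  {a b A : Fin 2 → ℝ → ℝ} {A₀ : ℝ → ℝ} {q p : ℝ → ℝ≥0∞} {x₀ : Fin 2 → ℝ} {u : Fin 2 → ℕ → ℝ}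
  {k d e : ℕ → ℝ} {Z : (n : ℕ) → Fin n → Ω → ℝ × ℝ}

/-- The linear combination of the boundary integrals with coefficients `c`. -/
def boundaryTerm (η : ℝ × ℝ → ℝ) (γ : Fin 2 → ℝ) (q p : ℝ → ℝ≥0∞) (x₀ : Fin 2 → ℝ) (k d e : ℕ → ℝ)
    (c : Fin 2 → ℝ) (n : ℕ) : ℝ :=
  c 0 * (weight k d e (γ 0) n / wMax k d e γ n) *
      (∫ v in Ioi (x₀ 1), boundaryIntegrand₂ p (η ∘ Prod.swap) (γ 0) v) +
    c 1 * (weight k d e (γ 1) n / wMax k d e γ n) *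
      ∫ x in Ioi (x₀ 0), boundaryIntegrand₂ q η (γ 1) x

theorem SequenceGrowth.abs_boundaryTerm_sub_le (h : SequenceGrowth k d e γ) :
    ∃ C : ℝ, 0 ≤ C ∧ ∀ᶠ n in atTop, ∀ (c c' : Fin 2 → ℝ) (B : ℝ), (∀ i, |c i - c' i| ≤ B) →
      |boundaryTerm η γ q p x₀ k d e c n - boundaryTerm η γ q p x₀ k d e c' n| ≤ C * B := by
  set I₁ := ∫ v in Ioi (x₀ 1), boundaryIntegrand₂ p (η ∘ Prod.swap) (γ 0) v with hI₁
  set I₂ := ∫ x in Ioi (x₀ 0), boundaryIntegrand₂ q η (γ 1) x with hI₂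
  refine ⟨|I₁| + |I₂|, by positivity, ?_⟩
  filter_upwards [(h.weight_tendsto 0).eventually_gt_atTop 0,
    (h.weight_tendsto 1).eventually_gt_atTop 0, h.wMax_tendsto.eventually_gt_atTop 0]
    with n h0 h1 h2 c c' B hc
  have hw : ∀ i, 0 < weight k d e (γ i) n → |weight k d e (γ i) n / wMax k d e γ n| ≤ 1 := fun i hi => by
    rw [abs_of_pos (div_pos hi h2), div_le_one h2]
    exact weight_le_wMax k d e γ i n
  have e : boundaryTerm η γ q p x₀ k d e c n - boundaryTerm η γ q p x₀ k d e c' n =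
      (c 0 - c' 0) * (weight k d e (γ 0) n / wMax k d e γ n) * I₁ +
        (c 1 - c' 1) * (weight k d e (γ 1) n / wMax k d e γ n) * I₂ := by
    unfold boundaryTerm; ring
  have hB : 0 ≤ B := (abs_nonneg _).trans (hc 0)
  rw [e]
  refine (abs_add_le _ _).trans ?_
  rw [abs_mul, abs_mul, abs_mul, abs_mul]
  calc _ ≤ B * 1 * |I₁| + B * 1 * |I₂| := by
        gcongr
        · exact hc 0
        · exact hw 0 h0
        · exact hc 1
        · exact hw 1 h1
    _ = _ := by ring

theorem bracket_rare (hm : ∀ n i, Measurable (Z n i)) (hlaw : ∀ n i, P.map (Z n i) = μ)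
    (hind : ∀ n, iIndepFun (Z n) P) (hS1 : SequenceGrowth k d e γ) (hS2 : SmallBias k d e γ A A₀)
    (hD1 : DependenceRate μ ν γ a b q k d e A₀)
    (hB : Base μ ν η γ ρ a b A q p x₀ (rate k d e γ) (remainder k A) u)
    (G : Fin 2 → ℝ) (δ M : ℝ) {E J : ℕ → Set (ℝ × ℝ)} (hJm : ∀ n, MeasurableSet (J n))
    (hJ : Negl (rate k d e γ) (fun n => n / k n * μ.real (J n)))
    (hE : (∀ n, E n = kernelSet μ q (rate k d e γ) d u (bracketAff γ a b k e G δ M) n ∪ J n) ∨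
      ∀ n, E n = kernelSet μ q (rate k d e γ) d u (bracketAff γ a b k e G δ M) n \ J n)
    {ε : ℝ} (hε : 0 < ε) :
    Rare P (fun n => {ω | ε ≤ |(d n / e n * (count (fun i => Z n i ω) (E n) / k n) -
      ν.real (failSet q)) / rate k d e γ n - boundaryTerm η γ q p x₀ k d e
        (fun i => ellParam (γ i) (parTheta (γ i) (G i) δ) (parChi (γ i) (G i) δ)
          (parXi (γ i) (G i) δ ((|γ i| + 2) * M))) n|}) := by
  obtain ⟨H, hS⟩ := exists_scheme_bracket hS1 hS2 hD1 hB G δ M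
  obtain ⟨C, hC0, hC⟩ := hS1.abs_boundaryTerm_sub_le (η := η) (q := q) (p := p) (x₀ := x₀)
  have hKm := Base.mainSet_measurable hB hS
  refine hS1.count_rare hm hlaw hind ?_ ?_ ?_ hε
  · filter_upwards [hKm] with n hn
    rcases hE with hE | hE
    · rw [hE]; exact MeasurableSet.union hn (hJm n)
    · rw [hE]; exact MeasurableSet.diff hn (hJm n)
  · set c : Fin 2 → ℝ := fun i => ellParam (γ i) (parTheta (γ i) (G i) δ) (parChi (γ i) (G i) δ)
          (parXi (γ i) (G i) δ ((|γ i| + 2) * M)) with hc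
    refine ⟨C * (|c 0| + |c 1|), ?_⟩
    filter_upwards [hC] with n hn
    have := hn c 0 (|c 0| + |c 1|) (fun i => by
      fin_cases i
      · simp
      · simp)
    simpa [boundaryTerm] using this
  · refine (hS.expansion_of_close (E := E) hB hJ ?_).congr fun n => ?_
    · filter_upwards [hKm] with n hn
      rcases hE with hE | hE
      · rw [hE, abs_of_nonneg (sub_nonneg.2 (measureReal_mono subset_union_left))]
        linarith [measureReal_union_le (μ := μ)
          (kernelSet μ q (rate k d e γ) d u (bracketAff γ a b k e G δ M) n) (J n)]
      · rw [hE, abs_sub_comm, abs_of_nonneg (sub_nonneg.2 (measureReal_mono sdiff_subset))]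
        have h1 : kernelSet μ q (rate k d e γ) d u (bracketAff γ a b k e G δ M) n ⊆
            (kernelSet μ q (rate k d e γ) d u (bracketAff γ a b k e G δ M) n \ J n) ∪ J n := by
          rw [sdiff_union_self]; exact subset_union_left
        linarith [(measureReal_mono h1 (μ := μ)).trans (measureReal_union_le _ _)]
    · rfl

/-- The expansion of the estimator of the exponent measure of the failure set. -/
theorem estimator_expansion (hm : ∀ n i, Measurable (Z n i)) (hlaw : ∀ n i, P.map (Z n i) = μ)
    (hind : ∀ n, iIndepFun (Z n) P) (hS1 : SequenceGrowth k d e γ) (hS2 : SmallBias k d e γ A A₀)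
    (hD1 : DependenceRate μ ν γ a b q k d e A₀)
    (hB : Base μ ν η γ ρ a b A q p x₀ (rate k d e γ) (remainder k A) u)
    {gh ah bh : ℕ → Fin 2 → Ω → ℝ} {α β Γ : Fin 2 → Ω → ℝ}
    (hM3 : EstimatorsConverge P k γ a b gh ah bh α β Γ) {ε : ℝ} (hε : 0 < ε) :
    Rare P (fun n => {ω | ε ≤ |(d n / e n * (count (fun i => Z n i ω)
      (estSet (fun i => gh n i ω) (fun i => ah n i ω) (fun i => bh n i ω) (n / (k n * e n))
        (tailImage (margins μ) (d n) (failSet q))) / k n) - ν.real (failSet q)) / rate k d e γ n -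
      boundaryTerm η γ q p x₀ k d e
        (fun i => limitCoeff (γ i) (α i ω) (β i ω) (Γ i ω)) n|}) := by
  obtain ⟨C, hC0, hC⟩ := hS1.abs_boundaryTerm_sub_le (η := η) (q := q) (p := p) (x₀ := x₀)
  choose κ hκ0 hκ using fun i => exists_ellParam_sub_le (γ i)
  set κ' := κ 0 + κ 1 with hκ'
  have hκle : ∀ i, κ i ≤ κ' := fun i => by
    fin_cases i
    · have := hκ0 1; simp [hκ', this.le]
    · have := hκ0 0; simp [hκ', this.le]
  have hκ'0 : 0 < κ' := (hκ0 0).trans_le (hκle 0)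
  set ε₁ := ε / (8 * (C * κ' + 1)) with hε₁
  have hε₁0 : 0 < ε₁ := by positivity
  set S := ∑ i, (1 + |γ i| + |γ i|⁻¹) with hSdef
  have hSle : ∀ i, 1 + |γ i| + |γ i|⁻¹ ≤ S := fun i =>
    Finset.single_le_sum (f := fun i => 1 + |γ i| + |γ i|⁻¹) (fun i _ => by positivity)
      (Finset.mem_univ i)
  have hS0 : 0 < S := lt_of_lt_of_le (by positivity) (hSle 0)
  set ε₂ := min 1 (ε₁ / (2 * S)) with hε₂
  have hε₂0 : 0 < ε₂ := by positivity
  refine rare_of_forall fun δ hδ => ?_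
  obtain ⟨M₀, hM₀, hPM⟩ := exists_measure_abs_gt_le (P := P)
    (X := fun ω => ∑ i, (|α i ω| + |β i ω| + |Γ i ω|))
    (Finset.measurable_sum _ fun i _ =>
      (((hM3.meas_α i).abs.add (hM3.meas_β i).abs).add (hM3.meas_Γ i).abs)) hδ
  set M := M₀ + 1 with hMdef
  have hM : 0 < M := by linarith
  obtain ⟨T, -, hTfin, hTcov⟩ := (isCompact_closedBall (0 : Fin 2 → ℝ) (S * M₀)).finite_cover_balls
    (half_pos hε₁0)
  set lowA := fun G => bracketAff γ a b k e G (2 * ε₁) M with hlowA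
  set J := fun G => junkSet μ q p x₀ (rate k d e γ) d u (lowA G) with hJdef
  set Ep := fun G n => kernelSet μ q (rate k d e γ) d u (lowA G) n ∪ J G n with hEp
  set Em := fun G n => kernelSet μ q (rate k d e γ) d u (bracketAff γ a b k e G (-(2 * ε₁)) (-M)) n \
    J G n with hEm
  set V := fun (n : ℕ) (x : ℝ) => (d n / e n * (x / k n) - ν.real (failSet q)) / rate k d e γ n with hV
  set cf := fun (G : Fin 2 → ℝ) (δ M : ℝ) (i : Fin 2) =>
    ellParam (γ i) (parTheta (γ i) (G i) δ) (parChi (γ i) (G i) δ)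
          (parXi (γ i) (G i) δ ((|γ i| + 2) * M)) with hcf
  set bt := boundaryTerm η γ q p x₀ k d e with hbt
  have hJm : ∀ G n, MeasurableSet (J G n) := fun G n => measurableSet_junkSet n
  have hJn : ∀ G, Negl (rate k d e γ) (fun n => n / k n * μ.real (J G n)) := fun G => by
    obtain ⟨H, hS⟩ := exists_scheme_bracket hS1 hS2 hD1 hB G (2 * ε₁) M
    exact hS.negl_junkSet hB
  have hRp : Rare P (fun n => ⋃ G ∈ T, {ω | ε / 2 ≤ |V n (count (fun i => Z n i ω) (Ep G n)) -
      bt (cf G (2 * ε₁) M) n|}) := Rare.biUnion hTfin fun G _ =>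
    bracket_rare hm hlaw hind hS1 hS2 hD1 hB G (2 * ε₁) M (hJm G) (hJn G) (Or.inl fun n => rfl)
      (half_pos hε)
  have hRm : Rare P (fun n => ⋃ G ∈ T, {ω | ε / 2 ≤ |V n (count (fun i => Z n i ω) (Em G n)) -
      bt (cf G (-(2 * ε₁)) (-M)) n|}) := Rare.biUnion hTfin fun G _ =>
    bracket_rare hm hlaw hind hS1 hS2 hD1 hB G (-(2 * ε₁)) (-M) (hJm G) (hJn G)
      (Or.inr fun n => rfl) (half_pos hε)
  have hRest : Rare P (fun n => ⋃ i ∈ (univ : Set (Fin 2)),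
      ({ω | ε₂ ≤ ‖√(k n) * (ah n i ω / a i (n / k n) - 1) - α i ω‖} ∪
      {ω | ε₂ ≤ ‖√(k n) * ((bh n i ω - b i (n / k n)) / a i (n / k n)) - β i ω‖} ∪
      {ω | ε₂ ≤ ‖√(k n) * (gh n i ω - γ i) - Γ i ω‖})) := Rare.biUnion finite_univ fun i _ =>
    Rare.union (Rare.union (tendstoInMeasure_iff_norm.1 (hM3.scale i) ε₂ hε₂0)
      (tendstoInMeasure_iff_norm.1 (hM3.location i) ε₂ hε₂0))
      (tendstoInMeasure_iff_norm.1 (hM3.index i) ε₂ hε₂0)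
  refine ⟨_, _, hPM, (hRp.union hRm).union hRest, ?_⟩
  have hsand : ∀ᶠ n : ℕ in atTop, ∀ G ∈ T, _ := (eventually_all_finite hTfin).2 fun G _ =>
    estSet_sandwich hS1 hS2 hD1 hB hM hε₁0 G
  filter_upwards [hsand, hC, hS1.rate_pos, hS1.k_tendsto.eventually_gt_atTop 0]
    with n hsand hC hrate hk ω hω
  by_contra hbad
  simp only [mem_union, mem_iUnion, mem_ofPred_eq, not_or, not_exists, not_le, not_lt, mem_univ,
    true_imp_iff, exists_prop, not_and, Real.norm_eq_abs] at hbad hω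
  obtain ⟨hX, ⟨hp, hmn⟩, hest⟩ := hbad
  have hX' : ∀ i, |α i ω| + |β i ω| + |Γ i ω| ≤ M₀ := fun i =>
    (Finset.single_le_sum (f := fun i => |α i ω| + |β i ω| + |Γ i ω|) (fun i _ => by positivity)
      (Finset.mem_univ i)).trans ((le_abs_self _).trans hX)
  set g : Fin 2 → ℝ := fun i => gridVar (γ i) (α i ω) (β i ω) (Γ i ω) with hg
  have hgrid : g ∈ Metric.closedBall (0 : Fin 2 → ℝ) (S * M₀) := by
    rw [mem_closedBall_zero_iff, pi_norm_le_iff_of_nonneg (by positivity)]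
    intro i
    have h0 := abs_nonneg (α i ω)
    have h1 := abs_nonneg (β i ω)
    have h2 := abs_nonneg (Γ i ω)
    have h3 := hX' i
    have := gridVar_sub_le (γ := γ i) (α := α i ω) (β := β i ω) (Γ := Γ i ω) (α' := 0) (β' := 0)
      (Γ' := 0) (ε := M₀) (by rw [sub_zero]; linarith) (by rw [sub_zero]; linarith)
      (by rw [sub_zero]; linarith)
    have h4 : gridVar (γ i) 0 0 0 = 0 := by simp [gridVar]
    rw [h4, sub_zero] at this
    refine this.trans ?_
    gcongr
    exact hSle i
  obtain ⟨G, hGT, hGg⟩ := mem_iUnion₂.1 (hTcov hgrid)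
  have hGi : ∀ i, |g i - G i| ≤ ε₁ / 2 := fun i => by
    rw [← Real.dist_eq]
    exact (dist_le_pi_dist g G i).trans (Metric.mem_ball.1 hGg).le
  have hgood := hsand G hGT (fun i => gh n i ω) (fun i => ah n i ω) (fun i => bh n i ω) (fun i => by
    obtain ⟨⟨h1, h2⟩, h3⟩ := hest i
    have h0' := abs_nonneg (α i ω)
    have h1' := abs_nonneg (β i ω)
    have h2' := abs_nonneg (Γ i ω)
    have h3' := hX' i
    have hε₂1 : ε₂ ≤ 1 := min_le_left _ _
    have hbd : ∀ x y : ℝ, |x - y| < ε₂ → |y| ≤ M₀ → |x| ≤ M := fun x y hxy hy => by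
      have := abs_sub_abs_le_abs_sub x y
      rw [hMdef]; linarith
    refine ⟨hbd _ _ h1 (by linarith), hbd _ _ h2 (by linarith), hbd _ _ h3 (by linarith), ?_⟩
    have h4 := gridVar_sub_le (γ := γ i) h1.le h2.le h3.le
    have h5 : (1 + |γ i| + |γ i|⁻¹) * ε₂ ≤ ε₁ / 2 := by
      calc _ ≤ S * (ε₁ / (2 * S)) := by
            gcongr
            · exact hSle i
            · exact min_le_right _ _
        _ = ε₁ / 2 := by field_simp
    have h6 := (abs_sub_le _ (g i) (G i)).trans (add_le_add (h4.trans h5) (hGi i))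
    linarith)
  have hVm : ∀ x y : ℝ, x ≤ y → V n x ≤ V n y := fun x y hxy => by
    have := hS1.d_pos n
    have := hS1.e_pos n
    simp only [hV]
    gcongr
  have hcoef : ∀ δ' M' : ℝ, |δ'| = 2 * ε₁ →
      |bt (cf G δ' M') n - bt (fun i => limitCoeff (γ i) (α i ω) (β i ω) (Γ i ω)) n| < ε / 2 := by
    intro δ' M' hδ'
    refine lt_of_le_of_lt (hC _ _ (κ' * (3 * ε₁)) fun i => ?_) ?_
    · refine (hκ i (G i) δ' _ _ _ _).trans ?_
      have h1 := hGi i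
      rw [abs_sub_comm] at h1
      have h2 := hκ0 i
      have h3 := hκle i
      have h4 : |G i - gridVar (γ i) (α i ω) (β i ω) (Γ i ω)| + |δ'| ≤ 3 * ε₁ := by
        rw [hδ']
        have : |G i - gridVar (γ i) (α i ω) (β i ω) (Γ i ω)| ≤ ε₁ / 2 := h1
        linarith
      exact mul_le_mul h3 h4 (by positivity) (by positivity)
    · have h1 : C * (κ' * (3 * ε₁)) = (C * κ') / (C * κ' + 1) * (3 * ε / 8) := by
        rw [hε₁]; field_simp
      have h2 : (C * κ') / (C * κ' + 1) ≤ 1 := by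
        rw [div_le_one (by positivity)]; linarith
      rw [h1]
      have h3 : 0 ≤ (C * κ') / (C * κ' + 1) := by positivity
      nlinarith
  have hup := abs_lt.1 (hp G hGT)
  have hlo := abs_lt.1 (hmn G hGT)
  have c1 := abs_lt.1 (hcoef (2 * ε₁) M (abs_of_pos (by positivity)))
  have c2 := abs_lt.1 (hcoef (-(2 * ε₁)) (-M) (by rw [abs_neg, abs_of_pos (by positivity)]))
  have v1 := hVm _ _ (count_mono (fun i => Z n i ω) hgood.2)
  have v2 := hVm _ _ (count_mono (fun i => Z n i ω) hgood.1)
  refine absurd hω (not_le.2 (abs_lt.2 ⟨?_, ?_⟩))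
  · show -ε < V n _ - bt _ n
    linarith [hlo.1, c2.1]
  · show V n _ - bt _ n < ε
    linarith [hup.2, c1.2]

end EstimatorExpansion

section FailureProbability

variable {Ω : Type*} [MeasurableSpace Ω] {P : Measure Ω} [IsProbabilityMeasure P]
  {μ ν : Measure (ℝ × ℝ)} {η : ℝ × ℝ → ℝ} {γ ρ : Fin 2 → ℝ}
  {a b A : Fin 2 → ℝ → ℝ} {A₀ : ℝ → ℝ} {q p : ℝ → ℝ≥0∞} {x₀ : Fin 2 → ℝ} {u : Fin 2 → ℕ → ℝ}
  {k d e : ℕ → ℝ}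

theorem BoundaryPair.measure_failSet_ne_top {γ₁ γ₂ x₁ x₂ : ℝ} (h : BoundaryPair q p γ₁ γ₂ x₁ x₂)
    (hν : ExponentDensity ν η) : ν (failSet q) ≠ ⊤ :=
  (h.distSet_lt_top hν (h₁ := OrderIso.refl ℝ) (h₂ := OrderIso.refl ℝ) rfl rfl).ne

theorem BoundaryPair.measure_failSet_pos {γ₁ γ₂ x₁ x₂ : ℝ} (h : BoundaryPair q p γ₁ γ₂ x₁ x₂)
    (hν : ExponentDensity ν η) : 0 < ν.real (failSet q) := by
  rw [measureReal_def, ENNReal.toReal_pos_iff]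
  refine ⟨pos_iff_ne_zero.2 fun h0 => ?_, (h.measure_failSet_ne_top hν).lt_top⟩
  set x := x₁ + 1
  set y := (q x).toReal
  have hx : 0 < x := by have := h.nonneg_left; positivity
  have hq := h.fin_left x (lt_add_one x₁)
  have hsub : Ici x ×ˢ Ici y ⊆ failSet q := by
    rintro z ⟨z1, z2⟩
    have z1 : x ≤ z.1 := z1
    have z2 : y ≤ z.2 := z2
    refine ⟨hx.le.trans z1, ENNReal.toReal_nonneg.trans z2, ?_⟩
    refine (h.anti_left (mem_Ici.2 hx.le) (mem_Ici.2 (hx.le.trans z1)) z1).trans ?_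
    rw [← ENNReal.ofReal_toReal hq.ne]
    exact ENNReal.ofReal_le_ofReal z2
  have h1 := measure_mono_null hsub h0
  rw [hν.eq_withDensity, withDensity_apply_eq_zero hν.measurable_quadDens] at h1
  have h2 : Ici x ×ˢ Ici y ⊆ {z | quadDens η z ≠ 0} ∩ Ici x ×ˢ Ici y := by
    intro z hz
    refine ⟨?_, hz⟩
    have z1 : x ≤ z.1 := hz.1
    have z2 : y ≤ z.2 := hz.2
    have hzQ := mem_quadrant_of_pos (hx.trans_le z1) (ENNReal.toReal_nonneg.trans z2)
    simp only [mem_ofPred_eq, quadDens, indicator_of_mem hzQ]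
    exact (ENNReal.ofReal_pos.2 (hν.pos z hzQ)).ne'
  have h3 := measure_mono_null h2 h1
  rw [Measure.volume_eq_prod, Measure.prod_prod] at h3
  simp at h3

theorem failSet_eq_empty (hq : ∀ x, 0 ≤ x → q x = ⊤) : failSet q = ∅ := by
  refine eq_empty_of_forall_notMem fun z hz => ?_
  have := hz.2.2
  rw [hq _ hz.1, top_le_iff] at this
  exact ENNReal.ofReal_ne_top this

theorem boundaryExponent_ne_zero (γ : ℝ) : boundaryExponent γ ≠ 0 := by
  unfold boundaryExponent
  split_ifs
  · linarith
  · norm_num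

theorem boundaryIntegrand₂_of_eq_top {γ x : ℝ} (h : q x = ⊤) : boundaryIntegrand₂ q η γ x = 0 := by
  rw [boundaryIntegrand₂, h, ENNReal.toReal_top, Real.zero_rpow (boundaryExponent_ne_zero γ), zero_mul]

theorem boundaryIntegrand₁_eq_zero (hq : ∀ x, 0 ≤ x → q x = ⊤) (γ : ℝ) :
    boundaryIntegrand₁ q η γ = fun _ => 0 := by
  funext v
  have : {x : ℝ | 0 < x ∧ q x ≤ ENNReal.ofReal v} = ∅ := by
    refine eq_empty_of_forall_notMem fun x hx => ?_
    have h1 := hx.2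
    rw [hq _ hx.1.le, top_le_iff] at h1
    exact ENNReal.ofReal_ne_top h1
  rw [boundaryIntegrand₁, qInv, this, image_empty, sInf_empty, ENNReal.toReal_top,
    Real.zero_rpow (boundaryExponent_ne_zero γ), zero_mul]

theorem boundaryIntegrand₂_eqOn_zero (hq : ∀ x, 0 ≤ x → q x = ⊤) (γ : ℝ) :
    EqOn (boundaryIntegrand₂ q η γ) (fun _ => 0) (Ioi (xl q)) := by
  intro x hx
  have hxl : 0 ≤ xl q := Real.sInf_nonneg fun x hx => hx.1
  exact boundaryIntegrand₂_of_eq_top (hq x (hxl.trans hx.le))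

theorem leadingTerm_eq_zero (hq : ∀ x, 0 ≤ x → q x = ⊤) (α β Γ : Fin 2 → Ω → ℝ) (n : ℕ) (ω : Ω) :
    leadingTerm k d e γ q η α β Γ n ω = 0 := by
  rw [leadingTerm, boundaryIntegrand₁_eq_zero hq,
    setIntegral_congr_fun measurableSet_Ioi (boundaryIntegrand₂_eqOn_zero hq (γ 1))]
  simp

theorem pHat_empty {n : ℕ} (k e : ℝ) (gh ah bh : Fin 2 → ℝ) (z : Fin n → ℝ × ℝ) :
    pHat k e gh ah bh z ∅ = 0 := by
  simp [pHat, nuHat]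

theorem mul_pHat {n : ℕ} (k d e : ℝ) (gh ah bh : Fin 2 → ℝ) (z : Fin n → ℝ × ℝ)
    (D : Set (ℝ × ℝ)) :
    d * pHat k e gh ah bh z D = d / e * (count z (estSet gh ah bh (n / (k * e)) D) / k) := by
  unfold pHat nuHat count estSet
  simp only [mem_ofPred_eq]
  ring

theorem leadingTerm_div (h : wMax k d e γ n ≠ 0) (α β Γ : Fin 2 → Ω → ℝ) (ω : Ω) :
    leadingTerm k d e γ q η α β Γ n ω / wMax k d e γ n =
      boundaryTerm η γ q (qInv q) ![xl q, (qInf q).toReal] k d e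
        (fun i => limitCoeff (γ i) (α i ω) (β i ω) (Γ i ω)) n := by
  have e1 : ∫ v in Ioi (![xl q, (qInf q).toReal] 1 : ℝ),
      boundaryIntegrand₂ (qInv q) (η ∘ Prod.swap) (γ 0) v =
      ∫ v in Ioi (qInf q).toReal, boundaryIntegrand₁ q η (γ 0) v := rfl
  have e2 : ∫ x in Ioi (![xl q, (qInf q).toReal] 0 : ℝ), boundaryIntegrand₂ q η (γ 1) x =
      ∫ x in Ioi (xl q), boundaryIntegrand₂ q η (γ 1) x := rfl
  rw [boundaryTerm, e1, e2, leadingTerm]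
  field_simp

theorem measurable_limitCoeff {α β Γ : Ω → ℝ} (γ : ℝ) (hα : Measurable α) (hβ : Measurable β)
    (hΓ : Measurable Γ) : Measurable fun ω => limitCoeff γ (α ω) (β ω) (Γ ω) := by
  unfold limitCoeff
  split_ifs <;> fun_prop

theorem measureReal_tailImage_expansion [IsProbabilityMeasure μ] (hS1 : SequenceGrowth k d e γ)
    (hS2 : SmallBias k d e γ A A₀) (hD1 : DependenceRate μ ν γ a b q k d e A₀)
    (hB : Base μ ν η γ ρ a b A q p x₀ (rate k d e γ) (remainder k A) u) :
    Tendsto (fun n => (d n * μ.real (tailImage (margins μ) (d n) (failSet q)) -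
      ν.real (failSet q)) / rate k d e γ n) atTop (𝓝 0) := by
  obtain ⟨H, hS⟩ := exists_scheme_id hS1 hS2 hD1 hB
  refine (hS.expansion_of_close (E := fun n => tailImage (margins μ) (d n) (failSet q)) hB
    (hS.negl_junkSet hB) ?_).congr fun n => ?_
  · filter_upwards [tailImage_sandwich hS1 hS2 hD1 hB] with n hn
    rw [abs_of_nonneg (sub_nonneg.2 (measureReal_mono hn.1))]
    linarith [(measureReal_mono hn.2 (μ := μ)).trans (measureReal_union_le _ _)]
  · simp

theorem estimator_error_rare [IsProbabilityMeasure μ] {Z : (n : ℕ) → Fin n → Ω → ℝ × ℝ}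
    (hm : ∀ n i, Measurable (Z n i)) (hlaw : ∀ n i, P.map (Z n i) = μ)
    (hind : ∀ n, iIndepFun (Z n) P) (hS1 : SequenceGrowth k d e γ) (hS2 : SmallBias k d e γ A A₀)
    (hD1 : DependenceRate μ ν γ a b q k d e A₀)
    (hB : Base μ ν η γ ρ a b A q (qInv q) ![xl q, (qInf q).toReal] (rate k d e γ) (remainder k A) u)
    {gh ah bh : ℕ → Fin 2 → Ω → ℝ} {α β Γ : Fin 2 → Ω → ℝ}
    (hM3 : EstimatorsConverge P k γ a b gh ah bh α β Γ) {ε : ℝ} (hε : 0 < ε) :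
    Rare P (fun n => {ω | ε ≤ |(√(k n) * d n * (pHat (k n) (e n) (fun i => gh n i ω)
      (fun i => ah n i ω) (fun i => bh n i ω) (fun i => Z n i ω)
        (tailImage (margins μ) (d n) (failSet q)) -
        μ.real (tailImage (margins μ) (d n) (failSet q))) -
      leadingTerm k d e γ q η α β Γ n ω) / wMax k d e γ n|}) := by
  refine (estimator_expansion hm hlaw hind hS1 hS2 hD1 hB hM3 (half_pos hε)).mono ?_
  have hp := (measureReal_tailImage_expansion hS1 hS2 hD1 hB).abs
  rw [abs_zero] at hp
  filter_upwards [hp.eventually (gt_mem_nhds (half_pos hε)), hS1.wMax_tendsto.eventually_gt_atTop 0,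
    hS1.sqrt_tendsto.eventually_gt_atTop 0] with n h1 h2 h3 ω hω
  simp only [mem_ofPred_eq] at hω ⊢
  rw [sub_div, leadingTerm_div h2.ne', mul_sub, mul_assoc, mul_pHat] at hω
  set x := d n / e n * (count (fun i => Z n i ω) (estSet (fun i => gh n i ω) (fun i => ah n i ω)
    (fun i => bh n i ω) (n / (k n * e n)) (tailImage (margins μ) (d n) (failSet q))) / k n)
  set y := μ.real (tailImage (margins μ) (d n) (failSet q))
  set l := boundaryTerm η γ q (qInv q) ![xl q, (qInf q).toReal] k d e
        (fun i => limitCoeff (γ i) (α i ω) (β i ω) (Γ i ω)) n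
  have e1 : (√(k n) * x - √(k n) * d n * y) / wMax k d e γ n - l =
      ((x - ν.real (failSet q)) / rate k d e γ n - l) -
        (d n * y - ν.real (failSet q)) / rate k d e γ n := by
    rw [rate]; field_simp; ring
  rw [e1] at hω
  linarith [hω.trans (abs_sub _ _)]

theorem ratio_error_rare {X Y l : ℕ → Ω → ℝ} {W s : ℕ → ℝ} {B : Ω → ℝ} (hB : Measurable B) {C : ℝ}
    (hC : 0 ≤ C) (hl : ∀ᶠ n in atTop, ∀ ω, |l n ω / W n| ≤ C * |B ω|)
    (hX : ∀ ε : ℝ, 0 < ε → Rare P (fun n => {ω | ε ≤ |(X n ω - l n ω) / W n|}))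
    (hs : Tendsto s atTop (𝓝 1)) (hY : ∀ᶠ n in atTop, ∀ ω, Y n ω = X n ω * s n) {ε : ℝ}
    (hε : 0 < ε) : Rare P (fun n => {ω | ε ≤ |(Y n ω - l n ω) / W n|}) := by
  refine rare_of_forall fun δ hδ => ?_
  obtain ⟨M, hM, hPM⟩ := exists_measure_abs_gt_le (P := P) hB hδ
  refine ⟨_, _, hPM, hX (ε / 4) (by positivity), ?_⟩
  have h1 : Tendsto (fun n => C * M * |s n - 1|) atTop (𝓝 0) := by
    simpa using ((hs.sub_const 1).abs).const_mul (C * M)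
  have h2 : Tendsto (fun n => |s n|) atTop (𝓝 1) := by simpa using hs.abs
  filter_upwards [hl, hY, h1.eventually (gt_mem_nhds (half_pos hε)),
    h2.eventually (gt_mem_nhds one_lt_two)] with n h3 h4 h5 h6 ω hω
  by_contra hbad
  simp only [mem_union, mem_ofPred_eq, not_or, not_lt, not_le] at hbad hω
  have e1 : (Y n ω - l n ω) / W n = (X n ω - l n ω) / W n * s n + l n ω / W n * (s n - 1) := by
    rw [h4]; ring
  rw [e1] at hω
  have e2 := hω.trans (abs_add_le _ _)
  rw [abs_mul, abs_mul] at e2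
  have e3 : |(X n ω - l n ω) / W n| * |s n| ≤ ε / 4 * 2 := by
    gcongr
    exact hbad.2.le
  have e4 : |l n ω / W n| * |s n - 1| ≤ C * M * |s n - 1| := by
    gcongr
    exact (h3 ω).trans (mul_le_mul_of_nonneg_left hbad.1 hC)
  linarith

end FailureProbability

end FailureProb

end

open FailureProb

theorem theorem1
    -- the law of `(X, Y)`, and for every `n` an i.i.d. sample of size `n` from it
    (μ : Measure (ℝ × ℝ)) [IsProbabilityMeasure μ]
    {Ω : Type*} [MeasurableSpace Ω] (P : Measure Ω) [IsProbabilityMeasure P]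
    (Z : (n : ℕ) → Fin n → Ω → ℝ × ℝ)
    (hZ_meas : ∀ n i, Measurable (Z n i))
    (hZ_law : ∀ n i, P.map (Z n i) = μ)
    (hZ_indep : ∀ n, iIndepFun (Z n) P)
    -- marginal conditions
    (γ ρ : Fin 2 → ℝ) (a b A : Fin 2 → ℝ → ℝ)
    (hM1 : ∀ i, FailureProb.RegularUpperTail (FailureProb.margins μ i))
    (hM2 : ∀ i, FailureProb.SecondOrder (FailureProb.margins μ i) (γ i) (ρ i) (a i) (b i) (A i))
    -- marginal estimators
    (k d e : ℕ → ℝ)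
    (gh ah bh : ℕ → Fin 2 → Ω → ℝ) (α β Γ : Fin 2 → Ω → ℝ)
    (hM3 : FailureProb.EstimatorsConverge P k γ a b gh ah bh α β Γ)
    -- failure set
    (q : ℝ → ℝ≥0∞)
    (hQ1 : FailureProb.BoundaryFun q)
    (hQ2 : FailureProb.BoundaryGrowth q γ)
    -- extremal dependence
    (ν : Measure (ℝ × ℝ)) (η : ℝ × ℝ → ℝ) (A₀ : ℝ → ℝ)
    (hν : FailureProb.IsExponentMeasure μ ν)
    (hD1 : FailureProb.DependenceRate μ ν γ a b q k d e A₀)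
    (hD2 : FailureProb.HasPosContDensity ν η)
    -- sequences
    (hS1 : FailureProb.SequenceGrowth k d e γ)
    (hS2 : FailureProb.SmallBias k d e γ A A₀)
    (hS3 : FailureProb.AxesNegligible k e γ q)
    -- failure sets, failure probabilities and their estimators
    (D : ℕ → Set (ℝ × ℝ))
    (hD : ∀ n, D n = FailureProb.tailImage (FailureProb.margins μ) (d n) (FailureProb.failSet q))
    (p : ℕ → ℝ) (hp : ∀ n, p n = μ.real (D n))
    (ph : ℕ → Ω → ℝ)
    (hph : ∀ n ω, ph n ω = FailureProb.pHat (k n) (e n) (fun i => gh n i ω) (fun i => ah n i ω)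
      (fun i => bh n i ω) (fun i => Z n i ω) (D n)) :
    IntegrableOn (FailureProb.boundaryIntegrand₁ q η (γ 0)) (Ioi (FailureProb.qInf q).toReal) ∧
    IntegrableOn (FailureProb.boundaryIntegrand₂ q η (γ 1)) (Ioi (FailureProb.xl q)) ∧
    TendstoInMeasure P
      (fun n ω => (√(k n) * d n * (ph n ω - p n) - FailureProb.leadingTerm k d e γ q η α β Γ n ω) /
        max (FailureProb.weight k d e (γ 0) n) (FailureProb.weight k d e (γ 1) n))
      atTop (fun _ => 0) ∧
    ν (FailureProb.failSet q) ≠ ⊤ ∧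
    Tendsto (fun n => p n * d n) atTop (𝓝 (ν.real (FailureProb.failSet q))) ∧
    TendstoInMeasure P
      (fun n ω => (√(k n) * ν.real (FailureProb.failSet q) * (ph n ω / p n - 1) -
          FailureProb.leadingTerm k d e γ q η α β Γ n ω) /
        max (FailureProb.weight k d e (γ 0) n) (FailureProb.weight k d e (γ 1) n))
      atTop (fun _ => 0) := by
  by_cases hne : ∃ x, 0 ≤ x ∧ q x < ⊤
  · obtain ⟨u, hB⟩ := exists_base hM1 hM2 hQ1 hQ2 hne hν hD2 hS1 hS2
    have hexp := measureReal_tailImage_expansion hS1 hS2 hD1 hB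
    have hpos := hB.pair.measure_failSet_pos hB.density
    have hdp : Tendsto (fun n => d n * p n) atTop (𝓝 (ν.real (failSet q))) := by
      have h1 := Negl.tendsto_zero hS1.rate_pos hS1.rate_tendsto hexp
      have h2 := h1.add_const (ν.real (failSet q))
      rw [zero_add] at h2
      refine h2.congr fun n => ?_
      rw [hp, hD]; ring
    have herr : ∀ ε : ℝ, 0 < ε → Rare P (fun n => {ω | ε ≤
        |(√(k n) * d n * (ph n ω - p n) - leadingTerm k d e γ q η α β Γ n ω) /
          wMax k d e γ n|}) := fun ε hε => by
      have h1 := estimator_error_rare hZ_meas hZ_law hZ_indep hS1 hS2 hD1 hB hM3 hε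
      refine h1.mono (Eventually.of_forall fun n => ?_)
      rw [hp, hD]
      simp only [hph, hD]
      exact subset_rfl
    refine ⟨hB.pair.swap.integrableOn_boundaryIntegrand (hB.index 0) hB.density.swap,
      hB.pair.integrableOn_boundaryIntegrand (hB.index 1) hB.density,
      tendstoInMeasure_iff_norm.2 fun ε hε => ?_, hB.pair.measure_failSet_ne_top hB.density,
      hdp.congr fun n => mul_comm _ _, tendstoInMeasure_iff_norm.2 fun ε hε => ?_⟩
    · simp only [sub_zero, Real.norm_eq_abs]
      exact herr ε hε
    · simp only [sub_zero, Real.norm_eq_abs]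
      obtain ⟨C, hC0, hC⟩ := hS1.abs_boundaryTerm_sub_le (η := η) (q := q)
        (p := qInv q) (x₀ := ![xl q, (qInf q).toReal])
      refine ratio_error_rare (X := fun n ω => √(k n) * d n * (ph n ω - p n))
        (Y := fun n ω => √(k n) * ν.real (failSet q) * (ph n ω / p n - 1))
        (s := fun n => ν.real (failSet q) / (d n * p n))
        (B := fun ω => ∑ i, |limitCoeff (γ i) (α i ω) (β i ω) (Γ i ω)|)
        (Finset.measurable_sum _ fun i _ => (measurable_limitCoeff _ (hM3.meas_α i)
          (hM3.meas_β i) (hM3.meas_Γ i)).abs) hC0 ?_ herr ?_ ?_ hε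
      · filter_upwards [hC, hS1.wMax_tendsto.eventually_gt_atTop 0] with n h1 h2 ω
        rw [leadingTerm_div h2.ne']
        have h3 := h1 (fun i => limitCoeff (γ i) (α i ω) (β i ω) (Γ i ω)) 0
          (∑ i, |limitCoeff (γ i) (α i ω) (β i ω) (Γ i ω)|) fun i => by
            simp only [Pi.zero_apply, sub_zero]
            exact Finset.single_le_sum
              (f := fun i => |limitCoeff (γ i) (α i ω) (β i ω) (Γ i ω)|)
              (fun i _ => abs_nonneg _) (Finset.mem_univ i)
        have h4 : boundaryTerm η γ q (qInv q)
            ![xl q, (qInf q).toReal] k d e 0 n = 0 := by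
          simp [boundaryTerm]
        rw [h4, sub_zero] at h3
        exact h3.trans (mul_le_mul_of_nonneg_left (le_abs_self _) hC0)
      · have h1 := (tendsto_const_nhds (x := ν.real (failSet q))).div hdp hpos.ne'
        rwa [div_self hpos.ne'] at h1
      · filter_upwards [hdp.eventually (lt_mem_nhds hpos)] with n hn ω
        have hp0 : p n ≠ 0 := fun h => by simp [h] at hn
        have hd0 := (hS1.d_pos n).ne'
        field_simp
  · have hq : ∀ x, 0 ≤ x → q x = ⊤ := fun x hx => by
      by_contra h
      exact hne ⟨x, hx, lt_top_iff_ne_top.2 h⟩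
    have hS := failSet_eq_empty hq
    have hDe : ∀ n, D n = ∅ := fun n => by
      rw [hD, hS]
      exact eq_empty_of_forall_notMem fun z hz => hz.choose_spec.1
    have hp0 : ∀ n, p n = 0 := fun n => by rw [hp, hDe, measureReal_empty]
    have hph0 : ∀ n ω, ph n ω = 0 := fun n ω => by rw [hph, hDe, pHat_empty]
    have hl := leadingTerm_eq_zero (k := k) (d := d) (e := e) (γ := γ) (η := η) hq α β Γ
    refine ⟨?_, ?_, tendstoInMeasure_iff_norm.2 fun ε hε => ?_, ?_, ?_,
      tendstoInMeasure_iff_norm.2 fun ε hε => ?_⟩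
    · rw [boundaryIntegrand₁_eq_zero hq]
      exact integrableOn_zero
    · exact integrableOn_zero.congr_fun (boundaryIntegrand₂_eqOn_zero hq _).symm
        measurableSet_Ioi
    · simp [hp0, hph0, hl, hε.not_ge]
    · simp [hS]
    · simp [hS, hp0]
    · simp [hS, hl, hε.not_ge]
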